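/- Let $d\ge 1$ and $\nu>-\tfrac12$, put $\gamma_\nu=\nu+\frac{d-1}{2}$ and assume $\gamma_\nu\neq 0$. Let $F_\nu$ be the probability measure on the closed unit ball $\mathbb{B}^d\subset\mathbb{R}^d$ whose density with respect to the Lebesgue measure is proportional to $(1-\|x\|^2)^{\nu-\frac12}$. For a measurable function $f:[-1,1]\to[0,1]$ and $m\ge 0$ let $$\lambda^*_m(f)=c_{\gamma_\nu}\int_{-1}^1 f(t)\,\frac{G_m^{\gamma_\nu}(t)}{G_m^{\gamma_\nu}(1)}\,(1-t^2)^{\gamma_\nu-\frac12}\,dt ,\qquad c_{\gamma_\nu}^{-1}=\int_{-1}^1(1-t^2)^{\gamma_\nu-\frac12}\,dt ,$$ where $G_m^{\gamma}$ is the Gegenbauer polynomial of degree $m$ and weight $\gamma$. For real $p$, write $f\in S^p_{\gamma_\nu}([-1,1])$ if $$\sum_{m\ge 0}|\lambda_m^*(f)|^2\,d_m\,(1+\nu_m^p)<\infty ,\qquad d_m=\binom{m+d-1}{m},\quad \nu_m=m(m+2\nu+d-1).$$ Let $W(x,y)=f(\langle x,y\rangle)$ on $\mathbb{B}^d\times\mathbb{B}^d$,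 and let $T_W$ be the integral operator $T_Wg(x)=\int_{\mathbb{B}^d}W(x,y)g(y)\,dF_\nu(y)$ on $L^2(\mathbb{B}^d,F_\nu)$. For independent random points $X_1,\dots,X_n$ with law $F_\nu$ let $T_n$ be the symmetric $n\times n$ matrix with entries $(T_n)_{ij}=\frac1n(1-\delta_{ij})f(\langle X_i,X_j\rangle)$. Write $\lambda(T)$ for the family of the nonzero eigenvalues of $T$, repeated according to multiplicity and completed by infinitely many zeros, and $$\delta_2(x,y)=\inf_{\sigma}\Big(\sum_i (x_i-y_{\sigma(i)})^2\Big)^{1/2},$$ where $\sigma$ runs over all bijections between the index sets. Suppose that $f\in S^p_{\gamma_\nu}([-1,1])$ for some $p>2\nu-1+\frac{5d}{2}$. Then for every $\alpha\in(0,1)$ there is a constant $C>0$, depending only on $d,\nu,p,f$ and $\alpha$, such that for every $n\ge 1$, with probability at least $1-\alpha$, $$\delta_2\big(\lambda(T_n),\lambda(T_W)\big)\le C\,n^{-\frac12}.$$ -/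

import Mathlib

open MeasureTheory ProbabilityTheory

noncomputable section

namespace BallGraph

/-! ### The latent distribution on the unit ball -/

/-- The measure on `ℝ^d`, carried by the closed unit ball, with density
`(1 - ‖x‖²)^(ν - 1/2)` with respect to the Lebesgue measure. -/
def ballWeight (d : ℕ) (ν : ℝ) : Measure (EuclideanSpace ℝ (Fin d)) :=
  (volume.restrict (Metric.closedBall 0 1)).withDensity
    fun x => ENNReal.ofReal ((1 - ‖x‖ ^ 2) ^ (ν - 1 / 2))

/-- The distribution `F_ν` on the closed unit ball of `ℝ^d`: the normalization of `ballWeight`.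
It is a probability measure for `ν > -1/2`. -/
def ballLaw (d : ℕ) (ν : ℝ) : Measure (EuclideanSpace ℝ (Fin d)) :=
  (ballWeight d ν Set.univ)⁻¹ • ballWeight d ν

instance isFiniteMeasure_ballLaw (d : ℕ) (ν : ℝ) : IsFiniteMeasure (ballLaw d ν) := by
  refine ⟨?_⟩
  simp only [ballLaw, Measure.smul_apply, smul_eq_mul]
  exact lt_of_le_of_lt (ENNReal.inv_mul_le_one _) ENNReal.one_lt_top

theorem ae_mem_ball (d : ℕ) (ν : ℝ) :
    ∀ᵐ x ∂(ballLaw d ν), x ∈ Metric.closedBall (0 : EuclideanSpace ℝ (Fin d)) 1 := by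
  refine Measure.ae_smul_measure ?_ _
  exact (withDensity_absolutelyContinuous _ _).ae_le
    (ae_restrict_mem Metric.isClosed_closedBall.measurableSet)

/-! ### Gegenbauer polynomials and Sobolev regularity -/

/-- The Gegenbauer polynomial `G_n^γ`, given by its three-term recurrence. -/
def gegenbauer (γ : ℝ) : ℕ → ℝ → ℝ
  | 0, _ => 1
  | 1, t => 2 * γ * t
  | n + 2, t =>
      (2 * (n + 1 + γ) * t * gegenbauer γ (n + 1) t - (n + 2 * γ) * gegenbauer γ n t) / (n + 2)

/-- The Gegenbauer weight `γ_ν = ν + (d - 1) / 2` attached to `F_ν`. -/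
def gammaWeight (d : ℕ) (ν : ℝ) : ℝ := ν + ((d : ℝ) - 1) / 2

/-- `λ*_n(f) = c_γ ∫_{-1}^1 f(t) (G_n^γ(t) / G_n^γ(1)) (1 - t²)^(γ - 1/2) dt`, where `c_γ` is such
that `λ*_0(1) = 1`. -/
def gegenbauerCoeff (γ : ℝ) (f : ℝ → ℝ) (n : ℕ) : ℝ :=
  (∫ t in (-1 : ℝ)..1, (1 - t ^ 2) ^ (γ - 1 / 2))⁻¹ *
    ∫ t in (-1 : ℝ)..1,
      f t * (gegenbauer γ n t / gegenbauer γ n 1) * (1 - t ^ 2) ^ (γ - 1 / 2)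

/-- `f ∈ S^p_{γ_ν}([-1,1])`: `∑ |λ*_n(f)|² d_n (1 + ν_n^p) < ∞` with `ν_n = n (n + 2ν + d - 1)`
and `d_n = binom (n + d - 1) n`, the dimension of the space of orthogonal polynomials of degree
exactly `n` in `d` variables. -/
def SobolevRegular (d : ℕ) (ν p : ℝ) (f : ℝ → ℝ) : Prop :=
  Summable fun n : ℕ =>
    |gegenbauerCoeff (gammaWeight d ν) f n| ^ 2 * ((n + d - 1).choose n : ℝ) *
      (1 + ((n : ℝ) * (n + 2 * ν + d - 1)) ^ p)

/-! ### Graphons and their integral operators -/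

/-- A graphon on `(X, μ)`: a symmetric measurable kernel with values in `[0, 1]`, the last
condition being required for almost all points. -/
structure IsGraphon {X : Type*} [MeasurableSpace X] (μ : Measure X) (W : X → X → ℝ) : Prop where
  measurable : Measurable (Function.uncurry W)
  symm : ∀ x y, W x y = W y x
  mem_Icc : ∀ᵐ x ∂μ, ∀ᵐ y ∂μ, W x y ∈ Set.Icc (0 : ℝ) 1

section Operator

variable {X : Type*} [MeasurableSpace X] {μ : Measure X} [IsFiniteMeasure μ] {W : X → X → ℝ}

theorem IsGraphon.ae_integrable (hW : IsGraphon μ W) (g : Lp ℝ 2 μ) :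
    ∀ᵐ x ∂μ, Integrable (fun y => W x y * g y) μ := by
  filter_upwards [hW.mem_Icc] with x hx
  have hg : Integrable (fun y => g y) μ := (Lp.memLp g).integrable (by norm_num)
  refine hg.bdd_mul (c := 1) ?_ ?_
  · exact (hW.measurable.comp measurable_prodMk_left).aestronglyMeasurable
  · filter_upwards [hx] with y hy
    rw [Real.norm_eq_abs, abs_of_nonneg hy.1]
    exact hy.2

theorem IsGraphon.memLp_integral (hW : IsGraphon μ W) (g : Lp ℝ 2 μ) :
    MemLp (fun x => ∫ y, W x y * g y ∂μ) 2 μ := by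
  have hg : Integrable (fun y => g y) μ := (Lp.memLp g).integrable (by norm_num)
  refine MemLp.of_bound ?_ (∫ y, ‖g y‖ ∂μ) ?_
  · have hm : StronglyMeasurable (Function.uncurry fun x y => W x y * g y) :=
      (hW.measurable.stronglyMeasurable).mul
        ((Lp.stronglyMeasurable g).comp_measurable measurable_snd)
    exact hm.integral_prod_right.aestronglyMeasurable
  · filter_upwards [hW.mem_Icc] with x hx
    refine norm_integral_le_of_norm_le hg.norm ?_
    filter_upwards [hx] with y hy
    rw [norm_mul, Real.norm_eq_abs, abs_of_nonneg hy.1]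
    exact mul_le_of_le_one_left (norm_nonneg _) hy.2

/-- The integral operator `T_W` on `L²(X, μ)`, `T_W g(x) = ∫ W(x, y) g(y) dμ(y)`. -/
def integralOperator (hW : IsGraphon μ W) : Module.End ℝ (Lp ℝ 2 μ) where
  toFun g := (hW.memLp_integral g).toLp _
  map_add' g h := by
    rw [← MemLp.toLp_add]
    refine MemLp.toLp_congr _ _ ?_
    filter_upwards [hW.ae_integrable g, hW.ae_integrable h] with x hg hh
    rw [Pi.add_apply, ← integral_add hg hh]
    refine integral_congr_ae ?_
    filter_upwards [Lp.coeFn_add g h] with y hy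
    rw [hy, Pi.add_apply, mul_add]
  map_smul' c g := by
    rw [RingHom.id_apply, ← MemLp.toLp_const_smul]
    refine MemLp.toLp_congr _ _ (Filter.Eventually.of_forall fun x => ?_)
    rw [Pi.smul_apply, smul_eq_mul, ← integral_const_mul]
    refine integral_congr_ae ?_
    filter_upwards [Lp.coeFn_smul c g] with y hy
    rw [hy, Pi.smul_apply, smul_eq_mul]
    ring

end Operator

/-- The dot product kernel `W(x, y) = f(⟨x, y⟩)`. -/
def dotKernel (d : ℕ) (f : ℝ → ℝ) (x y : EuclideanSpace ℝ (Fin d)) : ℝ := f (inner ℝ x y)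

/-- A link function `f : [-1, 1] → [0, 1]` gives a graphon on the ball, for every `F_ν`. -/
theorem isGraphon_dotKernel (d : ℕ) (ν : ℝ) {f : ℝ → ℝ} (hf : Measurable f)
    (hf01 : ∀ t ∈ Set.Icc (-1 : ℝ) 1, f t ∈ Set.Icc (0 : ℝ) 1) :
    IsGraphon (ballLaw d ν) (dotKernel d f) where
  measurable := hf.comp (by fun_prop)
  symm x y := by rw [dotKernel, dotKernel, real_inner_comm]
  mem_Icc := by
    filter_upwards [ae_mem_ball d ν] with x hx
    filter_upwards [ae_mem_ball d ν] with y hy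
    rw [mem_closedBall_zero_iff] at hx hy
    refine hf01 _ (abs_le.mp ?_)
    exact (abs_real_inner_le_norm x y).trans (mul_le_one₀ hx (norm_nonneg _) hy)

/-- The matrix `T_n` with entries `(1/n) (1 - δ_ij) f(⟨X_i, X_j⟩)`. -/
def kernelMatrix {d n : ℕ} (f : ℝ → ℝ) (X : Fin n → EuclideanSpace ℝ (Fin d)) :
    Matrix (Fin n) (Fin n) ℝ :=
  Matrix.of fun i j => if i = j then 0 else (1 / (n : ℝ)) * f (inner ℝ (X i) (X j))

/-! ### Spectra and the `ℓ²`-rearrangement distance -/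

/-- An index set for the nonzero eigenvalues of `T`, each one repeated according to its
multiplicity. For a compact self-adjoint operator the eigenspace of a nonzero eigenvalue has
finite dimension, and this dimension is the multiplicity. -/
def EigIndex {E : Type*} [AddCommGroup E] [Module ℝ E] (T : Module.End ℝ E) : Type :=
  Σ c : {c : ℝ // c ≠ 0}, Fin (Module.finrank ℝ (T.eigenspace c.1))

/-- `λ(T)`: the family of the nonzero eigenvalues of `T`, with multiplicity. -/
def eigs {E : Type*} [AddCommGroup E] [Module ℝ E] (T : Module.End ℝ E) : EigIndex T → ℝ :=
  fun i => i.1.1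

/-- A family of real numbers, completed by infinitely many zeros. -/
def padZero {ι : Type*} (x : ι → ℝ) : ι ⊕ ℕ → ℝ := Sum.elim x fun _ => 0

/-- The `ℓ²`-rearrangement distance `δ₂(x, y) = inf_σ (∑ᵢ (xᵢ - y_{σ(i)})²)^(1/2)` of two families
of real numbers, both completed by infinitely many zeros; `σ` runs over all bijections. -/
def delta2 {ι κ : Type*} (x : ι → ℝ) (y : κ → ℝ) : ENNReal :=
  ⨅ σ : (ι ⊕ ℕ) ≃ (κ ⊕ ℕ),
    (∑' i, ENNReal.ofReal ((padZero x i - padZero y (σ i)) ^ 2)) ^ (1 / 2 : ℝ)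

end BallGraph

end

namespace BallGraph

/-! ### The rearrangement distance -/

/-! Both spectra are compared with a common finite one. Let e_1, ..., e_R be orthonormal in L²(F_ν)
and approximate W by a degenerate kernel ∑ A_kl e_k(x) e_l(y), with A symmetric with eigenvalues β.
The Hoffman-Wielandt inequality (`delta2_eigs_le`) bounds δ₂(λ(T_W), β) by the L² distance τ of the
two kernels. On the sample, the vectors φ_k = n^(-1/2) (e_k(X_i))_i have a Gram matrix 1 + Δ, where
Δ has mean square of order 1/n. If they were orthonormal, ∑ A_kl φ_k φ_lᵀ would have spectrum β. It
differs from T_n by the sampled approximation error and by its diagonal, which costs O(n^(-1/2)).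

The delicate term is the passage from φ to an orthonormal system q. The crude bound ‖Δ‖ ‖A‖ loses
the rate, because R must grow with n. Instead the e_k are arranged in levels of increasing degree.
Gram-Schmidt is triangular, so the part of the QR factor up to level b feels only the part of Δ up
to level b (`sum_sq_sub_one_le_of_lowerSet`). The error becomes ∑_b √(g_b / n) a_b
(`exists_orthonormal_close`, `measure_delta2_gt_le`): g_b is the Christoffel bound times the
dimension at level b, and a_b is the norm of the rows of A at level b, which is at most twice the
approximation error at the previous level (`row_sum_le`). If g_b is of order s^(2b) and a_b of order
q^b with s q < 1, the series converges. Stopping at the last level J with g_J of order n makes τ, of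
order q^J, at most of order n^(-1/2). This is `exists_rate_of_approximation`.

The levels are polynomials of dyadic degree, and W is approximated by the partial sums of the
Gegenbauer expansion of f. If the Christoffel function in degree m is at most of order m^ρ and the
L² error of order m^(-σ), then s q < 1 reads (ρ + d) / 2 < σ. The Christoffel bound on the ball
comes from one-dimensional estimates averaged over segments (`exists_sq_le_integral_ballLaw`). The
errors come from the Sobolev condition and from Sonin's function, which bounds the normalised
Gegenbauer polynomials (`exists_sq_eval_orthoGegenbauer_le`).

Errors on [-1, 1] are carried to pairs of points of the ball in three ways: a uniform bound if d ≥ 2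
and ν ≤ 1/2; a bounded density of the scalar product with respect to the Gegenbauer weight if d ≥ 2
and ν > 1/2; and, if d = 1, an interpolation that loses an arbitrarily small part of the exponent.
-/

theorem ENNReal_sqrt_tsum_add_le {ι : Type*} (a b : ι → ENNReal) :
    (∑' i, (a i + b i) ^ (2 : ℝ)) ^ (1 / 2 : ℝ) ≤
      (∑' i, a i ^ (2 : ℝ)) ^ (1 / 2 : ℝ) + (∑' i, b i ^ (2 : ℝ)) ^ (1 / 2 : ℝ) := by
  -- With every set measurable, this is Minkowski's inequality for the counting measure.
  let _ : MeasurableSpace ι := ⊤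
  have h := ENNReal.lintegral_Lp_add_le (μ := Measure.count) (f := a) (g := b) (p := 2)
    (measurable_from_top.aemeasurable) (measurable_from_top.aemeasurable) (by norm_num)
  simpa [lintegral_count] using h

theorem ofReal_sq_eq_rpow (x : ℝ) :
    ENNReal.ofReal (x ^ 2) = ENNReal.ofReal |x| ^ (2 : ℝ) := by
  rw [ENNReal.ofReal_rpow_of_nonneg (abs_nonneg _) (by norm_num)]
  congr 1
  norm_cast
  rw [sq_abs]

theorem delta2_triangle {ι κ θ : Type*} (x : ι → ℝ) (y : κ → ℝ) (z : θ → ℝ) :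
    delta2 x z ≤ delta2 x y + delta2 y z := by
  unfold delta2
  rw [ENNReal.iInf_add]
  refine le_iInf fun σ => ?_
  rw [ENNReal.add_iInf]
  refine le_iInf fun τ => ?_
  refine (iInf_le _ (σ.trans τ)).trans ?_
  have h2 : ∑' i, ENNReal.ofReal ((padZero y i - padZero z (τ i)) ^ 2) =
      ∑' i, ENNReal.ofReal ((padZero y (σ i) - padZero z (τ (σ i))) ^ 2) :=
    (σ.tsum_eq (fun i => ENNReal.ofReal ((padZero y i - padZero z (τ i)) ^ 2))).symm
  rw [h2]
  simp only [ofReal_sq_eq_rpow]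
  refine le_trans ?_ (ENNReal_sqrt_tsum_add_le _ _)
  refine ENNReal.rpow_le_rpow (ENNReal.tsum_le_tsum fun i => ?_) (by norm_num)
  refine ENNReal.rpow_le_rpow ?_ (by norm_num)
  rw [← ENNReal.ofReal_add (abs_nonneg _) (abs_nonneg _)]
  exact ENNReal.ofReal_le_ofReal (by simpa using abs_sub_le _ _ _)

theorem delta2_comm {ι κ : Type*} (x : ι → ℝ) (y : κ → ℝ) : delta2 x y = delta2 y x := by
  refine le_antisymm ?_ ?_
  · refine le_iInf fun σ => (iInf_le _ σ.symm).trans (le_of_eq ?_)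
    rw [← σ.tsum_eq]
    simp only [Equiv.symm_apply_apply, sub_sq_comm]
  · refine le_iInf fun σ => (iInf_le _ σ.symm).trans (le_of_eq ?_)
    rw [← σ.tsum_eq]
    simp only [Equiv.symm_apply_apply, sub_sq_comm]

theorem ENNReal_tsum_sum_type {ι κ : Type*} (f : ι ⊕ κ → ENNReal) :
    ∑' i, f i = ∑' i, f (Sum.inl i) + ∑' j, f (Sum.inr j) :=
  Summable.tsum_sum ENNReal.summable ENNReal.summable

/-- Matching two families along a bijection of subfamilies, the rest being matched arbitrarily. -/
theorem delta2_le_of_partial {ι κ : Type*} [Countable ι] [Countable κ] (x : ι → ℝ) (y : κ → ℝ)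
    (s : Set ι) (t : Set κ) (e : s ≃ t) :
    delta2 x y ≤ (∑' i : s, ENNReal.ofReal ((x i - y (e i)) ^ 2) +
      (2 * ∑' i : (sᶜ : Set ι), ENNReal.ofReal (x i ^ 2) +
        2 * ∑' j : (tᶜ : Set κ), ENNReal.ofReal (y j ^ 2))) ^ (1 / 2 : ℝ) := by
  classical
  -- The padding makes both leftover families countably infinite, so any bijection between them
  -- serves; its cost is controlled by (a - b)² ≤ 2a² + 2b².
  obtain ⟨g⟩ : Nonempty (((sᶜ : Set ι) ⊕ ℕ) ≃ ((tᶜ : Set κ) ⊕ ℕ)) :=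
    nonempty_equiv_of_countable
  let a : s ⊕ ((sᶜ : Set ι) ⊕ ℕ) ≃ ι ⊕ ℕ :=
    (Equiv.sumAssoc _ _ _).symm.trans (Equiv.sumCongr (Equiv.Set.sumCompl s) (Equiv.refl _))
  let b : t ⊕ ((tᶜ : Set κ) ⊕ ℕ) ≃ κ ⊕ ℕ :=
    (Equiv.sumAssoc _ _ _).symm.trans (Equiv.sumCongr (Equiv.Set.sumCompl t) (Equiv.refl _))
  let σ : (ι ⊕ ℕ) ≃ (κ ⊕ ℕ) := a.symm.trans ((Equiv.sumCongr e g).trans b)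
  refine (iInf_le _ σ).trans (ENNReal.rpow_le_rpow ?_ (by norm_num))
  rw [← a.tsum_eq, ENNReal_tsum_sum_type]
  refine add_le_add (le_of_eq ?_) ?_
  · refine tsum_congr fun i => ?_
    simp [σ, a, b, padZero]
  · have hx : ∀ i, padZero x (a (Sum.inr i)) = Sum.elim (fun i : (sᶜ : Set ι) => x i)
        (fun _ => 0) i := by
      rintro (i | i) <;> simp [a, padZero]
    have hy : ∀ i, padZero y (σ (a (Sum.inr i))) = Sum.elim (fun i : (tᶜ : Set κ) => y i)
        (fun _ => 0) (g i) := by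
      intro i
      have : σ (a (Sum.inr i)) = b (Sum.inr (g i)) := by simp [σ]
      rw [this]
      rcases g i with j | j <;> simp [b, padZero]
    calc _ ≤ ∑' i : ((sᶜ : Set ι) ⊕ ℕ),
          (2 * ENNReal.ofReal ((Sum.elim (fun i : (sᶜ : Set ι) => x i) (fun _ => 0) i) ^ 2) +
            2 * ENNReal.ofReal ((Sum.elim (fun i : (tᶜ : Set κ) => y i) (fun _ => 0) (g i)) ^ 2)) := by
          refine ENNReal.tsum_le_tsum fun i => ?_
          rw [hx, hy]
          have h2 : (2 : ENNReal) = ENNReal.ofReal 2 := by simp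
          rw [h2, ← ENNReal.ofReal_mul (by norm_num), ← ENNReal.ofReal_mul (by norm_num),
            ← ENNReal.ofReal_add (by positivity) (by positivity)]
          refine ENNReal.ofReal_le_ofReal ?_
          nlinarith [sq_nonneg (Sum.elim (fun i : (sᶜ : Set ι) => x i) (fun _ => 0) i +
            Sum.elim (fun i : (tᶜ : Set κ) => y i) (fun _ => 0) (g i))]
      _ = _ := by
          rw [ENNReal.tsum_add, ENNReal.tsum_mul_left, ENNReal.tsum_mul_left,
            g.tsum_eq (fun j => ENNReal.ofReal
              ((Sum.elim (fun i : (tᶜ : Set κ) => y i) (fun _ => 0) j) ^ 2)),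
            ENNReal_tsum_sum_type, ENNReal_tsum_sum_type]
          simp

theorem delta2_eq_zero_of_support {ι κ : Type*} [Countable ι] [Countable κ] (x : ι → ℝ)
    (y : κ → ℝ) (s : Set ι) (t : Set κ) (e : s ≃ t) (he : ∀ i : s, x i = y (e i))
    (hs : ∀ i ∉ s, x i = 0) (ht : ∀ j ∉ t, y j = 0) : delta2 x y = 0 := by
  refine le_antisymm ((delta2_le_of_partial x y s t e).trans (le_of_eq ?_)) bot_le
  have h1 : ∀ i : (sᶜ : Set ι), x i = 0 := fun i => hs _ i.2
  have h2 : ∀ i : (tᶜ : Set κ), y i = 0 := fun i => ht _ i.2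
  simp [he, h1, h2]

theorem delta2_le_of_equiv {ι κ : Type*} [Fintype ι] [Fintype κ] (x : ι → ℝ)
    (y : κ → ℝ) (e : ι ≃ κ) {h : ℝ} (hh : 0 ≤ h) (hs : ∑ i, (x i - y (e i)) ^ 2 ≤ h ^ 2) :
    delta2 x y ≤ ENNReal.ofReal h := by
  refine (iInf_le _ (Equiv.sumCongr e (Equiv.refl ℕ))).trans ?_
  rw [ENNReal_tsum_sum_type, tsum_fintype]
  simp only [padZero, Equiv.sumCongr_apply, Sum.map_inl, Sum.elim_inl, Sum.map_inr, Sum.elim_inr,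
    sub_self, ne_eq, OfNat.ofNat_ne_zero, not_false_eq_true, zero_pow, ENNReal.ofReal_zero,
    tsum_zero, add_zero]
  rw [← ENNReal.ofReal_sum_of_nonneg (fun _ _ => sq_nonneg _)]
  have : ENNReal.ofReal h = ENNReal.ofReal (h ^ 2) ^ (1 / 2 : ℝ) := by
    rw [ENNReal.ofReal_rpow_of_nonneg (by positivity) (by norm_num), ← Real.sqrt_eq_rpow,
      Real.sqrt_sq hh]
  rw [this]
  exact ENNReal.rpow_le_rpow (ENNReal.ofReal_le_ofReal (by simpa using hs)) (by norm_num)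

end BallGraph

namespace BallGraph

/-! ### The Hoffman-Wielandt inequality -/

/-- A linear cost on doubly stochastic matrices is minimized at a bijection. -/
theorem exists_equiv_sum_le {ι κ : Type*} [Fintype ι] [Fintype κ] (M c : ι → κ → ℝ)
    (hM : ∀ i j, 0 ≤ M i j) (hrow : ∀ i, ∑ j, M i j = 1) (hcol : ∀ j, ∑ i, M i j = 1) :
    ∃ e : ι ≃ κ, ∑ i, c i (e i) ≤ ∑ i, ∑ j, M i j * c i j := by
  classical
  -- The total mass, counted by rows and by columns, equates the two cardinalities.
  have hcard : Fintype.card ι = Fintype.card κ := by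
    have : (Fintype.card ι : ℝ) = Fintype.card κ := by
      calc (Fintype.card ι : ℝ) = ∑ i, ∑ j, M i j := by simp [hrow]
        _ = ∑ j, ∑ i, M i j := Finset.sum_comm
        _ = _ := by simp [hcol]
    exact_mod_cast this
  let e₀ : ι ≃ κ := Fintype.equivOfCardEq hcard
  have hD : (Matrix.of fun i j => M i (e₀ j)) ∈ doublyStochastic ℝ ι := by
    rw [mem_doublyStochastic_iff_sum]
    refine ⟨fun i j => hM _ _, fun i => ?_, fun j => ?_⟩
    · simpa using (e₀.sum_comp (fun j => M i j)).trans (hrow i)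
    · simpa using hcol (e₀ j)
  -- Birkhoff's theorem: the cost is a convex combination of costs of bijections, so one of these is
  -- at most the average.
  obtain ⟨w, hw0, hw1, hw⟩ := exists_eq_sum_perm_of_mem_doublyStochastic hD
  have hsum : ∑ i, ∑ j, M i j * c i j = ∑ σ, w σ * ∑ i, c i (e₀ (σ i)) := by
    have h1 : ∀ i j, M i (e₀ j) = ∑ σ : Equiv.Perm ι, w σ * (if σ i = j then 1 else 0) := by
      intro i j
      have := congrFun (congrFun hw i) j
      simp only [Matrix.of_apply, Matrix.sum_apply, Matrix.smul_apply, smul_eq_mul] at this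
      rw [← this]
      refine Finset.sum_congr rfl fun σ _ => ?_
      simp [Equiv.Perm.permMatrix, PEquiv.toMatrix_apply, Equiv.toPEquiv_apply, eq_comm]
    calc ∑ i, ∑ j, M i j * c i j = ∑ i, ∑ j, M i (e₀ j) * c i (e₀ j) :=
          Finset.sum_congr rfl fun i _ => (e₀.sum_comp (fun j => M i j * c i j)).symm
      _ = ∑ i, ∑ j, ∑ σ : Equiv.Perm ι, w σ * ((if σ i = j then 1 else 0) * c i (e₀ j)) := by
          simp only [h1, Finset.sum_mul, mul_assoc]
      _ = ∑ i, ∑ σ : Equiv.Perm ι, ∑ j, w σ * ((if σ i = j then 1 else 0) * c i (e₀ j)) :=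
          Finset.sum_congr rfl fun i _ => Finset.sum_comm
      _ = ∑ i, ∑ σ : Equiv.Perm ι, w σ * c i (e₀ (σ i)) := by
          simp
      _ = _ := by rw [Finset.sum_comm]; simp only [Finset.mul_sum]
  by_contra! hcon
  have hlt : ∑ σ, w σ * ∑ i, ∑ j, M i j * c i j < ∑ σ, w σ * ∑ i, c i (e₀ (σ i)) := by
    have hex : ∃ σ, 0 < w σ := by
      by_contra! h
      have : ∑ σ, w σ ≤ 0 := Finset.sum_nonpos fun σ _ => h σ
      linarith
    obtain ⟨σ, hσ⟩ := hex
    refine Finset.sum_lt_sum (fun σ _ => mul_le_mul_of_nonneg_left (hcon (σ.trans e₀)).le (hw0 σ))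
      ⟨σ, Finset.mem_univ _, mul_lt_mul_of_pos_left (hcon (σ.trans e₀)) hσ⟩
  rw [← Finset.sum_mul, hw1, one_mul, ← hsum] at hlt
  exact lt_irrefl _ hlt

section Hilbert

variable {H : Type*} [NormedAddCommGroup H] [InnerProductSpace ℝ H]

theorem sum_inner_sq_eq_of_mem_span {ι : Type*} [Fintype ι] {v : ι → H} (hv : Orthonormal ℝ v)
    {x : H} (hx : x ∈ Submodule.span ℝ (Set.range v)) : ∑ i, inner ℝ (v i) x ^ 2 = ‖x‖ ^ 2 := by
  obtain ⟨c, rfl⟩ := (Submodule.mem_span_range_iff_exists_fun ℝ).1 hx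
  rw [← real_inner_self_eq_norm_sq, hv.inner_sum]
  refine Finset.sum_congr rfl fun i _ => ?_
  rw [hv.inner_right_fintype]
  simp [sq]

/-- The squared Hilbert-Schmidt norm of `T` is at most `c²`. -/
def HSBound (T : H → H) (c : ℝ) : Prop :=
  ∀ (m : ℕ) (u : Fin m → H), Orthonormal ℝ u → ∑ i, ‖T (u i)‖ ^ 2 ≤ c ^ 2

theorem HSBound.sum_le {T : H → H} {c : ℝ} (hT : HSBound T c) {ι : Type*} [Fintype ι] {u : ι → H}
    (hu : Orthonormal ℝ u) : ∑ i, ‖T (u i)‖ ^ 2 ≤ c ^ 2 := by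
  have := hT _ (u ∘ (Fintype.equivFin ι).symm) (hu.comp _ (Equiv.injective _))
  rwa [← (Fintype.equivFin ι).symm.sum_comp]

theorem orthonormal_sumElim {ι κ : Type*} {u : ι → H} {v : κ → H} (hu : Orthonormal ℝ u)
    (hv : Orthonormal ℝ v) (huv : ∀ i j, inner ℝ (u i) (v j) = 0) :
    Orthonormal ℝ (Sum.elim u v) := by
  refine ⟨?_, ?_⟩
  · rintro (i | i)
    · exact hu.1 i
    · exact hv.1 i
  · rintro (i | i) (j | j) hij
    · exact hu.2 (fun h => hij (by rw [h]))
    · exact huv i j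
    · rw [real_inner_comm]; exact huv j i
    · exact hv.2 (fun h => hij (by rw [h]))

/-- A matching of the spectra of two symmetric forms on a common finite-dimensional space. -/
theorem exists_matching {ι κ : Type*} [Fintype ι] [Fintype κ] {u : ι → H} {y : κ → H}
    (hu : Orthonormal ℝ u) (hy : Orthonormal ℝ y)
    (huy : ∀ i, u i ∈ Submodule.span ℝ (Set.range y))
    (hyu : ∀ j, y j ∈ Submodule.span ℝ (Set.range u)) (D : H → H) (α : ι → ℝ) (β : κ → ℝ)
    (hD : ∀ i j, inner ℝ (y j) (D (u i)) = (α i - β j) * inner ℝ (y j) (u i)) :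
    ∃ e : ι ≃ κ, ∑ i, (α i - β (e i)) ^ 2 ≤ ∑ i, ‖D (u i)‖ ^ 2 := by
  -- By Parseval in the common span, the squares ⟨y_j, u_i⟩² form a doubly stochastic matrix. The
  -- averaged cost is then ∑ ⟨y_j, D u_i⟩², which Bessel bounds.
  obtain ⟨e, he⟩ := exists_equiv_sum_le (fun i j => inner ℝ (y j) (u i) ^ 2)
    (fun i j => (α i - β j) ^ 2) (fun i j => sq_nonneg _)
    (fun i => by rw [sum_inner_sq_eq_of_mem_span hy (huy i), hu.1 i, one_pow])
    (fun j => by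
      have := sum_inner_sq_eq_of_mem_span hu (hyu j)
      rw [hy.1 j, one_pow] at this
      simpa only [real_inner_comm] using this)
  refine ⟨e, he.trans (Finset.sum_le_sum fun i _ => ?_)⟩
  have := hy.sum_inner_products_le (D (u i)) (s := Finset.univ)
  refine le_trans (le_of_eq (Finset.sum_congr rfl fun j _ => ?_)) this
  rw [hD, Real.norm_eq_abs, sq_abs]
  ring

end Hilbert

end BallGraph

/-! ### Spectral theory of compact symmetric operators -/

namespace BallGraph

section Spectral

variable {H : Type*} [NormedAddCommGroup H] [InnerProductSpace ℝ H] [CompleteSpace H]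

/-- A compact symmetric operator has an orthonormal family of eigenvectors, indexed by `EigIndex`,
off which it vanishes. -/
theorem exists_eigenfamily {T : H →L[ℝ] H} (hc : IsCompactOperator T)
    (hs : (T : H →ₗ[ℝ] H).IsSymmetric) :
    ∃ v : EigIndex (T : Module.End ℝ H) → H, Orthonormal ℝ v ∧
      (∀ i, T (v i) = eigs (T : Module.End ℝ H) i • v i) ∧
      ∀ x, (∀ i, inner ℝ (v i) x = 0) → T x = 0 := by
  -- Compactness makes each `finrank` in `EigIndex` a true dimension, so that orthonormal bases of
  -- the eigenspaces are indexed exactly by `EigIndex`.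
  have hfin : ∀ c : {c : ℝ // c ≠ 0}, FiniteDimensional ℝ
      (Module.End.eigenspace (T : Module.End ℝ H) c.1) := fun c =>
    ContinuousLinearMap.finite_dimensional_eigenspace hc c.1 c.2
  let b : ∀ c : {c : ℝ // c ≠ 0}, OrthonormalBasis _ ℝ
    (Module.End.eigenspace (T : Module.End ℝ H) c.1) := fun c => stdOrthonormalBasis ℝ _
  have hfam := hs.orthogonalFamily_eigenspaces
  have hfam' : OrthogonalFamily ℝ
      (fun c : {c : ℝ // c ≠ 0} => Module.End.eigenspace (T : Module.End ℝ H) c.1)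
      fun c => (Module.End.eigenspace (T : Module.End ℝ H) c.1).subtypeₗᵢ :=
    hfam.comp Subtype.val_injective
  refine ⟨fun i => (b i.1 i.2 : H), ?_, ?_, ?_⟩
  · exact hfam'.orthonormal_sigma_orthonormal (v_family := fun c => b c)
      (fun c => (b c).orthonormal)
  · intro i
    exact Module.End.mem_eigenspace_iff.1 (b i.1 i.2).2
  · intro x hx
    have hx' : ∀ c : {c : ℝ // c ≠ 0}, ∀ z ∈ Module.End.eigenspace (T : Module.End ℝ H) c.1,
        inner ℝ z x = 0 := by
      intro c z hz
      have hz' := (b c).sum_repr ⟨z, hz⟩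
      have hz'' : z = ∑ i, (b c).repr ⟨z, hz⟩ i • (b c i : H) := by
        conv_lhs => rw [show z = ((⟨z, hz⟩ : Module.End.eigenspace (T : Module.End ℝ H) c.1) : H)
          from rfl, ← hz']
        simp
      rw [hz'', sum_inner]
      refine Finset.sum_eq_zero fun i _ => ?_
      rw [real_inner_smul_left, hx ⟨c, i⟩, mul_zero]
    -- T x is orthogonal to every eigenspace, including the kernel, where the factor μ vanishes; the
    -- eigenspaces of a compact symmetric operator span a dense subspace.
    have hmem : T x ∈ (⨆ μ, Module.End.eigenspace (T : Module.End ℝ H) μ)ᗮ := by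
      rw [← Submodule.iInf_orthogonal, Submodule.mem_iInf]
      intro μ z hz
      have hTz : T z = μ • z := Module.End.mem_eigenspace_iff.1 hz
      have h1 : inner ℝ z (T x) = μ * inner ℝ z x := by
        rw [← real_inner_smul_left, ← hTz]
        exact (hs z x).symm
      rw [h1]
      by_cases hμ : μ = 0
      · simp [hμ]
      · rw [hx' ⟨μ, hμ⟩ z hz, mul_zero]
    rwa [ContinuousLinearMap.orthogonalComplement_iSup_eigenspaces_eq_bot hc hs,
      Submodule.mem_bot] at hmem

/-- Parseval's identity for the image of a symmetric operator vanishing off an orthonormal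
family of eigenvectors. -/
theorem hasSum_norm_sq_apply {ι : Type*} {T : H →L[ℝ] H} (hs : (T : H →ₗ[ℝ] H).IsSymmetric)
    {v : ι → H} (hv : Orthonormal ℝ v) {μ : ι → ℝ} (hT : ∀ i, T (v i) = μ i • v i)
    (h0 : ∀ x, (∀ i, inner ℝ (v i) x = 0) → T x = 0) (x : H) :
    HasSum (fun i => μ i ^ 2 * inner ℝ (v i) x ^ 2) (‖T x‖ ^ 2) := by
  -- T vanishes on Kᗮ and is symmetric, so T x lies in K. There the v i form a Hilbert basis, and
  -- Bessel becomes an equality.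
  let K := (Submodule.span ℝ (Set.range v)).topologicalClosure
  have hK : ∀ i, v i ∈ K := fun i =>
    Submodule.le_topologicalClosure _ (Submodule.subset_span ⟨i, rfl⟩)
  have : CompleteSpace K := (Submodule.isClosed_topologicalClosure _).completeSpace_coe
  let v' : ι → K := fun i => ⟨v i, hK i⟩
  have hv' : Orthonormal ℝ v' := by
    refine ⟨fun i => hv.1 i, fun i j hij => hv.2 hij⟩
  have hbot : (Submodule.span ℝ (Set.range v'))ᗮ = ⊥ := by
    rw [Submodule.eq_bot_iff]
    intro y hy
    have h1 : (y : H) ∈ (Submodule.span ℝ (Set.range v))ᗮ := by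
      rw [Submodule.mem_orthogonal]
      intro z hz
      induction hz using Submodule.span_induction with
      | mem z hz =>
        obtain ⟨i, rfl⟩ := hz
        exact hy (v' i) (Submodule.subset_span ⟨i, rfl⟩)
      | zero => simp
      | add a b _ _ ha hb => rw [inner_add_left, ha, hb, add_zero]
      | smul c a _ ha => rw [real_inner_smul_left, ha, mul_zero]
    rw [← Submodule.orthogonal_closure] at h1
    have := h1 (y : H) y.2
    exact Subtype.ext (inner_self_eq_zero.1 this)
  let b := HilbertBasis.mkOfOrthogonalEqBot hv' hbot
  have hTx : T x ∈ K := by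
    have hKK : Kᗮᗮ = K := Submodule.orthogonal_orthogonal K
    rw [← hKK]
    intro y hy
    have hy0 : T y = 0 := h0 y fun i => hy (v i) (hK i)
    have := hs y x
    simp only [ContinuousLinearMap.coe_coe] at this
    rw [← this, hy0, inner_zero_left]
  have := b.hasSum_inner_mul_inner ⟨T x, hTx⟩ ⟨T x, hTx⟩
  have hb : ∀ i, b i = v' i := fun i => by
    simp [b]
  rw [real_inner_self_eq_norm_sq] at this
  have heq : (fun i => μ i ^ 2 * inner ℝ (v i) x ^ 2) =
      fun i => inner ℝ (⟨T x, hTx⟩ : K) (b i) * inner ℝ (b i) (⟨T x, hTx⟩ : K) := by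
    funext i
    rw [hb]
    have h1 : inner ℝ (v i) (T x) = μ i * inner ℝ (v i) x := by
      rw [← real_inner_smul_left, ← hT]
      exact (hs (v i) x).symm
    change _ = inner ℝ (T x) (v i) * inner ℝ (v i) (T x)
    rw [real_inner_comm (v i) (T x), h1]
    ring
  rw [heq]
  exact this

/-- Bessel-type bound for the restriction of `T` to the complement of finitely many eigenvectors. -/
theorem sum_norm_sq_apply_le {ι : Type*} {T : H →L[ℝ] H} (hs : (T : H →ₗ[ℝ] H).IsSymmetric)
    {v : ι → H} (hv : Orthonormal ℝ v) {μ : ι → ℝ} (hT : ∀ i, T (v i) = μ i • v i)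
    (h0 : ∀ x, (∀ i, inner ℝ (v i) x = 0) → T x = 0) (hμ : Summable fun i => μ i ^ 2)
    (s : Finset ι) {m : ℕ} {z : Fin m → H} (hz : Orthonormal ℝ z)
    (hzs : ∀ i ∈ s, ∀ j, inner ℝ (v i) (z j) = 0) :
    ∑ j, ‖T (z j)‖ ^ 2 ≤ ∑' i : ((s : Set ι)ᶜ : Set ι), μ i ^ 2 := by
  have hsum := hasSum_sum (s := Finset.univ) fun j _ => hasSum_norm_sq_apply hs hv hT h0 (z j)
  have hsub : Summable fun i : ((s : Set ι)ᶜ : Set ι) => μ i ^ 2 := hμ.subtype _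
  rw [← hsum.tsum_eq, ← tsum_subtype_eq_of_support_subset (s := ((s : Set ι)ᶜ : Set ι))]
  · refine Summable.tsum_le_tsum (fun i => ?_) (hsum.summable.subtype _) hsub
    rw [← Finset.mul_sum]
    refine mul_le_of_le_one_right (sq_nonneg _) ?_
    -- With the roles exchanged: Bessel for the system z bounds the total weight of each μ i ^ 2 by
    -- ‖v i‖² = 1.
    have := hz.sum_inner_products_le (v i) (s := Finset.univ)
    rw [hv.1, one_pow] at this
    refine le_trans (le_of_eq (Finset.sum_congr rfl fun j _ => ?_)) this
    rw [Real.norm_eq_abs, sq_abs, real_inner_comm]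
  · intro i hi
    by_contra hmem
    simp only [Set.mem_compl_iff, Finset.mem_coe, not_not] at hmem
    refine hi ?_
    exact Finset.sum_eq_zero fun j _ => by rw [hzs i hmem j]; ring

end Spectral

end BallGraph

namespace BallGraph

section Spectral

variable {H : Type*} [NormedAddCommGroup H] [InnerProductSpace ℝ H]

/-- This puts the eigenvectors of two different operators into orthonormal bases of one common
finite-dimensional space, where they can be matched. -/
theorem orthonormal_and_span_extend {ι : Type*} [Finite ι] {a : ι → H} (ha : Orthonormal ℝ a)
    (S : Submodule ℝ H) (haS : Submodule.span ℝ (Set.range a) ≤ S) {κ : Type*} [Fintype κ]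
    (z : OrthonormalBasis κ ℝ ((Submodule.span ℝ (Set.range a))ᗮ ⊓ S : Submodule ℝ H)) :
    Orthonormal ℝ (Sum.elim a fun j => (z j : H)) ∧
      Submodule.span ℝ (Set.range (Sum.elim a fun j => (z j : H))) = S := by
  have : FiniteDimensional ℝ (Submodule.span ℝ (Set.range a)) :=
    FiniteDimensional.span_of_finite ℝ (Set.finite_range a)
  refine ⟨orthonormal_sumElim ha ?_ ?_, ?_⟩
  · exact z.orthonormal.comp_linearIsometry
      (Submodule.subtypeₗᵢ ((Submodule.span ℝ (Set.range a))ᗮ ⊓ S))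
  · intro i j
    exact (z j).2.1 (a i) (Submodule.subset_span ⟨i, rfl⟩)
  · rw [Set.Sum.elim_range, Submodule.span_union]
    have hz : Submodule.span ℝ (Set.range fun j => (z j : H)) =
        (Submodule.span ℝ (Set.range a))ᗮ ⊓ S := by
      have h1 := z.toBasis.span_eq
      have h2 := congrArg (Submodule.map
        ((Submodule.span ℝ (Set.range a))ᗮ ⊓ S : Submodule ℝ H).subtype) h1
      rw [Submodule.map_span, ← Set.range_comp, Submodule.map_top, Submodule.range_subtype] at h2
      simpa [Function.comp_def] using h2
    rw [hz]
    exact Submodule.sup_orthogonal_inf_of_hasOrthogonalProjection haS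

variable [CompleteSpace H]

/-- **Hoffman-Wielandt inequality**, for a compact symmetric operator and a symmetric operator of
finite rank. -/
theorem delta2_eigs_le {T : H →L[ℝ] H} (hc : IsCompactOperator T)
    (hs : (T : H →ₗ[ℝ] H).IsSymmetric) {c₀ : ℝ} (hT : HSBound T c₀) {κ : Type*} [Fintype κ]
    {w : κ → H} (hw : Orthonormal ℝ w) (β : κ → ℝ) {h : ℝ} (hh : 0 ≤ h)
    (hTB : HSBound (fun x => T x - ∑ q, (β q * inner ℝ (w q) x) • w q) h) :
    delta2 (eigs (T : Module.End ℝ H)) β ≤ ENNReal.ofReal h := by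
  classical
  obtain ⟨v, hv, hTv, h0⟩ := exists_eigenfamily hc hs
  set lam := eigs (T : Module.End ℝ H) with hlam
  have hsum : Summable fun i => lam i ^ 2 := by
    refine summable_of_sum_le (c := c₀ ^ 2) (fun i => sq_nonneg _) fun s => ?_
    have := hT.sum_le (u := fun i : s => v i) (hv.comp _ Subtype.val_injective)
    refine le_trans (le_of_eq ?_) this
    rw [← Finset.sum_coe_sort s]
    refine Finset.sum_congr rfl fun i _ => ?_
    rw [hTv, norm_smul, hv.1, mul_one, Real.norm_eq_abs, sq_abs]
  -- A summable family has countable support, and all the indexed eigenvalues are nonzero.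
  have hcount : Countable (EigIndex (T : Module.End ℝ H)) := by
    have h1 := hsum.countable_support
    have h2 : (Function.support fun i => lam i ^ 2) = Set.univ := by
      ext i
      simp only [Function.mem_support, Set.mem_univ, iff_true]
      exact pow_ne_zero _ i.1.2
    rw [h2] at h1
    exact Set.countable_univ_iff.1 h1
  refine ENNReal.le_of_forall_pos_le_add fun ε hε _ => ?_
  -- The tail ε²/4 is used twice, for the omitted eigenvalues and for their substitutes μ, each time
  -- with the factor 2 of `delta2_le_of_partial`; the total is ε².
  obtain ⟨s, htail⟩ : ∃ s : Finset (EigIndex (T : Module.End ℝ H)),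
      ∑' i : ((s : Set (EigIndex (T : Module.End ℝ H)))ᶜ : Set _), lam i ^ 2 < (ε : ℝ) ^ 2 / 4 := by
    have := (tendsto_tsum_compl_atTop_zero fun i => lam i ^ 2).eventually
      (gt_mem_nhds (show (0 : ℝ) < (ε : ℝ) ^ 2 / 4 by positivity))
    exact this.exists
  let vs : s → H := fun i => v i
  have hvs : Orthonormal ℝ vs := hv.comp _ Subtype.val_injective
  let S : Submodule ℝ H := Submodule.span ℝ (Set.range vs) ⊔ Submodule.span ℝ (Set.range w)
  have : FiniteDimensional ℝ (Submodule.span ℝ (Set.range vs)) :=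
    FiniteDimensional.span_of_finite ℝ (Set.finite_range vs)
  have : FiniteDimensional ℝ (Submodule.span ℝ (Set.range w)) :=
    FiniteDimensional.span_of_finite ℝ (Set.finite_range w)
  have hSfin : FiniteDimensional ℝ S := Submodule.finiteDimensional_sup _ _
  let S₁ : Submodule ℝ H := (Submodule.span ℝ (Set.range vs))ᗮ ⊓ S
  let S₂ : Submodule ℝ H := (Submodule.span ℝ (Set.range w))ᗮ ⊓ S
  have : FiniteDimensional ℝ S₁ := Submodule.finiteDimensional_inf_right _ _
  have : FiniteDimensional ℝ S₂ := Submodule.finiteDimensional_inf_right _ _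
  -- S need not be invariant under T, so T is compressed to S₁. The matching only needs the forms
  -- ⟨x, T u⟩ with x in S, and these are diagonal in the basis `u`.
  let T₁ : S₁ →ₗ[ℝ] S₁ :=
    (S₁.orthogonalProjectionOnto : H →ₗ[ℝ] S₁) ∘ₗ (T : H →ₗ[ℝ] H) ∘ₗ S₁.subtype
  have hT₁ : ∀ x y : S₁, inner ℝ x (T₁ y) = inner ℝ (x : H) (T y) := fun x y =>
    Submodule.inner_orthogonalProjectionOnto_eq_of_mem_left x (T y)
  have hT₁s : T₁.IsSymmetric := by
    intro x y
    rw [hT₁, real_inner_comm, hT₁]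
    rw [real_inner_comm]
    exact hs x y
  let zb := hT₁s.eigenvectorBasis rfl
  let μ := hT₁s.eigenvalues rfl
  have hzμ : ∀ (y : S₁) j, inner ℝ (y : H) (T (zb j)) = μ j * inner ℝ (y : H) (zb j : H) := by
    intro y j
    rw [← hT₁, hT₁s.apply_eigenvectorBasis rfl j, real_inner_smul_right]
    rfl
  let yb := stdOrthonormalBasis ℝ S₂
  obtain ⟨hu, huS⟩ := orthonormal_and_span_extend hvs S le_sup_left zb
  obtain ⟨hy, hyS⟩ := orthonormal_and_span_extend hw S le_sup_right yb
  set u := Sum.elim vs fun j => (zb j : H) with hudef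
  set y := Sum.elim w fun j => (yb j : H) with hydef
  let α : s ⊕ Fin (Module.finrank ℝ S₁) → ℝ := Sum.elim (fun i : s => lam i) μ
  let β' : κ ⊕ Fin (Module.finrank ℝ S₂) → ℝ := Sum.elim β fun _ => 0
  have hzv : ∀ i : s, ∀ j, inner ℝ (vs i) (zb j : H) = 0 := fun i j =>
    (zb j).2.1 (vs i) (Submodule.subset_span ⟨i, rfl⟩)
  have hTu : ∀ i, ∀ x ∈ S, inner ℝ x (T (u i)) = α i * inner ℝ x (u i) := by
    rintro (i | j) x hx
    · change inner ℝ x (T (v i)) = lam i * inner ℝ x (v i)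
      rw [hTv, real_inner_smul_right]
    · change inner ℝ x (T (zb j)) = μ j * inner ℝ x (zb j : H)
      have hx' : x ∈ Submodule.span ℝ (Set.range vs) ⊔ S₁ := by
        rw [Submodule.sup_orthogonal_inf_of_hasOrthogonalProjection
          (show Submodule.span ℝ (Set.range vs) ≤ S from le_sup_left)]
        exact hx
      obtain ⟨a, ha, b, hb, rfl⟩ := Submodule.mem_sup.1 hx'
      rw [inner_add_left, inner_add_left, hzμ ⟨b, hb⟩ j]
      have ha0 : inner ℝ a (zb j : H) = 0 := (zb j).2.1 a ha
      have ha1 : inner ℝ a (T (zb j)) = 0 := by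
        obtain ⟨c, rfl⟩ := (Submodule.mem_span_range_iff_exists_fun ℝ).1 ha
        rw [sum_inner]
        refine Finset.sum_eq_zero fun i _ => ?_
        have h1 : inner ℝ (vs i) (T (zb j)) = inner ℝ (T (vs i)) (zb j : H) := (hs _ _).symm
        rw [real_inner_smul_left, h1, hTv, real_inner_smul_left, hzv, mul_zero, mul_zero]
      rw [ha0, ha1, zero_add, zero_add]
  have hB : ∀ j x, inner ℝ (y j) (∑ q, (β q * inner ℝ (w q) x) • w q) =
      β' j * inner ℝ (y j) x := by
    rintro (q | j) x
    · change inner ℝ (w q) _ = β q * inner ℝ (w q) x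
      rw [hw.inner_right_fintype]
    · change inner ℝ (yb j : H) _ = 0 * _
      rw [zero_mul, inner_sum]
      refine Finset.sum_eq_zero fun q _ => ?_
      have h0 : inner ℝ (w q) (yb j : H) = 0 :=
        (yb j).2.1 (w q) (Submodule.subset_span ⟨q, rfl⟩)
      rw [real_inner_smul_right, real_inner_comm (w q) (yb j : H), h0, mul_zero]
  have hyS' : ∀ j, y j ∈ S := fun j => hyS ▸ Submodule.subset_span ⟨j, rfl⟩
  have huS' : ∀ j, u j ∈ S := fun j => huS ▸ Submodule.subset_span ⟨j, rfl⟩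
  obtain ⟨e, he⟩ := exists_matching hu hy (fun i => hyS.symm ▸ huS' i) (fun j => huS.symm ▸ hyS' j)
    (fun x => T x - ∑ q, (β q * inner ℝ (w q) x) • w q) α β' (by
      intro i j
      rw [inner_sub_right, hTu i _ (hyS' j), hB, sub_mul])
  have hmain : delta2 α β' ≤ ENNReal.ofReal h :=
    delta2_le_of_equiv α β' e hh (he.trans (hTB.sum_le hu))
  -- The eigenvalues of the compression are spurious, but they live on vectors orthogonal to the
  -- chosen eigenvectors and are therefore as small as the tail.
  have hμtail : ∑ j, μ j ^ 2 ≤ ∑' i : ((s : Set (EigIndex (T : Module.End ℝ H)))ᶜ : Set _),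
      lam i ^ 2 := by
    have hzo : Orthonormal ℝ fun j => (zb j : H) := hu.comp Sum.inr Sum.inr_injective
    refine le_trans (Finset.sum_le_sum fun j _ => ?_)
      (sum_norm_sq_apply_le hs hv hTv h0 hsum s hzo fun i hi j => hzv ⟨i, hi⟩ j)
    have h1 : |μ j| ≤ ‖T (zb j)‖ := by
      have h2 := hzμ (zb j) j
      rw [real_inner_self_eq_norm_sq, hzo.1 j, one_pow, mul_one] at h2
      rw [← h2]
      refine (abs_real_inner_le_norm _ _).trans ?_
      rw [hzo.1 j, one_mul]
    rw [← sq_abs]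
    exact pow_le_pow_left₀ (abs_nonneg _) h1 2
  have h1 : delta2 lam α ≤ ε := by
    have hpart := delta2_le_of_partial lam α (s : Set (EigIndex (T : Module.End ℝ H)))
      (Set.range Sum.inl) (Equiv.ofInjective Sum.inl Sum.inl_injective)
    refine hpart.trans ?_
    have e1 : ∑' i : (s : Set (EigIndex (T : Module.End ℝ H))), ENNReal.ofReal
        ((lam i - α ((Equiv.ofInjective (β := s ⊕ Fin (Module.finrank ℝ S₁)) Sum.inl
          Sum.inl_injective) i)) ^ 2) = 0 := by
      rw [ENNReal.tsum_eq_zero]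
      intro i
      simp [α]
    have e2 : ∑' i : ((s : Set (EigIndex (T : Module.End ℝ H)))ᶜ : Set _),
        ENNReal.ofReal (lam i ^ 2) ≤ ENNReal.ofReal ((ε : ℝ) ^ 2 / 4) := by
      rw [← ENNReal.ofReal_tsum_of_nonneg (fun _ => sq_nonneg _) (hsum.subtype _)]
      exact ENNReal.ofReal_le_ofReal htail.le
    have e3 : ∑' j : ((Set.range (Sum.inl : s → s ⊕ Fin (Module.finrank ℝ S₁)))ᶜ : Set _),
        ENNReal.ofReal (α j ^ 2) ≤ ENNReal.ofReal ((ε : ℝ) ^ 2 / 4) := by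
      have : ∑' j : ((Set.range (Sum.inl : s → s ⊕ Fin (Module.finrank ℝ S₁)))ᶜ : Set _),
        ENNReal.ofReal (α j ^ 2) = ∑' j, ENNReal.ofReal (μ j ^ 2) := by
        rw [Set.compl_range_inl, tsum_range (fun j => ENNReal.ofReal (α j ^ 2)) Sum.inr_injective]
        rfl
      rw [this, tsum_fintype, ← ENNReal.ofReal_sum_of_nonneg (fun _ _ => sq_nonneg _)]
      exact ENNReal.ofReal_le_ofReal (hμtail.trans htail.le)
    rw [e1, zero_add]
    have h2 : (2 : ENNReal) = ENNReal.ofReal 2 := by simp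
    calc _ ≤ (2 * ENNReal.ofReal ((ε : ℝ) ^ 2 / 4) + 2 * ENNReal.ofReal ((ε : ℝ) ^ 2 / 4)) ^
          (1 / 2 : ℝ) := by gcongr
      _ = ENNReal.ofReal ((ε : ℝ) ^ 2) ^ (1 / 2 : ℝ) := by
          rw [h2, ← ENNReal.ofReal_mul (by norm_num), ← ENNReal.ofReal_add (by positivity)
            (by positivity)]
          congr 2; ring
      _ = ε := by
          rw [ENNReal.ofReal_rpow_of_nonneg (by positivity) (by norm_num), ← Real.sqrt_eq_rpow,
            Real.sqrt_sq (NNReal.coe_nonneg ε)]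
          simp
  -- The directions of S₂ only add zeros to β.
  have h3 : delta2 β' β = 0 := by
    refine delta2_eq_zero_of_support β' β (Set.range Sum.inl) Set.univ
      ((Equiv.ofInjective Sum.inl Sum.inl_injective).symm.trans (Equiv.Set.univ κ).symm) ?_ ?_ ?_
    · rintro ⟨_, q, rfl⟩
      simp [β']
    · rintro (q | j) hj
      · exact absurd ⟨q, rfl⟩ hj
      · rfl
    · intro j hj
      exact absurd trivial hj
  calc delta2 lam β ≤ delta2 lam α + delta2 α β := delta2_triangle _ _ _
    _ ≤ delta2 lam α + (delta2 α β' + delta2 β' β) := by gcongr; exact delta2_triangle _ _ _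
    _ ≤ ε + (ENNReal.ofReal h + 0) := by rw [h3]; gcongr
    _ = ENNReal.ofReal h + ε := by rw [add_zero, add_comm]

end Spectral

theorem delta2_eq_zero_of_equiv {ι κ : Type*} (x : ι → ℝ) (y : κ → ℝ) (e : ι ≃ κ)
    (he : ∀ i, x i = y (e i)) : delta2 x y = 0 := by
  refine le_antisymm ((iInf_le _ (Equiv.sumCongr e (Equiv.refl ℕ))).trans (le_of_eq ?_)) bot_le
  rw [ENNReal_tsum_sum_type]
  simp [padZero, he]

/-- `Matrix.toLin'` acts on a space without the Euclidean inner product; this moves its spectrum to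
`EuclideanSpace`. -/
theorem delta2_eigs_conj {E E' : Type*} [AddCommGroup E] [Module ℝ E] [AddCommGroup E']
    [Module ℝ E'] (T : Module.End ℝ E) (T' : Module.End ℝ E') (e : E ≃ₗ[ℝ] E')
    (he : ∀ x, e (T x) = T' (e x)) : delta2 (eigs T) (eigs T') = 0 := by
  have hrank : ∀ c : ℝ, Module.finrank ℝ (T.eigenspace c) = Module.finrank ℝ (T'.eigenspace c) := by
    intro c
    have hmap : (T.eigenspace c).map (e : E →ₗ[ℝ] E') = T'.eigenspace c := by
      ext y
      rw [Submodule.mem_map, Module.End.mem_eigenspace_iff]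
      constructor
      · rintro ⟨x, hx, rfl⟩
        rw [Module.End.mem_eigenspace_iff] at hx
        simp [← he, hx]
      · intro hy
        refine ⟨e.symm y, ?_, by simp⟩
        rw [Module.End.mem_eigenspace_iff]
        apply e.injective
        rw [he, map_smul]
        simp [hy]
    rw [← hmap]
    exact (LinearEquiv.finrank_map_eq e _).symm
  exact delta2_eq_zero_of_equiv _ _ (Equiv.sigmaCongrRight fun c => finCongr (hrank c.1))
    fun i => rfl

/-- Each row of D contributes its coefficients along an orthonormal system, so Bessel applies row by
row. -/
theorem hsBound_mulVec {n : ℕ} (D : Matrix (Fin n) (Fin n) ℝ) {h : ℝ}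
    (hD : ∑ i, ∑ j, D i j ^ 2 ≤ h ^ 2) :
    HSBound (fun x : EuclideanSpace ℝ (Fin n) => WithLp.toLp 2 (D.mulVec x)) h := by
  intro m u hu
  refine le_trans ?_ hD
  have h1 : ∀ k, ‖WithLp.toLp 2 (D.mulVec (u k))‖ ^ 2 =
      ∑ i, inner ℝ (u k) (WithLp.toLp 2 (D i)) ^ 2 := by
    intro k
    rw [EuclideanSpace.norm_sq_eq]
    refine Finset.sum_congr rfl fun i _ => ?_
    rw [Real.norm_eq_abs, sq_abs, EuclideanSpace.inner_eq_star_dotProduct]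
    simp [Matrix.mulVec]
  simp only [h1]
  rw [Finset.sum_comm]
  refine Finset.sum_le_sum fun i _ => ?_
  have := hu.sum_inner_products_le (WithLp.toLp 2 (D i)) (s := Finset.univ)
  simp only [Real.norm_eq_abs, sq_abs] at this
  refine this.trans (le_of_eq ?_)
  rw [EuclideanSpace.norm_sq_eq]
  simp

/-- **Hoffman-Wielandt inequality** for a symmetric matrix and a symmetric matrix in spectral
form. -/
theorem delta2_eigs_matrix_le {n : ℕ} {M : Matrix (Fin n) (Fin n) ℝ} (hM : M.IsSymm)
    {κ : Type*} [Fintype κ] {w : κ → EuclideanSpace ℝ (Fin n)} (hw : Orthonormal ℝ w) (β : κ → ℝ)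
    {h : ℝ} (hh : 0 ≤ h) (hMB : ∑ i, ∑ j, (M i j - ∑ q, β q * w q i * w q j) ^ 2 ≤ h ^ 2) :
    delta2 (eigs (Matrix.toLin' M)) β ≤ ENNReal.ofReal h := by
  let T : EuclideanSpace ℝ (Fin n) →L[ℝ] EuclideanSpace ℝ (Fin n) :=
    LinearMap.toContinuousLinearMap (Matrix.toEuclideanLin M)
  have hTapp : ∀ x, T x = WithLp.toLp 2 (M.mulVec x) := fun x => rfl
  have hconj : delta2 (eigs (Matrix.toLin' M))
      (eigs (T : Module.End ℝ (EuclideanSpace ℝ (Fin n)))) = 0 :=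
    delta2_eigs_conj _ _ (WithLp.linearEquiv 2 ℝ (Fin n → ℝ)).symm fun x => rfl
  have hsymm : (T : EuclideanSpace ℝ (Fin n) →ₗ[ℝ] EuclideanSpace ℝ (Fin n)).IsSymmetric := by
    have : M.IsHermitian := by
      rw [Matrix.IsHermitian, Matrix.conjTranspose_eq_transpose_of_trivial]
      exact hM
    exact Matrix.isSymmetric_toEuclideanLin_iff.2 this
  have hcpt : IsCompactOperator T := isCompactOperator_of_locallyCompactSpace_dom T
  have h0 : HSBound T (Real.sqrt (∑ i, ∑ j, M i j ^ 2)) := by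
    refine hsBound_mulVec M (le_of_eq ?_)
    exact (Real.sq_sqrt (Finset.sum_nonneg fun i _ => Finset.sum_nonneg fun j _ =>
      sq_nonneg _)).symm
  have h1 : HSBound (fun x => T x - ∑ q, (β q * inner ℝ (w q) x) • w q) h := by
    have hD := hsBound_mulVec (Matrix.of fun i j => M i j - ∑ q, β q * w q i * w q j) hMB
    convert hD using 2 with x
    rw [hTapp]
    ext i
    simp only [PiLp.sub_apply, Matrix.mulVec, dotProduct, Matrix.of_apply, sub_mul,
      Finset.sum_sub_distrib]
    congr 1
    rw [WithLp.ofLp_sum, Finset.sum_apply]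
    simp only [WithLp.ofLp_smul, Pi.smul_apply, smul_eq_mul, Finset.sum_mul]
    rw [Finset.sum_comm]
    refine Finset.sum_congr rfl fun q _ => ?_
    rw [EuclideanSpace.inner_eq_star_dotProduct]
    simp only [dotProduct, star_trivial, Finset.mul_sum, Finset.sum_mul]
    refine Finset.sum_congr rfl fun j _ => ?_
    ring
  calc _ ≤ _ + _ := delta2_triangle _ (eigs (T : Module.End ℝ (EuclideanSpace ℝ (Fin n)))) _
    _ ≤ 0 + ENNReal.ofReal h := by
        rw [hconj]; gcongr; exact delta2_eigs_le hcpt hsymm h0 hw β hh h1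
    _ = _ := zero_add _

end BallGraph

/-! ### Perturbation of Cholesky and QR factors -/

namespace BallGraph

section Frobenius

open scoped Matrix.Norms.Frobenius
open Matrix

theorem frobenius_sq {ι κ : Type*} [Fintype ι] [Fintype κ] (A : Matrix ι κ ℝ) :
    ‖A‖ ^ 2 = ∑ i, ∑ j, A i j ^ 2 := by
  rw [Matrix.frobenius_norm_def, ← Real.rpow_natCast, ← Real.rpow_mul (by positivity)]
  norm_num

theorem trace_transpose_mul_eq_sum {ι κ : Type*} [Fintype ι] [Fintype κ] (A B : Matrix ι κ ℝ) :
    (Aᵀ * B).trace = ∑ i, ∑ j, A i j * B i j := by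
  rw [Finset.sum_comm]
  simp [Matrix.trace, Matrix.mul_apply]

theorem trace_transpose_mul_self {ι κ : Type*} [Fintype ι] [Fintype κ] (A : Matrix ι κ ℝ) :
    (Aᵀ * A).trace = ‖A‖ ^ 2 := by
  rw [trace_transpose_mul_eq_sum, frobenius_sq]
  simp only [sq]

theorem abs_trace_transpose_mul_le {ι κ : Type*} [Fintype ι] [Fintype κ] (A B : Matrix ι κ ℝ) :
    |(Aᵀ * B).trace| ≤ ‖A‖ * ‖B‖ := by
  refine abs_le_of_sq_le_sq ?_ (by positivity)
  rw [trace_transpose_mul_eq_sum, mul_pow, frobenius_sq, frobenius_sq]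
  simp only [← Fintype.sum_prod_type']
  exact Finset.sum_mul_sq_le_sq_mul_sq _ _ _

/-- Perturbation bound for the Cholesky factor of a matrix close to the identity. -/
theorem norm_sub_one_le_of_upperTriangular {ι : Type*} [Fintype ι] [LinearOrder ι]
    (U : Matrix ι ι ℝ) (hU : ∀ k l, l < k → U k l = 0) (hpos : ∀ k, 0 < U k k)
    (hD : ‖Uᵀ * U - 1‖ ≤ 1 / 2) : ‖U - 1‖ ^ 2 ≤ 2 * ‖Uᵀ * U - 1‖ ^ 2 := by
  set D := Uᵀ * U - 1 with hDdef
  have hUtri : U.BlockTriangular id := fun k l h => hU k l h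
  have hdet : IsUnit U.det := by
    rw [Matrix.det_of_isUpperTriangular hUtri]
    exact (Finset.prod_ne_zero_iff.2 fun i _ => (hpos i).ne').isUnit
  have : Invertible U := U.invertibleOfIsUnitDet hdet
  set V := U⁻¹ with hV
  have hUV : U * V = 1 := Matrix.mul_nonsing_inv U hdet
  have hVU : V * U = 1 := Matrix.nonsing_inv_mul U hdet
  have hVtri : V.BlockTriangular id := Matrix.blockTriangular_inv_of_blockTriangular hUtri
  have hVdiag : ∀ k, V k k = (U k k)⁻¹ := by
    intro k
    have h1 : (U * V) k k = 1 := by rw [hUV]; simp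
    rw [Matrix.mul_apply, Finset.sum_eq_single k] at h1
    · exact eq_inv_of_mul_eq_one_right h1
    · intro j _ hj
      rcases lt_or_gt_of_ne hj with h | h
      · rw [hU k j h, zero_mul]
      · rw [hVtri h, mul_zero]
    · simp
  -- X = U - Vᵀ, where V = U⁻¹ is upper triangular. Hence X agrees with U strictly above the
  -- diagonal and dominates U - 1 entry by entry; it is X that gets estimated.
  set X := Vᵀ * D with hX
  have hX' : X = U - Vᵀ := by
    rw [hX, hDdef, mul_sub, mul_one, ← mul_assoc, ← Matrix.transpose_mul, hUV, transpose_one,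
      one_mul]
  -- The form of UᵀU = 1 + D is bounded below by 1/2.
  have hlow : ∀ Y : Matrix ι ι ℝ, ‖Y‖ ^ 2 ≤ 2 * ‖U * Y‖ ^ 2 := by
    intro Y
    have h1 : ‖U * Y‖ ^ 2 = ‖Y‖ ^ 2 + (Yᵀ * (D * Y)).trace := by
      rw [← trace_transpose_mul_self, ← trace_transpose_mul_self, ← Matrix.trace_add,
        ← mul_add, Matrix.transpose_mul, hDdef, sub_mul, one_mul, add_sub_cancel,
        mul_assoc, mul_assoc]
    have h2 := abs_trace_transpose_mul_le Y (D * Y)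
    have h3 : ‖D * Y‖ ≤ ‖D‖ * ‖Y‖ := Matrix.frobenius_norm_mul D Y
    have h4 : ‖Y‖ * ‖D * Y‖ ≤ 1 / 2 * ‖Y‖ ^ 2 := by
      calc ‖Y‖ * ‖D * Y‖ ≤ ‖Y‖ * (1 / 2 * ‖Y‖) := by gcongr; exact h3.trans (by gcongr)
        _ = _ := by ring
    have h5 := (abs_le.1 (h2.trans h4)).1
    rw [h1]; linarith
  have hXD : ‖X‖ ^ 2 ≤ 2 * ‖D‖ ^ 2 := by
    have h1 := hlow (V * X)
    rw [show U * (V * X) = X by rw [← mul_assoc U V X, hUV, one_mul]] at h1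
    -- ‖X‖² is the Frobenius product of V X and D, and U (V X) = X gives ‖V X‖² ≤ 2 ‖X‖².
    have h2 : ‖X‖ ^ 2 ≤ ‖V * X‖ * ‖D‖ := by
      have h3 : (Xᵀ * X).trace = ((V * X)ᵀ * D).trace := by
        rw [Matrix.transpose_mul V X, mul_assoc, ← hX]
      rw [← trace_transpose_mul_self, h3]
      exact (le_abs_self _).trans (abs_trace_transpose_mul_le _ _)
    have h4 : (‖X‖ ^ 2) ^ 2 ≤ 2 * ‖X‖ ^ 2 * ‖D‖ ^ 2 := by
      calc (‖X‖ ^ 2) ^ 2 ≤ (‖V * X‖ * ‖D‖) ^ 2 := by gcongr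
        _ = ‖V * X‖ ^ 2 * ‖D‖ ^ 2 := by ring
        _ ≤ _ := by gcongr
    rcases (sq_nonneg ‖X‖).eq_or_lt with h | h
    · rw [← h]; positivity
    · nlinarith
  refine le_trans ?_ hXD
  rw [frobenius_sq, frobenius_sq]
  refine Finset.sum_le_sum fun k _ => Finset.sum_le_sum fun l _ => ?_
  rw [hX']
  simp only [Matrix.sub_apply, Matrix.transpose_apply]
  rcases lt_trichotomy k l with h | h | h
  · rw [hVtri h, Matrix.one_apply_ne h.ne]
  · subst h
    rw [hVdiag, Matrix.one_apply_eq]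
    have hp := hpos k
    -- Since U k k > 0, the second factor exceeds 1.
    have : U k k - (U k k)⁻¹ = (U k k - 1) * (1 + (U k k)⁻¹) := by field_simp; ring
    rw [this, mul_pow]
    refine le_mul_of_one_le_right (sq_nonneg _) ?_
    have := inv_pos.2 hp
    nlinarith
  · rw [hU k l h, Matrix.one_apply_ne h.ne', sub_zero, zero_pow two_ne_zero]
    exact sq_nonneg _

/-- The part of the Cholesky factor carried by a lower set obeys the perturbation bound relative
to the corresponding part of the Gram matrix. -/
theorem sum_sq_sub_one_le_of_lowerSet {ι : Type*} [Fintype ι] [LinearOrder ι]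
    (U : Matrix ι ι ℝ) (hU : ∀ k l, l < k → U k l = 0) (hpos : ∀ k, 0 < U k k)
    (hD : ‖Uᵀ * U - 1‖ ≤ 1 / 2) (p : ι → Prop) [DecidablePred p] (hp : ∀ k l, k ≤ l → p l → p k) :
    ∑ k, ∑ l, (if p l then (U - 1) k l ^ 2 else 0) ≤
      2 * ∑ k, ∑ l, if p k ∧ p l then (Uᵀ * U - 1) k l ^ 2 else 0 := by
  have hsplit : ∀ F : ι → ι → ℝ, ∑ k : {k // p k}, ∑ l : {k // p k}, F k l =
      ∑ k, ∑ l, if p k ∧ p l then F k l else 0 := by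
    intro F
    have h1 : ∀ k : ι, ∑ l : {k // p k}, F k l = ∑ l, if p l then F k l else 0 := fun k => by
      rw [← Finset.sum_filter, Finset.sum_subtype (Finset.univ.filter p) (p := p)
            (by simp)]
    calc ∑ k : {k // p k}, ∑ l : {k // p k}, F k l
        = ∑ k : {k // p k}, ∑ l, (if p l then F k l else 0) :=
          Finset.sum_congr rfl fun k _ => h1 k
      _ = ∑ k, if p k then ∑ l, (if p l then F k l else 0) else 0 := by
          rw [← Finset.sum_filter, Finset.sum_subtype (Finset.univ.filter p) (p := p)
            (by simp)]
      _ = _ := by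
          refine Finset.sum_congr rfl fun k _ => ?_
          split_ifs with h
          · simp [h]
          · simp [h]
  let U' : Matrix {k // p k} {k // p k} ℝ := U.submatrix (↑) (↑)
  -- A column of U indexed in the lower set has no entries outside it, so this block of UᵀU is built
  -- from the corresponding block of U alone.
  have hU' : U'ᵀ * U' - 1 = (Uᵀ * U - 1).submatrix (↑) (↑) := by
    ext k l
    have h1 : (U'ᵀ * U') k l = (Uᵀ * U) k l := by
      simp only [Matrix.mul_apply, Matrix.transpose_apply, U', Matrix.submatrix_apply]
      rw [← Finset.sum_subtype (Finset.univ.filter p) (p := p) (by simp) fun j => U j k * U j l,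
        Finset.sum_filter]
      refine Finset.sum_congr rfl fun j _ => ?_
      split_ifs with h
      · rfl
      · have : (l : ι) < j := lt_of_not_ge fun hjl => h (hp j l hjl l.2)
        rw [hU j l this, mul_zero]
    simp only [Matrix.sub_apply, h1, Matrix.submatrix_apply, Matrix.one_apply, Subtype.ext_iff]
  have hsmall : ‖U'ᵀ * U' - 1‖ ≤ 1 / 2 := by
    refine le_trans (abs_le_of_sq_le_sq' ?_ (norm_nonneg _)).2 hD
    rw [hU', frobenius_sq, frobenius_sq]
    refine le_trans (le_of_eq (hsplit fun k l => (Uᵀ * U - 1) k l ^ 2)) ?_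
    refine Finset.sum_le_sum fun k _ => Finset.sum_le_sum fun l _ => ?_
    split_ifs
    · exact le_rfl
    · exact sq_nonneg _
  have key : ‖U' - 1‖ ^ 2 ≤ 2 * ‖U'ᵀ * U' - 1‖ ^ 2 :=
    norm_sub_one_le_of_upperTriangular U' (fun k l h => hU k l h) (fun k => hpos k) hsmall
  rw [hU', frobenius_sq, frobenius_sq] at key
  refine le_trans (le_of_eq ?_) (key.trans (le_of_eq (congrArg (2 * ·)
    (hsplit fun k l => (Uᵀ * U - 1) k l ^ 2))))
  have h2 : ∀ k l : {k // p k}, (U' - 1) k l ^ 2 = (U - 1) k l ^ 2 := by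
    intro k l
    simp only [Matrix.sub_apply, U', Matrix.submatrix_apply, Matrix.one_apply, Subtype.ext_iff]
  simp only [h2]
  rw [hsplit (fun k l => (U - 1) k l ^ 2)]
  refine Finset.sum_congr rfl fun k _ => Finset.sum_congr rfl fun l _ => ?_
  by_cases hl : p l
  · by_cases hk : p k
    · simp [hl, hk]
    · have : l < k := lt_of_not_ge fun hkl => hk (hp k l hkl hl)
      simp [hl, hk, hU k l this, this.ne']
  · simp [hl]

/-- Gram-Schmidt in the order of the indices. The positive diagonal fixes the signs, without which U
could not be close to 1. -/
theorem exists_qr {R n : ℕ} (φ : Fin R → EuclideanSpace ℝ (Fin n)) (hφ : LinearIndependent ℝ φ) :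
    ∃ (q : Fin R → EuclideanSpace ℝ (Fin n)) (U : Matrix (Fin R) (Fin R) ℝ), Orthonormal ℝ q ∧
      (∀ k l, l < k → U k l = 0) ∧ (∀ k, 0 < U k k) ∧ (∀ l, φ l = ∑ k, U k l • q k) := by
  let q := InnerProductSpace.gramSchmidtNormed ℝ φ
  have hq : Orthonormal ℝ q := InnerProductSpace.gramSchmidtNormed_orthonormal hφ
  have hne : ∀ k, 0 < ‖InnerProductSpace.gramSchmidt ℝ φ k‖ := fun k =>
    norm_pos_iff.2 (InnerProductSpace.gramSchmidt_ne_zero k hφ)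
  have hqk : ∀ k x, inner ℝ (q k) x = ‖InnerProductSpace.gramSchmidt ℝ φ k‖⁻¹ *
      inner ℝ (InnerProductSpace.gramSchmidt ℝ φ k) x := by
    intro k x
    simp only [q, InnerProductSpace.gramSchmidtNormed]
    rw [real_inner_smul_left]
    rfl
  refine ⟨q, Matrix.of fun k l => inner ℝ (q k) (φ l), hq, ?_, ?_, ?_⟩
  · intro k l hlk
    rw [Matrix.of_apply, hqk, InnerProductSpace.gramSchmidt_inv_triangular ℝ φ hlk, mul_zero]
  · intro k
    rw [Matrix.of_apply, hqk]
    have h1 : inner ℝ (InnerProductSpace.gramSchmidt ℝ φ k) (φ k) =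
        ‖InnerProductSpace.gramSchmidt ℝ φ k‖ ^ 2 := by
      conv_lhs => rw [InnerProductSpace.gramSchmidt_def'' ℝ φ k]
      rw [inner_add_right, real_inner_self_eq_norm_sq, inner_sum, Finset.sum_eq_zero, add_zero]
      intro i hi
      rw [real_inner_smul_right, InnerProductSpace.gramSchmidt_orthogonal ℝ φ
        (Finset.mem_Iio.1 hi).ne', mul_zero]
    rw [h1]
    have := hne k
    positivity
  · intro l
    have hmem : φ l ∈ Submodule.span ℝ (Set.range q) := by
      rw [InnerProductSpace.span_gramSchmidtNormed_range, InnerProductSpace.span_gramSchmidt]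
      exact Submodule.subset_span ⟨l, rfl⟩
    obtain ⟨c, hc⟩ := (Submodule.mem_span_range_iff_exists_fun ℝ).1 hmem
    rw [← hc]
    refine Finset.sum_congr rfl fun k _ => ?_
    rw [Matrix.of_apply, ← hc, hq.inner_right_fintype]

end Frobenius

end BallGraph

namespace BallGraph

section Frobenius

open scoped Matrix.Norms.Frobenius
open Matrix

/-- If ∑ c_k φ_k = 0, then |c|² = -∑ c_k c_l Δ_kl ≤ ‖Δ‖ |c|² ≤ |c|² / 2. -/
theorem linearIndependent_of_gram {R n : ℕ} (φ : Fin R → EuclideanSpace ℝ (Fin n))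
    (Δ : Matrix (Fin R) (Fin R) ℝ) (hΔ : ∀ k l, inner ℝ (φ k) (φ l) = (1 + Δ) k l)
    (hsmall : ‖Δ‖ ≤ 1 / 2) : LinearIndependent ℝ φ := by
  rw [Fintype.linearIndependent_iff]
  intro c hc
  have h1 : ∑ k, c k ^ 2 + ∑ k, ∑ l, (c k * c l) * Δ k l = 0 := by
    have h2 : inner ℝ (∑ k, c k • φ k) (∑ l, c l • φ l) = 0 := by rw [hc, inner_zero_left]
    rw [sum_inner] at h2
    simp only [inner_sum, real_inner_smul_left, real_inner_smul_right, hΔ] at h2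
    rw [← h2, ← Finset.sum_add_distrib]
    refine Finset.sum_congr rfl fun k _ => ?_
    simp only [Matrix.add_apply, mul_add, Finset.sum_add_distrib, Matrix.one_apply]
    congr 1
    · simp [sq]
    · exact Finset.sum_congr rfl fun l _ => by ring
  have h3 : (∑ k, ∑ l, (c k * c l) * Δ k l) ^ 2 ≤ (∑ k, c k ^ 2) ^ 2 * ‖Δ‖ ^ 2 := by
    rw [frobenius_sq]
    have e1 : (∑ k, c k ^ 2) ^ 2 = ∑ k, ∑ l, (c k * c l) ^ 2 := by
      rw [sq, Finset.sum_mul_sum]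
      exact Finset.sum_congr rfl fun k _ => Finset.sum_congr rfl fun l _ => by ring
    rw [e1]
    simp only [← Fintype.sum_prod_type']
    exact Finset.sum_mul_sq_le_sq_mul_sq _ _ _
  have h0 : 0 ≤ ∑ k, c k ^ 2 := Finset.sum_nonneg fun k _ => sq_nonneg _
  have h4 : ∑ k, c k ^ 2 = 0 := by
    have h5 : ∑ k, ∑ l, (c k * c l) * Δ k l = -∑ k, c k ^ 2 := by linarith
    rw [h5, neg_sq] at h3
    by_contra hne
    have hpos : 0 < (∑ k, c k ^ 2) ^ 2 := by positivity
    have h6 : 1 ≤ ‖Δ‖ ^ 2 := by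
      by_contra! h7
      nlinarith
    nlinarith [norm_nonneg Δ]
  intro k
  have := (Finset.sum_eq_zero_iff_of_nonneg (fun k _ => sq_nonneg (c k))).1 h4 k
    (Finset.mem_univ _)
  exact pow_eq_zero_iff two_ne_zero |>.1 this

/-- Replacing nearly orthonormal vectors by an adapted orthonormal system in the matrix
`∑ A k l φ k φ lᵀ`. -/
theorem exists_orthonormal_close {R n : ℕ} (φ : Fin R → EuclideanSpace ℝ (Fin n))
    (Δ : Matrix (Fin R) (Fin R) ℝ) (hΔ : ∀ k l, inner ℝ (φ k) (φ l) = (1 + Δ) k l)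
    (hsmall : ‖Δ‖ ≤ 1 / 2) (A : Matrix (Fin R) (Fin R) ℝ) (hA : A.IsSymm)
    (lev : Fin R → ℕ) (hlev : Monotone lev) (J : ℕ) (hJ : ∀ k, lev k ≤ J) :
    ∃ q : Fin R → EuclideanSpace ℝ (Fin n), Orthonormal ℝ q ∧
      ‖(Matrix.of fun i j => ∑ k, ∑ l, A k l * φ k i * φ l j) -
        (Matrix.of fun i j => ∑ k, ∑ l, A k l * q k i * q l j : Matrix (Fin n) (Fin n) ℝ)‖ ≤
      6 * ∑ b ∈ Finset.range (J + 1),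
        Real.sqrt (∑ k, ∑ l, if lev k ≤ b ∧ lev l ≤ b then Δ k l ^ 2 else 0) *
          Real.sqrt (∑ k, ∑ l, if lev k = b then A k l ^ 2 else 0) := by
  obtain ⟨q, U, hq, hU, hpos, hφ⟩ := exists_qr φ (linearIndependent_of_gram φ Δ hΔ hsmall)
  refine ⟨q, hq, ?_⟩
  have hUU : Uᵀ * U - 1 = Δ := by
    ext k l
    have h1 : (Uᵀ * U) k l = inner ℝ (φ k) (φ l) := by
      rw [hφ k, hφ l, hq.inner_sum]
      simp [Matrix.mul_apply]
    rw [Matrix.sub_apply, h1, hΔ, Matrix.add_apply]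
    ring
  set N := U - 1 with hN
  have hUN : U = 1 + N := by rw [hN]; abel
  have hNle : ‖N‖ ≤ 1 := by
    have := norm_sub_one_le_of_upperTriangular U hU hpos (by rw [hUU]; exact hsmall)
    rw [hUU] at this
    nlinarith [norm_nonneg N, norm_nonneg Δ]
  let Q : Matrix (Fin n) (Fin R) ℝ := Matrix.of fun i k => q k i
  let Φ : Matrix (Fin n) (Fin R) ℝ := Matrix.of fun i k => φ k i
  have hΦ : Φ = Q * U := by
    ext i k
    simp only [Φ, Q, Matrix.of_apply, Matrix.mul_apply, hφ k]
    rw [WithLp.ofLp_sum, Finset.sum_apply]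
    simp [mul_comm]
  have hQQ : Qᵀ * Q = 1 := by
    ext k l
    have := orthonormal_iff_ite.1 hq k l
    rw [EuclideanSpace.inner_eq_star_dotProduct] at this
    rw [Matrix.one_apply, ← this]
    simp [Q, Matrix.mul_apply, dotProduct, mul_comm]
  have hform : ∀ Ψ : Matrix (Fin n) (Fin R) ℝ,
      (Matrix.of fun i j => ∑ k, ∑ l, A k l * Ψ i k * Ψ j l) = Ψ * A * Ψᵀ := by
    intro Ψ
    ext i j
    simp only [Matrix.of_apply, Matrix.mul_apply, Matrix.transpose_apply, Finset.sum_mul]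
    rw [Finset.sum_comm]
    refine Finset.sum_congr rfl fun k _ => Finset.sum_congr rfl fun l _ => ?_
    ring
  -- Q has orthonormal columns, so X ↦ Q X Qᵀ preserves the Frobenius norm and the question reduces
  -- to R × R matrices.
  have hiso : ∀ X : Matrix (Fin R) (Fin R) ℝ, ‖Q * X * Qᵀ‖ = ‖X‖ := by
    intro X
    have h1 : ‖Q * X * Qᵀ‖ ^ 2 = ‖X‖ ^ 2 := by
      rw [← trace_transpose_mul_self, ← trace_transpose_mul_self]
      have : (Q * X * Qᵀ)ᵀ * (Q * X * Qᵀ) = Q * (Xᵀ * X * Qᵀ) := by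
        simp only [Matrix.transpose_mul, Matrix.transpose_transpose, Matrix.mul_assoc]
        rw [← Matrix.mul_assoc Qᵀ Q, hQQ, Matrix.one_mul]
      rw [this, Matrix.trace_mul_comm, Matrix.mul_assoc, hQQ, Matrix.mul_one]
    exact (sq_eq_sq₀ (norm_nonneg _) (norm_nonneg _)).1 h1
  have h1 : (Matrix.of fun i j => ∑ k, ∑ l, A k l * φ k i * φ l j) -
        (Matrix.of fun i j => ∑ k, ∑ l, A k l * q k i * q l j : Matrix (Fin n) (Fin n) ℝ) =
      Q * (U * A * Uᵀ - A) * Qᵀ := by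
    have e1 := hform Φ
    have e2 := hform Q
    simp only [Φ, Q, Matrix.of_apply] at e1 e2
    rw [e1, e2]
    change Φ * A * Φᵀ - Q * A * Qᵀ = _
    rw [hΦ, Matrix.transpose_mul, Matrix.mul_sub, Matrix.sub_mul]
    simp only [Matrix.mul_assoc]
  rw [h1, hiso]
  -- Symmetry of A makes the second term the transpose of the first, and ‖N‖ ≤ 1 absorbs the third:
  -- the three cost 3 ‖N A‖. The factor 2 in `h5` then gives the constant 6.
  have h2 : U * A * Uᵀ - A = N * A + (N * A)ᵀ + N * A * Nᵀ := by
    rw [hUN, Matrix.transpose_mul, hA.eq, Matrix.transpose_add, Matrix.transpose_one]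
    noncomm_ring
  have h3 : ‖U * A * Uᵀ - A‖ ≤ 3 * ‖N * A‖ := by
    rw [h2]
    calc ‖N * A + (N * A)ᵀ + N * A * Nᵀ‖ ≤ ‖N * A‖ + ‖(N * A)ᵀ‖ + ‖N * A * Nᵀ‖ := norm_add₃_le
      _ ≤ ‖N * A‖ + ‖N * A‖ + ‖N * A‖ * 1 := by
          gcongr
          · exact (Matrix.frobenius_norm_transpose _).le
          · refine (Matrix.frobenius_norm_mul _ _).trans ?_
            rw [Matrix.frobenius_norm_transpose]
            gcongr
      _ = _ := by ring
  refine h3.trans ?_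
  -- The product N A is split along its inner index: the columns of N at level b meet the rows of A
  -- at level b. Bounding ‖N A‖ by ‖N‖ ‖A‖ would pair the full Gram defect with the large low-level
  -- rows of A.
  let Nb : ℕ → Matrix (Fin R) (Fin R) ℝ := fun b => Matrix.of fun k l =>
    if lev l = b then N k l else 0
  let Ab : ℕ → Matrix (Fin R) (Fin R) ℝ := fun b => Matrix.of fun k l =>
    if lev k = b then A k l else 0
  have h4 : N * A = ∑ b ∈ Finset.range (J + 1), Nb b * Ab b := by
    ext k l
    simp only [Matrix.sum_apply, Matrix.mul_apply, Nb, Ab, Matrix.of_apply]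
    rw [Finset.sum_comm]
    refine Finset.sum_congr rfl fun j _ => ?_
    rw [Finset.sum_eq_single_of_mem (lev j) (Finset.mem_range.2 (Nat.lt_succ_of_le (hJ j)))]
    · simp
    · intro b _ hb
      simp [hb.symm]
  have h5 : ∀ b, ‖Nb b‖ ≤ 2 * Real.sqrt
      (∑ k, ∑ l, if lev k ≤ b ∧ lev l ≤ b then Δ k l ^ 2 else 0) := by
    intro b
    have h6 := sum_sq_sub_one_le_of_lowerSet U hU hpos (by rw [hUU]; exact hsmall)
      (fun k => lev k ≤ b) (fun k l hkl hl => (hlev hkl).trans hl)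
    rw [hUU] at h6
    have h7 : ‖Nb b‖ ^ 2 ≤ ∑ k, ∑ l, (if lev l ≤ b then (U - 1) k l ^ 2 else 0) := by
      rw [frobenius_sq]
      refine Finset.sum_le_sum fun k _ => Finset.sum_le_sum fun l _ => ?_
      simp only [Nb, Matrix.of_apply]
      by_cases hl : lev l = b
      · simp [hl, hN]
      · simp only [hl, if_false, ne_eq, OfNat.ofNat_ne_zero, not_false_eq_true, zero_pow]
        split_ifs
        · exact sq_nonneg _
        · exact le_rfl
    have h8 : (0 : ℝ) ≤ ∑ k, ∑ l, if lev k ≤ b ∧ lev l ≤ b then Δ k l ^ 2 else 0 :=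
      Finset.sum_nonneg fun k _ => Finset.sum_nonneg fun l _ => by split_ifs <;> positivity
    refine (abs_le_of_sq_le_sq' ?_ (by positivity)).2
    rw [mul_pow, Real.sq_sqrt h8]
    linarith [h7.trans h6]
  have h9 : ∀ b, ‖Ab b‖ = Real.sqrt (∑ k, ∑ l, if lev k = b then A k l ^ 2 else 0) := by
    intro b
    rw [← Real.sqrt_sq (norm_nonneg (Ab b)), frobenius_sq]
    congr 1
    refine Finset.sum_congr rfl fun k _ => Finset.sum_congr rfl fun l _ => ?_
    simp only [Ab, Matrix.of_apply]
    split_ifs <;> simp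
  have h10 : ‖N * A‖ ≤ ∑ b ∈ Finset.range (J + 1), 2 *
      (Real.sqrt (∑ k, ∑ l, if lev k ≤ b ∧ lev l ≤ b then Δ k l ^ 2 else 0) *
          Real.sqrt (∑ k, ∑ l, if lev k = b then A k l ^ 2 else 0)) := by
    rw [h4]
    refine (norm_sum_le _ _).trans (Finset.sum_le_sum fun b _ => ?_)
    refine (Matrix.frobenius_norm_mul _ _).trans ?_
    rw [h9, ← mul_assoc]
    exact mul_le_mul_of_nonneg_right (h5 b) (Real.sqrt_nonneg _)
  rw [← Finset.mul_sum] at h10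
  linarith

end Frobenius

end BallGraph

/-! ### Hilbert-Schmidt operators -/

namespace BallGraph

section HilbertSchmidt

variable {H : Type*} [NormedAddCommGroup H] [InnerProductSpace ℝ H]

theorem HSBound.norm_apply_le {T : H →ₗ[ℝ] H} {c : ℝ} (hc : 0 ≤ c) (hT : HSBound T c) (x : H) :
    ‖T x‖ ≤ c * ‖x‖ := by
  rcases eq_or_ne x 0 with rfl | hx
  · simp
  have hx' : 0 < ‖x‖ := norm_pos_iff.2 hx
  have hu : Orthonormal ℝ (fun _ : Fin 1 => (‖x‖⁻¹ : ℝ) • x) := by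
    rw [orthonormal_subsingleton_iff]
    intro _
    rw [norm_smul, norm_inv, norm_norm, inv_mul_cancel₀ hx'.ne']
  have h1 := hT 1 _ hu
  simp only [Finset.univ_unique, Finset.sum_singleton, map_smul, norm_smul, norm_inv,
    norm_norm] at h1
  have h2 := abs_le_of_sq_le_sq' h1 hc
  have h3 := h2.2
  rw [inv_mul_le_iff₀ hx'] at h3
  linarith

/-- A Hilbert-Schmidt operator is compact. -/
theorem HSBound.isCompactOperator [CompleteSpace H] {T : H →L[ℝ] H} {c : ℝ} (hT : HSBound T c) :
    IsCompactOperator T := by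
  let S : Set ℝ := {a | ∃ (m : ℕ) (u : Fin m → H), Orthonormal ℝ u ∧ a = ∑ i, ‖T (u i)‖ ^ 2}
  have hSne : S.Nonempty := ⟨0, 0, Fin.elim0, ⟨fun i => i.elim0, fun i => i.elim0⟩, by simp⟩
  have hSbdd : BddAbove S := by
    refine ⟨c ^ 2, ?_⟩
    rintro _ ⟨m, u, hu, rfl⟩
    exact hT m u hu
  have happrox : ∀ ε : ℝ, 0 < ε → ∃ F : H →L[ℝ] H, IsCompactOperator F ∧ ‖T - F‖ ≤ ε := by
    intro ε hε
    -- A finite orthonormal system within ε² of the supremum leaves at most ε² to any further unit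
    -- vector, so T is ε-close to its restriction to the span of the system.
    obtain ⟨_, ⟨m, u, hu, rfl⟩, hlt⟩ := exists_lt_of_lt_csSup hSne
      (show sSup S - ε ^ 2 < sSup S by nlinarith)
    let K := Submodule.span ℝ (Set.range u)
    have : FiniteDimensional ℝ K := FiniteDimensional.span_of_finite ℝ (Set.finite_range u)
    let P : H →L[ℝ] H := K.starProjection
    refine ⟨T ∘L P, ?_, ?_⟩
    · have h1 : IsCompactOperator (K.orthogonalProjectionOnto) :=
        isCompactOperator_of_locallyCompactSpace_dom _
      exact h1.clm_comp (T ∘L K.subtypeL)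
    · refine ContinuousLinearMap.opNorm_le_bound _ hε.le fun x => ?_
      have hperp : ∀ y ∈ Kᗮ, ‖T y‖ ≤ ε * ‖y‖ := by
        intro y hy
        rcases eq_or_ne y 0 with rfl | hy0
        · simp
        have hy' : 0 < ‖y‖ := norm_pos_iff.2 hy0
        have hu1 : Orthonormal ℝ (fun _ : Fin 1 => (‖y‖⁻¹ : ℝ) • y) := by
          rw [orthonormal_subsingleton_iff]
          intro _
          rw [norm_smul, norm_inv, norm_norm, inv_mul_cancel₀ hy'.ne']
        have hext : Orthonormal ℝ (Sum.elim u fun _ : Fin 1 => (‖y‖⁻¹ : ℝ) • y) := by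
          refine orthonormal_sumElim hu hu1 fun i _ => ?_
          rw [real_inner_smul_right, hy (u i) (Submodule.subset_span ⟨i, rfl⟩), mul_zero]
        have hmem : ∑ i, ‖T (u i)‖ ^ 2 + ‖T ((‖y‖⁻¹ : ℝ) • y)‖ ^ 2 ∈ S := by
          refine ⟨m + 1, Sum.elim u (fun _ : Fin 1 => (‖y‖⁻¹ : ℝ) • y) ∘ finSumFinEquiv.symm,
            hext.comp _ (Equiv.injective _), ?_⟩
          have := finSumFinEquiv.symm.sum_comp fun i => ‖T (Sum.elim u
            (fun _ : Fin 1 => (‖y‖⁻¹ : ℝ) • y) i)‖ ^ 2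
          rw [Function.comp_def, this]
          simp
        have h2 := le_csSup hSbdd hmem
        have h3 : ‖T ((‖y‖⁻¹ : ℝ) • y)‖ ^ 2 ≤ ε ^ 2 := by linarith
        have h4 := (abs_le_of_sq_le_sq' h3 hε.le).2
        rw [map_smul, norm_smul, norm_inv, norm_norm, inv_mul_le_iff₀ hy'] at h4
        linarith
      have h1 : (T - T ∘L P) x = T (x - P x) := by simp
      rw [h1]
      refine (hperp _ (K.sub_starProjection_mem_orthogonal x)).trans ?_
      gcongr
      have h6 : x - P x = Kᗮ.starProjection x := by
        rw [Submodule.starProjection_orthogonal']; simp [P]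
      rw [h6]
      exact Kᗮ.norm_starProjection_apply_le x
  choose F hF hFT using fun k : ℕ => happrox (1 / ((k : ℝ) + 1)) (by positivity)
  refine isCompactOperator_of_tendsto (l := Filter.atTop) (F := F) ?_
    (Filter.Eventually.of_forall hF)
  rw [tendsto_iff_norm_sub_tendsto_zero]
  refine squeeze_zero (fun _ => norm_nonneg _) (fun k => ?_) tendsto_one_div_add_atTop_nhds_zero_nat
  rw [norm_sub_rev]
  exact hFT k

end HilbertSchmidt

/-! ### Integral operators with square integrable kernels -/

section Kernel

variable {X : Type*} [MeasurableSpace X] {μ : Measure X}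

theorem inner_Lp_eq_integral (g h : Lp ℝ 2 μ) : inner ℝ g h = ∫ x, g x * h x ∂μ := by
  rw [L2.inner_def]
  exact integral_congr_ae (Filter.Eventually.of_forall fun x => by simp [mul_comm])

/-- An integral operator is Hilbert-Schmidt, with the `L²` norm of the kernel as a bound. -/
theorem hsBound_of_kernel [SFinite μ] (S : Lp ℝ 2 μ → Lp ℝ 2 μ) (D : X → X → ℝ)
    (hD : Measurable (Function.uncurry D))
    (hS : ∀ g, S g =ᵐ[μ] fun x => ∫ y, D x y * g y ∂μ)
    (hD2 : Integrable (fun z : X × X => D z.1 z.2 ^ 2) (μ.prod μ)) {c : ℝ}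
    (hc : ∫ z : X × X, D z.1 z.2 ^ 2 ∂(μ.prod μ) ≤ c ^ 2) : HSBound S c := by
  intro m u hu
  refine le_trans ?_ hc
  rw [integral_prod _ hD2]
  have h1 : ∀ i, ‖S (u i)‖ ^ 2 = ∫ x, (∫ y, D x y * u i y ∂μ) ^ 2 ∂μ := by
    intro i
    rw [← real_inner_self_eq_norm_sq, inner_Lp_eq_integral]
    refine integral_congr_ae ?_
    filter_upwards [hS (u i)] with x hx
    rw [hx, sq]
  have hint : ∀ i, Integrable (fun x => (∫ y, D x y * u i y ∂μ) ^ 2) μ := by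
    intro i
    have h2 : MemLp (fun x => ∫ y, D x y * u i y ∂μ) 2 μ :=
      (memLp_congr_ae (hS (u i))).1 (Lp.memLp (S (u i)))
    exact h2.integrable_sq
  simp only [h1]
  rw [← integral_finsetSum _ fun i _ => hint i]
  refine integral_mono_ae (integrable_finsetSum _ fun i _ => hint i) hD2.integral_prod_left ?_
  filter_upwards [hD2.prod_right_ae] with x hx
  have hmem : MemLp (fun y => D x y) 2 μ :=
    (memLp_two_iff_integrable_sq (hD.comp measurable_prodMk_left).aestronglyMeasurable).2 hx
  -- Bessel for the section D(x, ·), to be integrated over x.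
  have hb := hu.sum_inner_products_le (hmem.toLp _) (s := Finset.univ)
  have h3 : ∀ i, inner ℝ (u i) (hmem.toLp _) = ∫ y, D x y * u i y ∂μ := by
    intro i
    rw [inner_Lp_eq_integral]
    refine integral_congr_ae ?_
    filter_upwards [hmem.coeFn_toLp] with y hy
    rw [hy, mul_comm]
  have h4 : ‖hmem.toLp _‖ ^ 2 = ∫ y, D x y ^ 2 ∂μ := by
    rw [← real_inner_self_eq_norm_sq, inner_Lp_eq_integral]
    refine integral_congr_ae ?_
    filter_upwards [hmem.coeFn_toLp] with y hy
    rw [hy, sq]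
  rw [h4] at hb
  simpa only [h3, Real.norm_eq_abs, sq_abs] using hb

theorem IsGraphon.ae_prod_mem_Icc [SFinite μ] {W : X → X → ℝ} (hW : IsGraphon μ W) :
    ∀ᵐ z ∂(μ.prod μ), W z.1 z.2 ∈ Set.Icc (0 : ℝ) 1 := by
  have hm : MeasurableSet {z : X × X | W z.1 z.2 ∈ Set.Icc (0 : ℝ) 1} :=
    hW.measurable measurableSet_Icc
  exact (Measure.ae_prod_iff_ae_ae hm).2 hW.mem_Icc

variable [IsProbabilityMeasure μ] {W : X → X → ℝ}

theorem integralOperator_ae (hW : IsGraphon μ W) (g : Lp ℝ 2 μ) :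
    integralOperator hW g =ᵐ[μ] fun x => ∫ y, W x y * g y ∂μ :=
  (hW.memLp_integral g).coeFn_toLp

theorem hsBound_integralOperator (hW : IsGraphon μ W) : HSBound (integralOperator hW) 1 := by
  have hint : Integrable (fun z : X × X => W z.1 z.2 ^ 2) (μ.prod μ) := by
    refine Integrable.of_bound (C := 1)
      ((hW.measurable.pow_const 2).aestronglyMeasurable) ?_
    filter_upwards [hW.ae_prod_mem_Icc] with z hz
    rw [Real.norm_eq_abs, abs_of_nonneg (sq_nonneg _)]
    exact pow_le_one₀ hz.1 hz.2
  refine hsBound_of_kernel _ W hW.measurable (integralOperator_ae hW) hint ?_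
  calc ∫ z : X × X, W z.1 z.2 ^ 2 ∂(μ.prod μ) ≤ ∫ _ : X × X, (1 : ℝ) ∂(μ.prod μ) := by
        refine integral_mono_ae hint (integrable_const _) ?_
        filter_upwards [hW.ae_prod_mem_Icc] with z hz
        exact pow_le_one₀ hz.1 hz.2
    _ = 1 ^ 2 := by simp

theorem isSymmetric_integralOperator (hW : IsGraphon μ W) :
    LinearMap.IsSymmetric (integralOperator hW) := by
  intro g h
  rw [inner_Lp_eq_integral, inner_Lp_eq_integral]
  have hg : Integrable (fun y => g y) μ := (Lp.memLp g).integrable (by norm_num)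
  have hh : Integrable (fun y => h y) μ := (Lp.memLp h).integrable (by norm_num)
  have hgh : Integrable (fun z : X × X => g z.1 * h z.2) (μ.prod μ) := hg.mul_prod hh
  have hWgh : Integrable (fun z : X × X => W z.1 z.2 * (g z.1 * h z.2)) (μ.prod μ) := by
    refine hgh.bdd_mul (c := 1) hW.measurable.aestronglyMeasurable ?_
    filter_upwards [hW.ae_prod_mem_Icc] with z hz
    rw [Real.norm_eq_abs, abs_of_nonneg hz.1]
    exact hz.2
  calc ∫ x, integralOperator hW g x * h x ∂μ = ∫ x, ∫ y, W y x * (g y * h x) ∂μ ∂μ := by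
        refine integral_congr_ae ?_
        filter_upwards [integralOperator_ae hW g] with x hx
        rw [hx, ← integral_mul_const]
        refine integral_congr_ae (Filter.Eventually.of_forall fun y => ?_)
        simp only [hW.symm x y, mul_assoc]
    _ = ∫ y, ∫ x, W y x * (g y * h x) ∂μ ∂μ :=
        integral_integral_swap (f := fun x y => W y x * (g y * h x)) hWgh.swap
    _ = ∫ y, g y * integralOperator hW h y ∂μ := by
        refine integral_congr_ae ?_
        filter_upwards [integralOperator_ae hW h] with y hy
        rw [hy, ← integral_const_mul]
        refine integral_congr_ae (Filter.Eventually.of_forall fun x => ?_)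
        simp only
        ring

end Kernel

end BallGraph

/-! ### Degenerate kernels and their spectra -/

namespace BallGraph

theorem exists_spectral_decomposition {R : ℕ} {A : Matrix (Fin R) (Fin R) ℝ} (hA : A.IsSymm) :
    ∃ (β : Fin R → ℝ) (c : Fin R → EuclideanSpace ℝ (Fin R)), Orthonormal ℝ c ∧
      ∀ k l, A k l = ∑ s, β s * c s k * c s l := by
  have hH : A.IsHermitian := by
    rw [Matrix.IsHermitian, Matrix.conjTranspose_eq_transpose_of_trivial]
    exact hA
  let b := hH.eigenvectorBasis
  refine ⟨hH.eigenvalues, b, b.orthonormal, fun k l => ?_⟩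
  let δ : EuclideanSpace ℝ (Fin R) := EuclideanSpace.single l 1
  have h1 : δ = ∑ s, b s l • b s := by
    conv_lhs => rw [← b.sum_repr δ]
    refine Finset.sum_congr rfl fun s _ => ?_
    rw [b.repr_apply_apply]
    simp [δ, EuclideanSpace.inner_single_right]
  have h2 : A k l = (A.mulVec δ) k := by
    simp [δ, Matrix.mulVec, dotProduct]
  rw [h2, h1, WithLp.ofLp_sum, Matrix.mulVec_sum, Finset.sum_apply]
  refine Finset.sum_congr rfl fun s _ => ?_
  rw [WithLp.ofLp_smul, Matrix.mulVec_smul, hH.mulVec_eigenvectorBasis]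
  simp only [Pi.smul_apply, smul_eq_mul]
  ring

/-- Eigenvectors of A give eigenvectors of ∑ A_kl q_k ⊗ q_l for any orthonormal q, with the same
eigenvalues. It is applied in L² and in ℝⁿ, so that both operators meet the same β. -/
theorem orthonormal_combination {H : Type*} [NormedAddCommGroup H] [InnerProductSpace ℝ H]
    {R : ℕ} {c : Fin R → EuclideanSpace ℝ (Fin R)} (hc : Orthonormal ℝ c) {q : Fin R → H}
    (hq : Orthonormal ℝ q) : Orthonormal ℝ fun s => ∑ k, c s k • q k := by
  rw [orthonormal_iff_ite] at hc ⊢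
  intro s t
  rw [← hc s t, hq.inner_sum, EuclideanSpace.inner_eq_star_dotProduct]
  simp [dotProduct, mul_comm]

/-- The degenerate kernel with coefficient matrix `A` in the system `e`. -/
def degenerateKernel {X : Type*} {R : ℕ} (A : Matrix (Fin R) (Fin R) ℝ) (e : Fin R → X → ℝ)
    (x y : X) : ℝ := ∑ k, ∑ l, A k l * e k x * e l y

section Kernel

variable {X : Type*} [MeasurableSpace X] {μ : Measure X} [IsProbabilityMeasure μ] {W : X → X → ℝ}
  {R : ℕ} {e : Fin R → X → ℝ} {A : Matrix (Fin R) (Fin R) ℝ}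

theorem measurable_degenerateKernel (he : ∀ k, Measurable (e k)) :
    Measurable (Function.uncurry (degenerateKernel A e)) := by
  unfold degenerateKernel Function.uncurry
  refine Finset.measurable_sum _ fun k _ => Finset.measurable_sum _ fun l _ => ?_
  exact (((he k).comp measurable_fst).const_mul _).mul ((he l).comp measurable_snd)

/-- Hoffman-Wielandt against the operator of the degenerate kernel, whose spectral form has
eigenvalues β and eigenvectors ∑ c_s(k) e_k; the Hilbert-Schmidt norm of the difference is
controlled by the L² norm of the kernel difference. -/
theorem delta2_eigs_integralOperator_le (hW : IsGraphon μ W) (he : ∀ k, Measurable (e k)) {C : ℝ}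
    (hb : ∀ᵐ x ∂μ, ∀ k, |e k x| ≤ C)
    (horth : ∀ k l, ∫ x, e k x * e l x ∂μ = if k = l then 1 else 0)
    {β : Fin R → ℝ} {c : Fin R → EuclideanSpace ℝ (Fin R)} (hc : Orthonormal ℝ c)
    (hA : ∀ k l, A k l = ∑ s, β s * c s k * c s l) {τ : ℝ} (hτ : 0 ≤ τ)
    (hint : Integrable (fun z : X × X => (W z.1 z.2 - degenerateKernel A e z.1 z.2) ^ 2)
      (μ.prod μ))
    (hWA : ∫ z : X × X, (W z.1 z.2 - degenerateKernel A e z.1 z.2) ^ 2 ∂(μ.prod μ) ≤ τ ^ 2) :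
    delta2 (eigs (integralOperator hW)) β ≤ ENNReal.ofReal τ := by
  have hmem : ∀ k, MemLp (e k) 2 μ := fun k => by
    refine MemLp.of_bound (he k).aestronglyMeasurable C ?_
    filter_upwards [hb] with x hx using hx k
  let q : Fin R → Lp ℝ 2 μ := fun k => (hmem k).toLp _
  have hqe : ∀ k, q k =ᵐ[μ] e k := fun k => (hmem k).coeFn_toLp
  have hq : Orthonormal ℝ q := by
    rw [orthonormal_iff_ite]
    intro k l
    rw [inner_Lp_eq_integral, ← horth k l]
    refine integral_congr_ae ?_
    filter_upwards [hqe k, hqe l] with x h1 h2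
    rw [h1, h2]
  have hw := orthonormal_combination hc hq
  have hHS := hsBound_integralOperator hW
  let T : Lp ℝ 2 μ →L[ℝ] Lp ℝ 2 μ := (integralOperator hW).mkContinuous 1
    (fun g => hHS.norm_apply_le zero_le_one g)
  have hTc : (T : Module.End ℝ (Lp ℝ 2 μ)) = integralOperator hW := rfl
  have hT : HSBound T 1 := hHS
  have hcomp : IsCompactOperator T := hT.isCompactOperator
  rw [← hTc]
  refine delta2_eigs_le hcomp (isSymmetric_integralOperator hW) hT hw β hτ ?_
  refine hsBound_of_kernel _ (fun x y => W x y - degenerateKernel A e x y)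
    (hW.measurable.sub (measurable_degenerateKernel he)) ?_ hint hWA
  intro g
  have hinner : ∀ k, inner ℝ (q k) g = ∫ y, e k y * g y ∂μ := by
    intro k
    rw [inner_Lp_eq_integral]
    refine integral_congr_ae ?_
    filter_upwards [hqe k] with x hx
    rw [hx]
  have hintk : ∀ k, Integrable (fun y => e k y * g y) μ := fun k =>
    (hmem k).integrable_mul (Lp.memLp g)
  have hB : (∑ s, (β s * inner ℝ (∑ k, c s k • q k) g) • ∑ k, c s k • q k) =
      ∑ k, (∑ l, A k l * inner ℝ (q l) g) • q k := by
    simp only [sum_inner, real_inner_smul_left, Finset.smul_sum, smul_smul]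
    rw [Finset.sum_comm]
    refine Finset.sum_congr rfl fun k _ => ?_
    rw [← Finset.sum_smul]
    congr 1
    simp only [hA, Finset.sum_mul, Finset.mul_sum]
    rw [Finset.sum_comm]
    refine Finset.sum_congr rfl fun l _ => Finset.sum_congr rfl fun s _ => ?_
    ring
  simp only [hB]
  have hsum : ∀ s : Finset (Fin R),
      ((∑ k ∈ s, (∑ l, A k l * inner ℝ (q l) g) • q k : Lp ℝ 2 μ) : X → ℝ) =ᵐ[μ]
      fun x => ∑ k ∈ s, (∑ l, A k l * inner ℝ (q l) g) * e k x := by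
    intro s
    induction s using Finset.induction_on with
    | empty =>
      simp only [Finset.sum_empty]
      exact Lp.coeFn_zero _ _ _
    | insert k s hk ih =>
      rw [Finset.sum_insert hk]
      filter_upwards [Lp.coeFn_add ((∑ l, A k l * inner ℝ (q l) g) • q k)
        (∑ k ∈ s, (∑ l, A k l * inner ℝ (q l) g) • q k),
        Lp.coeFn_smul (∑ l, A k l * inner ℝ (q l) g) (q k), ih, hqe k] with x h1 h2 h3 h4
      rw [h1, Pi.add_apply, h2, h3, Pi.smul_apply, h4, Finset.sum_insert hk, smul_eq_mul]
  filter_upwards [Lp.coeFn_sub (T g) (∑ k, (∑ l, A k l * inner ℝ (q l) g) • q k),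
    integralOperator_ae hW g, hsum Finset.univ, hW.ae_integrable g] with x h1 h2 h3 h4
  rw [h1, Pi.sub_apply, h3]
  change (integralOperator hW g) x - _ = _
  rw [h2]
  have h5 : ∀ y, degenerateKernel A e x y * g y =
      ∑ k, ∑ l, (A k l * e k x) * (e l y * g y) := by
    intro y
    simp only [degenerateKernel, Finset.sum_mul]
    exact Finset.sum_congr rfl fun k _ => Finset.sum_congr rfl fun l _ => by ring
  have hint5 : Integrable (fun y => degenerateKernel A e x y * g y) μ := by
    simp only [h5]
    exact integrable_finsetSum _ fun k _ => integrable_finsetSum _ fun l _ =>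
      (hintk l).const_mul _
  simp only [sub_mul]
  rw [integral_sub h4 hint5]
  congr 1
  simp only [h5]
  rw [integral_finsetSum _ fun k _ => integrable_finsetSum _ fun l _ => (hintk l).const_mul _]
  refine Finset.sum_congr rfl fun k _ => ?_
  rw [integral_finsetSum _ fun l _ => (hintk l).const_mul _, Finset.sum_mul]
  refine Finset.sum_congr rfl fun l _ => ?_
  rw [integral_const_mul, hinner]
  ring

end Kernel

end BallGraph

/-! ### The sampled matrix against the spectrum of the degenerate kernel -/

namespace BallGraph

section Sample

variable {X : Type*} {W : X → X → ℝ} {R : ℕ}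

/-- The matrix with entries `(1/n) (1 - δ_ij) W(x_i, x_j)`. -/
noncomputable def sampleMatrix {n : ℕ} (W : X → X → ℝ) (x : Fin n → X) : Matrix (Fin n) (Fin n) ℝ :=
  Matrix.of fun i j => if i = j then 0 else (1 / (n : ℝ)) * W (x i) (x j)

/-- The deviation of the empirical Gram matrix of the system `e` from the identity. -/
noncomputable def gramDefect {n : ℕ} (e : Fin R → X → ℝ) (x : Fin n → X) : Matrix (Fin R) (Fin R) ℝ :=
  Matrix.of fun k l => (1 / (n : ℝ)) * ∑ i, e k (x i) * e l (x i) - if k = l then 1 else 0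

/-- The part of the squared Frobenius norm of the Gram defect up to level `b`. -/
noncomputable def gramDefectSq {n : ℕ} (e : Fin R → X → ℝ) (lev : Fin R → ℕ) (b : ℕ) (x : Fin n → X) : ℝ :=
  ∑ k, ∑ l, if lev k ≤ b ∧ lev l ≤ b then gramDefect e x k l ^ 2 else 0

-- The root bounds the distance to `M₁`, the sampled degenerate kernel; the level sum bounds the
-- distance from `M₁` to `M₂`, the same form in orthonormal vectors, whose spectral form has
-- eigenvalues β. The diagonal of the sampled matrix is zero while that of `M₁` is not: n entries of
-- size at most B / n give B² / n under the root.
open scoped Matrix.Norms.Frobenius in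
theorem delta2_sampleMatrix_le {n : ℕ} (hn : 1 ≤ n) (hW : ∀ x y, W x y = W y x) (x : Fin n → X)
    (e : Fin R → X → ℝ) {A : Matrix (Fin R) (Fin R) ℝ} (hAs : A.IsSymm)
    {β : Fin R → ℝ} {c : Fin R → EuclideanSpace ℝ (Fin R)} (hc : Orthonormal ℝ c)
    (hA : ∀ k l, A k l = ∑ s, β s * c s k * c s l)
    (lev : Fin R → ℕ) (hlev : Monotone lev) (J : ℕ) (hJ : ∀ k, lev k ≤ J)
    (hsmall : gramDefectSq e lev J x ≤ 1 / 4) {t B : ℝ}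
    (hoff : (1 / (n : ℝ) ^ 2) * ∑ i, ∑ j, (if i = j then 0 else
      (W (x i) (x j) - degenerateKernel A e (x i) (x j)) ^ 2) ≤ t)
    (hdiag : ∀ i, |degenerateKernel A e (x i) (x i)| ≤ B) :
    delta2 (eigs (Matrix.toLin' (sampleMatrix W x))) β ≤
      ENNReal.ofReal (Real.sqrt (t + B ^ 2 / n) + 6 * ∑ b ∈ Finset.range (J + 1),
        Real.sqrt (gramDefectSq e lev b x) *
          Real.sqrt (∑ k, ∑ l, if lev k = b then A k l ^ 2 else 0)) := by
  have hn0 : (0 : ℝ) < n := by exact_mod_cast hn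
  let φ : Fin R → EuclideanSpace ℝ (Fin n) := fun k =>
    WithLp.toLp 2 fun i => (Real.sqrt n)⁻¹ * e k (x i)
  have hsq : (Real.sqrt n)⁻¹ * (Real.sqrt n)⁻¹ = 1 / (n : ℝ) := by
    rw [← mul_inv, Real.mul_self_sqrt hn0.le, one_div]
  set Δ := gramDefect e x with hΔdef
  have hΔ : ∀ k l, inner ℝ (φ k) (φ l) = (1 + Δ) k l := by
    intro k l
    rw [EuclideanSpace.inner_eq_star_dotProduct, Matrix.add_apply, hΔdef, gramDefect,
      Matrix.of_apply, Matrix.one_apply]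
    simp only [φ, dotProduct, star_trivial]
    rw [add_sub_cancel, ← hsq, Finset.mul_sum]
    exact Finset.sum_congr rfl fun i _ => by ring
  have hfull : ‖Δ‖ ^ 2 = gramDefectSq e lev J x := by
    rw [frobenius_sq, gramDefectSq]
    simp only [hJ, and_self, if_true]
    rfl
  have hΔsmall : ‖Δ‖ ≤ 1 / 2 := by
    refine (abs_le_of_sq_le_sq' ?_ (by norm_num)).2
    rw [hfull]; linarith
  obtain ⟨q, hq, hclose⟩ := exists_orthonormal_close φ Δ hΔ hΔsmall A hAs lev hlev J hJ
  have hw := orthonormal_combination hc hq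
  have hsymm : (sampleMatrix W x).IsSymm := by
    ext i j
    simp only [sampleMatrix, Matrix.transpose_apply, Matrix.of_apply, eq_comm, hW (x j) (x i)]
  refine delta2_eigs_matrix_le hsymm hw β (by positivity) ?_
  set M₁ : Matrix (Fin n) (Fin n) ℝ := Matrix.of fun i j => ∑ k, ∑ l, A k l * φ k i * φ l j
    with hM₁
  set M₂ : Matrix (Fin n) (Fin n) ℝ := Matrix.of fun i j => ∑ k, ∑ l, A k l * q k i * q l j
    with hM₂
  have hM₂' : ∀ i j, ∑ s, β s * (∑ k, c s k • q k) i * (∑ k, c s k • q k) j = M₂ i j := by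
    intro i j
    simp only [hM₂, Matrix.of_apply, WithLp.ofLp_sum, Finset.sum_apply, WithLp.ofLp_smul,
      Pi.smul_apply, smul_eq_mul, hA, Finset.sum_mul, Finset.mul_sum]
    rw [Finset.sum_comm]
    conv_rhs => rw [Finset.sum_comm]
    refine Finset.sum_congr rfl fun l _ => ?_
    rw [Finset.sum_comm]
    refine Finset.sum_congr rfl fun k _ => Finset.sum_congr rfl fun s _ => ?_
    ring
  simp only [hM₂']
  have hfrob := frobenius_sq (sampleMatrix W x - M₂)
  simp only [Matrix.sub_apply] at hfrob
  rw [← hfrob]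
  refine pow_le_pow_left₀ (norm_nonneg _) ?_ 2
  calc ‖sampleMatrix W x - M₂‖ = ‖(sampleMatrix W x - M₁) + (M₁ - M₂)‖ := by congr 1; abel
    _ ≤ ‖sampleMatrix W x - M₁‖ + ‖M₁ - M₂‖ := norm_add_le _ _
    _ ≤ _ := by
      refine add_le_add ?_ hclose
      refine Real.le_sqrt_of_sq_le ?_
      have hM₁' : ∀ i j, M₁ i j = (1 / (n : ℝ)) * degenerateKernel A e (x i) (x j) := by
        intro i j
        simp only [hM₁, Matrix.of_apply, degenerateKernel, φ, ← hsq, Finset.mul_sum]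
        exact Finset.sum_congr rfl fun k _ => Finset.sum_congr rfl fun l _ => by ring
      rw [frobenius_sq]
      have hentry : ∀ i j, (sampleMatrix W x - M₁) i j ^ 2 ≤
          (1 / (n : ℝ) ^ 2) * (if i = j then 0 else
            (W (x i) (x j) - degenerateKernel A e (x i) (x j)) ^ 2) +
          (if i = j then (1 / (n : ℝ) ^ 2) * B ^ 2 else 0) := by
        intro i j
        rw [Matrix.sub_apply, hM₁', sampleMatrix, Matrix.of_apply]
        split_ifs with hij
        · subst hij
          have h1 : degenerateKernel A e (x i) (x i) ^ 2 ≤ B ^ 2 := by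
            rw [← sq_abs]
            exact pow_le_pow_left₀ (abs_nonneg _) (hdiag i) 2
          calc (0 - 1 / (n : ℝ) * degenerateKernel A e (x i) (x i)) ^ 2
              = (1 / (n : ℝ) ^ 2) * degenerateKernel A e (x i) (x i) ^ 2 := by ring
            _ ≤ (1 / (n : ℝ) ^ 2) * B ^ 2 := by gcongr
            _ = _ := by ring
        · refine le_of_eq ?_
          ring
      refine (Finset.sum_le_sum fun i _ => Finset.sum_le_sum fun j _ => hentry i j).trans ?_
      simp only [Finset.sum_add_distrib, ← Finset.mul_sum]
      refine add_le_add hoff (le_of_eq ?_)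
      simp only [Finset.sum_ite_eq, Finset.mem_univ, if_true, Finset.sum_const, Finset.card_univ,
        Fintype.card_fin, nsmul_eq_mul]
      field_simp

end Sample

end BallGraph

/-! ### Second moments of the sample -/

namespace BallGraph

section Probability

variable {X : Type*} [MeasurableSpace X] {μ : Measure X} [IsProbabilityMeasure μ] {W : X → X → ℝ}
  {R : ℕ} {e : Fin R → X → ℝ} {A : Matrix (Fin R) (Fin R) ℝ}
  {Ω : Type*} [MeasurableSpace Ω] {P : Measure Ω} [IsProbabilityMeasure P] {n : ℕ}
  {S : Fin n → Ω → X}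

theorem memLp_two_gram_entry (he : ∀ k, Measurable (e k)) {C : ℝ}
    (hb : ∀ᵐ x ∂μ, ∀ k, |e k x| ≤ C) (k l : Fin R) : MemLp (fun x => e k x * e l x) 2 μ := by
  refine MemLp.of_bound ((he k).mul (he l)).aestronglyMeasurable (C * C) ?_
  filter_upwards [hb] with x hx
  rw [norm_mul, Real.norm_eq_abs, Real.norm_eq_abs]
  exact mul_le_mul (hx k) (hx l) (abs_nonneg _) ((abs_nonneg _).trans (hx k))

/-- The entry is a centred mean of n independent copies of e_k e_l, so its second moment is a
variance divided by n. -/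
theorem integral_gramDefect_sq_le (hn : 1 ≤ n) (he : ∀ k, Measurable (e k)) {C : ℝ}
    (hb : ∀ᵐ x ∂μ, ∀ k, |e k x| ≤ C)
    (horth : ∀ k l, ∫ x, e k x * e l x ∂μ = if k = l then 1 else 0)
    (hind : iIndepFun S P) (hlaw : ∀ i, HasLaw (S i) μ P) (k l : Fin R) :
    Integrable (fun ω => gramDefect e (fun i => S i ω) k l ^ 2) P ∧
      ∫ ω, gramDefect e (fun i => S i ω) k l ^ 2 ∂P ≤
        (1 / (n : ℝ)) * ∫ x, (e k x * e l x) ^ 2 ∂μ := by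
  have hn0 : (0 : ℝ) < n := by exact_mod_cast hn
  have hmem := memLp_two_gram_entry he hb k l
  let h : X → ℝ := fun x => e k x * e l x
  have hh : Measurable h := (he k).mul (he l)
  let Y : Fin n → Ω → ℝ := fun i ω => h (S i ω)
  have hY : ∀ i, MemLp (Y i) 2 P := fun i => by
    have : MemLp h 2 (P.map (S i)) := by rw [(hlaw i).map_eq]; exact hmem
    exact (memLp_map_measure_iff hh.aestronglyMeasurable (hlaw i).aemeasurable).1 this
  have hYint : ∀ i, ∫ ω, Y i ω ∂P = if k = l then 1 else 0 := fun i => by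
    rw [← horth k l, ← (hlaw i).map_eq]
    exact (integral_map (hlaw i).aemeasurable hh.aestronglyMeasurable).symm
  have hYsq : ∀ i, ∫ ω, Y i ω ^ 2 ∂P = ∫ x, (e k x * e l x) ^ 2 ∂μ := fun i => by
    rw [← (hlaw i).map_eq]
    exact (integral_map (hlaw i).aemeasurable (hh.pow_const 2).aestronglyMeasurable).symm
  have hYi : ∀ i, Integrable (Y i) P := fun i => (hY i).integrable (by norm_num)
  have hsum : MemLp (∑ i, Y i) 2 P := memLp_finsetSum' _ fun i _ => hY i
  have hEsum : ∫ ω, (∑ i, Y i) ω ∂P = n * if k = l then 1 else 0 := by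
    simp only [Finset.sum_apply]
    rw [integral_finsetSum _ fun i _ => hYi i]
    simp [hYint]
  have hgd : ∀ ω, gramDefect e (fun i => S i ω) k l =
      (1 / (n : ℝ)) * ((∑ i, Y i) ω - ∫ ω, (∑ i, Y i) ω ∂P) := by
    intro ω
    rw [hEsum, gramDefect, Matrix.of_apply, Finset.sum_apply]
    simp only [Y, h]
    field_simp
  have hvar : variance (∑ i, Y i) P ≤ n * ∫ x, (e k x * e l x) ^ 2 ∂μ := by
    rw [IndepFun.variance_sum (fun i _ => hY i)]
    · calc ∑ i, variance (Y i) P ≤ ∑ _i : Fin n, ∫ x, (e k x * e l x) ^ 2 ∂μ := by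
            refine Finset.sum_le_sum fun i _ => ?_
            rw [← hYsq i]
            exact variance_le_expectation_sq (hY i).aestronglyMeasurable
        _ = _ := by simp
    · intro i _ j _ hij
      exact (hind.indepFun hij).comp hh hh
  simp only [hgd, mul_pow]
  refine ⟨((hsum.sub (memLp_const _)).integrable_sq).const_mul _, ?_⟩
  rw [integral_const_mul, ← variance_eq_integral hsum.aestronglyMeasurable.aemeasurable]
  calc (1 / (n : ℝ)) ^ 2 * variance (∑ i, Y i) P
      ≤ (1 / (n : ℝ)) ^ 2 * (n * ∫ x, (e k x * e l x) ^ 2 ∂μ) := by gcongr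
    _ = _ := by field_simp

theorem integral_gramDefectSq_le (hn : 1 ≤ n) (he : ∀ k, Measurable (e k)) {C : ℝ}
    (hb : ∀ᵐ x ∂μ, ∀ k, |e k x| ≤ C)
    (horth : ∀ k l, ∫ x, e k x * e l x ∂μ = if k = l then 1 else 0)
    (hind : iIndepFun S P) (hlaw : ∀ i, HasLaw (S i) μ P) (lev : Fin R → ℕ) (b : ℕ) {κ : ℝ}
    (hκ : ∀ᵐ x ∂μ, ∑ k, (if lev k ≤ b then e k x ^ 2 else 0) ≤ κ) :
    Integrable (fun ω => gramDefectSq e lev b fun i => S i ω) P ∧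
      ∫ ω, gramDefectSq e lev b (fun i => S i ω) ∂P ≤
        (1 / (n : ℝ)) * (κ * (Finset.univ.filter fun k => lev k ≤ b).card) := by
  have hmain := fun k l => integral_gramDefect_sq_le hn he hb horth hind hlaw k l
  have hint : ∀ k l, Integrable (fun ω => if lev k ≤ b ∧ lev l ≤ b then
      gramDefect e (fun i => S i ω) k l ^ 2 else 0) P := by
    intro k l
    split_ifs
    · exact (hmain k l).1
    · exact integrable_zero _ _ _
  refine ⟨integrable_finsetSum _ fun k _ => integrable_finsetSum _ fun l _ => hint k l, ?_⟩
  have hsq : ∀ k, Integrable (fun x => e k x * e k x) μ := fun k =>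
    (memLp_two_gram_entry he hb k k).integrable (by norm_num)
  have hquad : ∀ k l, Integrable (fun x => (e k x * e l x) ^ 2) μ := fun k l =>
    (memLp_two_gram_entry he hb k l).integrable_sq
  have hquad' : ∀ k l, Integrable (fun x => if lev k ≤ b ∧ lev l ≤ b then
      (e k x * e l x) ^ 2 else 0) μ := by
    intro k l
    split_ifs
    · exact hquad k l
    · exact integrable_zero _ _ _
  have hsq' : ∀ k, Integrable (fun x => if lev k ≤ b then e k x ^ 2 else 0) μ := by
    intro k
    split_ifs
    · simpa only [sq] using hsq k
    · exact integrable_zero _ _ _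
  unfold gramDefectSq
  rw [integral_finsetSum _ fun k _ => integrable_finsetSum _ fun l _ => hint k l]
  have h1 : ∀ k, ∫ ω, ∑ l, (if lev k ≤ b ∧ lev l ≤ b then
      gramDefect e (fun i => S i ω) k l ^ 2 else 0) ∂P ≤
      ∑ l, (1 / (n : ℝ)) * ∫ x, (if lev k ≤ b ∧ lev l ≤ b then (e k x * e l x) ^ 2 else 0) ∂μ := by
    intro k
    rw [integral_finsetSum _ fun l _ => hint k l]
    refine Finset.sum_le_sum fun l _ => ?_
    split_ifs with h
    · exact (hmain k l).2
    · simp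
  refine (Finset.sum_le_sum fun k _ => h1 k).trans ?_
  simp only [← Finset.mul_sum]
  refine mul_le_mul_of_nonneg_left ?_ (by positivity)
  -- The double sum of e_k² e_l² is the square of the Christoffel sum. One factor is bounded by κ,
  -- and the other integrates to the number of functions; this is better than κ².
  have h2 : ∑ k, ∑ l, ∫ x, (if lev k ≤ b ∧ lev l ≤ b then (e k x * e l x) ^ 2 else 0) ∂μ =
      ∫ x, (∑ k, (if lev k ≤ b then e k x ^ 2 else 0)) *
        (∑ k, (if lev k ≤ b then e k x ^ 2 else 0)) ∂μ := by
    simp only [← integral_finsetSum _ fun l _ => hquad' _ l]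
    rw [← integral_finsetSum _ fun k _ => integrable_finsetSum _ fun l _ => hquad' k l]
    refine integral_congr_ae (Filter.Eventually.of_forall fun x => ?_)
    simp only [Finset.sum_mul_sum]
    refine Finset.sum_congr rfl fun k _ => Finset.sum_congr rfl fun l _ => ?_
    by_cases hk : lev k ≤ b <;> by_cases hl : lev l ≤ b <;> simp [hk, hl, mul_pow]
  rw [h2]
  have h3 : ∫ x, ∑ k, (if lev k ≤ b then e k x ^ 2 else 0) ∂μ =
      (Finset.univ.filter fun k => lev k ≤ b).card := by
    rw [integral_finsetSum _ fun k _ => hsq' k]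
    have h4 : ∀ k, ∫ x, (if lev k ≤ b then e k x ^ 2 else 0) ∂μ =
        if lev k ≤ b then 1 else 0 := by
      intro k
      split_ifs
      · have := horth k k
        simpa [sq] using this
      · simp
    simp only [h4, Finset.sum_boole]
  rw [← h3, ← integral_const_mul]
  have hK : Integrable (fun x => ∑ k, (if lev k ≤ b then e k x ^ 2 else 0)) μ :=
    integrable_finsetSum _ fun k _ => hsq' k
  refine integral_mono_ae ?_ (hK.const_mul _) ?_
  · have : (fun x => (∑ k, (if lev k ≤ b then e k x ^ 2 else 0)) *
        (∑ k, (if lev k ≤ b then e k x ^ 2 else 0))) =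
        fun x => ∑ k, ∑ l, (if lev k ≤ b ∧ lev l ≤ b then (e k x * e l x) ^ 2 else 0) := by
      funext x
      rw [Finset.sum_mul_sum]
      refine Finset.sum_congr rfl fun k _ => Finset.sum_congr rfl fun l _ => ?_
      by_cases hk : lev k ≤ b <;> by_cases hl : lev l ≤ b <;> simp [hk, hl, mul_pow]
    rw [this]
    exact integrable_finsetSum _ fun k _ => integrable_finsetSum _ fun l _ => hquad' k l
  · filter_upwards [hκ] with x hx
    refine mul_le_mul_of_nonneg_right hx (Finset.sum_nonneg fun k _ => ?_)
    split_ifs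
    · exact sq_nonneg _
    · exact le_rfl

/-- For i ≠ j the pair (X_i, X_j) has law μ ⊗ μ. Diagonal pairs do not, and are treated through the
pointwise bound B instead. -/
theorem integral_offDiagonal_le (hn : 1 ≤ n) {D : X × X → ℝ} (hD : Measurable D)
    (hint : Integrable (fun z => D z ^ 2) (μ.prod μ)) {t : ℝ}
    (ht : ∫ z, D z ^ 2 ∂(μ.prod μ) ≤ t) (ht0 : 0 ≤ t)
    (hind : iIndepFun S P) (hlaw : ∀ i, HasLaw (S i) μ P) :
    Integrable (fun ω => (1 / (n : ℝ) ^ 2) * ∑ i, ∑ j, (if i = j then 0 else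
      D (S i ω, S j ω) ^ 2)) P ∧
    ∫ ω, (1 / (n : ℝ) ^ 2) * ∑ i, ∑ j, (if i = j then 0 else D (S i ω, S j ω) ^ 2) ∂P ≤ t := by
  have hn0 : (0 : ℝ) < n := by exact_mod_cast hn
  have hpair : ∀ i j, i ≠ j → P.map (fun ω => (S i ω, S j ω)) = μ.prod μ := by
    intro i j hij
    have := (indepFun_iff_map_prod_eq_prod_map_map (hlaw i).aemeasurable
      (hlaw j).aemeasurable).1 (hind.indepFun hij)
    rw [this, (hlaw i).map_eq, (hlaw j).map_eq]
  have haem : ∀ i j, AEMeasurable (fun ω => (S i ω, S j ω)) P := fun i j =>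
    (hlaw i).aemeasurable.prodMk (hlaw j).aemeasurable
  have hint1 : ∀ i j, Integrable (fun ω => if i = j then 0 else D (S i ω, S j ω) ^ 2) P := by
    intro i j
    split_ifs with hij
    · exact integrable_zero _ _ _
    · rw [← hpair i j hij] at hint
      exact (integrable_map_measure (hD.pow_const 2).aestronglyMeasurable (haem i j)).1 hint
  have hval : ∀ i j, ∫ ω, (if i = j then 0 else D (S i ω, S j ω) ^ 2) ∂P ≤ t := by
    intro i j
    split_ifs with hij
    · simpa using ht0
    · refine le_trans (le_of_eq ?_) ht
      rw [← hpair i j hij]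
      exact (integral_map (haem i j) (hD.pow_const 2).aestronglyMeasurable).symm
  refine ⟨(integrable_finsetSum _ fun i _ => integrable_finsetSum _ fun j _ =>
    hint1 i j).const_mul _, ?_⟩
  rw [integral_const_mul, integral_finsetSum _ fun i _ => integrable_finsetSum _ fun j _ =>
    hint1 i j]
  have h1 : ∑ i, ∫ ω, ∑ j, (if i = j then 0 else D (S i ω, S j ω) ^ 2) ∂P ≤
      ∑ _i : Fin n, ∑ _j : Fin n, t := by
    refine Finset.sum_le_sum fun i _ => ?_
    rw [integral_finsetSum _ fun j _ => hint1 i j]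
    exact Finset.sum_le_sum fun j _ => hval i j
  calc _ ≤ (1 / (n : ℝ) ^ 2) * ∑ _i : Fin n, ∑ _j : Fin n, t := by gcongr
    _ = t := by simp; field_simp

end Probability

end BallGraph

/-! ### Exceptional events and the comparison by levels -/

namespace BallGraph

section LevelTheorem

variable {X : Type*} [MeasurableSpace X] {μ : Measure X} {W : X → X → ℝ}
  {R : ℕ} {e : Fin R → X → ℝ} {A : Matrix (Fin R) (Fin R) ℝ}
  {Ω : Type*} [MeasurableSpace Ω] {P : Measure Ω} [IsProbabilityMeasure P] {n : ℕ}
  {S : Fin n → Ω → X}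

theorem measure_ge_le_of_integral_le {Y : Ω → ℝ} (hY : Integrable Y P) (h0 : ∀ ω, 0 ≤ Y ω)
    {ε q : ℝ} (hε : 0 < ε) (h : ∫ ω, Y ω ∂P ≤ ε * q) : P {ω | ε ≤ Y ω} ≤ ENNReal.ofReal q := by
  have h1 := mul_meas_ge_le_integral_of_nonneg (Filter.Eventually.of_forall h0) hY ε
  have h2 : P.real {ω | ε ≤ Y ω} ≤ q := le_of_mul_le_mul_left (h1.trans h) hε
  rw [← ENNReal.ofReal_toReal (measure_ne_top P {ω | ε ≤ Y ω})]
  exact ENNReal.ofReal_le_ofReal h2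

/-- Jensen's inequality for the square root, by means of its tangent line at q. -/
theorem integral_sqrt_le {Y : Ω → ℝ} (hY : Integrable Y P) (h0 : ∀ ω, 0 ≤ Y ω) {q : ℝ}
    (hq : 0 < q) (h : ∫ ω, Y ω ∂P ≤ q) :
    Integrable (fun ω => Real.sqrt (Y ω)) P ∧ ∫ ω, Real.sqrt (Y ω) ∂P ≤ Real.sqrt q := by
  have ht : 0 < Real.sqrt q := Real.sqrt_pos.2 hq
  have hle : ∀ ω, Real.sqrt (Y ω) ≤ (Y ω / Real.sqrt q + Real.sqrt q) / 2 := by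
    intro ω
    have h1 := Real.sq_sqrt (h0 ω)
    have h2 : Real.sqrt (Y ω) * (2 * Real.sqrt q) ≤ Y ω + Real.sqrt q ^ 2 := by
      nlinarith [sq_nonneg (Real.sqrt (Y ω) - Real.sqrt q)]
    have h3 : (Y ω / Real.sqrt q + Real.sqrt q) / 2 =
        (Y ω + Real.sqrt q ^ 2) / (2 * Real.sqrt q) := by field_simp
    rw [h3, le_div_iff₀ (by positivity)]
    exact h2
  have hi : Integrable (fun ω => (Y ω / Real.sqrt q + Real.sqrt q) / 2) P :=
    ((hY.div_const _).add (integrable_const _)).div_const _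
  have hi' : Integrable (fun ω => Real.sqrt (Y ω)) P := by
    refine hi.mono' hY.aestronglyMeasurable.aemeasurable.sqrt.aestronglyMeasurable ?_
    exact Filter.Eventually.of_forall fun ω => by
      rw [Real.norm_of_nonneg (Real.sqrt_nonneg _)]; exact hle ω
  refine ⟨hi', (integral_mono hi' hi hle).trans ?_⟩
  rw [integral_div, integral_add (hY.div_const _) (integrable_const _), integral_div]
  simp only [integral_const, probReal_univ, one_smul]
  have : (∫ ω, Y ω ∂P) / Real.sqrt q ≤ Real.sqrt q := by
    rw [div_le_iff₀ ht, Real.mul_self_sqrt hq.le]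
    exact h
  linarith

theorem gramDefectSq_nonneg {X : Type*} {n : ℕ} (e : Fin R → X → ℝ) (lev : Fin R → ℕ) (b : ℕ) (x : Fin n → X) :
    0 ≤ gramDefectSq e lev b x :=
  Finset.sum_nonneg fun k _ => Finset.sum_nonneg fun l _ => by
    split_ifs
    · positivity
    · exact le_rfl

theorem integrable_sq_sub_degenerateKernel [IsProbabilityMeasure μ] (hW : IsGraphon μ W)
    (he : ∀ k, Measurable (e k)) {C : ℝ} (hb : ∀ᵐ x ∂μ, ∀ k, |e k x| ≤ C) :
    Integrable (fun z : X × X => (W z.1 z.2 - degenerateKernel A e z.1 z.2) ^ 2) (μ.prod μ) := by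
  have hm : Measurable fun z : X × X => W z.1 z.2 - degenerateKernel A e z.1 z.2 :=
    hW.measurable.sub (measurable_degenerateKernel he)
  refine Integrable.of_bound (hm.pow_const 2).aestronglyMeasurable
    ((1 + ∑ k, ∑ l, |A k l| * C * C) ^ 2) ?_
  have hb1 : ∀ᵐ z ∂(μ.prod μ), ∀ k, |e k z.1| ≤ C :=
    Measure.quasiMeasurePreserving_fst.ae hb
  have hb2 : ∀ᵐ z ∂(μ.prod μ), ∀ k, |e k z.2| ≤ C :=
    Measure.quasiMeasurePreserving_snd.ae hb
  filter_upwards [hW.ae_prod_mem_Icc, hb1, hb2] with z hz h1 h2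
  rw [norm_pow, Real.norm_eq_abs]
  refine pow_le_pow_left₀ (abs_nonneg _) ((abs_sub _ _).trans (add_le_add ?_ ?_)) 2
  · rw [abs_of_nonneg hz.1]; exact hz.2
  · unfold degenerateKernel
    refine (Finset.abs_sum_le_sum_abs _ _).trans (Finset.sum_le_sum fun k _ => ?_)
    refine (Finset.abs_sum_le_sum_abs _ _).trans (Finset.sum_le_sum fun l _ => ?_)
    rw [abs_mul, abs_mul]
    have hC : 0 ≤ C := (abs_nonneg _).trans (h1 k)
    exact mul_le_mul (mul_le_mul_of_nonneg_left (h1 k) (abs_nonneg _)) (h2 l) (abs_nonneg _)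
      (by positivity)

/-- A quantitative comparison of the spectra of a sampled kernel matrix and of the integral
operator, in terms of an approximation of the kernel by a degenerate kernel whose rows are
organised in levels. -/
theorem measure_delta2_gt_le [IsProbabilityMeasure μ] (hW : IsGraphon μ W) (hn : 1 ≤ n)
    (he : ∀ k, Measurable (e k)) {C : ℝ} (hb : ∀ᵐ x ∂μ, ∀ k, |e k x| ≤ C)
    (horth : ∀ k l, ∫ x, e k x * e l x ∂μ = if k = l then 1 else 0) (hAs : A.IsSymm)
    {lev : Fin R → ℕ} (hlev : Monotone lev) {J : ℕ} (hJ : ∀ k, lev k ≤ J)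
    {g a : ℕ → ℝ} (hg0 : ∀ b, 0 < g b)
    (hg : ∀ b ≤ J, ∃ κ, (∀ᵐ x ∂μ, ∑ k, (if lev k ≤ b then e k x ^ 2 else 0) ≤ κ) ∧
      κ * (Finset.univ.filter fun k => lev k ≤ b).card ≤ g b)
    (ha : ∀ b ≤ J, Real.sqrt (∑ k, ∑ l, if lev k = b then A k l ^ 2 else 0) ≤ a b)
    {τ B c α : ℝ} (hτ : 0 < τ) (hα : 0 < α) (hc : 0 < c)
    (hWA : ∫ z : X × X, (W z.1 z.2 - degenerateKernel A e z.1 z.2) ^ 2 ∂(μ.prod μ) ≤ τ ^ 2)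
    (hB : ∀ᵐ x ∂μ, |degenerateKernel A e x x| ≤ B)
    (hsum : ∑ b ∈ Finset.range (J + 1), Real.sqrt (g b) * a b ≤ c)
    (hJn : 12 * g J ≤ α * n)
    (hind : iIndepFun S P) (hlaw : ∀ i, HasLaw (S i) μ P) :
    P {ω | ¬ delta2 (eigs (Matrix.toLin' (sampleMatrix W fun i => S i ω)))
        (eigs (integralOperator hW)) ≤
      ENNReal.ofReal (τ + Real.sqrt (3 * τ ^ 2 / α + B ^ 2 / n) + 18 * c / (α * Real.sqrt n))} ≤
      ENNReal.ofReal α := by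
  have hn0 : (0 : ℝ) < n := by exact_mod_cast hn
  have hsn : 0 < Real.sqrt n := Real.sqrt_pos.2 hn0
  obtain ⟨β, v, hv, hA⟩ := exists_spectral_decomposition hAs
  have hint := integrable_sq_sub_degenerateKernel (A := A) hW he hb
  have hop := delta2_eigs_integralOperator_le hW he hb horth hv hA hτ.le hint hWA
  have hS : ∀ b ≤ J, Integrable (fun ω => gramDefectSq e lev b fun i => S i ω) P ∧
      ∫ ω, gramDefectSq e lev b (fun i => S i ω) ∂P ≤ g b / n := by
    intro b hbJ
    obtain ⟨κ, hκ, hκg⟩ := hg b hbJ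
    obtain ⟨h1, h2⟩ := integral_gramDefectSq_le hn he hb horth hind hlaw lev b hκ
    refine ⟨h1, h2.trans ?_⟩
    rw [div_eq_mul_one_div (g b), mul_comm (g b)]
    exact mul_le_mul_of_nonneg_left hκg (by positivity)
  have hsq : ∀ b ≤ J, Integrable (fun ω => Real.sqrt (gramDefectSq e lev b fun i => S i ω)) P ∧
      ∫ ω, Real.sqrt (gramDefectSq e lev b (fun i => S i ω)) ∂P ≤ Real.sqrt (g b / n) :=
    fun b hbJ => integral_sqrt_le (hS b hbJ).1 (fun ω => gramDefectSq_nonneg _ _ _ _)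
      (div_pos (hg0 b) hn0) (hS b hbJ).2
  have hrow : ∀ b, 0 ≤ Real.sqrt (∑ k, ∑ l, if lev k = b then A k l ^ 2 else 0) :=
    fun b => Real.sqrt_nonneg _
  -- Three events of probability α/3 each are discarded, and one null event. Here Markov's
  -- inequality at 1/4 uses 12 g_J ≤ α n; outside the event ‖Δ‖ ≤ 1/2, as the Cholesky bound
  -- requires.
  have hE1 : P {ω | 1 / 4 ≤ gramDefectSq e lev J fun i => S i ω} ≤ ENNReal.ofReal (α / 3) := by
    refine measure_ge_le_of_integral_le (hS J le_rfl).1 (fun ω => gramDefectSq_nonneg _ _ _ _)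
      (by norm_num) ((hS J le_rfl).2.trans ?_)
    rw [div_le_iff₀ hn0]
    linarith
  obtain ⟨ho1, ho2⟩ := integral_offDiagonal_le hn
    (hW.measurable.sub (measurable_degenerateKernel (A := A) he)) hint hWA (sq_nonneg τ) hind hlaw
  have hE2 := measure_ge_le_of_integral_le (ε := 3 * τ ^ 2 / α) (q := α / 3) ho1
    (fun ω => mul_nonneg (by positivity) (Finset.sum_nonneg fun i _ => Finset.sum_nonneg fun j _ => by
      split_ifs
      · exact le_rfl
      · positivity)) (by positivity) (ho2.trans (le_of_eq (by field_simp)))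
  have hint3 : ∀ b ∈ Finset.range (J + 1), Integrable (fun ω =>
      Real.sqrt (gramDefectSq e lev b fun i => S i ω) * Real.sqrt (∑ k, ∑ l,
        if lev k = b then A k l ^ 2 else 0)) P := fun b hbr =>
    (hsq b (Nat.lt_succ_iff.1 (Finset.mem_range.1 hbr))).1.mul_const _
  -- Markov's inequality is applied to the whole weighted sum, so that no union over the levels is
  -- paid. The factor 6 of `delta2_sampleMatrix_le` turns 3c into 18c.
  have hE3 : P {ω | 3 * c / (α * Real.sqrt n) ≤ ∑ b ∈ Finset.range (J + 1),
      Real.sqrt (gramDefectSq e lev b fun i => S i ω) * Real.sqrt (∑ k, ∑ l,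
        if lev k = b then A k l ^ 2 else 0)} ≤ ENNReal.ofReal (α / 3) := by
    refine measure_ge_le_of_integral_le (integrable_finsetSum _ hint3)
      (fun ω => Finset.sum_nonneg fun b _ => by positivity) (by positivity) ?_
    rw [integral_finsetSum _ hint3]
    calc ∑ b ∈ Finset.range (J + 1), ∫ ω, Real.sqrt (gramDefectSq e lev b fun i => S i ω) *
          Real.sqrt (∑ k, ∑ l, if lev k = b then A k l ^ 2 else 0) ∂P
        ≤ ∑ b ∈ Finset.range (J + 1), (Real.sqrt (g b) * a b) / Real.sqrt n := by
          refine Finset.sum_le_sum fun b hbr => ?_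
          have hbJ := Nat.lt_succ_iff.1 (Finset.mem_range.1 hbr)
          rw [integral_mul_const, mul_div_right_comm, ← Real.sqrt_div' _ hn0.le]
          exact mul_le_mul (hsq b hbJ).2 (ha b hbJ) (hrow b) (Real.sqrt_nonneg _)
      _ ≤ c / Real.sqrt n := by
          rw [← Finset.sum_div]
          gcongr
      _ = 3 * c / (α * Real.sqrt n) * (α / 3) := by field_simp
  have hE4 : P {ω | ¬ ∀ i, |degenerateKernel A e (S i ω) (S i ω)| ≤ B} = 0 := by
    have : ∀ᵐ ω ∂P, ∀ i, |degenerateKernel A e (S i ω) (S i ω)| ≤ B := by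
      rw [ae_all_iff]
      intro i
      have h := hB
      rw [← (hlaw i).map_eq] at h
      exact ae_of_ae_map (hlaw i).aemeasurable h
    exact ae_iff.1 this
  refine (measure_mono (t := (({ω | 1 / 4 ≤ gramDefectSq e lev J fun i => S i ω} ∪ _) ∪ _) ∪ _)
    ?_).trans ((measure_union_le _ _).trans (add_le_add ((measure_union_le _ _).trans
      (add_le_add ((measure_union_le _ _).trans (add_le_add hE1 hE2)) hE3)) hE4.le)) |>.trans ?_
  · intro ω hω
    by_contra hcon
    simp only [Set.mem_union, Set.mem_ofPred_eq, not_or, not_le, not_not] at hcon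
    obtain ⟨⟨⟨h1, h2⟩, h3⟩, h4⟩ := hcon
    apply hω
    have hmat := delta2_sampleMatrix_le hn hW.symm (fun i => S i ω) e hAs hv hA lev hlev J hJ
      h1.le h2.le h4
    refine (delta2_triangle _ β _).trans ?_
    rw [delta2_comm β]
    refine (add_le_add hmat hop).trans ?_
    rw [← ENNReal.ofReal_add (by positivity) hτ.le]
    refine ENNReal.ofReal_le_ofReal ?_
    have : 18 * c / (α * Real.sqrt n) = 6 * (3 * c / (α * Real.sqrt n)) := by ring
    rw [this]
    linarith
  · rw [add_zero, ← ENNReal.ofReal_add (by positivity) (by positivity),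
      ← ENNReal.ofReal_add (by positivity) (by positivity)]
    exact ENNReal.ofReal_le_ofReal (by linarith)

end LevelTheorem

end BallGraph

/-! ### Orthonormal systems adapted to a filtration -/

namespace BallGraph

section Adapted

variable {H : Type*} [NormedAddCommGroup H] [InnerProductSpace ℝ H]

/-- An orthonormal family adapted to a filtration by finite dimensional subspaces. -/
theorem exists_adapted_orthonormal (U : ℕ → Submodule ℝ H) (hU : Monotone U)
    [∀ b, FiniteDimensional ℝ (U b)] (J : ℕ) :
    ∃ (R : ℕ) (q : Fin R → H) (lev : Fin R → ℕ), Orthonormal ℝ q ∧ Monotone lev ∧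
      (∀ k, lev k < J) ∧ (∀ k, q k ∈ U (lev k)) ∧
      ∀ b < J, U b ≤ Submodule.span ℝ (q '' {k | lev k ≤ b}) := by
  induction J with
  | zero =>
    refine ⟨0, Fin.elim0, Fin.elim0, ?_, fun k => k.elim0, fun k => k.elim0, fun k => k.elim0,
      fun b hb => absurd hb (Nat.not_lt_zero b)⟩
    exact ⟨fun k => k.elim0, fun k => k.elim0⟩
  | succ J ih =>
    obtain ⟨R, q, lev, hq, hlev, hJ, hqU, hspan⟩ := ih
    let Q : Submodule ℝ H := Submodule.span ℝ (Set.range q)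
    have hQfin : FiniteDimensional ℝ Q := FiniteDimensional.span_of_finite ℝ (Set.finite_range q)
    -- The new level receives a basis of what U J adds to the previous vectors; appending it last
    -- keeps `lev` monotone.
    let N : Submodule ℝ H := Qᗮ ⊓ U J
    have hN : FiniteDimensional ℝ N := Submodule.finiteDimensional_of_le inf_le_right
    let u := stdOrthonormalBasis ℝ N
    let r := Module.finrank ℝ N
    have hqQ : ∀ k, q k ∈ Q := fun k => Submodule.subset_span ⟨k, rfl⟩
    have hQU : Q ≤ U J := by
      refine Submodule.span_le.2 ?_
      rintro _ ⟨k, rfl⟩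
      exact hU (hJ k).le (hqU k)
    have hUJ : U J ≤ Q ⊔ N := by
      intro x hx
      have hx1 : x - Q.starProjection x ∈ N :=
        ⟨Q.sub_starProjection_mem_orthogonal x,
          (U J).sub_mem hx (hQU (Q.starProjection_apply_mem x))⟩
      have : x = Q.starProjection x + (x - Q.starProjection x) := by abel
      rw [this]
      exact Submodule.add_mem_sup (Q.starProjection_apply_mem x) hx1
    refine ⟨R + r, Fin.addCases q fun i => (u i : H), Fin.addCases lev fun _ => J, ?_, ?_, ?_, ?_, ?_⟩
    · rw [orthonormal_iff_ite]
      have h1 := orthonormal_iff_ite.1 hq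
      have h2 := orthonormal_iff_ite.1 u.orthonormal
      intro k l
      induction k using Fin.addCases with
      | left k =>
        induction l using Fin.addCases with
        | left l => simpa using h1 k l
        | right l =>
          have : inner ℝ (q k) (u l : H) = 0 := (u l).2.1 (q k) (hqQ k)
          simpa [Fin.ext_iff, (Nat.lt_of_lt_of_le k.2 (Nat.le_add_right R l)).ne] using this
      | right k =>
        induction l using Fin.addCases with
        | left l =>
          have : inner ℝ (u k : H) (q l) = 0 := by
            rw [real_inner_comm]; exact (u k).2.1 (q l) (hqQ l)
          simpa [Fin.ext_iff, (Nat.lt_of_lt_of_le l.2 (Nat.le_add_right R k)).ne'] using this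
        | right l => simpa [Submodule.coe_inner] using h2 k l
    · intro k l hkl
      induction k using Fin.addCases with
      | left k =>
        induction l using Fin.addCases with
        | left l => simpa using hlev hkl
        | right l => simpa using (hJ k).le
      | right k =>
        induction l using Fin.addCases with
        | left l => simp [Fin.le_def] at hkl; omega
        | right l => simp
    · intro k
      induction k using Fin.addCases with
      | left k => simpa using (hJ k).trans (Nat.lt_succ_self J)
      | right k => simp
    · intro k
      induction k using Fin.addCases with
      | left k => simpa using hqU k
      | right k => simpa using (u k).2.2
    · intro b hb
      rcases Nat.lt_succ_iff_lt_or_eq.1 hb with hb' | rfl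
      · refine (hspan b hb').trans (Submodule.span_mono ?_)
        rintro _ ⟨k, hk, rfl⟩
        exact ⟨Fin.castAdd r k, by simpa using hk, by simp⟩
      · refine hUJ.trans (sup_le ?_ ?_)
        · refine Submodule.span_mono ?_
          rintro _ ⟨k, rfl⟩
          exact ⟨Fin.castAdd r k, by simpa using (hJ k).le, by simp⟩
        · intro x hx
          have : (⟨x, hx⟩ : N) = ∑ i, u.repr ⟨x, hx⟩ i • u i := (u.sum_repr _).symm
          have h3 : x = ∑ i, u.repr ⟨x, hx⟩ i • (u i : H) := by
            have := congrArg (Subtype.val) this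
            simpa using this
          rw [h3]
          refine Submodule.sum_mem _ fun i _ => Submodule.smul_mem _ _ (Submodule.subset_span ?_)
          exact ⟨Fin.natAdd R i, by simp, by simp⟩

end Adapted

end BallGraph

/-! ### Coefficient matrices of degenerate kernels -/

namespace BallGraph

section Expansion

variable {X : Type*} [MeasurableSpace X] {μ : Measure X}

theorem integral_sq_sum_of_orthonormal {ι : Type*} [Fintype ι] [DecidableEq ι] {E : ι → X → ℝ}
    (hint : ∀ s t, Integrable (fun x => E s x * E t x) μ)
    (horth : ∀ s t, ∫ x, E s x * E t x ∂μ = if s = t then 1 else 0) (c : ι → ℝ) :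
    ∫ x, (∑ s, c s * E s x) ^ 2 ∂μ = ∑ s, c s ^ 2 := by
  have h1 : ∀ x, (∑ s, c s * E s x) ^ 2 = ∑ s, ∑ t, c s * c t * (E s x * E t x) := by
    intro x
    rw [sq, Finset.sum_mul_sum]
    exact Finset.sum_congr rfl fun s _ => Finset.sum_congr rfl fun t _ => by ring
  simp only [h1]
  rw [integral_finsetSum _ fun s _ => integrable_finsetSum _ fun t _ => (hint s t).const_mul _]
  refine Finset.sum_congr rfl fun s _ => ?_
  rw [integral_finsetSum _ fun t _ => (hint s t).const_mul _]
  simp [integral_const_mul, horth, sq]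

variable {R : ℕ} {e : Fin R → X → ℝ}

theorem degenerateKernel_sub {X : Type*} {e : Fin R → X → ℝ} (A A' : Matrix (Fin R) (Fin R) ℝ) (x y : X) :
    degenerateKernel (A - A') e x y = degenerateKernel A e x y - degenerateKernel A' e x y := by
  unfold degenerateKernel
  rw [← Finset.sum_sub_distrib]
  refine Finset.sum_congr rfl fun k _ => ?_
  rw [← Finset.sum_sub_distrib]
  exact Finset.sum_congr rfl fun l _ => by rw [Matrix.sub_apply]; ring

variable [IsProbabilityMeasure μ]

theorem integral_degenerateKernel_sq (he : ∀ k, Measurable (e k)) {C : ℝ}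
    (hb : ∀ᵐ x ∂μ, ∀ k, |e k x| ≤ C)
    (horth : ∀ k l, ∫ x, e k x * e l x ∂μ = if k = l then 1 else 0)
    (M : Matrix (Fin R) (Fin R) ℝ) :
    ∫ z : X × X, degenerateKernel M e z.1 z.2 ^ 2 ∂(μ.prod μ) = ∑ k, ∑ l, M k l ^ 2 := by
  have hi : ∀ k l, Integrable (fun x => e k x * e l x) μ := fun k l =>
    (memLp_two_gram_entry he hb k l).integrable (by norm_num)
  have h := integral_sq_sum_of_orthonormal (μ := μ.prod μ) (ι := Fin R × Fin R)
    (E := fun s z => e s.1 z.1 * e s.2 z.2) ?_ ?_ (fun s => M s.1 s.2)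
  · simp only [Fintype.sum_prod_type] at h
    rw [← h]
    simp only [degenerateKernel, mul_assoc]
  · intro s t
    have := (hi s.1 t.1).mul_prod (hi s.2 t.2)
    refine this.congr (Filter.Eventually.of_forall fun z => ?_)
    simp only
    ring
  · intro s t
    have h1 : ∀ z : X × X, e s.1 z.1 * e s.2 z.2 * (e t.1 z.1 * e t.2 z.2) =
      (e s.1 z.1 * e t.1 z.1) * (e s.2 z.2 * e t.2 z.2) := fun z => by ring
    simp only [h1]
    rw [integral_prod_mul (fun x => e s.1 x * e t.1 x) fun y => e s.2 y * e t.2 y, horth, horth]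
    by_cases h1 : s.1 = t.1 <;> by_cases h2 : s.2 = t.2 <;> simp [h1, h2, Prod.ext_iff]

variable {W : X → X → ℝ}

/-- Rows that vanish in A' are rows of A - A', whose Frobenius norm is the L² distance of two
kernels both within s of W. This bounds the rows of the finest matrix at a given level by the error
of the preceding approximation. -/
theorem row_sum_le (hW : IsGraphon μ W) (he : ∀ k, Measurable (e k)) {C : ℝ}
    (hb : ∀ᵐ x ∂μ, ∀ k, |e k x| ≤ C)
    (horth : ∀ k l, ∫ x, e k x * e l x ∂μ = if k = l then 1 else 0)
    {A A' : Matrix (Fin R) (Fin R) ℝ} {s : ℝ}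
    (hA : ∫ z : X × X, (W z.1 z.2 - degenerateKernel A e z.1 z.2) ^ 2 ∂(μ.prod μ) ≤ s ^ 2)
    (hA' : ∫ z : X × X, (W z.1 z.2 - degenerateKernel A' e z.1 z.2) ^ 2 ∂(μ.prod μ) ≤ s ^ 2)
    {p : Fin R → Prop} [DecidablePred p] (h0 : ∀ k l, p k → A' k l = 0) :
    ∑ k, ∑ l, (if p k then A k l ^ 2 else 0) ≤ (2 * s) ^ 2 := by
  have hi := integrable_sq_sub_degenerateKernel (A := A) hW he hb
  have hi' := integrable_sq_sub_degenerateKernel (A := A') hW he hb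
  calc ∑ k, ∑ l, (if p k then A k l ^ 2 else 0) ≤ ∑ k, ∑ l, (A - A') k l ^ 2 := by
        refine Finset.sum_le_sum fun k _ => Finset.sum_le_sum fun l _ => ?_
        split_ifs with hk
        · rw [Matrix.sub_apply, h0 k l hk, sub_zero]
        · positivity
    _ = ∫ z : X × X, degenerateKernel (A - A') e z.1 z.2 ^ 2 ∂(μ.prod μ) :=
        (integral_degenerateKernel_sq he hb horth _).symm
    _ ≤ ∫ z : X × X, (2 * (W z.1 z.2 - degenerateKernel A e z.1 z.2) ^ 2 +
          2 * (W z.1 z.2 - degenerateKernel A' e z.1 z.2) ^ 2) ∂(μ.prod μ) := by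
        refine integral_mono_of_nonneg (Filter.Eventually.of_forall fun z => sq_nonneg _)
          ((hi.const_mul 2).add (hi'.const_mul 2)) (Filter.Eventually.of_forall fun z => ?_)
        simp only [degenerateKernel_sub]
        nlinarith [sq_nonneg (W z.1 z.2 - degenerateKernel A e z.1 z.2 +
          (W z.1 z.2 - degenerateKernel A' e z.1 z.2))]
    _ ≤ (2 * s) ^ 2 := by
        rw [integral_add (hi.const_mul 2) (hi'.const_mul 2), integral_const_mul,
          integral_const_mul]
        nlinarith

end Expansion

/-! ### Function spaces and the kernels they generate -/

section Spaces

variable {X : Type*} [MeasurableSpace X] {μ : Measure X}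

/-- A function space all of whose elements are square integrable, mapped to `L²`. -/
noncomputable def toLpSubmodule (V : Submodule ℝ (X → ℝ)) (hV : ∀ p ∈ V, MemLp p 2 μ) :
    V →ₗ[ℝ] Lp ℝ 2 μ where
  toFun p := (hV p.1 p.2).toLp _
  map_add' _ _ := MemLp.toLp_add _ _
  map_smul' c _ := MemLp.toLp_const_smul c _

theorem exists_sum_of_mem_span_image {H : Type*} [AddCommGroup H] [Module ℝ H] {R : ℕ}
    {q : Fin R → H} {s : Set (Fin R)} {x : H} (hx : x ∈ Submodule.span ℝ (q '' s)) :
    ∃ c : Fin R → ℝ, (∀ k, k ∉ s → c k = 0) ∧ x = ∑ k, c k • q k := by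
  classical
  induction hx using Submodule.span_induction with
  | mem x hx =>
    obtain ⟨k, hk, rfl⟩ := hx
    refine ⟨Pi.single k 1, fun l hl => Pi.single_eq_of_ne (fun h : l = k => hl (by rwa [h])) _, ?_⟩
    simp [Pi.single_apply]
  | zero => exact ⟨0, fun _ _ => rfl, by simp⟩
  | add x y _ _ hx hy =>
    obtain ⟨c, hc, rfl⟩ := hx
    obtain ⟨c', hc', rfl⟩ := hy
    exact ⟨c + c', fun k hk => by simp [hc k hk, hc' k hk], by
      simp [add_smul, Finset.sum_add_distrib]⟩
  | smul a x _ hx =>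
    obtain ⟨c, hc, rfl⟩ := hx
    exact ⟨a • c, fun k hk => by simp [hc k hk], by simp [Finset.smul_sum, mul_smul]⟩

/-- An adapted orthonormal system of functions for a filtration by finite dimensional spaces
of square integrable functions. -/
theorem exists_adapted_functions {V : ℕ → Submodule ℝ (X → ℝ)} (hmono : Monotone V)
    [hfin : ∀ b, FiniteDimensional ℝ (V b)] (hV : ∀ b, ∀ p ∈ V b, MemLp p 2 μ) (J : ℕ) :
    ∃ (R : ℕ) (e : Fin R → X → ℝ) (lev : Fin R → ℕ), Monotone lev ∧ (∀ k, lev k ≤ J) ∧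
      (∀ k, e k ∈ V (lev k)) ∧
      (∀ k l, ∫ x, e k x * e l x ∂μ = if k = l then 1 else 0) ∧
      (∀ b, (Finset.univ.filter fun k => lev k ≤ b).card ≤ Module.finrank ℝ (V b)) ∧
      ∀ b ≤ J, ∀ p ∈ V b, ∃ c : Fin R → ℝ, (∀ k, b < lev k → c k = 0) ∧
        ∀ᵐ x ∂μ, p x = ∑ k, c k * e k x := by
  let L := fun b => toLpSubmodule (V b) (hV b)
  let U := fun b => LinearMap.range (L b)
  have hU : Monotone U := by
    rintro a b hab _ ⟨p, rfl⟩
    exact ⟨⟨p.1, hmono hab p.2⟩, rfl⟩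
  obtain ⟨R, q, lev, hq, hlev, hJ, hqU, hspan⟩ := exists_adapted_orthonormal U hU (J + 1)
  choose e' he' using hqU
  let e : Fin R → X → ℝ := fun k => (e' k).1
  have hqe : ∀ k, q k =ᵐ[μ] e k := fun k => by
    rw [← he' k]
    exact (hV _ (e' k).1 (e' k).2).coeFn_toLp
  refine ⟨R, e, lev, hlev, fun k => Nat.lt_succ_iff.1 (hJ k), fun k => (e' k).2, ?_, ?_, ?_⟩
  · intro k l
    rw [← orthonormal_iff_ite.1 hq k l, inner_Lp_eq_integral]
    refine integral_congr_ae ?_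
    filter_upwards [hqe k, hqe l] with x h1 h2
    rw [h1, h2]
  · intro b
    -- The functions of level at most b are independent in the image of V b, which bounds their
    -- number.
    have hli : LinearIndependent ℝ fun k : {k // lev k ≤ b} =>
        (⟨q k, hU k.2 ⟨e' k, he' k⟩⟩ : U b) := by
      refine LinearIndependent.of_comp (U b).subtype ?_
      exact hq.linearIndependent.comp (fun k : {k // lev k ≤ b} => (k : Fin R))
        Subtype.val_injective
    have h1 := hli.fintype_card_le_finrank
    rw [Fintype.card_subtype] at h1
    exact h1.trans (LinearMap.finrank_range_le _)
  · intro b hb p hp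
    obtain ⟨c, hc, hsum⟩ := exists_sum_of_mem_span_image
      (hspan b (Nat.lt_succ_of_le hb) (⟨⟨p, hp⟩, rfl⟩ : L b ⟨p, hp⟩ ∈ U b))
    refine ⟨c, fun k hk => hc k (by simpa using hk), ?_⟩
    have h1 : (L b ⟨p, hp⟩ : X → ℝ) =ᵐ[μ] p := (hV b p hp).coeFn_toLp
    have h2 : ((∑ k, c k • q k : Lp ℝ 2 μ) : X → ℝ) =ᵐ[μ] ∑ k, c k • (q k : X → ℝ) := by
      refine (Lp.coeFn_finsetSum _ _).trans ?_
      have : ∀ᵐ x ∂μ, ∀ k, (c k • q k : Lp ℝ 2 μ) x = c k • q k x := by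
        rw [ae_all_iff]
        intro k
        filter_upwards [Lp.coeFn_smul (c k) (q k)] with x hx using hx
      filter_upwards [this] with x hx
      simp [hx]
    rw [hsum] at h1
    have h3 : ∀ᵐ x ∂μ, ∀ k, q k x = e k x := by
      rw [ae_all_iff]
      exact hqe
    filter_upwards [h1, h2, h3] with x hx1 hx2 hx3
    rw [← hx1, hx2]
    simp [hx3]

/-- A symmetric kernel generated by products `p x * p y` with `p` in the function space `V`. -/
def IsGeneratedBy (V : Submodule ℝ (X → ℝ)) (W : X → X → ℝ) : Prop :=
  ∃ (N : ℕ) (a : Fin N → ℝ) (p : Fin N → X → ℝ), (∀ i, p i ∈ V) ∧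
    ∀ x y, W x y = ∑ i, a i * p i x * p i y

/-- The identity is asserted on G × G for one set G of full measure, and not merely for almost every
pair, because the values at (x, x) enter the diagonal of the sampled matrix. -/
theorem IsGeneratedBy.exists_degenerateKernel {V : Submodule ℝ (X → ℝ)} {W : X → X → ℝ}
    (hW : IsGeneratedBy V W) {R : ℕ} {e : Fin R → X → ℝ} {Z : Fin R → Prop}
    (hexp : ∀ p ∈ V, ∃ c : Fin R → ℝ, (∀ k, Z k → c k = 0) ∧ ∀ᵐ x ∂μ, p x = ∑ k, c k * e k x) :
    ∃ A : Matrix (Fin R) (Fin R) ℝ, A.IsSymm ∧ (∀ k l, Z k → A k l = 0) ∧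
      ∃ G : Set X, (∀ᵐ x ∂μ, x ∈ G) ∧ ∀ x ∈ G, ∀ y ∈ G, W x y = degenerateKernel A e x y := by
  obtain ⟨N, a, p, hp, hWp⟩ := hW
  choose c hc0 hc using fun i => hexp (p i) (hp i)
  refine ⟨Matrix.of fun k l => ∑ i, a i * c i k * c i l, ?_, ?_,
    {x | ∀ i, p i x = ∑ k, c i k * e k x}, ae_all_iff.2 hc, ?_⟩
  · ext k l
    simp only [Matrix.transpose_apply, Matrix.of_apply]
    exact Finset.sum_congr rfl fun i _ => by ring
  · intro k l hk
    simp [hc0 _ k hk]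
  · intro x hx y hy
    rw [hWp, degenerateKernel]
    have : ∀ i, a i * p i x * p i y = ∑ k, ∑ l, a i * c i k * c i l * e k x * e l y := by
      intro i
      rw [hx i, hy i, mul_assoc, Finset.sum_mul_sum, Finset.mul_sum]
      refine Finset.sum_congr rfl fun k _ => ?_
      rw [Finset.mul_sum]
      exact Finset.sum_congr rfl fun l _ => by ring
    simp only [this, Matrix.of_apply]
    rw [Finset.sum_comm]
    refine Finset.sum_congr rfl fun k _ => ?_
    rw [Finset.sum_comm]
    exact Finset.sum_congr rfl fun l _ => by simp only [Finset.sum_mul]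

end Spaces

end BallGraph

/-! ### The rate n^(-1/2) from geometric approximation -/

namespace BallGraph

section Rate

universe u

variable {X : Type*} [MeasurableSpace X] {μ : Measure X} [IsProbabilityMeasure μ]
  {W : X → X → ℝ}

/-- Duality of the Christoffel function: the hypothesis is applied to p = ∑ e_k(x) e_k, whose value
at x and squared norm are both ∑ e_k(x)². -/
theorem sum_sq_le_of_pointwise_bound {R : ℕ} {e : Fin R → X → ℝ} (he : ∀ k, Measurable (e k))
    {C : ℝ} (hb : ∀ᵐ x ∂μ, ∀ k, |e k x| ≤ C)
    (horth : ∀ k l, ∫ x, e k x * e l x ∂μ = if k = l then 1 else 0)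
    {V : Submodule ℝ (X → ℝ)} {Z : Fin R → Prop} [DecidablePred Z] (hZ : ∀ k, Z k → e k ∈ V)
    {κ : ℝ} (hκ0 : 0 ≤ κ) {x : X} (hκ : ∀ p ∈ V, p x ^ 2 ≤ κ * ∫ y, p y ^ 2 ∂μ) :
    ∑ k, (if Z k then e k x ^ 2 else 0) ≤ κ := by
  set s := ∑ k, (if Z k then e k x ^ 2 else 0) with hs
  have hs0 : 0 ≤ s := Finset.sum_nonneg fun k _ => by
    split_ifs
    · positivity
    · exact le_rfl
  let c : Fin R → ℝ := fun k => if Z k then e k x else 0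
  have hpV : (fun y => ∑ k, c k * e k y) ∈ V := by
    have : (fun y => ∑ k, c k * e k y) = ∑ k, c k • e k := by
      funext y; simp
    rw [this]
    refine V.sum_mem fun k _ => ?_
    by_cases hk : Z k
    · exact V.smul_mem _ (hZ k hk)
    · simp [c, hk]
  have h1 := hκ _ hpV
  rw [integral_sq_sum_of_orthonormal (fun k l =>
    (memLp_two_gram_entry he hb k l).integrable (by norm_num)) horth] at h1
  have h2 : ∑ k, c k * e k x = s := by
    refine Finset.sum_congr rfl fun k _ => ?_
    by_cases hk : Z k <;> simp [c, hk, sq]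
  have h3 : ∑ k, c k ^ 2 = s := by
    refine Finset.sum_congr rfl fun k _ => ?_
    by_cases hk : Z k <;> simp [c, hk]
  rw [h3] at h1
  simp only [h2] at h1
  rcases hs0.eq_or_lt with h0 | h0
  · rwa [← h0]
  · nlinarith

theorem integral_congr_kernel {μ : Measure X} [SFinite μ] {W W' : X → X → ℝ} {K : X → X → ℝ} {G : Set X}
    (hG : ∀ᵐ x ∂μ, x ∈ G) (h : ∀ x ∈ G, ∀ y ∈ G, W x y = W' x y) :
    ∫ z : X × X, (K z.1 z.2 - W z.1 z.2) ^ 2 ∂(μ.prod μ) =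
      ∫ z : X × X, (K z.1 z.2 - W' z.1 z.2) ^ 2 ∂(μ.prod μ) := by
  refine integral_congr_ae ?_
  filter_upwards [Measure.quasiMeasurePreserving_fst.ae hG,
    Measure.quasiMeasurePreserving_snd.ae hG] with z h1 h2
  rw [h z.1 h1 z.2 h2]

/-- If a graphon is approximated at a geometric rate by kernels generated by an increasing
sequence of function spaces whose Christoffel functions and dimensions grow at a slower geometric
rate, the spectrum of the sampled matrix converges at the rate `n^(-1/2)`. -/
theorem exists_rate_of_approximation (hW : IsGraphon μ W) {V : ℕ → Submodule ℝ (X → ℝ)}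
    (hmono : Monotone V) (hV0 : V 0 = ⊥) (hfin : ∀ b, FiniteDimensional ℝ (V b))
    (hmeas : ∀ b, ∀ p ∈ V b, Measurable p) {G : Set X} (hG : ∀ᵐ x ∂μ, x ∈ G)
    (hbdd : ∀ b, ∀ p ∈ V b, ∃ C, ∀ x ∈ G, |p x| ≤ C)
    {K s q B : ℝ} (hK : 0 < K) (hs : 1 < s) (hq : 0 < q) (hq1 : q ≤ 1) (hsq : s * q < 1)
    (hκ : ∀ b, ∃ κ : ℝ, 0 ≤ κ ∧ (∀ p ∈ V b, ∀ x ∈ G, p x ^ 2 ≤ κ * ∫ y, p y ^ 2 ∂μ) ∧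
      κ * Module.finrank ℝ (V b) ≤ K * (s ^ b) ^ 2)
    {Wk : ℕ → X → X → ℝ} (hgen : ∀ b, IsGeneratedBy (V b) (Wk b))
    (happ : ∀ b, ∫ z : X × X, (W z.1 z.2 - Wk b z.1 z.2) ^ 2 ∂(μ.prod μ) ≤ (K * q ^ b) ^ 2)
    (hB : ∀ b, ∀ x ∈ G, |Wk b x x| ≤ B) {α : ℝ} (hα : 0 < α) :
    ∃ C : ℝ, 0 < C ∧ ∀ (n : ℕ), 1 ≤ n →
      ∀ (Ω : Type u) [MeasurableSpace Ω] (P : Measure Ω) [IsProbabilityMeasure P]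
        (S : Fin n → Ω → X), iIndepFun S P → (∀ i, HasLaw (S i) μ P) →
        P {ω | ¬ delta2 (eigs (Matrix.toLin' (sampleMatrix W fun i => S i ω)))
            (eigs (integralOperator hW)) ≤ ENNReal.ofReal (C * (n : ℝ) ^ (-(1 / 2) : ℝ))} ≤
          ENNReal.ofReal α := by
  set c : ℝ := 2 * Real.sqrt K * K * s / (1 - s * q) with hc
  have hsq0 : 0 < s * q := by positivity
  have hc0 : 0 < c := by
    have : 0 < 1 - s * q := by linarith
    positivity
  set C1 : ℝ := K * Real.sqrt (12 * K * s ^ 2 / α) with hC1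
  have hC10 : 0 < C1 := by positivity
  refine ⟨C1 + Real.sqrt (3 * C1 ^ 2 / α + B ^ 2) + 18 * c / α, by positivity, ?_⟩
  intro n hn Ω _ P _ S hind hlaw
  have hn0 : (0 : ℝ) < n := by exact_mod_cast hn
  have hex : ∃ J : ℕ, α * n < 12 * (K * (s ^ (J + 1)) ^ 2) := by
    obtain ⟨J, hJ⟩ := pow_unbounded_of_one_lt (α * n / (12 * K)) hs
    refine ⟨J, ?_⟩
    rw [div_lt_iff₀ (by positivity)] at hJ
    have h1 : s ^ J ≤ (s ^ (J + 1)) ^ 2 := by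
      rw [← pow_mul]
      exact pow_le_pow_right₀ hs.le (by omega)
    calc α * n < s ^ J * (12 * K) := hJ
      _ ≤ (s ^ (J + 1)) ^ 2 * (12 * K) := by gcongr
      _ = _ := by ring
  -- J is the last level whose Gram defect the sample of size n can afford. The failure at J + 1
  -- says that n is at most of order s^(2J), which with s q < 1 makes q^J of order n^(-1/2).
  obtain ⟨J, hJ1, hJ2⟩ : ∃ J : ℕ, α * n < 12 * (K * (s ^ (J + 1)) ^ 2) ∧
      (J = 0 ∨ 12 * (K * (s ^ J) ^ 2) ≤ α * n) := by
    classical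
    refine ⟨Nat.find hex, Nat.find_spec hex, ?_⟩
    rcases Nat.eq_zero_or_eq_succ_pred (Nat.find hex) with h | h
    · exact Or.inl h
    · right
      have := Nat.find_min hex (m := (Nat.find hex).pred) (by omega)
      rw [not_lt, ← Nat.succ_eq_add_one, ← h] at this
      exact this
  have hmem : ∀ b, ∀ p ∈ V b, MemLp p 2 μ := fun b p hp => by
    obtain ⟨C, hC⟩ := hbdd b p hp
    refine MemLp.of_bound (hmeas b p hp).aestronglyMeasurable C ?_
    filter_upwards [hG] with x hx using hC x hx
  obtain ⟨R, e, lev, hlev, hlevJ, heV, horth, hcard, hexp⟩ :=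
    exists_adapted_functions hmono hmem J
  have he : ∀ k, Measurable (e k) := fun k => hmeas _ _ (heV k)
  obtain ⟨C, hb'⟩ : ∃ C, ∀ x ∈ G, ∀ k, |e k x| ≤ C := by
    choose C hC using fun k => hbdd _ _ (heV k)
    refine ⟨∑ k, |C k|, fun x hx k => (hC k x hx).trans ((le_abs_self _).trans ?_)⟩
    exact Finset.single_le_sum (f := fun k => |C k|) (fun i _ => abs_nonneg _) (Finset.mem_univ k)
  have hb : ∀ᵐ x ∂μ, ∀ k, |e k x| ≤ C := by
    filter_upwards [hG] with x hx using hb' x hx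
  have hlev0 : ∀ k, lev k ≠ 0 := by
    intro k hk
    have h1 := heV k
    rw [hk, hV0, Submodule.mem_bot] at h1
    have h2 := horth k k
    simp [h1] at h2
  choose M hMs hM0 H hH hMH using fun b : Fin (J + 1) =>
    (hgen b).exists_degenerateKernel (Z := fun k => (b : ℕ) < lev k)
      (hexp b (Nat.lt_succ_iff.1 b.2))
  have happ' : ∀ b : Fin (J + 1), ∫ z : X × X, (W z.1 z.2 - degenerateKernel (M b) e z.1 z.2) ^ 2
      ∂(μ.prod μ) ≤ (K * q ^ (b : ℕ)) ^ 2 := fun b =>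
    (integral_congr_kernel (hH b) (hMH b)).symm.le.trans (happ b)
  -- The matrix of level b has no rows at level b + 1, so `row_sum_le` compares it with the finest
  -- matrix.
  have hrow : ∀ b, b + 1 ≤ J → Real.sqrt (∑ k, ∑ l, if lev k = b + 1 then
      M (Fin.last J) k l ^ 2 else 0) ≤ 2 * (K * q ^ b) := by
    intro b hbJ
    refine Real.sqrt_le_iff.2 ⟨by positivity, ?_⟩
    refine row_sum_le hW he hb horth ((happ' (Fin.last J)).trans ?_)
      (happ' ⟨b, by omega⟩) fun k l hk => hM0 ⟨b, by omega⟩ k l (by simp [hk])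
    have : q ^ J ≤ q ^ b := pow_le_pow_of_le_one hq.le hq1 (by omega)
    simp only [Fin.val_last]
    gcongr
  -- Level 0 is empty because V 0 = ⊥, so the values at 0 are free: `a 0 = 0` removes the term, and
  -- `g 0 = α / 12` is positive and satisfies 12 g 0 ≤ α n when J = 0.
  have key := measure_delta2_gt_le (S := S) (P := P) (A := M (Fin.last J)) hW hn he hb horth
    (hMs _) hlev hlevJ
    (g := fun b => if b = 0 then α / 12 else K * (s ^ b) ^ 2)
    (a := fun b => if b = 0 then 0 else 2 * (K * q ^ (b - 1)))
    ?_ ?_ ?_ (τ := K * q ^ J) (B := B) (by positivity) hα hc0 (happ' (Fin.last J)) ?_ ?_ ?_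
    hind hlaw
  · refine (measure_mono (Set.ofPred_subset_ofPred.2 fun ω hω h =>
      hω (h.trans (ENNReal.ofReal_le_ofReal ?_)))).trans key
    have hsn : 0 < Real.sqrt n := Real.sqrt_pos.2 hn0
    have hτ : K * q ^ J ≤ C1 / Real.sqrt n := by
      rw [le_div_iff₀ hsn, mul_assoc, hC1]
      refine mul_le_mul_of_nonneg_left ?_ hK.le
      refine Real.le_sqrt_of_sq_le ?_
      rw [mul_pow, Real.sq_sqrt hn0.le, le_div_iff₀ hα]
      calc (q ^ J) ^ 2 * n * α = (q ^ J) ^ 2 * (α * n) := by ring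
        _ ≤ (q ^ J) ^ 2 * (12 * (K * (s ^ (J + 1)) ^ 2)) := by gcongr
        _ = ((s * q) ^ J) ^ 2 * (12 * K * s ^ 2) := by rw [mul_pow]; ring
        _ ≤ 1 * (12 * K * s ^ 2) := by
            gcongr
            exact pow_le_one₀ (by positivity) (pow_le_one₀ hsq0.le hsq.le)
        _ = _ := one_mul _
    have hpow : (n : ℝ) ^ (-(1 / 2) : ℝ) = 1 / Real.sqrt n := by
      rw [Real.rpow_neg hn0.le, ← Real.sqrt_eq_rpow, one_div]
    rw [hpow, mul_one_div, add_div, add_div]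
    refine add_le_add (add_le_add hτ ?_) (le_of_eq ?_)
    · rw [le_div_iff₀ hsn, ← Real.sqrt_mul (by positivity)]
      refine Real.sqrt_le_sqrt ?_
      have h1 : (K * q ^ J) ^ 2 * n ≤ C1 ^ 2 := by
        have := pow_le_pow_left₀ (by positivity) ((le_div_iff₀ hsn).1 hτ) 2
        rwa [mul_pow, Real.sq_sqrt hn0.le] at this
      rw [add_mul, div_mul_cancel₀ _ hn0.ne']
      have h2 : 3 * (K * q ^ J) ^ 2 / α * n = 3 * ((K * q ^ J) ^ 2 * n) / α := by ring
      rw [h2]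
      gcongr
    · rw [div_div]
  · intro b
    split_ifs <;> positivity
  · intro b hbJ
    rcases eq_or_ne b 0 with rfl | hb0
    · refine ⟨0, ?_, ?_⟩
      · refine Filter.Eventually.of_forall fun x => le_of_eq ?_
        simp [hlev0]
      · simp only [if_pos, zero_mul]; positivity
    · obtain ⟨κ, hκ0, hκ1, hκ2⟩ := hκ b
      refine ⟨κ, ?_, ?_⟩
      · filter_upwards [hG] with x hx
        exact sum_sq_le_of_pointwise_bound he hb horth (V := V b) (fun k hk => hmono hk (heV k))
          hκ0 fun p hp => hκ1 p hp x hx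
      · rw [if_neg hb0]
        refine le_trans ?_ hκ2
        gcongr
        exact hcard b
  · intro b hbJ
    rcases b with _ | b
    · simp [hlev0]
    · simpa using hrow b hbJ
  · filter_upwards [hG, hH (Fin.last J)] with x hx hx'
    rw [← hMH (Fin.last J) x hx' x hx']
    exact hB _ x hx
  · rw [Finset.sum_range_succ']
    simp only [Nat.add_eq_zero_iff, one_ne_zero, and_false, if_false, if_true, mul_zero, add_zero,
      Nat.add_sub_cancel]
    -- Pairing g at level b + 1 with the error at level b produces (s q)^b, with one spare factor s;
    -- hence the value of c.
    have h1 : ∀ b ∈ Finset.range J, Real.sqrt (K * (s ^ (b + 1)) ^ 2) * (2 * (K * q ^ b)) =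
        2 * Real.sqrt K * K * s * (s * q) ^ b := by
      intro b _
      rw [Real.sqrt_mul hK.le, Real.sqrt_sq (by positivity), mul_pow]
      ring
    rw [Finset.sum_congr rfl h1, ← Finset.mul_sum, hc, div_eq_mul_inv]
    refine mul_le_mul_of_nonneg_left ?_ (by positivity)
    rw [← tsum_geometric_of_lt_one hsq0.le hsq]
    exact (summable_geometric_of_lt_one hsq0.le hsq).sum_le_tsum _ fun _ _ => by positivity
  · rcases hJ2 with rfl | hJ2
    · simp only [if_true]
      have : (1 : ℝ) ≤ n := by exact_mod_cast hn
      nlinarith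
    · rcases eq_or_ne J 0 with rfl | hJ0
      · simp only [if_true]
        have : (1 : ℝ) ≤ n := by exact_mod_cast hn
        nlinarith
      · rw [if_neg hJ0]
        exact hJ2

end Rate

end BallGraph

/-! ### Algebraic identities for Gegenbauer polynomials -/

namespace BallGraph

section GegenbauerAlgebra

open Polynomial

/-- The Gegenbauer polynomials, as elements of the polynomial ring. -/
noncomputable def gegenbauerPoly (γ : ℝ) : ℕ → ℝ[X]
  | 0 => 1
  | 1 => C (2 * γ) * X
  | n + 2 => C ((n + 2 : ℝ)⁻¹) *
      (C (2 * (n + 1 + γ)) * X * gegenbauerPoly γ (n + 1) - C (n + 2 * γ) * gegenbauerPoly γ n)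

theorem eval_gegenbauerPoly (γ : ℝ) (n : ℕ) (t : ℝ) :
    (gegenbauerPoly γ n).eval t = gegenbauer γ n t := by
  induction n using Nat.twoStepInduction with
  | zero => simp [gegenbauerPoly, gegenbauer]
  | one => simp [gegenbauerPoly, gegenbauer]
  | more n ih1 ih2 =>
    rw [gegenbauerPoly, gegenbauer]
    simp only [eval_mul, eval_C, eval_sub, eval_X, ih1, ih2]
    rw [div_eq_inv_mul]

theorem gegenbauerPoly_recurrence (γ : ℝ) (n : ℕ) :
    C (n + 2 : ℝ) * gegenbauerPoly γ (n + 2) =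
      C (2 * (n + 1 + γ)) * X * gegenbauerPoly γ (n + 1) - C (n + 2 * γ) * gegenbauerPoly γ n := by
  rw [gegenbauerPoly, ← mul_assoc, ← C_mul, mul_inv_cancel₀ (by positivity), C_1, one_mul]

/-- The pair closes under induction: the differentiated recurrence and the first identity give the
second one at n + 1, and the recurrence then gives the first. -/
theorem derivative_gegenbauerPoly_aux (γ : ℝ) (n : ℕ) :
    C (n + 1 : ℝ) * gegenbauerPoly γ (n + 1) =
      X * derivative (gegenbauerPoly γ (n + 1)) - derivative (gegenbauerPoly γ n) ∧
    C (n + 2 * γ) * gegenbauerPoly γ n =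
      derivative (gegenbauerPoly γ (n + 1)) - X * derivative (gegenbauerPoly γ n) := by
  induction n with
  | zero => constructor <;> simp [gegenbauerPoly, mul_comm]
  | succ n ih =>
    obtain ⟨h1, h2⟩ := ih
    have hr := gegenbauerPoly_recurrence γ n
    have hd := congrArg derivative hr
    simp only [derivative_mul, derivative_sub, derivative_C, zero_mul, zero_add, derivative_X,
      mul_one] at hd
    have hne : (C (n + 2 : ℝ) : ℝ[X]) ≠ 0 := by
      rw [Ne, C_eq_zero]; positivity
    have h3 : C ((n + 1 : ℕ) + 2 * γ) * gegenbauerPoly γ (n + 1) =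
        derivative (gegenbauerPoly γ (n + 1 + 1)) -
          X * derivative (gegenbauerPoly γ (n + 1)) := by
      apply mul_left_cancel₀ hne
      rw [mul_sub, show n + 1 + 1 = n + 2 from rfl, hd]
      simp only [map_add, map_mul, map_natCast, map_one, Nat.cast_add, Nat.cast_one,
        map_ofNat] at h1 h2 ⊢
      linear_combination ((n : ℝ[X]) + 2 * C γ) * h1
    refine ⟨?_, h3⟩
    simp only [map_add, map_mul, map_natCast, map_one, Nat.cast_add, Nat.cast_one,
      map_ofNat] at h1 h2 h3 hr ⊢
    rw [show n + 1 + 1 = n + 2 from rfl] at *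
    linear_combination hr + X * h3 + X * h1 - h2

theorem one_sub_sq_mul_derivative_gegenbauerPoly (γ : ℝ) (n : ℕ) :
    (1 - X ^ 2) * derivative (gegenbauerPoly γ (n + 1)) =
      C (n + 2 * γ) * gegenbauerPoly γ n - C (n + 1 : ℝ) * X * gegenbauerPoly γ (n + 1) := by
  obtain ⟨h1, h2⟩ := derivative_gegenbauerPoly_aux γ n
  linear_combination -h2 + X * h1

/-- Differentiate `one_sub_sq_mul_derivative_gegenbauerPoly` and eliminate the derivative of G_n.
Orthogonality and Sonin's function both rest on this equation. -/
theorem gegenbauerPoly_ode (γ : ℝ) (n : ℕ) :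
    (1 - X ^ 2) * derivative (derivative (gegenbauerPoly γ n)) -
      C (2 * γ + 1) * X * derivative (gegenbauerPoly γ n) +
        C ((n : ℝ) * (n + 2 * γ)) * gegenbauerPoly γ n = 0 := by
  rcases n with _ | n
  · simp [gegenbauerPoly]
  · have hd := congrArg derivative (one_sub_sq_mul_derivative_gegenbauerPoly γ n)
    obtain ⟨h1, h2⟩ := derivative_gegenbauerPoly_aux γ n
    simp only [derivative_mul, derivative_sub, derivative_C, zero_mul, zero_add, derivative_X,
      mul_one, derivative_one, derivative_X_pow] at hd
    simp only [map_add, map_mul, map_natCast, map_one, Nat.cast_add, Nat.cast_one,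
      map_ofNat, Nat.cast_ofNat] at h1 h2 hd ⊢
    linear_combination hd + ((n : ℝ[X]) + 2 * C γ) * h1

theorem gegenbauer_succ_one (γ : ℝ) (n : ℕ) :
    (n + 1 : ℝ) * (gegenbauerPoly γ (n + 1)).eval 1 =
      (n + 2 * γ) * (gegenbauerPoly γ n).eval 1 := by
  have h := congrArg (eval 1) (one_sub_sq_mul_derivative_gegenbauerPoly γ n)
  simp only [eval_mul, eval_sub, eval_one, eval_pow, eval_X, eval_C] at h
  linarith

theorem gegenbauerPoly_eval_neg (γ : ℝ) (n : ℕ) (t : ℝ) :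
    (gegenbauerPoly γ n).eval (-t) = (-1) ^ n * (gegenbauerPoly γ n).eval t := by
  induction n using Nat.twoStepInduction with
  | zero => simp [gegenbauerPoly]
  | one => simp [gegenbauerPoly]
  | more n ih1 ih2 =>
    rw [gegenbauerPoly]
    simp only [eval_mul, eval_C, eval_sub, eval_X, ih1, ih2, pow_succ]
    ring

/-- The recurrence solved for X G_n. At n = 0 this divides by 2γ, since G_1 = 2γX: for γ = 0 the
family would not span. -/
theorem X_mul_gegenbauerPoly_mem {γ : ℝ} (hγ : -(1 / 2) < γ) (hγ0 : γ ≠ 0) (n : ℕ) :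
    X * gegenbauerPoly γ n ∈
      Submodule.span ℝ (gegenbauerPoly γ '' Set.Iic (n + 1)) := by
  rcases n with _ | n
  · have : X * gegenbauerPoly γ 0 = (2 * γ)⁻¹ • gegenbauerPoly γ 1 := by
      rw [smul_eq_C_mul, gegenbauerPoly, gegenbauerPoly, mul_one, ← mul_assoc, ← C_mul,
        inv_mul_cancel₀ (by simpa using hγ0), C_1, one_mul]
    rw [this]
    exact Submodule.smul_mem _ _ (Submodule.subset_span ⟨1, by simp, rfl⟩)
  · have hne : 2 * (n + 1 + γ) ≠ 0 := by
      have : (0 : ℝ) ≤ n := n.cast_nonneg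
      have : 0 < 2 * (n + 1 + γ) := by linarith
      exact this.ne'
    have : X * gegenbauerPoly γ (n + 1) = (2 * (n + 1 + γ))⁻¹ •
        ((n + 2 : ℝ) • gegenbauerPoly γ (n + 2) + (n + 2 * γ) • gegenbauerPoly γ n) := by
      rw [eq_inv_smul_iff₀ hne]
      simp only [smul_eq_C_mul]
      linear_combination -gegenbauerPoly_recurrence γ n
    rw [this]
    refine Submodule.smul_mem _ _ (Submodule.add_mem _ (Submodule.smul_mem _ _ ?_)
      (Submodule.smul_mem _ _ ?_))
    · exact Submodule.subset_span ⟨n + 2, by simp, rfl⟩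
    · exact Submodule.subset_span ⟨n, by simp; omega, rfl⟩

theorem mem_span_gegenbauerPoly {γ : ℝ} (hγ : -(1 / 2) < γ) (hγ0 : γ ≠ 0) {m : ℕ} {p : ℝ[X]}
    (hp : p.natDegree ≤ m) :
    p ∈ Submodule.span ℝ (gegenbauerPoly γ '' Set.Iic m) := by
  have hX : ∀ k, X ^ k ∈ Submodule.span ℝ (gegenbauerPoly γ '' Set.Iic k) := by
    intro k
    induction k with
    | zero => exact Submodule.subset_span ⟨0, by simp, by simp [gegenbauerPoly]⟩
    | succ k ih =>
      rw [pow_succ']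
      have hle : Submodule.span ℝ (gegenbauerPoly γ '' Set.Iic k) ≤
          (Submodule.span ℝ (gegenbauerPoly γ '' Set.Iic (k + 1))).comap
            (LinearMap.mulLeft ℝ X) := by
        rw [Submodule.span_le]
        rintro _ ⟨j, hj, rfl⟩
        refine Submodule.span_mono (Set.image_mono ?_) (X_mul_gegenbauerPoly_mem hγ hγ0 j)
        exact Set.Iic_subset_Iic.2 (by simpa using hj)
      exact hle ih
  rw [p.as_sum_range_C_mul_X_pow' (Nat.lt_succ_of_le hp)]
  refine Submodule.sum_mem _ fun k hk => ?_
  rw [← smul_eq_C_mul]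
  refine Submodule.smul_mem _ _ (Submodule.span_mono (Set.image_mono ?_) (hX k))
  exact Set.Iic_subset_Iic.2 (Nat.lt_succ_iff.1 (Finset.mem_range.1 hk))

end GegenbauerAlgebra

end BallGraph

/-! ### The Gegenbauer weight and orthogonality -/

namespace BallGraph

section GegenbauerMeasure

open Polynomial

/-- One factor of (1 - t)^a (1 + t)^a is at most 1 on each half of the interval; this separates the
two endpoint singularities. -/
theorem one_sub_sq_rpow_le {a t : ℝ} (ha : a < 0) (ht : t ∈ Set.Ioo (-1 : ℝ) 1) :
    (1 - t ^ 2) ^ a ≤ (1 - t) ^ a + (1 + t) ^ a := by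
  have h1 : 0 < 1 - t := by linarith [ht.2]
  have h2 : 0 < 1 + t := by linarith [ht.1]
  have hfac : (1 - t ^ 2) ^ a = (1 - t) ^ a * (1 + t) ^ a := by
    rw [← Real.mul_rpow h1.le h2.le]; congr 1; ring
  have p1 : 0 < (1 - t) ^ a := Real.rpow_pos_of_pos h1 _
  have p2 : 0 < (1 + t) ^ a := Real.rpow_pos_of_pos h2 _
  rw [hfac]
  rcases le_total 0 t with h | h
  · have : (1 + t) ^ a ≤ 1 := Real.rpow_le_one_of_one_le_of_nonpos (by linarith) ha.le
    nlinarith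
  · have : (1 - t) ^ a ≤ 1 := Real.rpow_le_one_of_one_le_of_nonpos (by linarith) ha.le
    nlinarith

theorem intervalIntegrable_one_sub_sq_rpow {a : ℝ} (ha : -1 < a) :
    IntervalIntegrable (fun t : ℝ => (1 - t ^ 2) ^ a) volume (-1) 1 := by
  rcases le_or_gt 0 a with h0 | h0
  · refine (Continuous.rpow_const (by fun_prop) fun t => Or.inr h0).intervalIntegrable _ _
  · have h1 : IntervalIntegrable (fun t : ℝ => t ^ a) volume 0 2 :=
      intervalIntegral.intervalIntegrable_rpow' ha
    have h2 : IntervalIntegrable (fun t : ℝ => (1 + t) ^ a) volume (-1) 1 := by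
      have := h1.comp_add_left 1
      norm_num at this
      exact this
    have h3 : IntervalIntegrable (fun t : ℝ => (1 - t) ^ a) volume (-1) 1 := by
      have := h1.comp_sub_left 1
      norm_num at this
      exact this.symm
    rw [intervalIntegrable_iff_integrableOn_Ioo_of_le (by norm_num)] at h2 h3 ⊢
    refine Integrable.mono' (h3.add h2) ?_ ?_
    · exact (Measurable.pow_const (by fun_prop) _).aestronglyMeasurable
    · refine (ae_restrict_iff' measurableSet_Ioo).2 (Filter.Eventually.of_forall fun t ht => ?_)
      have h4 : 0 ≤ 1 - t ^ 2 := by nlinarith [ht.1, ht.2]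
      rw [Real.norm_of_nonneg (Real.rpow_nonneg h4 _)]
      exact one_sub_sq_rpow_le h0 ht

/-- The measure on `[-1, 1]` with density `(1 - t²)^(γ - 1/2)`. -/
noncomputable def gegenbauerMeasure (γ : ℝ) : Measure ℝ :=
  (volume.restrict (Set.Ioc (-1 : ℝ) 1)).withDensity
    fun t => ENNReal.ofReal ((1 - t ^ 2) ^ (γ - 1 / 2))

theorem measurable_gegenbauerDensity (γ : ℝ) :
    Measurable fun t : ℝ => ENNReal.ofReal ((1 - t ^ 2) ^ (γ - 1 / 2)) :=
  (Measurable.pow_const (by fun_prop) _).ennreal_ofReal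

theorem one_sub_sq_nonneg_of_mem_Icc {t : ℝ} (ht : t ∈ Set.Icc (-1 : ℝ) 1) : 0 ≤ 1 - t ^ 2 := by
  nlinarith [ht.1, ht.2]

theorem ae_gegenbauerMeasure_mem (γ : ℝ) :
    ∀ᵐ t ∂(gegenbauerMeasure γ), t ∈ Set.Ioc (-1 : ℝ) 1 :=
  (withDensity_absolutelyContinuous _ _).ae_le (ae_restrict_mem measurableSet_Ioc)

theorem integral_gegenbauerMeasure (γ : ℝ) (g : ℝ → ℝ) :
    ∫ t, g t ∂(gegenbauerMeasure γ) = ∫ t in (-1 : ℝ)..1, g t * (1 - t ^ 2) ^ (γ - 1 / 2) := by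
  rw [gegenbauerMeasure, integral_withDensity_eq_integral_toReal_smul
    (measurable_gegenbauerDensity γ) (by simp), intervalIntegral.integral_of_le (by norm_num)]
  refine setIntegral_congr_fun measurableSet_Ioc fun t ht => ?_
  have := one_sub_sq_nonneg_of_mem_Icc (Set.Ioc_subset_Icc_self ht)
  simp only [smul_eq_mul, ENNReal.toReal_ofReal (Real.rpow_nonneg this _), mul_comm]

variable {γ : ℝ}

theorem isFiniteMeasure_gegenbauerMeasure (hγ : -(1 / 2) < γ) :
    IsFiniteMeasure (gegenbauerMeasure γ) := by
  refine isFiniteMeasure_withDensity_ofReal ?_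
  have := intervalIntegrable_one_sub_sq_rpow (a := γ - 1 / 2) (by linarith)
  rw [intervalIntegrable_iff_integrableOn_Ioc_of_le (by norm_num)] at this
  exact this.2

theorem integrable_polynomial (hγ : -(1 / 2) < γ) (p : ℝ[X]) :
    Integrable (fun t => p.eval t) (gegenbauerMeasure γ) := by
  have := isFiniteMeasure_gegenbauerMeasure hγ
  obtain ⟨c, hc⟩ := isCompact_Icc.exists_bound_of_continuousOn
    (p.continuous.continuousOn (s := Set.Icc (-1 : ℝ) 1))
  refine Integrable.of_bound p.continuous.aestronglyMeasurable c ?_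
  filter_upwards [ae_gegenbauerMeasure_mem γ] with t ht using hc t (Set.Ioc_subset_Icc_self ht)

/-- Integration of polynomials against the Gegenbauer weight. -/
noncomputable def weightIntegral (γ : ℝ) (p : ℝ[X]) : ℝ := ∫ t, p.eval t ∂(gegenbauerMeasure γ)

theorem weightIntegral_add (hγ : -(1 / 2) < γ) (p q : ℝ[X]) :
    weightIntegral γ (p + q) = weightIntegral γ p + weightIntegral γ q := by
  simp only [weightIntegral, eval_add]
  exact integral_add (integrable_polynomial hγ p) (integrable_polynomial hγ q)

theorem weightIntegral_C_mul (c : ℝ) (p : ℝ[X]) :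
    weightIntegral γ (C c * p) = c * weightIntegral γ p := by
  simp only [weightIntegral, eval_mul, eval_C]
  exact integral_const_mul _ _

theorem weightIntegral_sub (hγ : -(1 / 2) < γ) (p q : ℝ[X]) :
    weightIntegral γ (p - q) = weightIntegral γ p - weightIntegral γ q := by
  simp only [weightIntegral, eval_sub]
  exact integral_sub (integrable_polynomial hγ p) (integrable_polynomial hγ q)

/-- Against the weight, the integrand is the derivative of (1 - t²)^(γ + 1/2) r(t), which vanishes
at both ends. -/
theorem weightIntegral_parts (hγ : -(1 / 2) < γ) (r : ℝ[X]) :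
    weightIntegral γ ((1 - X ^ 2) * derivative r - C (2 * γ + 1) * X * r) = 0 := by
  rw [weightIntegral, integral_gegenbauerMeasure]
  have hint := integrable_polynomial hγ ((1 - X ^ 2) * derivative r - C (2 * γ + 1) * X * r)
  have hcont : ContinuousOn (fun t : ℝ => (1 - t ^ 2) ^ (γ + 1 / 2) * r.eval t)
      (Set.Icc (-1) 1) :=
    ((Continuous.rpow_const (by fun_prop) fun t => Or.inr (by linarith)).mul
      r.continuous).continuousOn
  rw [intervalIntegral.integral_eq_sub_of_hasDerivAt_of_le (by norm_num) hcont]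
  · norm_num [Real.zero_rpow (show γ + 1 / 2 ≠ 0 by linarith)]
  · intro t ht
    have hpos : 0 < 1 - t ^ 2 := by nlinarith [ht.1, ht.2]
    have h1 : HasDerivAt (fun t : ℝ => 1 - t ^ 2) (-(2 * t)) t := by
      simpa using ((hasDerivAt_pow 2 t).const_sub 1)
    have h2 := h1.rpow_const (p := γ + 1 / 2) (Or.inl hpos.ne')
    have h3 := h2.mul (r.hasDerivAt t)
    refine h3.congr_deriv ?_
    have h4 : (1 - t ^ 2) ^ (γ + 1 / 2) = (1 - t ^ 2) * (1 - t ^ 2) ^ (γ - 1 / 2) := by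
      rw [show γ + 1 / 2 = 1 + (γ - 1 / 2) by ring, Real.rpow_add hpos, Real.rpow_one]
    rw [h4, show γ + 1 / 2 - 1 = γ - 1 / 2 by ring]
    simp only [eval_mul, eval_sub, eval_one, eval_pow, eval_X, eval_C]
    ring
  · rw [gegenbauerMeasure, integrable_withDensity_iff_integrable_smul'
      (measurable_gegenbauerDensity γ) (by simp)] at hint
    rw [intervalIntegrable_iff_integrableOn_Ioc_of_le (by norm_num)]
    refine hint.congr ((ae_restrict_iff' measurableSet_Ioc).2
      (Filter.Eventually.of_forall fun t ht => ?_))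
    have := one_sub_sq_nonneg_of_mem_Icc (Set.Ioc_subset_Icc_self ht)
    simp only [smul_eq_mul, ENNReal.toReal_ofReal (Real.rpow_nonneg this _), mul_comm]

/-- Integration by parts with r = G_n' q, followed by the differential equation. -/
theorem weightIntegral_derivative_mul (hγ : -(1 / 2) < γ) (n : ℕ) (q : ℝ[X]) :
    weightIntegral γ ((1 - X ^ 2) * derivative (gegenbauerPoly γ n) * derivative q) =
      n * (n + 2 * γ) * weightIntegral γ (gegenbauerPoly γ n * q) := by
  have h1 := weightIntegral_parts hγ (derivative (gegenbauerPoly γ n) * q)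
  rw [derivative_mul] at h1
  have h2 : (1 - X ^ 2) * (derivative (derivative (gegenbauerPoly γ n)) * q +
      derivative (gegenbauerPoly γ n) * derivative q) -
        C (2 * γ + 1) * X * (derivative (gegenbauerPoly γ n) * q) =
      (1 - X ^ 2) * derivative (gegenbauerPoly γ n) * derivative q -
        C ((n : ℝ) * (n + 2 * γ)) * (gegenbauerPoly γ n * q) := by
    linear_combination q * gegenbauerPoly_ode γ n
  rw [h2, weightIntegral_sub hγ, weightIntegral_C_mul] at h1
  linarith

/-- The energy form is symmetric in m and n, while the eigenvalues differ by (m - n)(m + n + 2γ) ≠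
0. -/
theorem weightIntegral_gegenbauerPoly_mul (hγ : -(1 / 2) < γ) {m n : ℕ} (hmn : m ≠ n) :
    weightIntegral γ (gegenbauerPoly γ m * gegenbauerPoly γ n) = 0 := by
  have h1 := weightIntegral_derivative_mul hγ m (gegenbauerPoly γ n)
  have h2 := weightIntegral_derivative_mul hγ n (gegenbauerPoly γ m)
  rw [mul_right_comm, h1, mul_comm (gegenbauerPoly γ n)] at h2
  have h3 : ((m : ℝ) - n) * (m + n + 2 * γ) *
      weightIntegral γ (gegenbauerPoly γ m * gegenbauerPoly γ n) = 0 := by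
    linear_combination h2
  have h4 : ((m : ℝ) - n) ≠ 0 := sub_ne_zero.2 (by exact_mod_cast hmn)
  have h5 : (m + n + 2 * γ : ℝ) ≠ 0 := by
    have : (1 : ℝ) ≤ m + n := by
      have : 1 ≤ m + n := by omega
      exact_mod_cast this
    have : (0 : ℝ) < m + n + 2 * γ := by linarith
    exact this.ne'
  exact (mul_eq_zero.1 h3).resolve_left (mul_ne_zero h4 h5)

/-- The squared norm of the Gegenbauer polynomial in the weighted `L²` space. -/
noncomputable def gegenbauerNormSq (γ : ℝ) (n : ℕ) : ℝ :=
  weightIntegral γ (gegenbauerPoly γ n * gegenbauerPoly γ n)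

/-- The moment I of X G_(n+1) G_n is computed twice, from the recurrence tested against the lower
and against the upper neighbour. -/
theorem gegenbauerNormSq_succ (hγ : -(1 / 2) < γ) (n : ℕ) :
    (n + 1 : ℝ) * (n + 1 + γ) * gegenbauerNormSq γ (n + 1) =
      (n + γ) * (n + 2 * γ) * gegenbauerNormSq γ n := by
  set I := weightIntegral γ (X * gegenbauerPoly γ (n + 1) * gegenbauerPoly γ n) with hI
  have h1 : 2 * (n + 1 + γ) * I = (n + 2 * γ) * gegenbauerNormSq γ n := by
    have hr := congrArg (fun p => weightIntegral γ (p * gegenbauerPoly γ n))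
      (gegenbauerPoly_recurrence γ n)
    simp only [sub_mul, mul_assoc, weightIntegral_sub hγ, weightIntegral_C_mul] at hr
    rw [weightIntegral_gegenbauerPoly_mul hγ (by omega : n + 2 ≠ n)] at hr
    rw [hI, gegenbauerNormSq]
    simp only [mul_assoc]
    linarith
  have h2 : 2 * (n + γ) * I = (n + 1) * gegenbauerNormSq γ (n + 1) := by
    rcases n with _ | n
    · rw [hI, gegenbauerNormSq]
      have h3 : gegenbauerPoly γ (0 + 1) * gegenbauerPoly γ (0 + 1) =
          C (2 * γ) * (X * gegenbauerPoly γ (0 + 1) * gegenbauerPoly γ 0) := by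
        simp only [gegenbauerPoly]; ring
      rw [h3, weightIntegral_C_mul]
      simp
    · have hr := congrArg (fun p => weightIntegral γ (p * gegenbauerPoly γ (n + 2)))
        (gegenbauerPoly_recurrence γ n)
      simp only [sub_mul, mul_assoc, weightIntegral_sub hγ, weightIntegral_C_mul] at hr
      rw [weightIntegral_gegenbauerPoly_mul hγ (by omega : n ≠ n + 2)] at hr
      have h3 : I = weightIntegral γ (X * (gegenbauerPoly γ (n + 1) * gegenbauerPoly γ (n + 2))) := by
        rw [hI]; congr 1; ring
      rw [h3, gegenbauerNormSq]
      push_cast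
      linear_combination -hr
  linear_combination (n + γ) * h1 - (n + 1 + γ) * h2

theorem gegenbauerNormSq_pos (hγ : -(1 / 2) < γ) (hγ0 : γ ≠ 0) (n : ℕ) :
    0 < gegenbauerNormSq γ n := by
  have h0 : 0 < gegenbauerNormSq γ 0 := by
    rw [gegenbauerNormSq, weightIntegral, integral_gegenbauerMeasure]
    simp only [gegenbauerPoly, mul_one, eval_one, one_mul]
    refine intervalIntegral.intervalIntegral_pos_of_pos_on
      (intervalIntegrable_one_sub_sq_rpow (by linarith)) (fun t ht => ?_) (by norm_num)
    exact Real.rpow_pos_of_pos (by nlinarith [ht.1, ht.2]) _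
  induction n with
  | zero => exact h0
  | succ n ih =>
    have h1 := gegenbauerNormSq_succ hγ n
    have hn : (0 : ℝ) ≤ n := n.cast_nonneg
    have h2 : 0 < (n + γ) * (n + 2 * γ) := by
      rcases n with _ | n
      · have := mul_self_pos.2 hγ0
        simp only [Nat.cast_zero, zero_add]
        nlinarith
      · push_cast
        have : (0 : ℝ) ≤ n := n.cast_nonneg
        exact mul_pos (by linarith) (by linarith)
    have h3 : 0 < (n + 1 : ℝ) * (n + 1 + γ) := mul_pos (by linarith) (by linarith)
    have h4 : 0 < (n + 1 : ℝ) * (n + 1 + γ) * gegenbauerNormSq γ (n + 1) := by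
      rw [h1]; positivity
    exact pos_of_mul_pos_right h4 h3.le

end GegenbauerMeasure

end BallGraph

/-! ### Pointwise bounds for normalised Gegenbauer polynomials -/

namespace BallGraph

section GegenbauerBounds

open Polynomial

variable {γ : ℝ}

/-- By 1 + x ≤ exp x the logarithms telescope: 1/(n + 1) is at most log((n + 1)/n), which serves s ≥
0, and at least log((n + 2)/(n + 1)), which serves s < 0. -/
theorem exists_bound_of_ratio {s : ℝ} {E : ℕ → ℝ} (hE : ∀ n, 1 ≤ n → 0 ≤ E n)
    (hrec : ∀ n : ℕ, 1 ≤ n → E (n + 1) = E n * (1 + s / (n + 1))) :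
    ∃ K, ∀ n : ℕ, 1 ≤ n → E n ≤ K * ((n : ℝ) + 1) ^ s := by
  have hstep : ∀ n : ℕ, 1 ≤ n → E (n + 1) ≤ E n * Real.exp (s / (n + 1)) := by
    intro n hn
    rw [hrec n hn]
    refine mul_le_mul_of_nonneg_left ?_ (hE n hn)
    linarith [Real.add_one_le_exp (s / (n + 1))]
  rcases le_or_gt 0 s with hs | hs
  · refine ⟨E 1, fun n hn => ?_⟩
    have h1 : E n ≤ E 1 * (n : ℝ) ^ s := by
      induction n, hn using Nat.le_induction with
      | base => simp
      | succ n hn ih =>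
        have hn0 : (0 : ℝ) < n := by exact_mod_cast hn
        refine (hstep n hn).trans ((mul_le_mul_of_nonneg_right ih (Real.exp_pos _).le).trans ?_)
        rw [mul_assoc]
        refine mul_le_mul_of_nonneg_left ?_ (hE 1 le_rfl)
        rw [Real.rpow_def_of_pos hn0, ← Real.exp_add]
        push_cast
        rw [Real.rpow_def_of_pos (by positivity), Real.exp_le_exp]
        have h2 := Real.log_le_sub_one_of_pos (x := (n : ℝ) / (n + 1)) (by positivity)
        rw [Real.log_div hn0.ne' (by positivity)] at h2
        have h3 : (n : ℝ) / (n + 1) - 1 = -(1 / (n + 1)) := by field_simp; ring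
        have h4 : s / (n + 1) = s * (1 / (n + 1)) := by ring
        rw [h4]
        nlinarith
    refine h1.trans (mul_le_mul_of_nonneg_left ?_ (hE 1 le_rfl))
    exact Real.rpow_le_rpow (by positivity) (by linarith) hs
  · refine ⟨E 1 * (2 : ℝ) ^ (-s), fun n hn => ?_⟩
    induction n, hn using Nat.le_induction with
    | base =>
      norm_num
      rw [mul_assoc, ← Real.rpow_add (by norm_num)]
      simp
    | succ n hn ih =>
      have hn0 : (0 : ℝ) < n := by exact_mod_cast hn
      refine (hstep n hn).trans ((mul_le_mul_of_nonneg_right ih (Real.exp_pos _).le).trans ?_)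
      rw [mul_assoc]
      refine mul_le_mul_of_nonneg_left ?_ (mul_nonneg (hE 1 le_rfl) (by positivity))
      rw [Real.rpow_def_of_pos (by positivity), ← Real.exp_add]
      push_cast
      rw [Real.rpow_def_of_pos (by positivity), Real.exp_le_exp]
      have h2 := Real.log_le_sub_one_of_pos (x := ((n : ℝ) + 1 + 1) / (n + 1)) (by positivity)
      rw [Real.log_div (by positivity) (by positivity)] at h2
      have h3 : ((n : ℝ) + 1 + 1) / (n + 1) - 1 = 1 / (n + 1) := by field_simp; ring
      have h4 : s / (n + 1) = s * (1 / (n + 1)) := by ring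
      rw [h4]
      nlinarith

/-- The Gegenbauer polynomials, normalised in the weighted `L²` space. -/
noncomputable def orthoGegenbauer (γ : ℝ) (n : ℕ) : ℝ[X] :=
  C (Real.sqrt (gegenbauerNormSq γ n))⁻¹ * gegenbauerPoly γ n

theorem weightIntegral_orthoGegenbauer (hγ : -(1 / 2) < γ) (hγ0 : γ ≠ 0) (m n : ℕ) :
    weightIntegral γ (orthoGegenbauer γ m * orthoGegenbauer γ n) = if m = n then 1 else 0 := by
  have h1 : orthoGegenbauer γ m * orthoGegenbauer γ n =
      C ((Real.sqrt (gegenbauerNormSq γ m))⁻¹ * (Real.sqrt (gegenbauerNormSq γ n))⁻¹) *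
        (gegenbauerPoly γ m * gegenbauerPoly γ n) := by
    rw [orthoGegenbauer, orthoGegenbauer, C_mul]; ring
  rw [h1, weightIntegral_C_mul]
  split_ifs with h
  · subst h
    have h2 := gegenbauerNormSq_pos hγ hγ0 m
    rw [← mul_inv, Real.mul_self_sqrt h2.le]
    exact inv_mul_cancel₀ h2.ne'
  · rw [weightIntegral_gegenbauerPoly_mul hγ h, mul_zero]

theorem eval_orthoGegenbauer_sq (hγ : -(1 / 2) < γ) (hγ0 : γ ≠ 0) (n : ℕ) (t : ℝ) :
    (orthoGegenbauer γ n).eval t ^ 2 = (gegenbauerPoly γ n).eval t ^ 2 / gegenbauerNormSq γ n := by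
  rw [orthoGegenbauer, eval_mul, eval_C, mul_pow, inv_pow,
    Real.sq_sqrt (gegenbauerNormSq_pos hγ hγ0 n).le, div_eq_inv_mul]

theorem exists_eval_one_orthoGegenbauer_le (hγ : -(1 / 2) < γ) (hγ0 : γ ≠ 0) :
    ∃ K, 0 < K ∧ ∀ n : ℕ, (orthoGegenbauer γ n).eval 1 ^ 2 ≤ K * ((n : ℝ) + 1) ^ (2 * γ) := by
  set D : ℕ → ℝ := fun n => (orthoGegenbauer γ n).eval 1 ^ 2 with hD
  have hrec : ∀ n : ℕ, 1 ≤ n → D (n + 1) * ((n + 1) * (n + γ)) =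
      D n * ((n + 2 * γ) * (n + 1 + γ)) := by
    intro n hn
    have hn1 : (1 : ℝ) ≤ n := by exact_mod_cast hn
    simp only [hD, eval_orthoGegenbauer_sq hγ hγ0]
    have h1 := gegenbauer_succ_one γ n
    have h2 := gegenbauerNormSq_succ hγ n
    have h3 := gegenbauerNormSq_pos hγ hγ0 n
    have h4 := gegenbauerNormSq_pos hγ hγ0 (n + 1)
    have h5 : (n + 1 : ℝ) ≠ 0 := by linarith
    have h6 : (n + 2 * γ : ℝ) ≠ 0 := by
      have : 0 < (n + 2 * γ : ℝ) := by linarith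
      exact this.ne'
    rw [div_mul_eq_mul_div, div_mul_eq_mul_div, div_eq_div_iff h4.ne' h3.ne']
    apply mul_left_cancel₀ (mul_ne_zero h5 h6)
    have h7 : ((n + 1 : ℝ) * (gegenbauerPoly γ (n + 1)).eval 1) ^ 2 =
      ((n + 2 * γ) * (gegenbauerPoly γ n).eval 1) ^ 2 := by rw [h1]
    linear_combination (n + γ) * (n + 2 * γ) * gegenbauerNormSq γ n * h7 -
      (n + 2 * γ) ^ 2 * (gegenbauerPoly γ n).eval 1 ^ 2 * h2
  -- Dividing by n + γ simplifies the ratio of consecutive terms to (n + 2γ)/(n + 1) = 1 + (2γ -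
  -- 1)/(n + 1).
  obtain ⟨K, hK⟩ := exists_bound_of_ratio (s := 2 * γ - 1) (E := fun n => D n / (n + γ))
    (fun n hn => by
      have : (1 : ℝ) ≤ n := by exact_mod_cast hn
      exact div_nonneg (sq_nonneg _) (by linarith))
    (fun n hn => by
      have h1 : (1 : ℝ) ≤ n := by exact_mod_cast hn
      have h2 : (n + γ : ℝ) ≠ 0 := by
        have : 0 < (n + γ : ℝ) := by linarith
        exact this.ne'
      have h3 : (n + 1 + γ : ℝ) ≠ 0 := by
        have : 0 < (n + 1 + γ : ℝ) := by linarith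
        exact this.ne'
      have h4 : (n + 1 : ℝ) ≠ 0 := by linarith
      have h5 := hrec n hn
      push_cast
      rw [one_add_div h4, div_mul_div_comm, div_eq_div_iff h3 (mul_ne_zero h2 h4)]
      linear_combination h5)
  refine ⟨|K| * (1 + |γ|) + D 0 + 1, by positivity, fun n => ?_⟩
  have hp : 0 < ((n : ℝ) + 1) ^ (2 * γ) := by positivity
  rcases Nat.eq_zero_or_pos n with rfl | hn
  · simp only [Nat.cast_zero, zero_add, Real.one_rpow, mul_one]
    have : 0 ≤ |K| * (1 + |γ|) := by positivity
    change D 0 ≤ _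
    linarith
  · have h1 : (1 : ℝ) ≤ n := by exact_mod_cast hn
    have h2 : 0 < (n + γ : ℝ) := by linarith
    have h3 := hK n hn
    rw [div_le_iff₀ h2] at h3
    change D n ≤ _
    have h4 : ((n : ℝ) + 1) ^ (2 * γ) = ((n : ℝ) + 1) ^ (2 * γ - 1) * (n + 1) := by
      rw [← Real.rpow_add_one (by positivity)]; congr 1; ring
    have hD0 : 0 ≤ D 0 := sq_nonneg _
    calc D n ≤ K * ((n : ℝ) + 1) ^ (2 * γ - 1) * (n + γ) := h3
      _ ≤ |K| * ((n : ℝ) + 1) ^ (2 * γ - 1) * ((1 + |γ|) * (n + 1)) := by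
          refine mul_le_mul ?_ ?_ h2.le (by positivity)
          · exact mul_le_mul_of_nonneg_right (le_abs_self K) (by positivity)
          · nlinarith [le_abs_self γ, abs_nonneg γ]
      _ = |K| * (1 + |γ|) * ((n : ℝ) + 1) ^ (2 * γ) := by rw [h4]; ring
      _ ≤ _ := by
          refine mul_le_mul_of_nonneg_right ?_ hp.le
          linarith

/-- Sonin's function of the normalised Gegenbauer polynomial. -/
noncomputable def soninPoly (γ : ℝ) (n : ℕ) : ℝ[X] :=
  orthoGegenbauer γ n ^ 2 + C ((n : ℝ) * (n + 2 * γ))⁻¹ *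
    ((1 - X ^ 2) * derivative (orthoGegenbauer γ n) ^ 2)

/-- The differential equation cancels the mixed terms, and the sign of the derivative is that of γ t
wherever it is nonzero. Both uniform bounds follow from this monotonicity. -/
theorem derivative_soninPoly (hγ : -(1 / 2) < γ) {n : ℕ} (hn : 1 ≤ n) :
    derivative (soninPoly γ n) = C (4 * γ * ((n : ℝ) * (n + 2 * γ))⁻¹) * X *
      derivative (orthoGegenbauer γ n) ^ 2 := by
  have hode : (1 - X ^ 2) * derivative (derivative (orthoGegenbauer γ n)) -
      C (2 * γ + 1) * X * derivative (orthoGegenbauer γ n) +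
        C ((n : ℝ) * (n + 2 * γ)) * orthoGegenbauer γ n = 0 := by
    simp only [orthoGegenbauer, derivative_C_mul]
    linear_combination C (Real.sqrt (gegenbauerNormSq γ n))⁻¹ * gegenbauerPoly_ode γ n
  have hn1 : (1 : ℝ) ≤ n := by exact_mod_cast hn
  have hΛ : (n : ℝ) * (n + 2 * γ) ≠ 0 := by
    have : 0 < (n : ℝ) * (n + 2 * γ) := mul_pos (by linarith) (by linarith)
    exact this.ne'
  have hC : C ((n : ℝ) * (n + 2 * γ)) * C ((n : ℝ) * (n + 2 * γ))⁻¹ = (1 : ℝ[X]) := by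
    rw [← C_mul, mul_inv_cancel₀ hΛ, C_1]
  rw [soninPoly]
  simp only [derivative_add, derivative_mul, derivative_pow, derivative_C, derivative_sub,
    derivative_one, derivative_X, zero_mul, zero_add, Nat.cast_ofNat, mul_one, zero_sub,
    Nat.add_one_sub_one, pow_one]
  simp only [map_mul, map_add, map_ofNat, map_one] at hC hode ⊢
  linear_combination 2 * C ((n : ℝ) * (n + 2 * γ))⁻¹ * derivative (orthoGegenbauer γ n) * hode -
    2 * orthoGegenbauer γ n * derivative (orthoGegenbauer γ n) * hC

theorem sq_le_soninPoly (hγ : -(1 / 2) < γ) {n : ℕ} (hn : 1 ≤ n) {t : ℝ}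
    (ht : t ∈ Set.Icc (-1 : ℝ) 1) :
    (orthoGegenbauer γ n).eval t ^ 2 ≤ (soninPoly γ n).eval t := by
  have hn1 : (1 : ℝ) ≤ n := by exact_mod_cast hn
  have hΛ : 0 < (n : ℝ) * (n + 2 * γ) := mul_pos (by linarith) (by linarith)
  have := one_sub_sq_nonneg_of_mem_Icc ht
  simp only [soninPoly, eval_add, eval_pow, eval_mul, eval_C, eval_sub, eval_one, eval_X]
  have : 0 ≤ ((n : ℝ) * (n + 2 * γ))⁻¹ *
    ((1 - t ^ 2) * eval t (derivative (orthoGegenbauer γ n)) ^ 2) := by positivity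
  linarith

/-- For γ > 0 Sonin's function is largest at ±1, where its derivative term vanishes. -/
theorem sq_eval_orthoGegenbauer_le_eval_one (hγ : 0 < γ) (n : ℕ) {t : ℝ}
    (ht : t ∈ Set.Icc (-1 : ℝ) 1) :
    (orthoGegenbauer γ n).eval t ^ 2 ≤ (orthoGegenbauer γ n).eval 1 ^ 2 := by
  have hγ' : -(1 / 2) < γ := by linarith
  rcases Nat.eq_zero_or_pos n with rfl | hn
  · simp [orthoGegenbauer, gegenbauerPoly]
  have hn1 : (1 : ℝ) ≤ n := by exact_mod_cast hn
  have hΛ : 0 < (n : ℝ) * (n + 2 * γ) := mul_pos (by linarith) (by linarith)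
  have hd : ∀ t, deriv (fun t => (soninPoly γ n).eval t) t = 4 * γ * ((n : ℝ) * (n + 2 * γ))⁻¹ *
      t * (derivative (orthoGegenbauer γ n)).eval t ^ 2 := by
    intro t
    rw [Polynomial.deriv, derivative_soninPoly hγ' hn]
    simp
  refine (sq_le_soninPoly hγ' hn ht).trans ?_
  have hend : ∀ s : ℝ, s ^ 2 = 1 → (soninPoly γ n).eval s = (orthoGegenbauer γ n).eval s ^ 2 := by
    intro s hs
    simp [soninPoly, hs]
  rcases le_total 0 t with h | h
  · have hm : MonotoneOn (fun t => (soninPoly γ n).eval t) (Set.Icc 0 1) := by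
      refine monotoneOn_of_deriv_nonneg (convex_Icc 0 1) (soninPoly γ n).continuousOn
        (soninPoly γ n).differentiable.differentiableOn fun s hs => ?_
      rw [interior_Icc] at hs
      rw [hd]
      have := hs.1
      positivity
    rw [← hend 1 (by norm_num)]
    exact hm ⟨h, ht.2⟩ ⟨by norm_num, le_rfl⟩ ht.2
  · have hm : AntitoneOn (fun t => (soninPoly γ n).eval t) (Set.Icc (-1) 0) := by
      refine antitoneOn_of_deriv_nonpos (convex_Icc (-1) 0) (soninPoly γ n).continuousOn
        (soninPoly γ n).differentiable.differentiableOn fun s hs => ?_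
      rw [interior_Icc] at hs
      rw [hd]
      have h1 : 0 ≤ 4 * γ * ((n : ℝ) * (n + 2 * γ))⁻¹ *
        (derivative (orthoGegenbauer γ n)).eval s ^ 2 := by positivity
      nlinarith [hs.2]
    have h1 : (orthoGegenbauer γ n).eval 1 ^ 2 = (orthoGegenbauer γ n).eval (-1) ^ 2 := by
      rw [orthoGegenbauer, eval_mul, eval_mul, gegenbauerPoly_eval_neg, eval_C, eval_C, mul_pow,
        mul_pow, mul_pow, ← pow_mul, mul_comm n 2, pow_mul]
      simp
    rw [h1, ← hend (-1) (by norm_num)]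
    exact hm ⟨le_rfl, by norm_num⟩ ⟨ht.1, h⟩ ht.1

/-- Each of the two terms of Sonin's function has integral 1, the second by Green's formula. -/
theorem weightIntegral_soninPoly (hγ : -(1 / 2) < γ) (hγ0 : γ ≠ 0) {n : ℕ} (hn : 1 ≤ n) :
    weightIntegral γ (soninPoly γ n) = 2 := by
  have hn1 : (1 : ℝ) ≤ n := by exact_mod_cast hn
  have hΛ : 0 < (n : ℝ) * (n + 2 * γ) := mul_pos (by linarith) (by linarith)
  have h1 := weightIntegral_orthoGegenbauer hγ hγ0 n n
  have h2 : weightIntegral γ ((1 - X ^ 2) * derivative (orthoGegenbauer γ n) ^ 2) =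
      n * (n + 2 * γ) := by
    have h3 := weightIntegral_derivative_mul hγ n (orthoGegenbauer γ n)
    set c := (Real.sqrt (gegenbauerNormSq γ n))⁻¹ with hc
    have h4 : (1 - X ^ 2) * derivative (orthoGegenbauer γ n) ^ 2 =
        C c * ((1 - X ^ 2) * derivative (gegenbauerPoly γ n) *
          derivative (orthoGegenbauer γ n)) := by
      have : derivative (orthoGegenbauer γ n) = C c * derivative (gegenbauerPoly γ n) := by
        rw [orthoGegenbauer, derivative_C_mul]
      rw [sq, this]; ring
    have h5 : orthoGegenbauer γ n * orthoGegenbauer γ n =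
        C c * (gegenbauerPoly γ n * orthoGegenbauer γ n) := by
      conv_lhs => rw [orthoGegenbauer]
      rw [orthoGegenbauer]; ring
    rw [h4, weightIntegral_C_mul, h3]
    rw [h5, weightIntegral_C_mul, if_pos rfl] at h1
    linear_combination n * (n + 2 * γ) * h1
  rw [soninPoly, weightIntegral_add hγ, weightIntegral_C_mul, h2, sq, h1, if_pos rfl,
    inv_mul_cancel₀ hΛ.ne']
  norm_num

/-- For γ < 0 Sonin's function S is largest at 0. Its integral is 2 and S(t) ≥ (1 - t²) S(0), so
S(0) is bounded independently of n. -/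
theorem exists_sq_eval_orthoGegenbauer_le_of_neg (hγ : -(1 / 2) < γ) (hγ0 : γ < 0) :
    ∃ K, 0 < K ∧ ∀ (n : ℕ), ∀ t ∈ Set.Icc (-1 : ℝ) 1, (orthoGegenbauer γ n).eval t ^ 2 ≤ K := by
  set I := weightIntegral γ (1 - X ^ 2) with hI
  have hIpos : 0 < I := by
    rw [hI, weightIntegral, integral_gegenbauerMeasure]
    have h1 : ∀ t ∈ Set.uIcc (-1 : ℝ) 1, (1 - X ^ 2 : ℝ[X]).eval t * (1 - t ^ 2) ^ (γ - 1 / 2) =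
        (1 - t ^ 2) ^ (γ + 1 / 2) := by
      intro t ht
      rw [Set.uIcc_of_le (by norm_num)] at ht
      have h2 := one_sub_sq_nonneg_of_mem_Icc ht
      rw [show γ + 1 / 2 = 1 + (γ - 1 / 2) by ring, Real.rpow_add' h2 (by linarith), Real.rpow_one]
      simp
    rw [intervalIntegral.integral_congr h1]
    refine intervalIntegral.intervalIntegral_pos_of_pos_on
      (intervalIntegrable_one_sub_sq_rpow (by linarith)) (fun t ht => ?_) (by norm_num)
    exact Real.rpow_pos_of_pos (by nlinarith [ht.1, ht.2]) _
  refine ⟨2 / I + (gegenbauerNormSq γ 0)⁻¹, ?_, fun n t ht => ?_⟩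
  · have := gegenbauerNormSq_pos hγ hγ0.ne 0
    positivity
  have hh := gegenbauerNormSq_pos hγ hγ0.ne 0
  rcases Nat.eq_zero_or_pos n with rfl | hn
  · rw [eval_orthoGegenbauer_sq hγ hγ0.ne]
    simp only [gegenbauerPoly, eval_one, one_pow, one_div]
    have : 0 < 2 / I := by positivity
    linarith
  have hn1 : (1 : ℝ) ≤ n := by exact_mod_cast hn
  have hΛ : 0 < (n : ℝ) * (n + 2 * γ) := mul_pos (by linarith) (by linarith)
  set S := fun t => (soninPoly γ n).eval t with hS
  have hSd : ∀ t, HasDerivAt S (4 * γ * ((n : ℝ) * (n + 2 * γ))⁻¹ *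
      t * (derivative (orthoGegenbauer γ n)).eval t ^ 2) t := by
    intro t
    have := (soninPoly γ n).hasDerivAt t
    rw [derivative_soninPoly hγ hn] at this
    simpa using this
  have hSval : ∀ t, S t = (orthoGegenbauer γ n).eval t ^ 2 + ((n : ℝ) * (n + 2 * γ))⁻¹ *
      ((1 - t ^ 2) * (derivative (orthoGegenbauer γ n)).eval t ^ 2) := by
    intro t
    simp [hS, soninPoly]
  have hup : ∀ t ∈ Set.Icc (-1 : ℝ) 1, S t ≤ S 0 := by
    intro t ht
    rcases le_total 0 t with h | h
    · have hm : AntitoneOn S (Set.Icc 0 1) := by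
        refine antitoneOn_of_deriv_nonpos (convex_Icc 0 1) (soninPoly γ n).continuousOn
          (soninPoly γ n).differentiable.differentiableOn fun s hs => ?_
        rw [interior_Icc] at hs
        rw [(hSd s).deriv]
        have h1 : 0 ≤ -γ * (((n : ℝ) * (n + 2 * γ))⁻¹ *
          (derivative (orthoGegenbauer γ n)).eval s ^ 2) :=
          mul_nonneg (by linarith) (by positivity)
        nlinarith [hs.1]
      exact hm ⟨le_rfl, by norm_num⟩ ⟨h, ht.2⟩ h
    · have hm : MonotoneOn S (Set.Icc (-1) 0) := by
        refine monotoneOn_of_deriv_nonneg (convex_Icc (-1) 0) (soninPoly γ n).continuousOn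
          (soninPoly γ n).differentiable.differentiableOn fun s hs => ?_
        rw [interior_Icc] at hs
        rw [(hSd s).deriv]
        have h1 : 0 ≤ -γ * (((n : ℝ) * (n + 2 * γ))⁻¹ *
          (derivative (orthoGegenbauer γ n)).eval s ^ 2) :=
          mul_nonneg (by linarith) (by positivity)
        nlinarith [hs.2]
      exact hm ⟨ht.1, h⟩ ⟨by norm_num, le_rfl⟩ h
  have hquot : ∀ s ∈ Set.Ioo (-1 : ℝ) 1, HasDerivAt (fun t => S t / (1 - t ^ 2))
      ((4 * γ * ((n : ℝ) * (n + 2 * γ))⁻¹ * s * (derivative (orthoGegenbauer γ n)).eval s ^ 2 *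
        (1 - s ^ 2) - S s * (-(2 * s))) / (1 - s ^ 2) ^ 2) s := by
    intro s hs
    have hpos : 0 < 1 - s ^ 2 := by nlinarith [hs.1, hs.2]
    have h1 : HasDerivAt (fun t : ℝ => 1 - t ^ 2) (-(2 * s)) s := by
      simpa using ((hasDerivAt_pow 2 s).const_sub 1)
    exact (hSd s).div h1 hpos.ne'
  -- The numerator involves 4γv + 2S, where v is the derivative term of S. This equals 2p² + (2 +
  -- 4γ)v with p the normalised polynomial, which is nonnegative as γ > -1/2; so S/(1 - t²) grows
  -- away from 0.
  have hnum : ∀ s ∈ Set.Ioo (-1 : ℝ) 1, ∃ a, 0 ≤ a ∧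
      (4 * γ * ((n : ℝ) * (n + 2 * γ))⁻¹ * s * (derivative (orthoGegenbauer γ n)).eval s ^ 2 *
        (1 - s ^ 2) - S s * (-(2 * s))) / (1 - s ^ 2) ^ 2 = s * a := by
    intro s hs
    have hpos : 0 < 1 - s ^ 2 := by nlinarith [hs.1, hs.2]
    set v := ((n : ℝ) * (n + 2 * γ))⁻¹ *
      ((1 - s ^ 2) * (derivative (orthoGegenbauer γ n)).eval s ^ 2) with hv
    have hv0 : 0 ≤ v := by positivity
    refine ⟨(4 * γ * v + 2 * S s) / (1 - s ^ 2) ^ 2, ?_, ?_⟩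
    · refine div_nonneg ?_ (by positivity)
      rw [hSval s, ← hv]
      nlinarith [sq_nonneg ((orthoGegenbauer γ n).eval s)]
    · rw [hv]; ring
  have hlow : ∀ t ∈ Set.Ioo (-1 : ℝ) 1, (1 - t ^ 2) * S 0 ≤ S t := by
    intro t ht
    have hpos : 0 < 1 - t ^ 2 := by nlinarith [ht.1, ht.2]
    have h0 : S 0 / (1 - 0 ^ 2) ≤ S t / (1 - t ^ 2) := by
      rcases le_total 0 t with h | h
      · have hm : MonotoneOn (fun t => S t / (1 - t ^ 2)) (Set.Ico 0 1) := by
          have hsub : Set.Ico (0 : ℝ) 1 ⊆ Set.Ioo (-1) 1 := fun s hs => ⟨by linarith [hs.1], hs.2⟩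
          refine monotoneOn_of_deriv_nonneg (convex_Ico 0 1)
            (fun s hs => (hquot s (hsub hs)).continuousAt.continuousWithinAt)
            (fun s hs => (hquot s (hsub (interior_subset hs))).differentiableAt.differentiableWithinAt)
            fun s hs => ?_
          have hs' := interior_subset hs
          obtain ⟨a, ha, hae⟩ := hnum s (hsub hs')
          rw [(hquot s (hsub hs')).deriv, hae]
          exact mul_nonneg hs'.1 ha
        exact hm ⟨le_rfl, by norm_num⟩ ⟨h, ht.2⟩ h
      · have hm : AntitoneOn (fun t => S t / (1 - t ^ 2)) (Set.Ioc (-1) 0) := by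
          have hsub : Set.Ioc (-1 : ℝ) 0 ⊆ Set.Ioo (-1) 1 := fun s hs => ⟨hs.1, by linarith [hs.2]⟩
          refine antitoneOn_of_deriv_nonpos (convex_Ioc (-1) 0)
            (fun s hs => (hquot s (hsub hs)).continuousAt.continuousWithinAt)
            (fun s hs => (hquot s (hsub (interior_subset hs))).differentiableAt.differentiableWithinAt)
            fun s hs => ?_
          have hs' := interior_subset hs
          obtain ⟨a, ha, hae⟩ := hnum s (hsub hs')
          rw [(hquot s (hsub hs')).deriv, hae]
          exact mul_nonpos_of_nonpos_of_nonneg hs'.2 ha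
        exact hm ⟨ht.1, h⟩ ⟨by norm_num, le_rfl⟩ h
    rw [le_div_iff₀ hpos] at h0
    norm_num at h0
    linarith
  have hlow' : ∀ t ∈ Set.Ioc (-1 : ℝ) 1, (1 - t ^ 2) * S 0 ≤ S t := by
    intro t ht
    rcases ht.2.eq_or_lt with rfl | h
    · norm_num
      exact (sq_nonneg _).trans (sq_le_soninPoly hγ hn ⟨by norm_num, le_rfl⟩)
    · exact hlow t ⟨ht.1, h⟩
  have hint : I * S 0 ≤ 2 := by
    rw [← weightIntegral_soninPoly hγ hγ0.ne hn, hI, weightIntegral, weightIntegral,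
      ← integral_mul_const]
    refine integral_mono_ae ((integrable_polynomial hγ _).mul_const _)
      (integrable_polynomial hγ _) ?_
    filter_upwards [ae_gegenbauerMeasure_mem γ] with t ht
    simpa using hlow' t ht
  have h1 : S 0 ≤ 2 / I := by
    rw [le_div_iff₀ hIpos]; linarith
  have h2 := (sq_le_soninPoly hγ hn ht).trans (hup t ht)
  have : 0 < (gegenbauerNormSq γ 0)⁻¹ := by positivity
  linarith

theorem exists_sq_eval_orthoGegenbauer_le (hγ : -(1 / 2) < γ) (hγ0 : γ ≠ 0) :
    ∃ K, 0 < K ∧ ∀ (n : ℕ), ∀ t ∈ Set.Icc (-1 : ℝ) 1,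
      (orthoGegenbauer γ n).eval t ^ 2 ≤ K * ((n : ℝ) + 1) ^ (2 * max γ 0) := by
  rcases hγ0.lt_or_gt with h | h
  · obtain ⟨K, hK, h1⟩ := exists_sq_eval_orthoGegenbauer_le_of_neg hγ h
    refine ⟨K, hK, fun n t ht => ?_⟩
    rw [max_eq_right h.le, mul_zero, Real.rpow_zero, mul_one]
    exact h1 n t ht
  · obtain ⟨K, hK, h1⟩ := exists_eval_one_orthoGegenbauer_le hγ hγ0
    refine ⟨K, hK, fun n t ht => ?_⟩
    rw [max_eq_left h.le]
    exact (sq_eval_orthoGegenbauer_le_eval_one h n ht).trans (h1 n)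

end GegenbauerBounds

end BallGraph

/-! ### Christoffel functions on the interval -/

namespace BallGraph

section Christoffel

open Polynomial

variable {γ : ℝ}

/-- The linear combination of normalised Gegenbauer polynomials with coefficients `b`, up to
degree `M`. -/
noncomputable def gegenbauerSum (γ : ℝ) (b : ℕ → ℝ) (M : ℕ) : ℝ[X] :=
  ∑ m ∈ Finset.range (M + 1), C (b m) * orthoGegenbauer γ m

theorem eval_gegenbauerSum (b : ℕ → ℝ) (M : ℕ) (t : ℝ) :
    (gegenbauerSum γ b M).eval t =
      ∑ m ∈ Finset.range (M + 1), b m * (orthoGegenbauer γ m).eval t := by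
  simp [gegenbauerSum, eval_finsetSum]

theorem natDegree_gegenbauerPoly_le (γ : ℝ) (n : ℕ) : (gegenbauerPoly γ n).natDegree ≤ n := by
  induction n using Nat.twoStepInduction with
  | zero => simp [gegenbauerPoly]
  | one => exact (natDegree_C_mul_le _ _).trans natDegree_X_le
  | more n ih1 ih2 =>
    rw [gegenbauerPoly]
    refine (natDegree_C_mul_le _ _).trans ((natDegree_sub_le _ _).trans (max_le ?_ ?_))
    · rw [mul_assoc]
      refine (natDegree_C_mul_le _ _).trans (natDegree_mul_le.trans ?_)
      have := natDegree_X_le (R := ℝ)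
      omega
    · exact (natDegree_C_mul_le _ _).trans (by omega)

theorem natDegree_gegenbauerSum_le (b : ℕ → ℝ) (M : ℕ) : (gegenbauerSum γ b M).natDegree ≤ M := by
  refine natDegree_sum_le_of_forall_le _ _ fun m hm => ?_
  refine (natDegree_C_mul_le _ _).trans ((natDegree_C_mul_le _ _).trans ?_)
  exact (natDegree_gegenbauerPoly_le γ m).trans (Nat.lt_succ_iff.1 (Finset.mem_range.1 hm))

theorem exists_gegenbauerSum_eq (hγ : -(1 / 2) < γ) (hγ0 : γ ≠ 0) {m : ℕ} {p : ℝ[X]}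
    (hp : p.natDegree ≤ m) : ∃ c : ℕ → ℝ, p = gegenbauerSum γ c m := by
  have h := mem_span_gegenbauerPoly hγ hγ0 hp
  clear hp
  induction h using Submodule.span_induction with
  | mem x hx =>
    obtain ⟨j, hj, rfl⟩ := hx
    refine ⟨Pi.single j (Real.sqrt (gegenbauerNormSq γ j)), ?_⟩
    rw [gegenbauerSum, Finset.sum_eq_single_of_mem j (by simpa [Nat.lt_succ_iff] using hj)]
    · rw [Pi.single_eq_same, orthoGegenbauer, ← mul_assoc, ← C_mul, mul_inv_cancel₀, C_1, one_mul]
      exact (Real.sqrt_pos.2 (gegenbauerNormSq_pos hγ hγ0 j)).ne'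
    · intro k _ hk
      rw [Pi.single_eq_of_ne hk, C_0, zero_mul]
  | zero => exact ⟨0, by simp [gegenbauerSum]⟩
  | add x y _ _ hx hy =>
    obtain ⟨c, rfl⟩ := hx
    obtain ⟨c', rfl⟩ := hy
    exact ⟨c + c', by simp [gegenbauerSum, add_mul, Finset.sum_add_distrib]⟩
  | smul a x _ hx =>
    obtain ⟨c, rfl⟩ := hx
    exact ⟨a • c, by simp [gegenbauerSum, Finset.mul_sum, smul_eq_C_mul, mul_assoc]⟩

theorem weightIntegral_finset_sum (hγ : -(1 / 2) < γ) {ι : Type*} (s : Finset ι) (p : ι → ℝ[X]) :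
    weightIntegral γ (∑ i ∈ s, p i) = ∑ i ∈ s, weightIntegral γ (p i) := by
  simp only [weightIntegral, eval_finsetSum]
  exact integral_finsetSum _ fun i _ => integrable_polynomial hγ (p i)

theorem weightIntegral_finset_sum_sq (hγ : -(1 / 2) < γ) (hγ0 : γ ≠ 0) (s : Finset ℕ)
    (b : ℕ → ℝ) :
    weightIntegral γ ((∑ m ∈ s, C (b m) * orthoGegenbauer γ m) ^ 2) = ∑ m ∈ s, b m ^ 2 := by
  rw [sq, Finset.sum_mul_sum, weightIntegral_finset_sum hγ]
  refine Finset.sum_congr rfl fun m hm => ?_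
  rw [weightIntegral_finset_sum hγ]
  have h1 : ∀ j, weightIntegral γ (C (b m) * orthoGegenbauer γ m * (C (b j) * orthoGegenbauer γ j)) =
      if m = j then b m ^ 2 else 0 := by
    intro j
    have : C (b m) * orthoGegenbauer γ m * (C (b j) * orthoGegenbauer γ j) =
        C (b m * b j) * (orthoGegenbauer γ m * orthoGegenbauer γ j) := by rw [C_mul]; ring
    rw [this, weightIntegral_C_mul, weightIntegral_orthoGegenbauer hγ hγ0]
    split_ifs with h
    · subst h; ring
    · ring
  simp only [h1, Finset.sum_ite_eq, hm, if_true]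

/-- The Christoffel function bound. -/
theorem sq_eval_le_christoffel (hγ : -(1 / 2) < γ) (hγ0 : γ ≠ 0) {m : ℕ} {p : ℝ[X]}
    (hp : p.natDegree ≤ m) (t : ℝ) :
    p.eval t ^ 2 ≤ (∑ j ∈ Finset.range (m + 1), (orthoGegenbauer γ j).eval t ^ 2) *
      ∫ s, p.eval s ^ 2 ∂(gegenbauerMeasure γ) := by
  obtain ⟨c, rfl⟩ := exists_gegenbauerSum_eq hγ hγ0 hp
  have h1 := weightIntegral_finset_sum_sq hγ hγ0 (Finset.range (m + 1)) c
  rw [weightIntegral] at h1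
  simp only [eval_pow] at h1
  rw [show (∫ s, (gegenbauerSum γ c m).eval s ^ 2 ∂(gegenbauerMeasure γ)) =
    ∑ j ∈ Finset.range (m + 1), c j ^ 2 from h1, eval_gegenbauerSum, mul_comm]
  exact Finset.sum_mul_sq_le_sq_mul_sq _ _ _

theorem sum_range_rpow_le {a : ℝ} (ha : 0 ≤ a) (m : ℕ) :
    ∑ j ∈ Finset.range (m + 1), ((j : ℝ) + 1) ^ a ≤ ((m : ℝ) + 1) ^ (a + 1) := by
  calc ∑ j ∈ Finset.range (m + 1), ((j : ℝ) + 1) ^ a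
      ≤ ∑ _j ∈ Finset.range (m + 1), ((m : ℝ) + 1) ^ a := by
        refine Finset.sum_le_sum fun j hj => Real.rpow_le_rpow (by positivity) ?_ ha
        have : j ≤ m := Nat.lt_succ_iff.1 (Finset.mem_range.1 hj)
        have : (j : ℝ) ≤ m := by exact_mod_cast this
        linarith
    _ = ((m : ℝ) + 1) ^ (a + 1) := by
        rw [Finset.sum_const, Finset.card_range, nsmul_eq_mul, Real.rpow_add_one (by positivity)]
        push_cast
        ring

/-- The uniform bounds of all degrees up to m are added, which raises the exponent by one. -/
theorem exists_christoffel_le (hγ : -(1 / 2) < γ) (hγ0 : γ ≠ 0) :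
    ∃ K, 0 < K ∧ ∀ (m : ℕ) (p : ℝ[X]), p.natDegree ≤ m → ∀ t ∈ Set.Icc (-1 : ℝ) 1,
      p.eval t ^ 2 ≤ K * ((m : ℝ) + 1) ^ (2 * max γ 0 + 1) *
        ∫ s, p.eval s ^ 2 ∂(gegenbauerMeasure γ) := by
  obtain ⟨K, hK, h⟩ := exists_sq_eval_orthoGegenbauer_le hγ hγ0
  refine ⟨K, hK, fun m p hp t ht => (sq_eval_le_christoffel hγ hγ0 hp t).trans ?_⟩
  refine mul_le_mul_of_nonneg_right ?_ (integral_nonneg fun s => sq_nonneg _)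
  refine (Finset.sum_le_sum fun j _ => h j t ht).trans ?_
  rw [← Finset.mul_sum]
  exact mul_le_mul_of_nonneg_left (sum_range_rpow_le (by positivity) m) hK.le

end Christoffel

/-! ### Completeness of polynomials and tails of series -/

section Expansion

open Polynomial

variable {γ : ℝ} {f : ℝ → ℝ}

theorem integrable_of_bound_Icc (hγ : -(1 / 2) < γ) {g : ℝ → ℝ}
    (hg : AEStronglyMeasurable g (gegenbauerMeasure γ)) {c : ℝ}
    (hc : ∀ t ∈ Set.Icc (-1 : ℝ) 1, |g t| ≤ c) : Integrable g (gegenbauerMeasure γ) := by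
  have := isFiniteMeasure_gegenbauerMeasure hγ
  refine Integrable.of_bound hg c ?_
  filter_upwards [ae_gegenbauerMeasure_mem γ] with t ht using hc t (Set.Ioc_subset_Icc_self ht)

theorem exists_eval_bound (p : ℝ[X]) : ∃ c, ∀ t ∈ Set.Icc (-1 : ℝ) 1, |p.eval t| ≤ c :=
  isCompact_Icc.exists_bound_of_continuousOn p.continuous.continuousOn

/-- A bounded function orthogonal to all polynomials vanishes almost everywhere. -/
theorem ae_eq_zero_of_forall_polynomial (hγ : -(1 / 2) < γ) {h : ℝ → ℝ}
    (hm : AEStronglyMeasurable h (gegenbauerMeasure γ)) {c : ℝ}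
    (hc : ∀ t ∈ Set.Icc (-1 : ℝ) 1, |h t| ≤ c)
    (hp : ∀ p : ℝ[X], ∫ t, h t * p.eval t ∂(gegenbauerMeasure γ) = 0) :
    ∀ᵐ t ∂(gegenbauerMeasure γ), h t = 0 := by
  have hfin := isFiniteMeasure_gegenbauerMeasure hγ
  have hi := integrable_of_bound_Icc hγ hm hc
  have hc0 : 0 ≤ c := (abs_nonneg _).trans (hc 0 (by norm_num))
  refine ae_eq_zero_of_integral_contDiff_smul_eq_zero hi.locallyIntegrable fun g hg _ => ?_
  have hgc : Continuous g := hg.continuous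
  refine abs_eq_zero.1 (le_antisymm (le_of_forall_pos_le_add fun ε hε => ?_) (abs_nonneg _))
  rw [zero_add]
  set T := ∫ t, |h t| ∂(gegenbauerMeasure γ) with hT
  have hT0 : 0 ≤ T := integral_nonneg fun t => abs_nonneg _
  -- Weierstrass: a test function is replaced by a polynomial at a cost of at most ε; the
  -- denominator T + 1 covers T = 0.
  obtain ⟨p, hpg⟩ := exists_polynomial_near_of_continuousOn (-1) 1 g hgc.continuousOn
    (ε / (T + 1)) (by positivity)
  obtain ⟨c1, hc1⟩ := isCompact_Icc.exists_bound_of_continuousOn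
    (hgc.continuousOn (s := Set.Icc (-1 : ℝ) 1))
  obtain ⟨c2, hc2⟩ := exists_eval_bound p
  have hi1 : Integrable (fun t => g t • h t) (gegenbauerMeasure γ) := by
    refine integrable_of_bound_Icc hγ (c := c1 * c)
      (hgc.aestronglyMeasurable.smul hm) fun t ht => ?_
    rw [smul_eq_mul, abs_mul]
    exact mul_le_mul (hc1 t ht) (hc t ht) (abs_nonneg _) ((abs_nonneg _).trans (hc1 t ht))
  have hi2 : Integrable (fun t => h t * p.eval t) (gegenbauerMeasure γ) := by
    refine integrable_of_bound_Icc hγ (c := c * c2)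
      (hm.mul p.continuous.aestronglyMeasurable) fun t ht => ?_
    rw [abs_mul]
    exact mul_le_mul (hc t ht) (hc2 t ht) (abs_nonneg _) hc0
  have h1 : ∫ t, g t • h t ∂(gegenbauerMeasure γ) =
      ∫ t, (g t • h t - h t * p.eval t) ∂(gegenbauerMeasure γ) := by
    rw [integral_sub hi1 hi2, hp p, sub_zero]
  rw [h1]
  calc |∫ t, (g t • h t - h t * p.eval t) ∂(gegenbauerMeasure γ)|
      ≤ ∫ t, ε / (T + 1) * |h t| ∂(gegenbauerMeasure γ) := by
        rw [← Real.norm_eq_abs]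
        refine norm_integral_le_of_norm_le (hi.abs.const_mul _) ?_
        filter_upwards [ae_gegenbauerMeasure_mem γ] with t ht
        rw [smul_eq_mul, mul_comm (h t), ← sub_mul, Real.norm_eq_abs, abs_mul, abs_sub_comm]
        exact mul_le_mul_of_nonneg_right (hpg t (Set.Ioc_subset_Icc_self ht)).le (abs_nonneg _)
    _ = ε * (T / (T + 1)) := by rw [integral_const_mul]; ring
    _ ≤ ε := by
        have : T / (T + 1) ≤ 1 := by rw [div_le_one (by positivity)]; linarith
        nlinarith

/-- Beyond M the weight relative to its value at M is at least 1. -/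
theorem tsum_tail_le {v : ℕ → ℝ} (hv : ∀ m, 0 ≤ v m) {σ : ℝ} (hσ : 0 ≤ σ)
    (hs : Summable fun m : ℕ => v m * ((m : ℝ) + 1) ^ σ) (M : ℕ) :
    Summable v ∧ ∑' m, v (m + (M + 1)) ≤ (∑' m : ℕ, v m * ((m : ℝ) + 1) ^ σ) *
      ((M : ℝ) + 1) ^ (-σ) := by
  have hv1 : Summable v := by
    refine Summable.of_nonneg_of_le hv (fun m => ?_) hs
    exact le_mul_of_one_le_right (hv m) (Real.one_le_rpow (by linarith [m.cast_nonneg (α := ℝ)]) hσ)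
  refine ⟨hv1, ?_⟩
  have hM : (0 : ℝ) < (M : ℝ) + 1 := by positivity
  have hs' := (summable_nat_add_iff (M + 1)).2 hs
  calc ∑' m, v (m + (M + 1))
      ≤ ∑' m : ℕ, v (m + (M + 1)) * (((m + (M + 1) : ℕ) : ℝ) + 1) ^ σ * ((M : ℝ) + 1) ^ (-σ) := by
        refine Summable.tsum_le_tsum (fun m => ?_) ((summable_nat_add_iff (M + 1)).2 hv1)
          (hs'.mul_right _)
        rw [mul_assoc]
        refine le_mul_of_one_le_right (hv _) ?_
        rw [Real.rpow_neg hM.le, ← div_eq_mul_inv, one_le_div (by positivity)]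
        refine Real.rpow_le_rpow hM.le ?_ hσ
        push_cast
        linarith [m.cast_nonneg (α := ℝ)]
    _ = (∑' m : ℕ, v (m + (M + 1)) * (((m + (M + 1) : ℕ) : ℝ) + 1) ^ σ) *
          ((M : ℝ) + 1) ^ (-σ) := tsum_mul_right
    _ ≤ _ := by
        refine mul_le_mul_of_nonneg_right ?_ (by positivity)
        rw [← hs.sum_add_tsum_nat_add (M + 1)]
        exact le_add_of_nonneg_left (Finset.sum_nonneg fun m _ => mul_nonneg (hv m) (by positivity))

end Expansion

end BallGraph

/-! ### Approximation by partial Gegenbauer expansions -/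

namespace BallGraph

section Approximation

open Polynomial

variable {γ : ℝ} {f : ℝ → ℝ}

/-- The coefficients of a function with respect to the normalised Gegenbauer polynomials. -/
noncomputable def orthoCoeff (γ : ℝ) (f : ℝ → ℝ) (m : ℕ) : ℝ :=
  ∫ t, f t * (orthoGegenbauer γ m).eval t ∂(gegenbauerMeasure γ)

theorem weightIntegral_gegenbauerSum_mul (hγ : -(1 / 2) < γ) (hγ0 : γ ≠ 0) (b : ℕ → ℝ) {m N : ℕ}
    (hm : m ≤ N) : weightIntegral γ (gegenbauerSum γ b N * orthoGegenbauer γ m) = b m := by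
  rw [gegenbauerSum, Finset.sum_mul, weightIntegral_finset_sum hγ]
  simp only [mul_assoc, weightIntegral_C_mul, weightIntegral_orthoGegenbauer hγ hγ0]
  simp [Nat.lt_succ_of_le hm]

theorem gegenbauerSum_sub (b : ℕ → ℝ) {M N : ℕ} (h : M ≤ N) :
    gegenbauerSum γ b N - gegenbauerSum γ b M =
      ∑ m ∈ Finset.Ico (M + 1) (N + 1), C (b m) * orthoGegenbauer γ m := by
  rw [gegenbauerSum, gegenbauerSum, Finset.sum_Ico_eq_sub _ (by omega)]

/-- A function whose Gegenbauer coefficients decay is approximated by the partial sums of its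
expansion, uniformly and in the weighted `L²` norm. -/
theorem gegenbauerSum_approximation (hγ : -(1 / 2) < γ) (hγ0 : γ ≠ 0) (hf : Measurable f)
    (hf01 : ∀ t ∈ Set.Icc (-1 : ℝ) 1, f t ∈ Set.Icc (0 : ℝ) 1) {s σ : ℝ} (hσ : 0 ≤ σ)
    (hσs : σ + max γ 0 + 1 / 2 < s)
    (hsum : Summable fun m : ℕ => orthoCoeff γ f m ^ 2 * ((m : ℝ) + 1) ^ (2 * s)) :
    ∃ K, 0 < K ∧ ∀ M : ℕ,
      (∀ t ∈ Set.Icc (-1 : ℝ) 1, |(gegenbauerSum γ (orthoCoeff γ f) M).eval t| ≤ K) ∧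
      (∀ᵐ t ∂(gegenbauerMeasure γ), |f t - (gegenbauerSum γ (orthoCoeff γ f) M).eval t| ≤
        K * ((M : ℝ) + 1) ^ (-σ)) ∧
      ∫ t, (f t - (gegenbauerSum γ (orthoCoeff γ f) M).eval t) ^ 2 ∂(gegenbauerMeasure γ) ≤
        K * ((M : ℝ) + 1) ^ (-(2 * s)) := by
  have hfin := isFiniteMeasure_gegenbauerMeasure hγ
  set b := orthoCoeff γ f with hb
  obtain ⟨K0, hK0, hsup⟩ := exists_sq_eval_orthoGegenbauer_le hγ hγ0
  set v : ℕ → ℝ := fun m => |b m| * (Real.sqrt K0 * ((m : ℝ) + 1) ^ (max γ 0)) with hv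
  have hv0 : ∀ m, 0 ≤ v m := fun m => by positivity
  have hvb : ∀ m, ∀ t ∈ Set.Icc (-1 : ℝ) 1, |b m * (orthoGegenbauer γ m).eval t| ≤ v m := by
    intro m t ht
    rw [abs_mul]
    refine mul_le_mul_of_nonneg_left ?_ (abs_nonneg _)
    refine abs_le_of_sq_le_sq ?_ (by positivity)
    rw [mul_pow, Real.sq_sqrt hK0.le, ← Real.rpow_natCast (((m : ℝ) + 1) ^ (max γ 0)),
      ← Real.rpow_mul (by positivity)]
    rw [mul_comm (max γ 0)]
    exact hsup m t ht
  -- The inequality 2xy ≤ x² + y² splits the product into the weighted coefficients and a power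
  -- series with exponent 2(s - σ - max γ 0) > 1.
  have hvsum : Summable fun m : ℕ => v m * ((m : ℝ) + 1) ^ σ := by
    have h1 : Summable fun m : ℕ => ((m : ℝ) + 1) ^ (-(2 * (s - σ - max γ 0))) := by
      have := (summable_nat_add_iff 1).2 (Real.summable_nat_rpow
        (p := -(2 * (s - σ - max γ 0))) |>.2 (by linarith))
      simpa using this
    refine Summable.of_nonneg_of_le (fun m => mul_nonneg (hv0 m) (by positivity)) (fun m => ?_)
      ((hsum.add h1).mul_left (Real.sqrt K0 / 2))
    have hm : (0 : ℝ) < (m : ℝ) + 1 := by positivity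
    set x := |b m| * ((m : ℝ) + 1) ^ s with hx
    set y := ((m : ℝ) + 1) ^ (-(s - σ - max γ 0)) with hy
    have e1 : v m * ((m : ℝ) + 1) ^ σ = Real.sqrt K0 * (x * y) := by
      have : ((m : ℝ) + 1) ^ s * ((m : ℝ) + 1) ^ (-(s - σ - max γ 0)) =
          ((m : ℝ) + 1) ^ (max γ 0) * ((m : ℝ) + 1) ^ σ := by
        rw [← Real.rpow_add hm, ← Real.rpow_add hm]; congr 1; ring
      rw [hv, hx, hy]
      linear_combination -(|b m| * Real.sqrt K0) * this
    have e2 : b m ^ 2 * ((m : ℝ) + 1) ^ (2 * s) = x ^ 2 := by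
      rw [hx, mul_pow, sq_abs, ← Real.rpow_natCast (((m : ℝ) + 1) ^ s),
        ← Real.rpow_mul hm.le]
      congr 2; push_cast; ring
    have e3 : ((m : ℝ) + 1) ^ (-(2 * (s - σ - max γ 0))) = y ^ 2 := by
      rw [hy, ← Real.rpow_natCast (((m : ℝ) + 1) ^ _), ← Real.rpow_mul hm.le]
      congr 1; push_cast; ring
    rw [e1, e2, e3]
    nlinarith [sq_nonneg (x - y), Real.sqrt_nonneg K0, mul_nonneg (Real.sqrt_nonneg K0)
      (sq_nonneg (x - y))]
  have hvS : Summable v := (tsum_tail_le hv0 hσ hvsum 0).1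
  -- The expansion converges uniformly to `ft`. That `ft` equals f almost everywhere is a separate
  -- point: both have the same moments, and polynomials are complete for bounded functions.
  set ft : ℝ → ℝ := fun t => ∑' m, b m * (orthoGegenbauer γ m).eval t with hft
  have hsumt : ∀ t ∈ Set.Icc (-1 : ℝ) 1, Summable fun m => b m * (orthoGegenbauer γ m).eval t :=
    fun t ht => Summable.of_norm_bounded hvS fun m => hvb m t ht
  set V := ∑' m, v m with hV
  have hV0 : 0 ≤ V := tsum_nonneg hv0
  have hFV : ∀ M, ∀ t ∈ Set.Icc (-1 : ℝ) 1, |(gegenbauerSum γ b M).eval t| ≤ V := by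
    intro M t ht
    rw [eval_gegenbauerSum]
    refine (Finset.abs_sum_le_sum_abs _ _).trans ((Finset.sum_le_sum fun m _ => hvb m t ht).trans ?_)
    exact hvS.sum_le_tsum _ fun m _ => hv0 m
  have htend : ∀ t ∈ Set.Icc (-1 : ℝ) 1,
      Filter.Tendsto (fun N => (gegenbauerSum γ b N).eval t) Filter.atTop (nhds (ft t)) := by
    intro t ht
    simp only [eval_gegenbauerSum]
    exact (Filter.tendsto_add_atTop_iff_nat 1).2 (hsumt t ht).hasSum.tendsto_sum_nat
  set T := ∑' m : ℕ, v m * ((m : ℝ) + 1) ^ σ with hT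
  have hT0 : 0 ≤ T := tsum_nonneg fun m => mul_nonneg (hv0 m) (by positivity)
  have htail : ∀ M, ∀ t ∈ Set.Icc (-1 : ℝ) 1,
      |ft t - (gegenbauerSum γ b M).eval t| ≤ T * ((M : ℝ) + 1) ^ (-σ) := by
    intro M t ht
    have h1 : ft t - (gegenbauerSum γ b M).eval t =
        ∑' m, b (m + (M + 1)) * (orthoGegenbauer γ (m + (M + 1))).eval t := by
      change (∑' m, b m * (orthoGegenbauer γ m).eval t) - _ = _
      rw [eval_gegenbauerSum, ← (hsumt t ht).sum_add_tsum_nat_add (M + 1)]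
      ring
    rw [h1, ← Real.norm_eq_abs]
    refine le_trans ?_ (tsum_tail_le hv0 hσ hvsum M).2
    exact tsum_of_norm_bounded ((summable_nat_add_iff (M + 1)).2 hvS).hasSum
      fun m => hvb (m + (M + 1)) t ht
  have hftV : ∀ t ∈ Set.Icc (-1 : ℝ) 1, |ft t| ≤ V := fun t ht =>
    le_of_tendsto (htend t ht).abs (Filter.Eventually.of_forall fun N => hFV N t ht)
  have hftm : AEStronglyMeasurable ft (gegenbauerMeasure γ) := by
    refine aestronglyMeasurable_of_tendsto_ae Filter.atTop
      (f := fun N t => (gegenbauerSum γ b N).eval t)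
      (fun N => (gegenbauerSum γ b N).continuous.aestronglyMeasurable) ?_
    filter_upwards [ae_gegenbauerMeasure_mem γ] with t ht
    exact htend t (Set.Ioc_subset_Icc_self ht)
  have hf1 : ∀ t ∈ Set.Icc (-1 : ℝ) 1, |f t| ≤ 1 := fun t ht => by
    rw [abs_of_nonneg (hf01 t ht).1]; exact (hf01 t ht).2
  have hmom : ∀ m, ∫ t, ft t * (orthoGegenbauer γ m).eval t ∂(gegenbauerMeasure γ) = b m := by
    intro m
    obtain ⟨c, hc⟩ := exists_eval_bound (orthoGegenbauer γ m)
    have h1 : Filter.Tendsto (fun N => ∫ t, (gegenbauerSum γ b N).eval t *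
        (orthoGegenbauer γ m).eval t ∂(gegenbauerMeasure γ)) Filter.atTop
        (nhds (∫ t, ft t * (orthoGegenbauer γ m).eval t ∂(gegenbauerMeasure γ))) := by
      refine tendsto_integral_of_dominated_convergence (fun _ => V * c)
        (fun N => ((gegenbauerSum γ b N).continuous.mul
          (orthoGegenbauer γ m).continuous).aestronglyMeasurable) (integrable_const _) ?_ ?_
      · intro N
        filter_upwards [ae_gegenbauerMeasure_mem γ] with t ht
        have ht' := Set.Ioc_subset_Icc_self ht
        rw [norm_mul]
        exact mul_le_mul (hFV N t ht') (hc t ht') (norm_nonneg _) hV0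
      · filter_upwards [ae_gegenbauerMeasure_mem γ] with t ht
        exact (htend t (Set.Ioc_subset_Icc_self ht)).mul_const _
    refine tendsto_nhds_unique h1 (tendsto_const_nhds.congr' ?_)
    filter_upwards [Filter.eventually_ge_atTop m] with N hN
    have := weightIntegral_gegenbauerSum_mul hγ hγ0 b hN
    simpa [weightIntegral] using this.symm
  have hzero : ∀ᵐ t ∂(gegenbauerMeasure γ), f t - ft t = 0 := by
    have hdm : AEStronglyMeasurable (fun t => f t - ft t) (gegenbauerMeasure γ) :=
      hf.aestronglyMeasurable.sub hftm
    have hdb : ∀ t ∈ Set.Icc (-1 : ℝ) 1, |f t - ft t| ≤ 1 + V := fun t ht =>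
      (abs_sub _ _).trans (add_le_add (hf1 t ht) (hftV t ht))
    have hI : ∀ p : ℝ[X], Integrable (fun t => (f t - ft t) * p.eval t) (gegenbauerMeasure γ) := by
      intro p
      obtain ⟨c, hc⟩ := exists_eval_bound p
      refine integrable_of_bound_Icc hγ (hdm.mul p.continuous.aestronglyMeasurable)
        (c := (1 + V) * c) fun t ht => ?_
      rw [abs_mul]
      exact mul_le_mul (hdb t ht) (hc t ht) (abs_nonneg _) (by positivity)
    have hI' : ∀ (m : ℕ) {g : ℝ → ℝ} (_ : AEStronglyMeasurable g (gegenbauerMeasure γ)) {c : ℝ}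
        (_ : 0 ≤ c) (_ : ∀ t ∈ Set.Icc (-1 : ℝ) 1, |g t| ≤ c),
        Integrable (fun t => g t * (orthoGegenbauer γ m).eval t) (gegenbauerMeasure γ) := by
      intro m g hg c hc0 hc
      obtain ⟨c', hc'⟩ := exists_eval_bound (orthoGegenbauer γ m)
      refine integrable_of_bound_Icc hγ
        (hg.mul (orthoGegenbauer γ m).continuous.aestronglyMeasurable) (c := c * c') fun t ht => ?_
      rw [abs_mul]
      exact mul_le_mul (hc t ht) (hc' t ht) (abs_nonneg _) hc0
    refine ae_eq_zero_of_forall_polynomial hγ hdm hdb fun p => ?_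
    obtain ⟨c, hc⟩ := exists_gegenbauerSum_eq hγ hγ0 (le_refl p.natDegree)
    rw [hc]
    simp only [eval_gegenbauerSum, Finset.mul_sum]
    rw [integral_finsetSum]
    · refine Finset.sum_eq_zero fun m _ => ?_
      have h1 : ∀ t, (f t - ft t) * (c m * (orthoGegenbauer γ m).eval t) =
        c m * (f t * (orthoGegenbauer γ m).eval t - ft t * (orthoGegenbauer γ m).eval t) :=
        fun t => by ring
      simp only [h1]
      rw [integral_const_mul, integral_sub (hI' m hf.aestronglyMeasurable zero_le_one hf1)
        (hI' m hftm hV0 hftV), hmom m]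
      change c m * (orthoCoeff γ f m - b m) = 0
      rw [hb, sub_self, mul_zero]
    · intro m _
      have := hI (C (c m) * orthoGegenbauer γ m)
      simpa using this
  set Q := ∑' m : ℕ, b m ^ 2 * ((m : ℝ) + 1) ^ (2 * s) with hQ
  have hs0 : 0 ≤ s := by
    have : 0 ≤ max γ 0 := le_max_right _ _
    linarith
  have hQ0 : 0 ≤ Q := tsum_nonneg fun m => mul_nonneg (sq_nonneg _) (by positivity)
  refine ⟨V + T + Q + 1, by positivity, fun M => ⟨fun t ht => ?_, ?_, ?_⟩⟩
  · linarith [hFV M t ht]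
  · filter_upwards [hzero, ae_gegenbauerMeasure_mem γ] with t h1 ht
    rw [sub_eq_zero.1 h1]
    refine (htail M t (Set.Ioc_subset_Icc_self ht)).trans (mul_le_mul_of_nonneg_right ?_
      (by positivity))
    linarith
  · have h1 : ∫ t, (f t - (gegenbauerSum γ b M).eval t) ^ 2 ∂(gegenbauerMeasure γ) =
        ∫ t, (ft t - (gegenbauerSum γ b M).eval t) ^ 2 ∂(gegenbauerMeasure γ) := by
      refine integral_congr_ae ?_
      filter_upwards [hzero] with t ht
      rw [sub_eq_zero.1 ht]
    -- The L² tail is obtained from Parseval for finite blocks by letting the upper end tend to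
    -- infinity.
    have h2 : Filter.Tendsto (fun N => ∫ t, ((gegenbauerSum γ b N).eval t -
        (gegenbauerSum γ b M).eval t) ^ 2 ∂(gegenbauerMeasure γ)) Filter.atTop
        (nhds (∫ t, (ft t - (gegenbauerSum γ b M).eval t) ^ 2 ∂(gegenbauerMeasure γ))) := by
      refine tendsto_integral_of_dominated_convergence (fun _ => (V + V) ^ 2)
        (fun N => (((gegenbauerSum γ b N).continuous.sub
          (gegenbauerSum γ b M).continuous).pow 2).aestronglyMeasurable) (integrable_const _) ?_ ?_
      · intro N
        filter_upwards [ae_gegenbauerMeasure_mem γ] with t ht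
        have ht' := Set.Ioc_subset_Icc_self ht
        rw [norm_pow]
        exact pow_le_pow_left₀ (norm_nonneg _)
          ((abs_sub _ _).trans (add_le_add (hFV N t ht') (hFV M t ht'))) 2
      · filter_upwards [ae_gegenbauerMeasure_mem γ] with t ht
        exact ((htend t (Set.Ioc_subset_Icc_self ht)).sub_const _).pow 2
    have hb2 := tsum_tail_le (v := fun m => b m ^ 2) (fun m => sq_nonneg _)
      (by linarith : 0 ≤ 2 * s) hsum M
    rw [h1]
    refine le_of_tendsto h2 ?_
    filter_upwards [Filter.eventually_ge_atTop M] with N hN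
    have h3 := weightIntegral_finset_sum_sq hγ hγ0 (Finset.Ico (M + 1) (N + 1)) b
    rw [← gegenbauerSum_sub b hN, weightIntegral] at h3
    simp only [eval_pow, eval_sub] at h3
    rw [h3]
    calc ∑ m ∈ Finset.Ico (M + 1) (N + 1), b m ^ 2
        = ∑ m ∈ Finset.range (N + 1 - (M + 1)), b (m + (M + 1)) ^ 2 := by
          rw [Finset.sum_Ico_eq_sum_range]
          exact Finset.sum_congr rfl fun m _ => by rw [add_comm]
      _ ≤ ∑' m, b (m + (M + 1)) ^ 2 :=
          ((summable_nat_add_iff (f := fun m => b m ^ 2) (M + 1)).2 hb2.1).sum_le_tsum _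
            fun m _ => sq_nonneg _
      _ ≤ Q * ((M : ℝ) + 1) ^ (-(2 * s)) := hb2.2
      _ ≤ _ := by
          refine mul_le_mul_of_nonneg_right ?_ (by positivity)
          linarith

end Approximation

end BallGraph

/-! ### Sobolev regularity as decay of coefficients -/

namespace BallGraph

section Sobolev

open Polynomial

variable {γ : ℝ} {f : ℝ → ℝ}

theorem eval_one_gegenbauerPoly_ne_zero (hγ : -(1 / 2) < γ) (hγ0 : γ ≠ 0) (n : ℕ) :
    (gegenbauerPoly γ n).eval 1 ≠ 0 := by
  induction n with
  | zero => simp [gegenbauerPoly]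
  | succ n ih =>
    have h := gegenbauer_succ_one γ n
    have h1 : (n + 2 * γ : ℝ) ≠ 0 := by
      rcases n with _ | n
      · simpa using hγ0
      · have : (0 : ℝ) ≤ n := n.cast_nonneg
        have : (0 : ℝ) < (n + 1 : ℕ) + 2 * γ := by push_cast; linarith
        exact this.ne'
    intro h0
    rw [h0, mul_zero] at h
    exact mul_ne_zero h1 ih h.symm

theorem orthoCoeff_sq (hγ : -(1 / 2) < γ) (hγ0 : γ ≠ 0) (f : ℝ → ℝ) (m : ℕ) :
    orthoCoeff γ f m ^ 2 = gegenbauerNormSq γ 0 ^ 2 * (orthoGegenbauer γ m).eval 1 ^ 2 *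
      gegenbauerCoeff γ f m ^ 2 := by
  have hG := eval_one_gegenbauerPoly_ne_zero hγ hγ0 m
  have h0 := gegenbauerNormSq_pos hγ hγ0 0
  -- The squared norm of the constant 1 is the inverse of c_γ.
  have hh : gegenbauerNormSq γ 0 = ∫ t in (-1 : ℝ)..1, (1 - t ^ 2) ^ (γ - 1 / 2) := by
    rw [gegenbauerNormSq, weightIntegral, integral_gegenbauerMeasure]
    simp [gegenbauerPoly]
  have h1 : gegenbauerCoeff γ f m = (gegenbauerNormSq γ 0)⁻¹ * ((gegenbauerPoly γ m).eval 1)⁻¹ *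
      ∫ t, f t * (gegenbauerPoly γ m).eval t ∂(gegenbauerMeasure γ) := by
    rw [gegenbauerCoeff, ← hh, integral_gegenbauerMeasure,
      ← intervalIntegral.integral_const_mul, ← intervalIntegral.integral_const_mul]
    refine intervalIntegral.integral_congr fun t _ => ?_
    simp only [eval_gegenbauerPoly]
    ring
  have h2 : orthoCoeff γ f m = (Real.sqrt (gegenbauerNormSq γ m))⁻¹ *
      ∫ t, f t * (gegenbauerPoly γ m).eval t ∂(gegenbauerMeasure γ) := by
    rw [orthoCoeff, ← integral_const_mul]
    refine integral_congr_ae (Filter.Eventually.of_forall fun t => ?_)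
    simp only [orthoGegenbauer, eval_mul, eval_C]
    ring
  rw [h1, h2, orthoGegenbauer, eval_mul, eval_C]
  field_simp

theorem pow_le_factorial_mul_choose (m k : ℕ) :
    ((m : ℝ) + 1) ^ k ≤ (k.factorial : ℝ) * ((m + k).choose m : ℝ) := by
  have h1 := Nat.pow_succ_le_ascFactorial (m + 1) k
  have h2 : (m + 1).ascFactorial k = k.factorial * (m + k).choose m := by
    rw [Nat.ascFactorial_eq_factorial_mul_choose, Nat.choose_symm_add]
  rw [h2] at h1
  exact_mod_cast h1

/-- m(m + 2γ) is comparable with (m + 1)² for m ≥ 1, through m + 2γ ≥ min(1, 1 + 2γ) m; at m = 0 the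
summand 1 takes over. -/
theorem exists_rpow_le_eigenvalue (hγ : -(1 / 2) < γ) {p : ℝ} (hp : 0 < p) :
    ∃ K, 0 < K ∧ ∀ m : ℕ, ((m : ℝ) + 1) ^ (2 * p) ≤ K * (1 + ((m : ℝ) * (m + 2 * γ)) ^ p) := by
  set q := min 1 (1 + 2 * γ) with hq
  have hq0 : 0 < q := lt_min one_pos (by linarith)
  refine ⟨(4 / q) ^ p + 1, by positivity, fun m => ?_⟩
  rcases Nat.eq_zero_or_pos m with rfl | hm
  · simp only [Nat.cast_zero, zero_add, Real.one_rpow, zero_mul, Real.zero_rpow hp.ne', add_zero]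
    have : 0 < (4 / q) ^ p := by positivity
    linarith
  · have hm1 : (1 : ℝ) ≤ m := by exact_mod_cast hm
    have h1 : q * (m : ℝ) ≤ m + 2 * γ := by
      rcases le_total 0 γ with h | h
      · have : q ≤ 1 := min_le_left _ _
        nlinarith
      · have : q ≤ 1 + 2 * γ := min_le_right _ _
        nlinarith
    have h2 : ((m : ℝ) + 1) ^ 2 ≤ 4 / q * (m * (m + 2 * γ)) := by
      rw [div_mul_eq_mul_div, le_div_iff₀ hq0]
      have h3 : q * (m : ℝ) * m ≤ (m + 2 * γ) * m := mul_le_mul_of_nonneg_right h1 (by linarith)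
      have h4 : ((m : ℝ) + 1) ^ 2 ≤ 4 * (m * m) := by nlinarith
      nlinarith
    have h5 : 0 ≤ (m : ℝ) * (m + 2 * γ) := mul_nonneg (by linarith) (by nlinarith)
    have h6 : 0 ≤ ((m : ℝ) * (m + 2 * γ)) ^ p := Real.rpow_nonneg h5 _
    have h7 : 0 < (4 / q) ^ p := by positivity
    calc ((m : ℝ) + 1) ^ (2 * p) = (((m : ℝ) + 1) ^ 2) ^ p := by
          rw [Real.rpow_mul (by positivity), Real.rpow_two]
      _ ≤ (4 / q * (m * (m + 2 * γ))) ^ p := Real.rpow_le_rpow (by positivity) h2 hp.le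
      _ = (4 / q) ^ p * ((m : ℝ) * (m + 2 * γ)) ^ p := Real.mul_rpow (by positivity) h5
      _ ≤ _ := by nlinarith

theorem gammaWeight_gt {d : ℕ} (hd : 1 ≤ d) {ν : ℝ} (hν : -(1 / 2) < ν) :
    -(1 / 2) < gammaWeight d ν := by
  have : (1 : ℝ) ≤ d := by exact_mod_cast hd
  rw [gammaWeight]
  linarith

/-- Counting exponents: the squared value at 1 grows at most like (m + 1)^(2γ) with 2γ = 2ν + d - 1,
and d_m at least like (m + 1)^(d - 1). The discrepancy 2ν changes 2p into 2(p - ν). -/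
theorem summable_orthoCoeff {d : ℕ} (hd : 1 ≤ d) {ν : ℝ} (hν : -(1 / 2) < ν)
    (hγ0 : gammaWeight d ν ≠ 0) {p : ℝ} (hp : 0 < p) (hfp : SobolevRegular d ν p f) :
    Summable fun m : ℕ =>
      orthoCoeff (gammaWeight d ν) f m ^ 2 * ((m : ℝ) + 1) ^ (2 * (p - ν)) := by
  have hγ := gammaWeight_gt hd hν
  set γ := gammaWeight d ν with hγdef
  obtain ⟨K1, hK1, h1⟩ := exists_eval_one_orthoGegenbauer_le hγ hγ0
  obtain ⟨K2, hK2, h2⟩ := exists_rpow_le_eigenvalue hγ hp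
  rw [SobolevRegular] at hfp
  refine Summable.of_nonneg_of_le (fun m => mul_nonneg (sq_nonneg _) (by positivity)) (fun m => ?_)
    (hfp.mul_left (gegenbauerNormSq γ 0 ^ 2 * K1 * K2 * ((d - 1).factorial : ℝ)))
  obtain ⟨k, rfl⟩ : ∃ k, d = k + 1 := ⟨d - 1, by omega⟩
  have e1 : (m : ℝ) + 2 * ν + ((k + 1 : ℕ) : ℝ) - 1 = m + 2 * γ := by
    rw [hγdef, gammaWeight]; push_cast; ring
  have e2 : m + (k + 1) - 1 = m + k := by omega
  rw [orthoCoeff_sq hγ hγ0, e1, e2, sq_abs, ← hγdef, Nat.add_sub_cancel]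
  have hm : (0 : ℝ) < (m : ℝ) + 1 := by positivity
  have e3 : ((m : ℝ) + 1) ^ (2 * γ) * ((m : ℝ) + 1) ^ (2 * (p - ν)) =
      ((m : ℝ) + 1) ^ (2 * p) * ((m : ℝ) + 1) ^ k := by
    rw [← Real.rpow_add hm, ← Real.rpow_natCast, ← Real.rpow_add hm]
    congr 1
    rw [hγdef, gammaWeight]; push_cast; ring
  have h3 := pow_le_factorial_mul_choose m k
  set P := gegenbauerNormSq γ 0 ^ 2 * gegenbauerCoeff γ f m ^ 2 with hP
  have hP0 : 0 ≤ P := by positivity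
  have h4 : 0 ≤ 1 + ((m : ℝ) * (m + 2 * γ)) ^ p :=
    nonneg_of_mul_nonneg_right ((by positivity : (0 : ℝ) ≤ ((m : ℝ) + 1) ^ (2 * p)).trans (h2 m)) hK2
  calc gegenbauerNormSq γ 0 ^ 2 * (orthoGegenbauer γ m).eval 1 ^ 2 * gegenbauerCoeff γ f m ^ 2 *
        ((m : ℝ) + 1) ^ (2 * (p - ν))
      = P * ((orthoGegenbauer γ m).eval 1 ^ 2 * ((m : ℝ) + 1) ^ (2 * (p - ν))) := by rw [hP]; ring
    _ ≤ P * (K1 * ((m : ℝ) + 1) ^ (2 * γ) * ((m : ℝ) + 1) ^ (2 * (p - ν))) := by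
        gcongr
        exact h1 m
    _ = P * (K1 * (((m : ℝ) + 1) ^ (2 * p) * ((m : ℝ) + 1) ^ k)) := by rw [← e3]; ring
    _ ≤ P * (K1 * ((K2 * (1 + ((m : ℝ) * (m + 2 * γ)) ^ p)) *
          ((k.factorial : ℝ) * ((m + k).choose m : ℝ)))) := by
        refine mul_le_mul_of_nonneg_left (mul_le_mul_of_nonneg_left ?_ hK1.le) hP0
        exact mul_le_mul (h2 m) h3 (by positivity) (mul_nonneg hK2.le h4)
    _ = _ := by rw [hP]; ring

end Sobolev

end BallGraph

/-! ### Polynomial functions in several variables -/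

namespace BallGraph

section PolynomialSpaces

/-- The monomial function with exponents `k`. -/
def monomialFn {d : ℕ} (k : Fin d → ℕ) (x : EuclideanSpace ℝ (Fin d)) : ℝ := ∏ i, x i ^ k i

/-- The polynomial functions of degree at most `m` in each coordinate. -/
def polySpace (d m : ℕ) : Submodule ℝ (EuclideanSpace ℝ (Fin d) → ℝ) :=
  Submodule.span ℝ (Set.range fun k : Fin d → Fin (m + 1) => monomialFn fun i => (k i : ℕ))

theorem monomialFn_mem_polySpace {d m : ℕ} {k : Fin d → ℕ} (hk : ∀ i, k i ≤ m) :
    monomialFn k ∈ polySpace d m :=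
  Submodule.subset_span ⟨fun i => ⟨k i, Nat.lt_succ_of_le (hk i)⟩, rfl⟩

theorem polySpace_mono (d : ℕ) : Monotone (polySpace d) := by
  intro m n hmn
  refine Submodule.span_le.2 ?_
  rintro _ ⟨k, rfl⟩
  exact monomialFn_mem_polySpace fun i => (Nat.lt_succ_iff.1 (k i).2).trans hmn

instance finiteDimensional_polySpace (d m : ℕ) : FiniteDimensional ℝ (polySpace d m) :=
  FiniteDimensional.span_of_finite ℝ (Set.finite_range _)

theorem finrank_polySpace_le (d m : ℕ) : Module.finrank ℝ (polySpace d m) ≤ (m + 1) ^ d := by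
  refine (finrank_range_le_card (R := ℝ) _).trans ?_
  simp

theorem continuous_of_mem_polySpace {d m : ℕ} {p : EuclideanSpace ℝ (Fin d) → ℝ}
    (hp : p ∈ polySpace d m) : Continuous p := by
  induction hp using Submodule.span_induction with
  | mem p hp =>
    obtain ⟨k, rfl⟩ := hp
    unfold monomialFn
    fun_prop
  | zero => exact continuous_const
  | add p q _ _ hp hq => exact hp.add hq
  | smul a p _ hp => exact hp.const_smul a

-- Restriction to lines reduces point evaluation to one variable. The factor d appears because
-- `polySpace` limits the degree in each coordinate separately.
open Polynomial in
theorem exists_polynomial_on_line {d m : ℕ} {p : EuclideanSpace ℝ (Fin d) → ℝ}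
    (hp : p ∈ polySpace d m) (a v : EuclideanSpace ℝ (Fin d)) :
    ∃ P : ℝ[X], P.natDegree ≤ d * m ∧ ∀ t, P.eval t = p (a + t • v) := by
  induction hp using Submodule.span_induction with
  | mem p hp =>
    obtain ⟨k, rfl⟩ := hp
    refine ⟨∏ i, (C (a i) + C (v i) * X) ^ (k i : ℕ), ?_, fun t => ?_⟩
    · refine (natDegree_prod_le _ _).trans ?_
      calc ∑ i, ((C (a i) + C (v i) * X) ^ (k i : ℕ)).natDegree ≤ ∑ _i : Fin d, m := by
            refine Finset.sum_le_sum fun i _ => natDegree_pow_le.trans ?_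
            have h1 : (C (a i) + C (v i) * X : ℝ[X]).natDegree ≤ 1 := by
              refine (natDegree_add_le _ _).trans (max_le (by simp) ?_)
              exact (natDegree_C_mul_le _ _).trans natDegree_X_le
            calc (k i : ℕ) * _ ≤ (k i : ℕ) * 1 := Nat.mul_le_mul_left _ h1
              _ ≤ m := by have := (k i).2; omega
        _ = d * m := by simp
    · simp only [eval_prod, eval_pow, eval_add, eval_mul, eval_C, eval_X, monomialFn,
        PiLp.add_apply, PiLp.smul_apply, smul_eq_mul, mul_comm t]
  | zero => exact ⟨0, by simp, by simp⟩
  | add p q _ _ hp hq =>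
    obtain ⟨P, hP, hP'⟩ := hp
    obtain ⟨Q, hQ, hQ'⟩ := hq
    exact ⟨P + Q, (natDegree_add_le _ _).trans (max_le hP hQ), fun t => by simp [hP', hQ']⟩
  | smul c p _ hp =>
    obtain ⟨P, hP, hP'⟩ := hp
    exact ⟨c • P, (natDegree_smul_le _ _).trans hP, fun t => by simp [hP']⟩

theorem IsGeneratedBy.of_fintype {X : Type*} {V : Submodule ℝ (X → ℝ)} {W : X → X → ℝ}
    {ι : Type*} [Fintype ι] (a : ι → ℝ) (p : ι → X → ℝ) (hp : ∀ i, p i ∈ V)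
    (hW : ∀ x y, W x y = ∑ i, a i * p i x * p i y) : IsGeneratedBy V W := by
  let φ := Fintype.equivFin ι
  refine ⟨Fintype.card ι, a ∘ φ.symm, p ∘ φ.symm, fun i => hp _, fun x y => ?_⟩
  rw [hW]
  exact (φ.symm.sum_comp fun i => a i * p i x * p i y).symm

theorem prod_coord_mem_polySpace {d j m : ℕ} (hj : j ≤ m) (s : Fin j → Fin d) :
    (fun x : EuclideanSpace ℝ (Fin d) => ∏ a, x (s a)) ∈ polySpace d m := by
  have h : (fun x : EuclideanSpace ℝ (Fin d) => ∏ a, x (s a)) =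
      monomialFn fun i => (Finset.univ.filter fun a => s a = i).card := by
    funext x
    rw [monomialFn, ← Finset.prod_fiberwise_of_maps_to (g := s) (t := Finset.univ)
      fun a _ => Finset.mem_univ _]
    refine Finset.prod_congr rfl fun i _ => ?_
    rw [Finset.prod_congr rfl (g := fun _ => x i) fun a ha => by
      rw [(Finset.mem_filter.1 ha).2], Finset.prod_const]
  rw [h]
  refine monomialFn_mem_polySpace fun i => (Finset.card_filter_le _ _).trans ?_
  simpa using hj

-- Expanding the power ⟨x, y⟩^j over words of length j gives products with the same monomial in x
-- and in y, as `IsGeneratedBy` demands.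
open Polynomial in
theorem isGeneratedBy_eval_inner {d m : ℕ} {F : ℝ[X]} (hF : F.natDegree ≤ m) :
    IsGeneratedBy (polySpace d m)
      fun x y : EuclideanSpace ℝ (Fin d) => F.eval (inner ℝ x y) := by
  refine IsGeneratedBy.of_fintype (ι := Σ j : Fin (m + 1), (Fin j → Fin d))
    (fun s => F.coeff s.1) (fun s x => ∏ a, x (s.2 a))
    (fun s => prod_coord_mem_polySpace (Nat.lt_succ_iff.1 s.1.2) s.2) fun x y => ?_
  rw [eval_eq_sum_range' (Nat.lt_succ_of_le hF), Fintype.sum_sigma, ← Fin.sum_univ_eq_sum_range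
    (fun j => F.coeff j * inner ℝ x y ^ j)]
  refine Finset.sum_congr rfl fun j _ => ?_
  have h1 : inner ℝ x y = ∑ i, x i * y i := by
    rw [PiLp.inner_apply]
    exact Finset.sum_congr rfl fun i _ => by simp [mul_comm]
  rw [h1, Fintype.sum_pow, Finset.mul_sum]
  refine Finset.sum_congr rfl fun s _ => ?_
  rw [Finset.prod_mul_distrib, mul_assoc]

theorem exists_bound_of_mem_polySpace {d m : ℕ} {p : EuclideanSpace ℝ (Fin d) → ℝ}
    (hp : p ∈ polySpace d m) :
    ∃ C, ∀ x ∈ Metric.closedBall (0 : EuclideanSpace ℝ (Fin d)) 1, |p x| ≤ C :=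
  (isCompact_closedBall _ _).exists_bound_of_continuousOn
    (continuous_of_mem_polySpace hp).continuousOn

end PolynomialSpaces

end BallGraph

/-! ### Christoffel functions on the ball -/

namespace BallGraph

section PointEvaluation

open Polynomial in
/-- A bound for the value of a polynomial at an end point of a segment, by a weighted mean. -/
theorem exists_eval_zero_sq_le {β : ℝ} (hβ : 0 ≤ β) :
    ∃ K, 0 < K ∧ ∀ (m : ℕ) (P : ℝ[X]), P.natDegree ≤ m →
      P.eval 0 ^ 2 ≤ K * ((m : ℝ) + 1) ^ (2 * β + 2) *
        ∫ t in (0 : ℝ)..1, P.eval t ^ 2 * t ^ β := by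
  -- With γ = β + 1/2 the weight is (1 - s²)^β. Under t = (1 - s)/2 it becomes (4t(1 - t))^β ≤ 4^β
  -- t^β, and the end point s = 1 becomes t = 0.
  obtain ⟨K, hK, h⟩ := exists_christoffel_le (γ := β + 1 / 2) (by linarith) (by linarith)
  refine ⟨K * (2 * 4 ^ β), by positivity, fun m P hP => ?_⟩
  have hQ : (P.comp (C (1 / 2) - C (1 / 2) * X)).natDegree ≤ m := by
    refine natDegree_comp_le.trans ?_
    have h1 : (C (1 / 2) - C (1 / 2) * X : ℝ[X]).natDegree ≤ 1 := by
      refine (natDegree_sub_le _ _).trans (max_le (by simp) ?_)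
      exact (natDegree_C_mul_le _ _).trans natDegree_X_le
    calc P.natDegree * _ ≤ P.natDegree * 1 := Nat.mul_le_mul_left _ h1
      _ ≤ m := by omega
  have h1 := h m _ hQ 1 (by norm_num)
  rw [integral_gegenbauerMeasure, max_eq_left (by linarith)] at h1
  simp only [eval_comp, eval_sub, eval_C, eval_mul, eval_X] at h1
  norm_num at h1
  rw [show 2 * (β + 1 / 2) + 1 = 2 * β + 2 by ring] at h1
  have h2 : ∫ s in (-1 : ℝ)..1, P.eval (1 / 2 - 1 / 2 * s) ^ 2 * (1 - s ^ 2) ^ β =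
      2 * ∫ t in (0 : ℝ)..1, P.eval t ^ 2 * (4 * t * (1 - t)) ^ β := by
    have h3 := intervalIntegral.integral_comp_sub_mul (a := -1) (b := 1)
      (fun t : ℝ => P.eval t ^ 2 * (4 * t * (1 - t)) ^ β) (c := 1 / 2) (by norm_num) (1 / 2)
    norm_num at h3
    rw [← h3]
    refine intervalIntegral.integral_congr fun s _ => ?_
    congr 2
    ring
  have h4 : ∫ t in (0 : ℝ)..1, P.eval t ^ 2 * (4 * t * (1 - t)) ^ β ≤
      4 ^ β * ∫ t in (0 : ℝ)..1, P.eval t ^ 2 * t ^ β := by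
    rw [← intervalIntegral.integral_const_mul]
    have hc : Continuous fun t : ℝ => P.eval t ^ 2 := P.continuous.pow 2
    refine intervalIntegral.integral_mono_on (by norm_num)
      ((hc.mul (Continuous.rpow_const (by fun_prop) fun _ => Or.inr hβ)).intervalIntegrable _ _)
      (((hc.mul (Continuous.rpow_const continuous_id fun _ => Or.inr hβ)).const_mul
        (4 ^ β : ℝ)).intervalIntegrable _ _) fun t ht => ?_
    have h5 : (4 * t * (1 - t)) ^ β ≤ 4 ^ β * t ^ β := by
      rw [← Real.mul_rpow (by norm_num) ht.1]
      refine Real.rpow_le_rpow (mul_nonneg (by linarith [ht.1]) (by linarith [ht.2])) ?_ hβ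
      nlinarith [ht.1, ht.2]
    nlinarith [sq_nonneg (P.eval t)]
  have h6 : 0 ≤ K * ((m : ℝ) + 1) ^ (2 * β + 2) := by positivity
  norm_num at h2
  calc P.eval 0 ^ 2 ≤ _ := h1
    _ ≤ K * ((m : ℝ) + 1) ^ (2 * β + 2) *
        (2 * (4 ^ β * ∫ t in (0 : ℝ)..1, P.eval t ^ 2 * t ^ β)) := by
        refine mul_le_mul_of_nonneg_left ?_ h6
        rw [h2]
        linarith
    _ = _ := by ring

variable {d : ℕ} {ν : ℝ}

theorem lintegral_comp_add_smul {h : EuclideanSpace ℝ (Fin d) → ENNReal} (hh : Measurable h)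
    (a : EuclideanSpace ℝ (Fin d)) {t : ℝ} (ht : 0 < t) :
    ∫⁻ y, h (a + t • y) = ENNReal.ofReal ((t ^ d)⁻¹) * ∫⁻ z, h z := by
  have h1 : ∫⁻ y, h (a + t • y) = ∫⁻ z, h (a + z) ∂(Measure.map (t • ·) volume) :=
    (lintegral_map (hh.comp (measurable_const_add a)) (measurable_const_smul t)).symm
  rw [h1, Measure.map_addHaar_smul _ ht.ne', lintegral_smul_measure,
    lintegral_add_left_eq_self (fun z => h z) a, finrank_euclideanSpace_fin, abs_of_pos (by positivity)]
  rfl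

/-- Moving from x by a fraction t towards the ball of radius 1/2 brings the norm below 1 - t/2. If ν
≤ 1/2 the density is at least 1 there, whence the truncated exponent. -/
theorem weight_ge_of_mem_cone {x y : EuclideanSpace ℝ (Fin d)} (hx : ‖x‖ ≤ 1) (hy : ‖y‖ ≤ 1 / 2)
    {t : ℝ} (ht : t ∈ Set.Ioc (0 : ℝ) 1) :
    (1 - t) • x + t • y ∈ Metric.closedBall (0 : EuclideanSpace ℝ (Fin d)) 1 ∧
    (t / 2) ^ (max (ν - 1 / 2) 0) ≤ (1 - ‖(1 - t) • x + t • y‖ ^ 2) ^ (ν - 1 / 2) := by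
  have ht0 := ht.1
  have hz : ‖(1 - t) • x + t • y‖ ≤ 1 - t / 2 := by
    refine (norm_add_le _ _).trans ?_
    rw [norm_smul, norm_smul, Real.norm_of_nonneg (by linarith [ht.2]), Real.norm_of_nonneg ht0.le]
    nlinarith [ht.2]
  set z := (1 - t) • x + t • y
  have hz0 := norm_nonneg z
  have h1 : t / 2 ≤ 1 - ‖z‖ ^ 2 := by nlinarith [ht.2]
  refine ⟨by rw [mem_closedBall_zero_iff]; linarith, ?_⟩
  rcases le_total 0 (ν - 1 / 2) with h | h
  · rw [max_eq_left h]
    exact Real.rpow_le_rpow (by linarith) h1 h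
  · rw [max_eq_right h, Real.rpow_zero]
    exact Real.one_le_rpow_of_pos_of_le_one_of_nonpos (by linarith) (by nlinarith) h

theorem measurable_ballDensity (d : ℕ) (ν : ℝ) :
    Measurable fun x : EuclideanSpace ℝ (Fin d) => ENNReal.ofReal ((1 - ‖x‖ ^ 2) ^ (ν - 1 / 2)) :=
  (Measurable.pow_const (by fun_prop) _).ennreal_ofReal

theorem lintegral_ballWeight {h : EuclideanSpace ℝ (Fin d) → ENNReal} (hh : Measurable h) :
    ∫⁻ x, h x ∂(ballWeight d ν) = ∫⁻ x, (Metric.closedBall (0 : EuclideanSpace ℝ (Fin d)) 1).indicator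
      (fun x => ENNReal.ofReal ((1 - ‖x‖ ^ 2) ^ (ν - 1 / 2)) * h x) x := by
  rw [ballWeight, lintegral_withDensity_eq_lintegral_mul _ (measurable_ballDensity d ν) hh,
    lintegral_indicator Metric.isClosed_closedBall.measurableSet]
  rfl

/-- The first factor is the Jacobian of y ↦ (1 - t)x + ty, the second the lower bound for the
density on its image. -/
theorem setLIntegral_cone_le {h : EuclideanSpace ℝ (Fin d) → ENNReal} (hh : Measurable h)
    {x : EuclideanSpace ℝ (Fin d)} (hx : ‖x‖ ≤ 1) {t : ℝ} (ht : t ∈ Set.Ioc (0 : ℝ) 1) :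
    ∫⁻ y in Metric.closedBall (0 : EuclideanSpace ℝ (Fin d)) (1 / 2), h ((1 - t) • x + t • y) ≤
      ENNReal.ofReal ((t ^ d)⁻¹ * ((t / 2) ^ (max (ν - 1 / 2) 0))⁻¹) *
        ∫⁻ z, h z ∂(ballWeight d ν) := by
  have ht0 := ht.1
  set k := ((t / 2) ^ (max (ν - 1 / 2) 0)) with hk
  have hk0 : 0 < k := by positivity
  set g := (Metric.closedBall (0 : EuclideanSpace ℝ (Fin d)) 1).indicator
      (fun x => ENNReal.ofReal ((1 - ‖x‖ ^ 2) ^ (ν - 1 / 2)) * h x) with hg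
  have hgm : Measurable g := ((measurable_ballDensity d ν).mul hh).indicator
    Metric.isClosed_closedBall.measurableSet
  rw [lintegral_ballWeight hh, ENNReal.ofReal_mul (by positivity), mul_right_comm,
    ← lintegral_comp_add_smul hgm ((1 - t) • x) ht0, mul_comm, ← lintegral_const_mul' _ _ (by simp)]
  refine (lintegral_mono_ae ?_).trans (setLIntegral_le_lintegral _ _)
  refine (ae_restrict_iff' Metric.isClosed_closedBall.measurableSet).2
    (Filter.Eventually.of_forall fun y hy => ?_)
  rw [mem_closedBall_zero_iff] at hy
  obtain ⟨h1, h2⟩ := weight_ge_of_mem_cone (ν := ν) hx hy ht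
  rw [hg, Set.indicator_of_mem h1, ← mul_assoc, ← ENNReal.ofReal_mul (by positivity)]
  refine le_mul_of_one_le_left (zero_le) ?_
  rw [ENNReal.one_le_ofReal, inv_mul_eq_div, one_le_div hk0]
  exact h2

theorem ballWeight_univ_ne [IsProbabilityMeasure (ballLaw d ν)] :
    ballWeight d ν Set.univ ≠ 0 ∧ ballWeight d ν Set.univ ≠ ⊤ := by
  have h : (ballLaw d ν) Set.univ = 1 := measure_univ
  simp only [ballLaw, Measure.smul_apply, smul_eq_mul] at h
  constructor
  · intro h0; rw [h0] at h; simp at h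
  · intro h0; rw [h0] at h; simp at h

theorem lintegral_ballWeight_eq [IsProbabilityMeasure (ballLaw d ν)]
    (h : EuclideanSpace ℝ (Fin d) → ENNReal) :
    ∫⁻ z, h z ∂(ballWeight d ν) = ballWeight d ν Set.univ * ∫⁻ z, h z ∂(ballLaw d ν) := by
  obtain ⟨h0, h1⟩ := ballWeight_univ_ne (d := d) (ν := ν)
  rw [ballLaw, lintegral_smul_measure, smul_eq_mul, ← mul_assoc, ENNReal.mul_inv_cancel h0 h1,
    one_mul]

/-- The one-dimensional bound on the segment from x to y is averaged over y in the ball of radius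
1/2. The choice β = d - 1 + θ + η makes t^β absorb the Jacobian t^(-d) and the density factor
t^(-θ), leaving the integrable t^(η - 1). -/
theorem exists_sq_le_integral_ballLaw [IsProbabilityMeasure (ballLaw d ν)] (hd : 1 ≤ d)
    {η : ℝ} (hη : 0 < η) :
    ∃ K, 0 < K ∧ ∀ (m : ℕ), ∀ p ∈ polySpace d m,
      ∀ x ∈ Metric.closedBall (0 : EuclideanSpace ℝ (Fin d)) 1,
        p x ^ 2 ≤ K * ((m : ℝ) + 1) ^ (2 * (d + max (ν - 1 / 2) 0 + η)) *
          ∫ y, p y ^ 2 ∂(ballLaw d ν) := by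
  set θ := max (ν - 1 / 2) 0 with hθ
  have hθ0 : 0 ≤ θ := le_max_right _ _
  have hd1 : (1 : ℝ) ≤ d := by exact_mod_cast hd
  obtain ⟨K, hK, hseg⟩ := exists_eval_zero_sq_le (β := d - 1 + θ + η) (by linarith)
  set β := (d : ℝ) - 1 + θ + η with hβ
  have hβ0 : 0 ≤ β := by rw [hβ]; linarith
  obtain ⟨hZ0, hZ1⟩ := ballWeight_univ_ne (d := d) (ν := ν)
  set Z := (ballWeight d ν Set.univ).toReal with hZ
  have hZpos : 0 < Z := ENNReal.toReal_pos hZ0 hZ1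
  set Bh := Metric.closedBall (0 : EuclideanSpace ℝ (Fin d)) (1 / 2) with hBh
  have hV0 : volume Bh ≠ 0 := (Metric.measure_closedBall_pos _ _ (by norm_num)).ne'
  have hV1 : volume Bh ≠ ⊤ := measure_closedBall_lt_top.ne
  set V := (volume Bh).toReal with hV
  have hVpos : 0 < V := ENNReal.toReal_pos hV0 hV1
  refine ⟨K * (d : ℝ) ^ (2 * β + 2) * 2 ^ θ * η⁻¹ * Z / V, by positivity, fun m p hp x hx => ?_⟩
  rw [mem_closedBall_zero_iff] at hx
  have hpc := continuous_of_mem_polySpace hp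
  set L := K * (((d * m : ℕ) : ℝ) + 1) ^ (2 * β + 2) with hL
  have hL0 : 0 < L := by positivity
  set I := ∫ y, p y ^ 2 ∂(ballLaw d ν) with hI
  have hI0 : 0 ≤ I := integral_nonneg fun y => sq_nonneg _
  have hIl : ∫⁻ z, ENNReal.ofReal (p z ^ 2) ∂(ballWeight d ν) = ENNReal.ofReal (Z * I) := by
    rw [lintegral_ballWeight_eq, ENNReal.ofReal_mul hZpos.le, hZ, ENNReal.ofReal_toReal hZ1, hI,
      ofReal_integral_eq_lintegral_ofReal _ (Filter.Eventually.of_forall fun y => sq_nonneg _)]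
    obtain ⟨c, hc⟩ := exists_bound_of_mem_polySpace hp
    refine Integrable.of_bound (hpc.pow 2).aestronglyMeasurable (c ^ 2) ?_
    filter_upwards [ae_mem_ball d ν] with y hy
    rw [norm_pow]
    exact pow_le_pow_left₀ (norm_nonneg _) (hc y hy) 2
  have hpt : ∀ y : EuclideanSpace ℝ (Fin d), ENNReal.ofReal (p x ^ 2) ≤ ENNReal.ofReal L *
      ∫⁻ t in Set.Ioc (0 : ℝ) 1, ENNReal.ofReal (p ((1 - t) • x + t • y) ^ 2 * t ^ β) := by
    intro y
    obtain ⟨P, hP, hPe⟩ := exists_polynomial_on_line hp x (y - x)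
    have hPe' : ∀ t, P.eval t = p ((1 - t) • x + t • y) := fun t => by
      rw [hPe]; congr 1; rw [smul_sub, sub_smul, one_smul]; abel
    have h1 := hseg _ P hP
    rw [← hL] at h1
    have hcont : Continuous fun t : ℝ => P.eval t ^ 2 * t ^ β :=
      (P.continuous.pow 2).mul (Continuous.rpow_const continuous_id fun _ => Or.inr hβ0)
    have h2 : ENNReal.ofReal (∫ t in (0 : ℝ)..1, P.eval t ^ 2 * t ^ β) =
        ∫⁻ t in Set.Ioc (0 : ℝ) 1, ENNReal.ofReal (P.eval t ^ 2 * t ^ β) := by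
      rw [intervalIntegral.integral_of_le (by norm_num)]
      refine ofReal_integral_eq_lintegral_ofReal ?_ ?_
      · exact (hcont.integrableOn_Icc (a := 0) (b := 1)).mono_set Set.Ioc_subset_Icc_self
      · refine (ae_restrict_iff' measurableSet_Ioc).2 (Filter.Eventually.of_forall fun t ht => ?_)
        exact mul_nonneg (sq_nonneg _) (Real.rpow_nonneg ht.1.le _)
    simp only [← hPe', ← h2]
    rw [← ENNReal.ofReal_mul hL0.le]
    refine ENNReal.ofReal_le_ofReal ?_
    rw [hPe 0, zero_smul, add_zero] at h1
    exact h1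
  have hswap : ENNReal.ofReal (p x ^ 2) * volume Bh ≤ ENNReal.ofReal L *
      ∫⁻ t in Set.Ioc (0 : ℝ) 1, ∫⁻ y in Bh,
        ENNReal.ofReal (p ((1 - t) • x + t • y) ^ 2 * t ^ β) := by
    have hm : Measurable fun q : EuclideanSpace ℝ (Fin d) × ℝ =>
        ENNReal.ofReal (p ((1 - q.2) • x + q.2 • q.1) ^ 2 * q.2 ^ β) := by
      refine Measurable.ennreal_ofReal (Measurable.mul ?_ (measurable_snd.pow_const _))
      exact ((hpc.comp (by fun_prop)).pow 2).measurable
    rw [← setLIntegral_const, lintegral_lintegral_swap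
      (μ := volume.restrict (Set.Ioc (0 : ℝ) 1)) (ν := volume.restrict Bh)
      (f := fun t y => ENNReal.ofReal (p ((1 - t) • x + t • y) ^ 2 * t ^ β))
      (hm.comp measurable_swap).aemeasurable, ← lintegral_const_mul' _ _ (by simp)]
    exact lintegral_mono fun y => hpt y
  have hinner : ∀ t ∈ Set.Ioc (0 : ℝ) 1, ∫⁻ y in Bh,
      ENNReal.ofReal (p ((1 - t) • x + t • y) ^ 2 * t ^ β) ≤
        ENNReal.ofReal (2 ^ θ * (Z * I) * t ^ (η - 1)) := by
    intro t ht
    have ht0 := ht.1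
    have h1 := setLIntegral_cone_le (ν := ν) (h := fun z => ENNReal.ofReal (p z ^ 2))
      (hpc.pow 2).measurable.ennreal_ofReal hx ht
    rw [hIl, ← ENNReal.ofReal_mul (by positivity)] at h1
    have h2 : ∀ y, ENNReal.ofReal (p ((1 - t) • x + t • y) ^ 2 * t ^ β) =
        ENNReal.ofReal (t ^ β) * ENNReal.ofReal (p ((1 - t) • x + t • y) ^ 2) := fun y => by
      rw [mul_comm, ENNReal.ofReal_mul (by positivity)]
    simp only [h2]
    rw [lintegral_const_mul' _ _ (by simp)]
    refine (mul_le_mul_right h1 _).trans ?_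
    rw [← ENNReal.ofReal_mul (by positivity)]
    refine ENNReal.ofReal_le_ofReal (le_of_eq ?_)
    have h3 : t ^ β = t ^ (η - 1) * (t ^ d * t ^ θ) := by
      rw [← Real.rpow_natCast t d, ← Real.rpow_add ht0, ← Real.rpow_add ht0]
      congr 1; rw [hβ]; ring
    rw [← hθ, h3, Real.div_rpow ht0.le (by norm_num)]
    field_simp
  have hfinal : ENNReal.ofReal (p x ^ 2) * volume Bh ≤
      ENNReal.ofReal L * ENNReal.ofReal (2 ^ θ * (Z * I) * η⁻¹) := by
    refine hswap.trans (mul_le_mul_right ?_ _)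
    refine (setLIntegral_mono' measurableSet_Ioc hinner).trans (le_of_eq ?_)
    have hint : IntervalIntegrable (fun t : ℝ => 2 ^ θ * (Z * I) * t ^ (η - 1)) volume 0 1 :=
      (intervalIntegral.intervalIntegrable_rpow' (by linarith)).const_mul _
    rw [← ofReal_integral_eq_lintegral_ofReal
      ((intervalIntegrable_iff_integrableOn_Ioc_of_le (by norm_num)).1 hint)]
    · rw [← intervalIntegral.integral_of_le (by norm_num), intervalIntegral.integral_const_mul,
        integral_rpow (Or.inl (by linarith))]
      congr 1
      rw [sub_add_cancel, Real.one_rpow, Real.zero_rpow hη.ne']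
      ring
    · refine (ae_restrict_iff' measurableSet_Ioc).2 (Filter.Eventually.of_forall fun t ht => ?_)
      have := ht.1
      have : 0 ≤ t ^ (η - 1) := by positivity
      simp only [Pi.zero_apply]
      positivity
  have hreal : p x ^ 2 * V ≤ L * (2 ^ θ * (Z * I) * η⁻¹) := by
    rw [← ENNReal.ofReal_toReal hV1, ← hV, ← ENNReal.ofReal_mul (sq_nonneg _),
      ← ENNReal.ofReal_mul hL0.le, ENNReal.ofReal_le_ofReal_iff (by positivity)] at hfinal
    exact hfinal
  have hLle : L ≤ K * ((d : ℝ) ^ (2 * β + 2) * ((m : ℝ) + 1) ^ (2 * β + 2)) := by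
    rw [hL, ← Real.mul_rpow (by positivity) (by positivity)]
    refine mul_le_mul_of_nonneg_left (Real.rpow_le_rpow (by positivity) ?_ (by linarith)) hK.le
    push_cast
    nlinarith
  rw [show 2 * (d + θ + η) = 2 * β + 2 by rw [hβ]; ring]
  rw [← le_div_iff₀ hVpos] at hreal
  refine hreal.trans ?_
  rw [div_mul_eq_mul_div, div_mul_eq_mul_div, div_le_div_iff_of_pos_right hVpos]
  calc L * (2 ^ θ * (Z * I) * η⁻¹)
      ≤ K * ((d : ℝ) ^ (2 * β + 2) * ((m : ℝ) + 1) ^ (2 * β + 2)) * (2 ^ θ * (Z * I) * η⁻¹) := by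
        refine mul_le_mul_of_nonneg_right hLle (by positivity)
    _ = _ := by ring

end PointEvaluation

end BallGraph

/-! ### Null sets, slices and rotations -/

namespace BallGraph

section Slicing

variable {d : ℕ} {ν : ℝ}

theorem ae_ballWeight_of_ae_volume {Q : EuclideanSpace ℝ (Fin d) → Prop}
    (h : ∀ᵐ x, Q x) : ∀ᵐ x ∂(ballLaw d ν), Q x := by
  refine Measure.ae_smul_measure ?_ _
  exact (withDensity_absolutelyContinuous _ _).ae_le (ae_restrict_of_ae h)

theorem ae_volume_of_ae_gegenbauerMeasure {γ : ℝ} {Q : ℝ → Prop}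
    (h : ∀ᵐ t ∂(gegenbauerMeasure γ), Q t) : ∀ᵐ t, t ∈ Set.Ioo (-1 : ℝ) 1 → Q t := by
  rw [gegenbauerMeasure, ae_withDensity_iff (measurable_gegenbauerDensity γ),
    ae_restrict_iff' measurableSet_Ioc] at h
  filter_upwards [h] with t ht hIoo
  refine ht (Set.Ioo_subset_Ioc_self hIoo) ?_
  have : 0 < 1 - t ^ 2 := by nlinarith [hIoo.1, hIoo.2]
  exact (ENNReal.ofReal_pos.2 (Real.rpow_pos_of_pos this _)).ne'

/-- A property of almost every `t ∈ [-1, 1]` holds at almost every scalar product. -/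
theorem ae_prod_inner {γ : ℝ} (hd : 1 ≤ d) {s : Set ℝ} (hs : MeasurableSet s)
    (h : ∀ᵐ t ∂(gegenbauerMeasure γ), t ∈ s) :
    ∀ᵐ z ∂((ballLaw d ν).prod (ballLaw d ν)), inner ℝ z.1 z.2 ∈ s := by
  have hne : Nonempty (Fin d) := ⟨⟨0, hd⟩⟩
  have hmeas : MeasurableSet {z : EuclideanSpace ℝ (Fin d) × EuclideanSpace ℝ (Fin d) |
      inner ℝ z.1 z.2 ∈ s} := by
    have : Measurable fun z : EuclideanSpace ℝ (Fin d) × EuclideanSpace ℝ (Fin d) =>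
      inner ℝ z.1 z.2 := by fun_prop
    exact this hs
  have h1 := ae_volume_of_ae_gegenbauerMeasure h
  refine (Measure.ae_prod_mem_iff_ae_ae_mem hmeas).2 ?_
  have hx0 : ∀ᵐ x ∂(ballLaw d ν), x ≠ 0 :=
    ae_ballWeight_of_ae_volume (Measure.ae_ne volume 0)
  have hx1 : ∀ᵐ x ∂(ballLaw d ν), x ∉ Metric.sphere (0 : EuclideanSpace ℝ (Fin d)) 1 :=
    ae_ballWeight_of_ae_volume (measure_eq_zero_iff_ae_notMem.1
      (Measure.addHaar_sphere volume 0 1))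
  filter_upwards [ae_mem_ball d ν, hx0, hx1] with x hx hx0 hx1
  rw [mem_closedBall_zero_iff] at hx
  rw [mem_sphere_zero_iff_norm] at hx1
  have hx2 : ‖x‖ < 1 := lt_of_le_of_ne hx hx1
  -- For x ≠ 0 the linear form ⟨x, ·⟩ pulls null sets back to null sets; ‖x‖ < 1 keeps its values on
  -- the ball inside (-1, 1), where the Gegenbauer density is positive.
  have hsurj : Function.Surjective (innerₛₗ ℝ x : EuclideanSpace ℝ (Fin d) →ₗ[ℝ] ℝ) := by
    refine LinearMap.surjective fun h0 => hx0 ?_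
    have := congrArg (fun L : EuclideanSpace ℝ (Fin d) →ₗ[ℝ] ℝ => L x) h0
    simpa using this
  have h2 : ∀ᵐ y : EuclideanSpace ℝ (Fin d), innerₛₗ ℝ x y ∈ (Set.Ioo (-1 : ℝ) 1)ᶜ ∪ s := by
    refine (ae_comp_linearMap_mem_iff _ volume volume hsurj
      (measurableSet_Ioo.compl.union hs)).2 ?_
    filter_upwards [h1] with t ht
    by_cases hI : t ∈ Set.Ioo (-1 : ℝ) 1
    · exact Or.inr (ht hI)
    · exact Or.inl hI
  filter_upwards [ae_ballWeight_of_ae_volume (ν := ν) h2, ae_mem_ball d ν] with y hy hyb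
  rw [mem_closedBall_zero_iff] at hyb
  refine hy.resolve_left fun hc => hc (abs_lt.1 ?_)
  calc |inner ℝ x y| ≤ ‖x‖ * ‖y‖ := abs_real_inner_le_norm x y
    _ ≤ ‖x‖ * 1 := by gcongr
    _ < 1 := by linarith

theorem setLIntegral_norm_rpow_lt_top {E : Type*} [NormedAddCommGroup E] [NormedSpace ℝ E]
    [Nontrivial E] [FiniteDimensional ℝ E] [MeasurableSpace E] [BorelSpace E] (μ : Measure E)
    [μ.IsAddHaarMeasure] {θ : ℝ} (hθ : θ < Module.finrank ℝ E) :
    ∫⁻ x in Metric.closedBall (0 : E) 1, ENNReal.ofReal (‖x‖ ^ (-θ)) ∂μ < ⊤ := by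
  have h1 : IntegrableOn (fun x : E => ‖x‖ ^ (-θ)) (Metric.ball 0 2) μ := by
    rw [integrableOn_fun_norm_addHaar μ (f := fun r => r ^ (-θ))]
    have hpos : 0 < Module.finrank ℝ E := Module.finrank_pos
    have h2 : IntervalIntegrable (fun r : ℝ => r ^ ((Module.finrank ℝ E : ℝ) - 1 - θ)) volume 0 2 :=
      intervalIntegral.intervalIntegrable_rpow' (by linarith)
    rw [intervalIntegrable_iff_integrableOn_Ioo_of_le (by norm_num)] at h2
    refine h2.congr_fun (fun r hr => ?_) measurableSet_Ioo
    have hr0 : 0 < r := hr.1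
    simp only [smul_eq_mul]
    rw [← Real.rpow_natCast, ← Real.rpow_add hr0, Nat.cast_sub hpos, Nat.cast_one, sub_eq_add_neg _ θ]
  have h3 := (h1.mono_set (Metric.closedBall_subset_ball (by norm_num : (1 : ℝ) < 2))).2
  refine lt_of_le_of_lt (lintegral_mono fun x => ?_) h3
  exact (Real.ofReal_le_enorm _)

/-- Integration over the Euclidean space by slices orthogonal to the first coordinate. -/
theorem lintegral_slice {k : ℕ} {h : ℝ → (Fin k → ℝ) → ENNReal}
    (hh : Measurable (Function.uncurry h)) :
    ∫⁻ z : EuclideanSpace ℝ (Fin (k + 1)), h (z 0) (fun i => z i.succ) =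
      ∫⁻ s : ℝ, ∫⁻ y : Fin k → ℝ, h s y := by
  have h1 := (volume_preserving_piFinSuccAbove (fun _ : Fin (k + 1) => ℝ) 0).comp
    (PiLp.volume_preserving_ofLp (Fin (k + 1)))
  have h2 : Measurable fun q : ℝ × (Fin k → ℝ) => h q.1 q.2 := hh
  have h3 := h1.lintegral_comp h2
  have h4 : ∫⁻ s : ℝ, ∫⁻ y : Fin k → ℝ, h s y =
      ∫⁻ q : ℝ × (Fin k → ℝ), h q.1 q.2 := (lintegral_prod _ h2.aemeasurable).symm
  rw [h4]
  exact h3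

/-- Rotation invariance: only one coordinate and the norm matter. -/
theorem lintegral_inner_norm {k : ℕ} {H : ℝ → ℝ → ENNReal} (hH : Measurable (Function.uncurry H))
    {x : EuclideanSpace ℝ (Fin (k + 1))} (hx : x ≠ 0) :
    ∫⁻ y : EuclideanSpace ℝ (Fin (k + 1)), H (inner ℝ x y) ‖y‖ =
      ∫⁻ z : EuclideanSpace ℝ (Fin (k + 1)), H (‖x‖ * z 0) ‖z‖ := by
  have hx' : ‖x‖ ≠ 0 := norm_ne_zero_iff.2 hx
  obtain ⟨b, hb⟩ := Orthonormal.exists_orthonormalBasis_extension_of_card_eq (𝕜 := ℝ)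
    (E := EuclideanSpace ℝ (Fin (k + 1))) (ι := Fin (k + 1)) (by simp)
    (v := fun _ => ‖x‖⁻¹ • x) (s := {0}) (by
      refine ⟨fun i => ?_, fun i j hij => ?_⟩
      · simp [norm_smul, hx']
      · exact absurd (Subsingleton.elim i j) hij)
  have hb0 : b 0 = ‖x‖⁻¹ • x := hb 0 rfl
  have h1 := b.measurePreserving_repr.lintegral_comp
    (f := fun z : EuclideanSpace ℝ (Fin (k + 1)) => H (‖x‖ * z 0) ‖z‖)
    (hH.comp (by fun_prop : Measurable fun z : EuclideanSpace ℝ (Fin (k + 1)) =>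
      (‖x‖ * z 0, ‖z‖)))
  rw [← h1]
  refine lintegral_congr fun y => ?_
  rw [LinearIsometryEquiv.norm_map, b.repr_apply_apply, hb0, real_inner_smul_left,
    mul_inv_cancel_left₀ hx']

theorem lintegral_mul_left_eq {h : ℝ → ENNReal} (hh : Measurable h) {r : ℝ} (hr : r ≠ 0) :
    ∫⁻ s, h (r * s) = ENNReal.ofReal |r|⁻¹ * ∫⁻ t, h t := by
  have h1 : ∫⁻ s, h (r * s) = ∫⁻ t, h t ∂(Measure.map (r * ·) volume) :=
    (lintegral_map hh (measurable_const_mul r)).symm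
  rw [h1, Real.map_volume_mul_left hr, lintegral_smul_measure, abs_inv]
  rfl

theorem lintegral_gegenbauerMeasure {γ : ℝ} {g : ℝ → ENNReal} (hg : Measurable g) :
    ∫⁻ t, g t ∂(gegenbauerMeasure γ) = ∫⁻ t, (Set.Ioo (-1 : ℝ) 1).indicator
      (fun t => ENNReal.ofReal ((1 - t ^ 2) ^ (γ - 1 / 2)) * g t) t := by
  rw [gegenbauerMeasure, lintegral_withDensity_eq_lintegral_mul _ (measurable_gegenbauerDensity γ)
    hg, lintegral_indicator measurableSet_Ioo, restrict_Ioo_eq_restrict_Ioc]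
  rfl

end Slicing

end BallGraph

/-! ### The law of the scalar product for ν > 1/2 -/

namespace BallGraph

section ScalarProductLaw

variable {ν : ℝ}

theorem volume_box {k : ℕ} {ρ : ℝ} (hρ : 0 ≤ ρ) :
    volume {y : Fin k → ℝ | ∀ i, |y i| ≤ ρ} = ENNReal.ofReal ((2 * ρ) ^ k) := by
  have h1 : {y : Fin k → ℝ | ∀ i, |y i| ≤ ρ} = Set.pi Set.univ fun _ => Set.Icc (-ρ) ρ := by
    ext y
    simp only [Set.mem_ofPred_eq, Set.mem_pi, Set.mem_univ, forall_true_left, Set.mem_Icc, abs_le]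
  rw [h1, volume_pi_pi]
  simp only [Real.volume_Icc, Finset.prod_const, Finset.card_univ, Fintype.card_fin]
  rw [ENNReal.ofReal_pow (by positivity)]
  congr 2
  ring

/-- After a rotation the scalar product is ‖x‖ s, with s the first coordinate. Integrating over the
slice raises the exponent of 1 - s² from ν - 1/2 to γ - 1/2; the substitution t = ‖x‖ s costs ‖x‖⁻¹
and only increases 1 - s² to 1 - t². -/
theorem lintegral_inner_ballWeight_le {k : ℕ} (hν : 1 / 2 < ν) {g : ℝ → ENNReal}
    (hg : Measurable g) {x : EuclideanSpace ℝ (Fin (k + 1))} (hx0 : x ≠ 0) (hx1 : ‖x‖ ≤ 1) :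
    ∫⁻ y, g (inner ℝ x y) ∂(ballWeight (k + 1) ν) ≤
      ENNReal.ofReal (2 ^ k * ‖x‖⁻¹) * ∫⁻ t, g t ∂(gegenbauerMeasure (gammaWeight (k + 1) ν)) := by
  set γ := gammaWeight (k + 1) ν with hγ
  have hγe : γ - 1 / 2 = (ν - 1 / 2) + k / 2 := by
    rw [hγ, gammaWeight]; push_cast; ring
  have hγ0 : 0 < γ - 1 / 2 := by rw [hγe]; have : (0 : ℝ) ≤ k := k.cast_nonneg; linarith
  set r := ‖x‖ with hr
  have hr0 : 0 < r := norm_pos_iff.2 hx0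
  let H : ℝ → ℝ → ENNReal := fun a n =>
    (Set.Iic (1 : ℝ)).indicator (fun n => ENNReal.ofReal ((1 - n ^ 2) ^ (ν - 1 / 2))) n * g a
  have hH : Measurable (Function.uncurry H) := by
    refine Measurable.mul ?_ (hg.comp measurable_fst)
    refine Measurable.comp (g := (Set.Iic (1 : ℝ)).indicator
      (fun n => ENNReal.ofReal ((1 - n ^ 2) ^ (ν - 1 / 2)))) ?_ measurable_snd
    exact ((Measurable.pow_const (by fun_prop) _).ennreal_ofReal).indicator measurableSet_Iic
  have h1 : ∫⁻ y, g (inner ℝ x y) ∂(ballWeight (k + 1) ν) =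
      ∫⁻ y : EuclideanSpace ℝ (Fin (k + 1)), H (inner ℝ x y) ‖y‖ := by
    rw [lintegral_ballWeight (h := fun y => g (inner ℝ x y)) (hg.comp (by fun_prop))]
    refine lintegral_congr fun y => ?_
    by_cases hy : ‖y‖ ≤ 1
    · rw [Set.indicator_of_mem (mem_closedBall_zero_iff.2 hy)]
      simp [H, Set.indicator_of_mem (Set.mem_Iic.2 hy)]
    · rw [Set.indicator_of_notMem (by rwa [mem_closedBall_zero_iff])]
      simp [H, Set.indicator_of_notMem (show ‖y‖ ∉ Set.Iic (1 : ℝ) from hy)]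
  rw [h1, lintegral_inner_norm hH hx0]
  let T : Set (ℝ × (Fin k → ℝ)) := {q | ∀ i, |q.2 i| ≤ Real.sqrt (1 - q.1 ^ 2)}
  have hT : MeasurableSet T := by
    have : T = ⋂ i, {q | |q.2 i| ≤ Real.sqrt (1 - q.1 ^ 2)} := by
      ext q; simp [T]
    rw [this]
    refine MeasurableSet.iInter fun i => measurableSet_le (by fun_prop) (by fun_prop)
  let c : ℝ → ENNReal := fun s =>
    (Set.Ioo (-1 : ℝ) 1).indicator (fun s => ENNReal.ofReal ((1 - s ^ 2) ^ (ν - 1 / 2))) s *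
      g (r * s)
  have hc : Measurable c := by
    refine Measurable.mul ?_ (hg.comp (measurable_const_mul r))
    exact ((Measurable.pow_const (by fun_prop) _).ennreal_ofReal).indicator measurableSet_Ioo
  let h : ℝ → (Fin k → ℝ) → ENNReal := fun s y => c s * T.indicator (fun _ => 1) (s, y)
  have hh : Measurable (Function.uncurry h) := by
    refine Measurable.mul (hc.comp measurable_fst) ?_
    exact (measurable_const.indicator hT).comp (by fun_prop)
  -- On a slice the density is bounded by its value at the centre, and the slice of the ball is
  -- enclosed in a cube of side 2√(1 - s²); hence the constant 2^k.
  have h2 : ∫⁻ z : EuclideanSpace ℝ (Fin (k + 1)), H (r * z 0) ‖z‖ ≤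
      ∫⁻ z : EuclideanSpace ℝ (Fin (k + 1)), h (z 0) (fun i => z i.succ) := by
    refine lintegral_mono fun z => ?_
    by_cases hz : ‖z‖ ≤ 1
    · have hsum : ‖z‖ ^ 2 = z 0 ^ 2 + ∑ i : Fin k, z i.succ ^ 2 := by
        rw [EuclideanSpace.norm_sq_eq, Fin.sum_univ_succ]
        simp
      have hz2 : ‖z‖ ^ 2 ≤ 1 := pow_le_one₀ (norm_nonneg _) hz
      have hs0 : 0 ≤ ∑ i : Fin k, z i.succ ^ 2 := Finset.sum_nonneg fun i _ => sq_nonneg _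
      have hle : (1 - ‖z‖ ^ 2) ^ (ν - 1 / 2) ≤ (1 - z 0 ^ 2) ^ (ν - 1 / 2) :=
        Real.rpow_le_rpow (by linarith) (by linarith) (by linarith)
      have hmem : (z 0, fun i : Fin k => z i.succ) ∈ T := by
        intro i
        refine Real.abs_le_sqrt ?_
        have := Finset.single_le_sum (f := fun i : Fin k => z i.succ ^ 2)
          (fun i _ => sq_nonneg _) (Finset.mem_univ i)
        simp only at this ⊢
        linarith
      simp only [H, h, c, Set.indicator_of_mem (Set.mem_Iic.2 hz), Set.indicator_of_mem hmem, mul_one]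
      refine mul_le_mul_left ?_ _
      by_cases hI : z 0 ∈ Set.Ioo (-1 : ℝ) 1
      · rw [Set.indicator_of_mem hI]
        exact ENNReal.ofReal_le_ofReal hle
      · have h3 : 1 ≤ z 0 ^ 2 := by
          by_contra hcon
          exact hI (abs_lt.1 ((sq_lt_one_iff_abs_lt_one _).1 (not_le.1 hcon)))
        have h4 : 1 - ‖z‖ ^ 2 = 0 := by linarith
        -- The density vanishes on the sphere because the exponent ν - 1/2 is positive.
        rw [h4, Real.zero_rpow (by linarith)]
        simp
    · simp [H, Set.indicator_of_notMem (show ‖z‖ ∉ Set.Iic (1 : ℝ) from hz)]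
  refine h2.trans ?_
  rw [lintegral_slice hh, lintegral_gegenbauerMeasure hg]
  set φ := (Set.Ioo (-1 : ℝ) 1).indicator
      (fun t => ENNReal.ofReal ((1 - t ^ 2) ^ (γ - 1 / 2)) * g t) with hφ
  have hφm : Measurable φ := ((measurable_gegenbauerDensity γ).mul hg).indicator measurableSet_Ioo
  rw [ENNReal.ofReal_mul (by positivity), mul_assoc, ← abs_of_pos hr0,
    ← lintegral_mul_left_eq hφm hr0.ne', ← lintegral_const_mul' _ _ (by simp)]
  refine lintegral_mono fun s => ?_
  simp only [h]
  have hTs : Measurable fun y : Fin k → ℝ => T.indicator (fun _ => (1 : ENNReal)) (s, y) :=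
    (measurable_const.indicator hT).comp (by fun_prop)
  have hbox : ∫⁻ y : Fin k → ℝ, T.indicator (fun _ => (1 : ENNReal)) (s, y) =
      ENNReal.ofReal ((2 * Real.sqrt (1 - s ^ 2)) ^ k) := by
    rw [← volume_box (Real.sqrt_nonneg _)]
    have hm : MeasurableSet {y : Fin k → ℝ | ∀ i, |y i| ≤ Real.sqrt (1 - s ^ 2)} :=
      hT.preimage (by fun_prop : Measurable fun y : Fin k → ℝ => (s, y))
    rw [← lintegral_indicator_one hm]
    rfl
  rw [lintegral_const_mul _ hTs, hbox]
  by_cases hs : s ∈ Set.Ioo (-1 : ℝ) 1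
  · have hpos : 0 < 1 - s ^ 2 := by nlinarith [hs.1, hs.2]
    have hsr : (r * s) ^ 2 ≤ s ^ 2 := by
      rw [mul_pow]
      exact mul_le_of_le_one_left (sq_nonneg s) (pow_le_one₀ hr0.le hx1)
    have hrs : r * s ∈ Set.Ioo (-1 : ℝ) 1 :=
      abs_lt.1 ((sq_lt_one_iff_abs_lt_one _).1 (by linarith))
    rw [hφ, Set.indicator_of_mem hrs]
    simp only [c, Set.indicator_of_mem hs]
    rw [mul_right_comm, ← mul_assoc, ← ENNReal.ofReal_mul (by positivity),
      ← ENNReal.ofReal_mul (by positivity)]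
    refine mul_le_mul_left (ENNReal.ofReal_le_ofReal ?_) _
    calc (1 - s ^ 2) ^ (ν - 1 / 2) * (2 * Real.sqrt (1 - s ^ 2)) ^ k
        = 2 ^ k * ((1 - s ^ 2) ^ (ν - 1 / 2) * Real.sqrt (1 - s ^ 2) ^ k) := by
          rw [mul_pow]; ring
      _ = 2 ^ k * (1 - s ^ 2) ^ (γ - 1 / 2) := by
          rw [Real.sqrt_eq_rpow, ← Real.rpow_natCast ((1 - s ^ 2) ^ (1 / 2 : ℝ)),
            ← Real.rpow_mul hpos.le, ← Real.rpow_add hpos, hγe]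
          congr 2
          ring
      _ ≤ _ := by
          refine mul_le_mul_of_nonneg_left ?_ (by positivity)
          exact Real.rpow_le_rpow hpos.le (by linarith) hγ0.le
  · simp [c, Set.indicator_of_notMem hs]

/-- ‖x‖⁻¹ is integrable near the origin in dimension at least two, and the density is at most 1 when
ν > 1/2. -/
theorem lintegral_norm_inv_ballLaw_ne_top {k : ℕ} (hk : 1 ≤ k) (hν : 1 / 2 < ν)
    [IsProbabilityMeasure (ballLaw (k + 1) ν)] :
    ∫⁻ x, ENNReal.ofReal ‖x‖⁻¹ ∂(ballLaw (k + 1) ν) ≠ ⊤ := by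
  obtain ⟨hZ0, hZ1⟩ := ballWeight_univ_ne (d := k + 1) (ν := ν)
  rw [ballLaw, lintegral_smul_measure, smul_eq_mul]
  refine ENNReal.mul_ne_top (ENNReal.inv_ne_top.2 hZ0) ?_
  rw [lintegral_ballWeight (by fun_prop), lintegral_indicator Metric.isClosed_closedBall.measurableSet]
  have h1 := setLIntegral_norm_rpow_lt_top (volume : Measure (EuclideanSpace ℝ (Fin (k + 1))))
    (θ := 1) (by
      rw [finrank_euclideanSpace_fin]
      exact_mod_cast Nat.lt_succ_of_le hk)
  refine (lt_of_le_of_lt (setLIntegral_mono' Metric.isClosed_closedBall.measurableSet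
    fun x hx => ?_) h1).ne
  rw [mem_closedBall_zero_iff] at hx
  rw [Real.rpow_neg_one]
  refine mul_le_of_le_one_left zero_le ?_
  rw [ENNReal.ofReal_le_one]
  exact Real.rpow_le_one (by nlinarith [norm_nonneg x]) (by nlinarith [norm_nonneg x])
    (by linarith)

/-- For `ν > 1/2` and dimension at least two, the law of the scalar product of two independent
points has a bounded density with respect to the Gegenbauer measure. -/
theorem exists_lintegral_inner_prod_le {k : ℕ} (hk : 1 ≤ k) (hν : 1 / 2 < ν)
    [IsProbabilityMeasure (ballLaw (k + 1) ν)] :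
    ∃ K : ENNReal, K ≠ ⊤ ∧ ∀ g : ℝ → ENNReal, Measurable g →
      ∫⁻ z, g (inner ℝ z.1 z.2) ∂((ballLaw (k + 1) ν).prod (ballLaw (k + 1) ν)) ≤
        K * ∫⁻ t, g t ∂(gegenbauerMeasure (gammaWeight (k + 1) ν)) := by
  obtain ⟨hZ0, hZ1⟩ := ballWeight_univ_ne (d := k + 1) (ν := ν)
  set Z := ballWeight (k + 1) ν Set.univ with hZ
  refine ⟨Z⁻¹ * (ENNReal.ofReal (2 ^ k) * ∫⁻ x, ENNReal.ofReal ‖x‖⁻¹ ∂(ballLaw (k + 1) ν)),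
    ENNReal.mul_ne_top (ENNReal.inv_ne_top.2 hZ0) (ENNReal.mul_ne_top ENNReal.ofReal_ne_top
      (lintegral_norm_inv_ballLaw_ne_top hk hν)), fun g hg => ?_⟩
  set I := ∫⁻ t, g t ∂(gegenbauerMeasure (gammaWeight (k + 1) ν)) with hI
  have hgm : Measurable fun z : EuclideanSpace ℝ (Fin (k + 1)) × EuclideanSpace ℝ (Fin (k + 1)) =>
    g (inner ℝ z.1 z.2) := hg.comp (by fun_prop)
  rw [lintegral_prod _ hgm.aemeasurable]
  have h1 : ∀ᵐ x ∂(ballLaw (k + 1) ν), ∫⁻ y, g (inner ℝ x y) ∂(ballLaw (k + 1) ν) ≤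
      (Z⁻¹ * ENNReal.ofReal (2 ^ k) * I) * ENNReal.ofReal ‖x‖⁻¹ := by
    filter_upwards [ae_mem_ball (k + 1) ν,
      ae_ballWeight_of_ae_volume (ν := ν) (Measure.ae_ne volume 0)] with x hx hx0
    rw [mem_closedBall_zero_iff] at hx
    have h2 := lintegral_inner_ballWeight_le hν hg hx0 hx
    rw [ballLaw, lintegral_smul_measure, smul_eq_mul]
    refine (mul_le_mul_right h2 _).trans (le_of_eq ?_)
    rw [ENNReal.ofReal_mul (by positivity)]
    ring
  refine (lintegral_mono_ae h1).trans (le_of_eq ?_)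
  rw [lintegral_const_mul _ (by fun_prop)]
  ring

end ScalarProductLaw

end BallGraph

/-! ### Products of two weighted variables on the line -/

namespace BallGraph

section OneDimensional

variable {ν : ℝ}

/-- Since 1 - (ux)² ≤ (1 - x²) + (1 - u²), the larger summand is at least half of the left side. For
b < 0 this bounds its power by 2^(-b) ≤ 2 times that of 1 - (ux)²; for b ≥ 0 monotonicity suffices.
-/
theorem weight_mul_weight_le {b x u : ℝ} (hb : -1 < b) (hx : x ∈ Set.Ioo (-1 : ℝ) 1)
    (hu : u ∈ Set.Ioo (-1 : ℝ) 1) :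
    (1 - x ^ 2) ^ b * (1 - u ^ 2) ^ b ≤
      2 * (1 - (u * x) ^ 2) ^ b * ((1 - x ^ 2) ^ b + (1 - u ^ 2) ^ b) := by
  have hX : 0 < 1 - x ^ 2 := by nlinarith [hx.1, hx.2]
  have hU : 0 < 1 - u ^ 2 := by nlinarith [hu.1, hu.2]
  have hX1 : 1 - x ^ 2 ≤ 1 - (u * x) ^ 2 := by nlinarith [sq_nonneg x]
  have hU1 : 1 - u ^ 2 ≤ 1 - (u * x) ^ 2 := by nlinarith [sq_nonneg u]
  have hsum : 1 - (u * x) ^ 2 ≤ (1 - x ^ 2) + (1 - u ^ 2) := by nlinarith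
  have hP : 0 < 1 - (u * x) ^ 2 := by linarith
  have p1 : 0 < (1 - x ^ 2) ^ b := Real.rpow_pos_of_pos hX _
  have p2 : 0 < (1 - u ^ 2) ^ b := Real.rpow_pos_of_pos hU _
  have p3 : 0 < (1 - (u * x) ^ 2) ^ b := Real.rpow_pos_of_pos hP _
  rcases le_or_gt 0 b with h | h
  · have h1 : (1 - x ^ 2) ^ b ≤ (1 - (u * x) ^ 2) ^ b := Real.rpow_le_rpow hX.le hX1 h
    nlinarith [mul_pos p3 p1, mul_pos p3 p2, mul_le_mul_of_nonneg_right h1 p2.le]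
  · have key : ∀ v, 0 < v → 1 - (u * x) ^ 2 ≤ 2 * v → v ^ b ≤ 2 * (1 - (u * x) ^ 2) ^ b := by
      intro v hv hle
      have h1 : (2 * v) ^ b ≤ (1 - (u * x) ^ 2) ^ b :=
        Real.rpow_le_rpow_of_nonpos hP hle h.le
      rw [Real.mul_rpow (by norm_num) hv.le] at h1
      have h2 : (2 : ℝ)⁻¹ ≤ 2 ^ b := by
        rw [← Real.rpow_neg_one]
        exact Real.rpow_le_rpow_of_exponent_le (by norm_num) hb.le
      have h3 : 0 < v ^ b := Real.rpow_pos_of_pos hv _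
      nlinarith
    rcases le_total (1 - x ^ 2) (1 - u ^ 2) with hc | hc
    · have := key _ hU (by linarith)
      nlinarith [mul_pos p3 p1, mul_pos p3 p2, mul_le_mul_of_nonneg_left this p1.le]
    · have := key _ hX (by linarith)
      nlinarith [mul_pos p3 p1, mul_pos p3 p2, mul_le_mul_of_nonneg_right this p2.le]

/-- The Gegenbauer density, extended by zero outside the open interval. -/
noncomputable def openDensity (γ t : ℝ) : ENNReal :=
  (Set.Ioo (-1 : ℝ) 1).indicator (fun t => ENNReal.ofReal ((1 - t ^ 2) ^ (γ - 1 / 2))) t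

theorem measurable_openDensity (γ : ℝ) : Measurable (openDensity γ) :=
  (measurable_gegenbauerDensity γ).indicator measurableSet_Ioo

theorem lintegral_gegenbauerMeasure_eq {γ : ℝ} {g : ℝ → ENNReal} (hg : Measurable g) :
    ∫⁻ t, g t ∂(gegenbauerMeasure γ) = ∫⁻ t, openDensity γ t * g t := by
  rw [lintegral_gegenbauerMeasure hg]
  refine lintegral_congr fun t => ?_
  by_cases ht : t ∈ Set.Ioo (-1 : ℝ) 1
  · simp [openDensity, ht]
  · rw [openDensity, Set.indicator_of_notMem ht, Set.indicator_of_notMem ht, zero_mul]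

theorem lintegral_openDensity_ne_top (hν : -(1 / 2) < ν) : ∫⁻ t, openDensity ν t ≠ ⊤ := by
  have h1 := lintegral_gegenbauerMeasure_eq (γ := ν) (g := fun _ => 1) measurable_const
  have := isFiniteMeasure_gegenbauerMeasure hν
  simp only [mul_one, lintegral_const, one_mul] at h1
  rw [← h1]
  exact measure_ne_top _ _

theorem openDensity_mul_le {x u : ℝ} (hν : -(1 / 2) < ν) :
    openDensity ν x * openDensity ν u ≤ 2 * openDensity ν (u * x) *
      (openDensity ν x * (Set.Ioo (-1 : ℝ) 1).indicator 1 u +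
        openDensity ν u * (Set.Ioo (-1 : ℝ) 1).indicator 1 x) := by
  by_cases hx : x ∈ Set.Ioo (-1 : ℝ) 1
  swap
  · simp [openDensity, hx]
  by_cases hu : u ∈ Set.Ioo (-1 : ℝ) 1
  swap
  · simp [openDensity, hu]
  have hux : u * x ∈ Set.Ioo (-1 : ℝ) 1 := by
    refine abs_lt.1 ?_
    rw [abs_mul]
    have h1 := abs_lt.2 hx
    have h2 := abs_lt.2 hu
    nlinarith [abs_nonneg x, abs_nonneg u]
  have hX : 0 < 1 - x ^ 2 := by nlinarith [hx.1, hx.2]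
  have hU : 0 < 1 - u ^ 2 := by nlinarith [hu.1, hu.2]
  have hP : 0 < 1 - (u * x) ^ 2 := by nlinarith [hux.1, hux.2]
  simp only [openDensity, Set.indicator_of_mem hx, Set.indicator_of_mem hu,
    Set.indicator_of_mem hux, Pi.one_apply, mul_one]
  rw [← ENNReal.ofReal_mul (by positivity), ← ENNReal.ofReal_add (by positivity) (by positivity),
    ← ENNReal.ofReal_ofNat, ← ENNReal.ofReal_mul (by norm_num), ← ENNReal.ofReal_mul (by positivity)]
  exact ENNReal.ofReal_le_ofReal (weight_mul_weight_le (by linarith) hx hu)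

theorem openDensity_mul_arg_le {x u : ℝ} (hx : x ∈ Set.Ioo (-1 : ℝ) 1) (hu : |u| ≤ 1) :
    openDensity ν (u * x) ≤ 1 + openDensity ν x := by
  have h1 := abs_lt.2 hx
  have hle : (u * x) ^ 2 ≤ x ^ 2 := by
    rw [mul_pow]
    exact mul_le_of_le_one_left (sq_nonneg x) ((sq_le_one_iff_abs_le_one u).2 hu)
  have hX : 0 < 1 - x ^ 2 := by nlinarith [hx.1, hx.2]
  by_cases hux : u * x ∈ Set.Ioo (-1 : ℝ) 1
  · simp only [openDensity, Set.indicator_of_mem hx, Set.indicator_of_mem hux]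
    rcases le_total 0 (ν - 1 / 2) with h | h
    · refine le_trans ?_ le_self_add
      rw [ENNReal.ofReal_le_one]
      exact Real.rpow_le_one (by linarith) (by nlinarith [sq_nonneg (u * x)]) h
    · refine le_trans ?_ le_add_self
      exact ENNReal.ofReal_le_ofReal (Real.rpow_le_rpow_of_nonpos hX (by linarith) h)
  · simp [openDensity, hux]

theorem le_rpow_mul_rpow_of_le {a A B : ENNReal} {θ : ℝ} (h0 : 0 ≤ θ) (h1 : θ ≤ 1) (hA : a ≤ A)
    (hB : a ≤ B) : a ≤ A ^ (1 - θ) * B ^ θ := by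
  calc a = a ^ ((1 - θ) + θ) := by rw [sub_add_cancel, ENNReal.rpow_one]
    _ = a ^ (1 - θ) * a ^ θ := ENNReal.rpow_add_of_nonneg _ _ (by linarith) h0
    _ ≤ A ^ (1 - θ) * B ^ θ := by gcongr

/-- The singularities do not interact: for |u| ≥ 1/2 the power is at most 2, and for |u| ≤ 1/2 the
density is at most 2. -/
theorem lintegral_openDensity_mul_rpow_ne_top (hν : -(1 / 2) < ν) {θ : ℝ} (h0 : 0 ≤ θ)
    (h1 : θ < 1) : ∫⁻ u, openDensity ν u * ENNReal.ofReal (|u| ^ (-θ)) ≠ ⊤ := by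
  have hI := setLIntegral_norm_rpow_lt_top (volume : Measure ℝ) (θ := θ) (by simpa using h1)
  have hbound : ∀ u : ℝ, openDensity ν u * ENNReal.ofReal (|u| ^ (-θ)) ≤
      2 * openDensity ν u + 2 * (Metric.closedBall (0 : ℝ) 1).indicator
        (fun u => ENNReal.ofReal (‖u‖ ^ (-θ))) u := by
    intro u
    by_cases hu : u ∈ Set.Ioo (-1 : ℝ) 1
    swap
    · simp [openDensity, hu]
    have habs := abs_lt.2 hu
    have hball : u ∈ Metric.closedBall (0 : ℝ) 1 := by
      rw [mem_closedBall_zero_iff]; exact habs.le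
    rw [Set.indicator_of_mem hball, Real.norm_eq_abs]
    rcases le_total (1 / 2) |u| with h | h
    · refine le_trans ?_ le_self_add
      rw [mul_comm]
      refine mul_le_mul_left ?_ _
      rw [← ENNReal.ofReal_ofNat]
      refine ENNReal.ofReal_le_ofReal ?_
      calc |u| ^ (-θ) ≤ (1 / 2 : ℝ) ^ (-θ) :=
            Real.rpow_le_rpow_of_nonpos (by norm_num) h (by linarith)
        _ = 2 ^ θ := by
            rw [one_div, Real.inv_rpow (by norm_num), Real.rpow_neg (by norm_num), inv_inv]
        _ ≤ 2 ^ (1 : ℝ) := Real.rpow_le_rpow_of_exponent_le (by norm_num) h1.le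
        _ = 2 := Real.rpow_one 2
    · refine le_trans ?_ le_add_self
      refine mul_le_mul_left ?_ _
      simp only [openDensity, Set.indicator_of_mem hu]
      rw [← ENNReal.ofReal_ofNat]
      refine ENNReal.ofReal_le_ofReal ?_
      have hu2 : u ^ 2 ≤ 1 / 4 := by rw [← sq_abs]; nlinarith [abs_nonneg u]
      rcases le_total 0 (ν - 1 / 2) with h' | h'
      · exact (Real.rpow_le_one (by linarith) (by nlinarith [sq_nonneg u]) h').trans (by norm_num)
      · calc (1 - u ^ 2) ^ (ν - 1 / 2) ≤ (1 / 2 : ℝ) ^ (ν - 1 / 2) :=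
              Real.rpow_le_rpow_of_nonpos (by norm_num) (by linarith) h'
          _ ≤ (1 / 2 : ℝ) ^ (-1 : ℝ) :=
              Real.rpow_le_rpow_of_exponent_ge (by norm_num) (by norm_num) (by linarith)
          _ = 2 := by rw [Real.rpow_neg_one]; norm_num
  refine ((lintegral_mono hbound).trans_lt ?_).ne
  rw [lintegral_add_left ((measurable_openDensity ν).const_mul 2),
    lintegral_const_mul' _ _ (by simp), lintegral_const_mul' _ _ (by simp),
    lintegral_indicator Metric.isClosed_closedBall.measurableSet]
  exact ENNReal.add_lt_top.2 ⟨ENNReal.mul_lt_top (by simp)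
    (lintegral_openDensity_ne_top hν).lt_top, ENNReal.mul_lt_top (by simp) hI⟩

/-- After `openDensity_mul_le` and the symmetry in u and x, the inner integral for fixed u is at
most A(2 + m), and by scaling at most I/|u|. As 1/|u| is not integrable at 0, the two bounds are
interpolated, which leaves |u|^(-θ) with θ < 1. -/
theorem exists_lintegral_mul_prod_le (hν : -(1 / 2) < ν) {θ : ℝ} (h0 : 0 ≤ θ) (h1 : θ < 1) :
    ∃ K : ENNReal, K ≠ ⊤ ∧ ∀ (g : ℝ → ENNReal) (A : ENNReal), Measurable g →
      (∀ t ∈ Set.Icc (-1 : ℝ) 1, g t ≤ A) →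
      ∫⁻ u, ∫⁻ x, g (u * x) ∂(gegenbauerMeasure ν) ∂(gegenbauerMeasure ν) ≤
        K * A ^ (1 - θ) * (∫⁻ t, g t ∂(gegenbauerMeasure ν)) ^ θ := by
  set m := ∫⁻ t, openDensity ν t with hm
  have hmt : m ≠ ⊤ := lintegral_openDensity_ne_top hν
  set c := ∫⁻ u, openDensity ν u * ENNReal.ofReal (|u| ^ (-θ)) with hc
  have hct : c ≠ ⊤ := lintegral_openDensity_mul_rpow_ne_top hν h0 h1
  refine ⟨4 * (2 + m) ^ (1 - θ) * c, ?_, fun g A hg hA => ?_⟩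
  · refine ENNReal.mul_ne_top (ENNReal.mul_ne_top (by simp) ?_) hct
    exact ENNReal.rpow_ne_top_of_nonneg (by linarith) (by simp [hmt])
  set I := ∫⁻ t, g t ∂(gegenbauerMeasure ν) with hI
  have hIe : I = ∫⁻ t, openDensity ν t * g t := lintegral_gegenbauerMeasure_eq hg
  let one : ℝ → ENNReal := (Set.Ioo (-1 : ℝ) 1).indicator 1
  have hone : Measurable one := measurable_one.indicator measurableSet_Ioo
  let φ : ℝ → ENNReal := fun t => openDensity ν t * g t
  have hφ : Measurable φ := (measurable_openDensity ν).mul hg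
  have hω := measurable_openDensity ν
  have hgm : Measurable fun q : ℝ × ℝ => g (q.1 * q.2) := hg.comp (by fun_prop)
  have hφm : Measurable fun q : ℝ × ℝ => φ (q.1 * q.2) := hφ.comp (by fun_prop)
  have e1 : ∫⁻ u, ∫⁻ x, g (u * x) ∂(gegenbauerMeasure ν) ∂(gegenbauerMeasure ν) =
      ∫⁻ u, ∫⁻ x, openDensity ν x * openDensity ν u * g (u * x) := by
    have : ∀ u, ∫⁻ x, g (u * x) ∂(gegenbauerMeasure ν) = ∫⁻ x, openDensity ν x * g (u * x) :=
      fun u => lintegral_gegenbauerMeasure_eq (hg.comp (measurable_const_mul u))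
    simp only [this]
    rw [lintegral_gegenbauerMeasure_eq]
    · refine lintegral_congr fun u => ?_
      have hm' : Measurable fun x => openDensity ν x * g (u * x) :=
        hω.mul (hg.comp (measurable_const_mul u))
      rw [← lintegral_const_mul _ hm']
      refine lintegral_congr fun x => ?_
      ring
    · exact ((hω.comp measurable_snd).mul hgm).lintegral_prod_right'
  have hpt : ∀ u x, openDensity ν x * openDensity ν u * g (u * x) ≤
      2 * (one u * openDensity ν x * φ (u * x)) + 2 * (openDensity ν u * one x * φ (u * x)) := by
    intro u x
    refine (mul_le_mul_left (openDensity_mul_le hν) _).trans (le_of_eq ?_)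
    simp only [φ, one]
    ring
  have m1 : Measurable fun q : ℝ × ℝ => one q.1 * openDensity ν q.2 * φ (q.1 * q.2) :=
    ((hone.comp measurable_fst).mul (hω.comp measurable_snd)).mul hφm
  have m2 : Measurable fun q : ℝ × ℝ => openDensity ν q.1 * one q.2 * φ (q.1 * q.2) :=
    ((hω.comp measurable_fst).mul (hone.comp measurable_snd)).mul hφm
  have e2 : ∫⁻ u, ∫⁻ x, one u * openDensity ν x * φ (u * x) =
      ∫⁻ u, ∫⁻ x, openDensity ν u * one x * φ (u * x) := by
    rw [lintegral_lintegral_swap m1.aemeasurable]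
    refine lintegral_congr fun u => lintegral_congr fun x => ?_
    rw [mul_comm (one x), mul_comm x u]
  have hinner : ∀ᵐ u : ℝ, ∫⁻ x, openDensity ν u * one x * φ (u * x) ≤
      (A * (2 + m)) ^ (1 - θ) * I ^ θ * (openDensity ν u * ENNReal.ofReal (|u| ^ (-θ))) := by
    filter_upwards [Measure.ae_ne volume (0 : ℝ)] with u hu0
    by_cases hu : u ∈ Set.Ioo (-1 : ℝ) 1
    swap
    · simp [openDensity, hu]
    have hu1 := (abs_lt.2 hu).le
    have hm3 : Measurable fun x => one x * φ (u * x) :=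
      hone.mul (hφ.comp (measurable_const_mul u))
    simp only [mul_assoc (openDensity ν u)]
    rw [lintegral_const_mul _ hm3]
    have b1 : ∫⁻ x, one x * φ (u * x) ≤ A * (2 + m) := by
      calc ∫⁻ x, one x * φ (u * x) ≤ ∫⁻ x, A * (one x + openDensity ν x) := by
            refine lintegral_mono fun x => ?_
            by_cases hx : x ∈ Set.Ioo (-1 : ℝ) 1
            · simp only [one, φ, Set.indicator_of_mem hx, Pi.one_apply, one_mul]
              rw [mul_comm]
              refine mul_le_mul' (hA _ ?_) (openDensity_mul_arg_le hx hu1)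
              refine abs_le.1 ?_
              rw [abs_mul]
              exact mul_le_one₀ hu1 (abs_nonneg _) (abs_lt.2 hx).le
            · simp [one, hx]
        _ = A * (2 + m) := by
            have hm' : Measurable fun x => one x + openDensity ν x := hone.add hω
            rw [lintegral_const_mul _ hm', lintegral_add_left hone]
            simp only [one]
            rw [lintegral_indicator_one measurableSet_Ioo, Real.volume_Ioo]
            norm_num [hm]
    have b2 : ∫⁻ x, one x * φ (u * x) ≤ ENNReal.ofReal |u|⁻¹ * I := by
      rw [hIe]
      change _ ≤ ENNReal.ofReal |u|⁻¹ * ∫⁻ t, φ t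
      rw [← lintegral_mul_left_eq hφ hu0]
      refine lintegral_mono fun x => mul_le_of_le_one_left zero_le ?_
      exact Set.indicator_le_self' (by simp) x
    have b3 := le_rpow_mul_rpow_of_le h0 h1.le b1 b2
    rw [ENNReal.mul_rpow_of_nonneg (ENNReal.ofReal |u|⁻¹) I h0,
      ENNReal.ofReal_rpow_of_nonneg (by positivity) h0, Real.inv_rpow (abs_nonneg u),
      ← Real.rpow_neg (abs_nonneg u)] at b3
    refine (mul_le_mul_right b3 _).trans (le_of_eq ?_)
    ring
  rw [e1]
  calc ∫⁻ u, ∫⁻ x, openDensity ν x * openDensity ν u * g (u * x)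
      ≤ ∫⁻ u, ∫⁻ x, (2 * (one u * openDensity ν x * φ (u * x)) +
          2 * (openDensity ν u * one x * φ (u * x))) :=
        lintegral_mono fun u => lintegral_mono fun x => hpt u x
    _ = 4 * ∫⁻ u, ∫⁻ x, openDensity ν u * one x * φ (u * x) := by
        have : ∀ u, ∫⁻ x, (2 * (one u * openDensity ν x * φ (u * x)) +
            2 * (openDensity ν u * one x * φ (u * x))) =
            2 * (∫⁻ x, one u * openDensity ν x * φ (u * x)) +
              2 * ∫⁻ x, openDensity ν u * one x * φ (u * x) := by
          intro u
          have n1 : Measurable fun x => one u * openDensity ν x * φ (u * x) :=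
            m1.comp measurable_prodMk_left
          rw [lintegral_add_left (n1.const_mul 2), lintegral_const_mul' _ _ (by simp),
            lintegral_const_mul' _ _ (by simp)]
        simp only [this]
        rw [lintegral_add_left (m1.lintegral_prod_right'.const_mul 2),
          lintegral_const_mul' _ _ (by simp), lintegral_const_mul' _ _ (by simp), e2, ← add_mul]
        norm_num
    _ ≤ 4 * ∫⁻ u, (A * (2 + m)) ^ (1 - θ) * I ^ θ *
          (openDensity ν u * ENNReal.ofReal (|u| ^ (-θ))) := by
        gcongr 1
        exact lintegral_mono_ae hinner
    _ = 4 * (2 + m) ^ (1 - θ) * c * A ^ (1 - θ) * I ^ θ := by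
        have hm' : Measurable fun u => openDensity ν u * ENNReal.ofReal (|u| ^ (-θ)) :=
          hω.mul (by fun_prop)
        rw [lintegral_const_mul _ hm', ← hc,
          ENNReal.mul_rpow_of_nonneg _ _ (by linarith : 0 ≤ 1 - θ)]
        ring

end OneDimensional

end BallGraph

/-! ### The one-dimensional ball -/

namespace BallGraph

section DimensionOne

variable {ν : ℝ}

theorem gammaWeight_one (ν : ℝ) : gammaWeight 1 ν = ν := by simp [gammaWeight]

theorem norm_eq_abs_coord (x : EuclideanSpace ℝ (Fin 1)) : ‖x‖ = |x 0| := by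
  rw [EuclideanSpace.norm_eq]
  simp [Real.sqrt_sq_eq_abs]

theorem inner_eq_mul_coord (x y : EuclideanSpace ℝ (Fin 1)) : inner ℝ x y = x 0 * y 0 := by
  rw [PiLp.inner_apply]
  simp [mul_comm]

/-- In dimension one the weight on the ball is the Gegenbauer measure. -/
theorem lintegral_ballWeight_one {φ : ℝ → ENNReal} (hφ : Measurable φ) :
    ∫⁻ y, φ (y 0) ∂(ballWeight 1 ν) = ∫⁻ t, φ t ∂(gegenbauerMeasure ν) := by
  let h : ℝ → ENNReal := (Set.Icc (-1 : ℝ) 1).indicator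
    (fun t => ENNReal.ofReal ((1 - t ^ 2) ^ (ν - 1 / 2)) * φ t)
  have hh : Measurable h := ((measurable_gegenbauerDensity ν).mul hφ).indicator measurableSet_Icc
  rw [lintegral_ballWeight (h := fun y => φ (y 0)) (hφ.comp (by fun_prop))]
  have h1 : ∀ y : EuclideanSpace ℝ (Fin 1), (Metric.closedBall (0 : EuclideanSpace ℝ (Fin 1)) 1).indicator
      (fun x => ENNReal.ofReal ((1 - ‖x‖ ^ 2) ^ (ν - 1 / 2)) * φ (x 0)) y = h (y 0) := by
    intro y
    have hiff : y ∈ Metric.closedBall (0 : EuclideanSpace ℝ (Fin 1)) 1 ↔ y 0 ∈ Set.Icc (-1 : ℝ) 1 := by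
      rw [mem_closedBall_zero_iff, norm_eq_abs_coord, abs_le, Set.mem_Icc]
    by_cases hy : y 0 ∈ Set.Icc (-1 : ℝ) 1
    · rw [Set.indicator_of_mem (hiff.2 hy)]
      simp only [h, Set.indicator_of_mem hy]
      rw [norm_eq_abs_coord, sq_abs]
    · rw [Set.indicator_of_notMem (fun hc => hy (hiff.1 hc))]
      simp only [h, Set.indicator_of_notMem hy]
  rw [lintegral_congr h1]
  have h2 := lintegral_slice (k := 0) (h := fun s _ => h s) (hh.comp measurable_fst)
  rw [h2, gegenbauerMeasure, lintegral_withDensity_eq_lintegral_mul _ (measurable_gegenbauerDensity ν)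
    hφ, restrict_Ioc_eq_restrict_Icc, ← lintegral_indicator measurableSet_Icc]
  refine lintegral_congr fun t => ?_
  rw [lintegral_const, volume_pi, Measure.pi_univ]
  simp only [Finset.univ_eq_empty, Finset.prod_empty, mul_one]
  rfl

theorem lintegral_ballLaw_one {φ : ℝ → ENNReal} (hφ : Measurable φ) :
    ∫⁻ y, φ (y 0) ∂(ballLaw 1 ν) =
      (ballWeight 1 ν Set.univ)⁻¹ * ∫⁻ t, φ t ∂(gegenbauerMeasure ν) := by
  rw [ballLaw, lintegral_smul_measure, lintegral_ballWeight_one hφ, smul_eq_mul]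

/-- In dimension one, the law of the scalar product of two independent points is comparable to the
Gegenbauer measure up to an arbitrarily small loss in the exponent. -/
theorem exists_lintegral_inner_prod_le_rpow (hν : -(1 / 2) < ν)
    [IsProbabilityMeasure (ballLaw 1 ν)] {θ : ℝ} (h0 : 0 ≤ θ) (h1 : θ < 1) :
    ∃ K : ENNReal, K ≠ ⊤ ∧ ∀ (g : ℝ → ENNReal) (A : ENNReal), Measurable g →
      (∀ t ∈ Set.Icc (-1 : ℝ) 1, g t ≤ A) →
      ∫⁻ z, g (inner ℝ z.1 z.2) ∂((ballLaw 1 ν).prod (ballLaw 1 ν)) ≤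
        K * A ^ (1 - θ) * (∫⁻ t, g t ∂(gegenbauerMeasure ν)) ^ θ := by
  obtain ⟨K, hK, hKb⟩ := exists_lintegral_mul_prod_le hν h0 h1
  obtain ⟨hZ0, hZ1⟩ := ballWeight_univ_ne (d := 1) (ν := ν)
  set Z := ballWeight 1 ν Set.univ with hZ
  refine ⟨Z⁻¹ * Z⁻¹ * K, ENNReal.mul_ne_top (ENNReal.mul_ne_top (ENNReal.inv_ne_top.2 hZ0)
    (ENNReal.inv_ne_top.2 hZ0)) hK, fun g A hg hA => ?_⟩
  have hgm : Measurable fun z : EuclideanSpace ℝ (Fin 1) × EuclideanSpace ℝ (Fin 1) =>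
    g (inner ℝ z.1 z.2) := hg.comp (by fun_prop)
  have hgu : Measurable fun q : ℝ × ℝ => g (q.1 * q.2) := hg.comp (by fun_prop)
  rw [lintegral_prod _ hgm.aemeasurable]
  have e1 : ∀ x : EuclideanSpace ℝ (Fin 1), ∫⁻ y, g (inner ℝ x y) ∂(ballLaw 1 ν) =
      Z⁻¹ * ∫⁻ t, g (x 0 * t) ∂(gegenbauerMeasure ν) := by
    intro x
    simp only [inner_eq_mul_coord]
    exact lintegral_ballLaw_one (hg.comp (measurable_const_mul (x 0)))
  have := isFiniteMeasure_gegenbauerMeasure hν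
  have hm : Measurable fun u => ∫⁻ t, g (u * t) ∂(gegenbauerMeasure ν) :=
    hgu.lintegral_prod_right'
  simp only [e1]
  rw [lintegral_const_mul' _ _ (ENNReal.inv_ne_top.2 hZ0), lintegral_ballLaw_one hm, ← mul_assoc,
    mul_assoc (Z⁻¹ * Z⁻¹ * K), mul_assoc (Z⁻¹ * Z⁻¹), ← mul_assoc K]
  exact mul_le_mul_right (hKb g A hg hA) _

/-- On the line the weight is the Gegenbauer measure itself, so the Christoffel bound of the
interval applies directly, with a smaller exponent than the average over segments. -/
theorem exists_sq_le_integral_ballLaw_one [IsProbabilityMeasure (ballLaw 1 ν)] (hν : -(1 / 2) < ν)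
    (hν0 : ν ≠ 0) :
    ∃ K : ℝ, 0 < K ∧ ∀ m : ℕ, ∀ p ∈ polySpace 1 m, ∀ x ∈ Metric.closedBall 0 1,
      p x ^ 2 ≤ K * ((m : ℝ) + 1) ^ (2 * max ν 0 + 1) * ∫ y, p y ^ 2 ∂(ballLaw 1 ν) := by
  obtain ⟨K, hK, hKb⟩ := exists_christoffel_le hν hν0
  obtain ⟨hZ0, hZ1⟩ := ballWeight_univ_ne (d := 1) (ν := ν)
  set Z := ballWeight 1 ν Set.univ with hZ
  have hZr : 0 < Z.toReal := ENNReal.toReal_pos hZ0 hZ1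
  refine ⟨K * Z.toReal, by positivity, fun m p hp x hx => ?_⟩
  obtain ⟨P, hPd, hP⟩ := exists_polynomial_on_line hp 0 (EuclideanSpace.single 0 1)
  have hline : ∀ y : EuclideanSpace ℝ (Fin 1), p y = P.eval (y 0) := by
    intro y
    rw [hP]
    congr 1
    ext i
    rw [Subsingleton.elim i 0]
    simp
  have hx' : x 0 ∈ Set.Icc (-1 : ℝ) 1 := by
    rw [mem_closedBall_zero_iff, norm_eq_abs_coord] at hx
    exact abs_le.1 hx
  have h1 := hKb m P (by simpa using hPd) (x 0) hx'
  have h2 : ∫ s, P.eval s ^ 2 ∂(gegenbauerMeasure ν) = Z.toReal * ∫ y, p y ^ 2 ∂(ballLaw 1 ν) := by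
    simp only [hline]
    have hm : Measurable fun s : ℝ => P.eval s ^ 2 := by fun_prop
    rw [integral_eq_lintegral_of_nonneg_ae (Filter.Eventually.of_forall fun _ => sq_nonneg _)
      hm.aestronglyMeasurable, integral_eq_lintegral_of_nonneg_ae
      (Filter.Eventually.of_forall fun _ => sq_nonneg _)
      (hm.comp (by fun_prop : Measurable fun y : EuclideanSpace ℝ (Fin 1) => y 0)).aestronglyMeasurable,
      lintegral_ballLaw_one (φ := fun s => ENNReal.ofReal (P.eval s ^ 2)) hm.ennreal_ofReal,
      ENNReal.toReal_mul, ENNReal.toReal_inv, mul_inv_cancel_left₀ hZr.ne']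
  rw [h2] at h1
  rw [hline x]
  calc _ ≤ _ := h1
    _ = _ := by ring

end DimensionOne

end BallGraph

/-! ### Approximation rates of the kernel -/

namespace BallGraph

section KernelApproximation

variable {d : ℕ} {ν : ℝ} {f : ℝ → ℝ}

theorem integral_le_of_lintegral_ofReal_le {X : Type*} [MeasurableSpace X] {μ : Measure X}
    {h : X → ℝ} (hm : Measurable h) (h0 : ∀ x, 0 ≤ h x) {c : ℝ} (hc : 0 ≤ c)
    (hle : ∫⁻ x, ENNReal.ofReal (h x) ∂μ ≤ ENNReal.ofReal c) : ∫ x, h x ∂μ ≤ c := by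
  rw [integral_eq_lintegral_of_nonneg_ae (Filter.Eventually.of_forall h0) hm.aestronglyMeasurable]
  exact ENNReal.toReal_le_of_le_ofReal hc hle

/-- The Gegenbauer expansion of order `M` of the link function. -/
noncomputable abbrev linkApprox (d : ℕ) (ν : ℝ) (f : ℝ → ℝ) (M : ℕ) : Polynomial ℝ :=
  gegenbauerSum (gammaWeight d ν) (orthoCoeff (gammaWeight d ν) f) M

theorem measurable_sq_sub_eval (hf : Measurable f) (Q : Polynomial ℝ) :
    Measurable fun t => (f t - Q.eval t) ^ 2 := by fun_prop

theorem measurable_sq_sub_eval_inner (hf : Measurable f) (Q : Polynomial ℝ) :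
    Measurable fun z : EuclideanSpace ℝ (Fin d) × EuclideanSpace ℝ (Fin d) =>
      (dotKernel d f z.1 z.2 - Q.eval (inner ℝ z.1 z.2)) ^ 2 :=
  (measurable_sq_sub_eval hf Q).comp (by fun_prop)

theorem sq_sub_eval_le (hf01 : ∀ t ∈ Set.Icc (-1 : ℝ) 1, f t ∈ Set.Icc (0 : ℝ) 1)
    {Q : Polynomial ℝ} {K : ℝ} (hQ : ∀ t ∈ Set.Icc (-1 : ℝ) 1, |Q.eval t| ≤ K) :
    ∀ t ∈ Set.Icc (-1 : ℝ) 1, (f t - Q.eval t) ^ 2 ≤ (1 + K) ^ 2 := by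
  intro t ht
  have h1 := hf01 t ht
  have h2 := abs_le.1 (hQ t ht)
  refine sq_le_sq' ?_ ?_ <;> linarith [h1.1, h1.2, h2.1, h2.2]

theorem lintegral_ofReal_sq_sub_eval {γ : ℝ} (hγ : -(1 / 2) < γ) (hf : Measurable f)
    (hf01 : ∀ t ∈ Set.Icc (-1 : ℝ) 1, f t ∈ Set.Icc (0 : ℝ) 1) {Q : Polynomial ℝ} {K : ℝ}
    (hQ : ∀ t ∈ Set.Icc (-1 : ℝ) 1, |Q.eval t| ≤ K) :
    ∫⁻ t, ENNReal.ofReal ((f t - Q.eval t) ^ 2) ∂(gegenbauerMeasure γ) =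
      ENNReal.ofReal (∫ t, (f t - Q.eval t) ^ 2 ∂(gegenbauerMeasure γ)) := by
  have := isFiniteMeasure_gegenbauerMeasure hγ
  refine (ofReal_integral_eq_lintegral_ofReal ?_
    (Filter.Eventually.of_forall fun _ => sq_nonneg _)).symm
  refine Integrable.of_bound (measurable_sq_sub_eval hf Q).aestronglyMeasurable ((1 + K) ^ 2) ?_
  filter_upwards [ae_gegenbauerMeasure_mem γ] with t ht
  rw [Real.norm_eq_abs, abs_of_nonneg (sq_nonneg _)]
  exact sq_sub_eval_le hf01 hQ t (Set.Ioc_subset_Icc_self ht)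

/-- The polynomial spaces have Christoffel functions of growth `ρ`, and the kernel is approximated
in `L²` at the rate `σ` by the Gegenbauer expansions of the link function. -/
def HasApproximationRate (d : ℕ) (ν : ℝ) (f : ℝ → ℝ) (ρ σ K : ℝ) : Prop :=
  (∀ m : ℕ, ∀ p ∈ polySpace d m, ∀ x ∈ Metric.closedBall (0 : EuclideanSpace ℝ (Fin d)) 1,
    p x ^ 2 ≤ K * ((m : ℝ) + 1) ^ ρ * ∫ y, p y ^ 2 ∂(ballLaw d ν)) ∧
  ∀ M : ℕ, (∀ t ∈ Set.Icc (-1 : ℝ) 1, |(linkApprox d ν f M).eval t| ≤ K) ∧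
    ∫ z : EuclideanSpace ℝ (Fin d) × EuclideanSpace ℝ (Fin d),
      (dotKernel d f z.1 z.2 - (linkApprox d ν f M).eval (inner ℝ z.1 z.2)) ^ 2
        ∂((ballLaw d ν).prod (ballLaw d ν)) ≤ K * ((M : ℝ) + 1) ^ (-(2 * σ))

theorem HasApproximationRate.of_parts {ρ σ K₁ K₂ K₃ : ℝ}
    (h₁ : ∀ m : ℕ, ∀ p ∈ polySpace d m, ∀ x ∈ Metric.closedBall (0 : EuclideanSpace ℝ (Fin d)) 1,
      p x ^ 2 ≤ K₁ * ((m : ℝ) + 1) ^ ρ * ∫ y, p y ^ 2 ∂(ballLaw d ν))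
    (h₂ : ∀ M : ℕ, ∀ t ∈ Set.Icc (-1 : ℝ) 1, |(linkApprox d ν f M).eval t| ≤ K₂)
    (h₃ : ∀ M : ℕ, ∫ z : EuclideanSpace ℝ (Fin d) × EuclideanSpace ℝ (Fin d),
      (dotKernel d f z.1 z.2 - (linkApprox d ν f M).eval (inner ℝ z.1 z.2)) ^ 2
        ∂((ballLaw d ν).prod (ballLaw d ν)) ≤ K₃ * ((M : ℝ) + 1) ^ (-(2 * σ))) :
    ∃ K, 0 < K ∧ HasApproximationRate d ν f ρ σ K := by
  refine ⟨max (max K₁ K₂) (max K₃ 1), lt_max_of_lt_right (lt_max_of_lt_right one_pos),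
    fun m p hp x hx => ?_, fun M => ⟨fun t ht => ?_, ?_⟩⟩
  · refine (h₁ m p hp x hx).trans ?_
    have : 0 ≤ ∫ y, p y ^ 2 ∂(ballLaw d ν) := integral_nonneg fun _ => sq_nonneg _
    gcongr
    exact (le_max_left _ _).trans (le_max_left _ _)
  · exact (h₂ M t ht).trans ((le_max_right _ _).trans (le_max_left _ _))
  · refine (h₃ M).trans ?_
    gcongr
    exact (le_max_left _ _).trans (le_max_right _ _)

variable [IsProbabilityMeasure (ballLaw d ν)] {s : ℝ}

/-- The L² rate is taken from the uniform one, for which a transfer of null sets suffices. Uniform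
rates are available for σ < s - ν - d/2, while ρ = 2d + δ/2 demands σ > 3d/2 + δ/4. There is room
because s - ν > 5d/2 - 1 ≥ 2d, and δ measures it. -/
theorem exists_approximationRate_of_le_half (hd : 2 ≤ d) (hν : -(1 / 2) < ν) (hν' : ν ≤ 1 / 2)
    (hf : Measurable f) (hf01 : ∀ t ∈ Set.Icc (-1 : ℝ) 1, f t ∈ Set.Icc (0 : ℝ) 1)
    (hs : ν - 1 + 5 * (d : ℝ) / 2 < s)
    (hsum : Summable fun m : ℕ =>
      orthoCoeff (gammaWeight d ν) f m ^ 2 * ((m : ℝ) + 1) ^ (2 * s)) :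
    ∃ ρ σ K : ℝ, 0 ≤ ρ ∧ (ρ + d) / 2 < σ ∧ 0 < K ∧ HasApproximationRate d ν f ρ σ K := by
  have hd2 : (2 : ℝ) ≤ d := by exact_mod_cast hd
  have hγ : 0 < gammaWeight d ν := by rw [gammaWeight]; linarith
  set δ := s - ν - 2 * (d : ℝ) with hδ
  have hδ0 : 0 < δ := by rw [hδ]; linarith
  set σ := 3 * (d : ℝ) / 2 + δ / 2 with hσ
  obtain ⟨K1, hK1, h1⟩ := exists_sq_le_integral_ballLaw (d := d) (ν := ν) (by omega)
    (η := δ / 4) (by positivity)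
  obtain ⟨K2, hK2, h2⟩ := gegenbauerSum_approximation (by linarith) hγ.ne' hf hf01 (s := s) (σ := σ)
    (by positivity) (by rw [max_eq_left hγ.le, gammaWeight, hσ, hδ]; linarith) hsum
  rw [max_eq_right (by linarith), add_zero] at h1
  obtain ⟨K, hK, hr⟩ := HasApproximationRate.of_parts (σ := σ) (K₃ := K2 ^ 2) h1
    (fun M => (h2 M).1) fun M => by
      have h3 := ae_prod_inner (d := d) (ν := ν) (by omega)
        (s := {t | |f t - (linkApprox d ν f M).eval t| ≤ K2 * ((M : ℝ) + 1) ^ (-σ)})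
        (measurableSet_le (by fun_prop) measurable_const) (h2 M).2.1
      calc ∫ z : EuclideanSpace ℝ (Fin d) × EuclideanSpace ℝ (Fin d),
            (dotKernel d f z.1 z.2 - (linkApprox d ν f M).eval (inner ℝ z.1 z.2)) ^ 2
              ∂((ballLaw d ν).prod (ballLaw d ν))
          ≤ ∫ z : EuclideanSpace ℝ (Fin d) × EuclideanSpace ℝ (Fin d),
              (K2 * ((M : ℝ) + 1) ^ (-σ)) ^ 2 ∂((ballLaw d ν).prod (ballLaw d ν)) := by
            refine integral_mono_of_nonneg (Filter.Eventually.of_forall fun _ => sq_nonneg _)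
              (integrable_const _) ?_
            filter_upwards [h3] with z hz
            exact sq_le_sq' (abs_le.1 hz).1 (abs_le.1 hz).2
        _ = K2 ^ 2 * ((M : ℝ) + 1) ^ (-(2 * σ)) := by
            rw [integral_const, probReal_univ, one_smul, mul_pow, ← Real.rpow_mul_natCast (by positivity)]
            congr 2
            push_cast
            ring
  exact ⟨_, σ, K, by positivity, by rw [hσ]; linarith, hK, hr⟩

/-- The bounded density of the scalar product transfers the weighted L² rate s without loss; the
uniform estimate, with σ = 0, only serves boundedness. Here ρ = 2(d + ν), and the requirement is
3d/2 + ν < s. -/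
theorem exists_approximationRate_of_half_lt (hd : 2 ≤ d) (hν : 1 / 2 < ν)
    (hf : Measurable f) (hf01 : ∀ t ∈ Set.Icc (-1 : ℝ) 1, f t ∈ Set.Icc (0 : ℝ) 1)
    (hs : ν - 1 + 5 * (d : ℝ) / 2 < s)
    (hsum : Summable fun m : ℕ =>
      orthoCoeff (gammaWeight d ν) f m ^ 2 * ((m : ℝ) + 1) ^ (2 * s)) :
    ∃ ρ σ K : ℝ, 0 ≤ ρ ∧ (ρ + d) / 2 < σ ∧ 0 < K ∧ HasApproximationRate d ν f ρ σ K := by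
  have hd2 : (2 : ℝ) ≤ d := by exact_mod_cast hd
  have hγ : 0 < gammaWeight d ν := by rw [gammaWeight]; linarith
  obtain ⟨K1, hK1, h1⟩ := exists_sq_le_integral_ballLaw (d := d) (ν := ν) (by omega)
    (η := 1 / 2) (by positivity)
  obtain ⟨K2, hK2, h2⟩ := gegenbauerSum_approximation (by linarith) hγ.ne' hf hf01 (s := s) (σ := 0)
    le_rfl (by rw [max_eq_left hγ.le, gammaWeight]; linarith) hsum
  rw [max_eq_left (by linarith)] at h1
  obtain ⟨K3, hK3, h3⟩ : ∃ K : ENNReal, K ≠ ⊤ ∧ ∀ g : ℝ → ENNReal, Measurable g →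
      ∫⁻ z, g (inner ℝ z.1 z.2) ∂((ballLaw d ν).prod (ballLaw d ν)) ≤
        K * ∫⁻ t, g t ∂(gegenbauerMeasure (gammaWeight d ν)) := by
    obtain ⟨k, rfl⟩ : ∃ k, d = k + 1 := ⟨d - 1, by omega⟩
    exact exists_lintegral_inner_prod_le (by omega) hν
  obtain ⟨K, hK, hr⟩ := HasApproximationRate.of_parts (σ := s) (K₃ := K3.toReal * K2) h1
    (fun M => (h2 M).1) fun M => by
      refine integral_le_of_lintegral_ofReal_le (measurable_sq_sub_eval_inner hf _)
        (fun _ => sq_nonneg _) (by positivity) ?_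
      refine (h3 (fun t => ENNReal.ofReal ((f t - (linkApprox d ν f M).eval t) ^ 2))
        (measurable_sq_sub_eval hf _).ennreal_ofReal).trans ?_
      rw [lintegral_ofReal_sq_sub_eval (by linarith) hf hf01 (h2 M).1, mul_assoc,
        ENNReal.ofReal_mul ENNReal.toReal_nonneg, ENNReal.ofReal_toReal hK3]
      gcongr
      exact (h2 M).2.2
  exact ⟨_, s, K, by linarith, by linarith, hK, hr⟩

/-- The interpolated transfer turns the rate s into θs. Since s exceeds max(ν, 0) + 1 = (ρ + 1)/2
strictly, some θ < 1 keeps θs above it. -/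
theorem exists_approximationRate_one [IsProbabilityMeasure (ballLaw 1 ν)] (hν : -(1 / 2) < ν)
    (hν0 : ν ≠ 0) (hf : Measurable f)
    (hf01 : ∀ t ∈ Set.Icc (-1 : ℝ) 1, f t ∈ Set.Icc (0 : ℝ) 1) (hs : ν + 3 / 2 < s)
    (hsum : Summable fun m : ℕ => orthoCoeff (gammaWeight 1 ν) f m ^ 2 * ((m : ℝ) + 1) ^ (2 * s)) :
    ∃ ρ σ K : ℝ, 0 ≤ ρ ∧ (ρ + (1 : ℕ)) / 2 < σ ∧ 0 < K ∧ HasApproximationRate 1 ν f ρ σ K := by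
  have hmax : max ν 0 + 1 < s := by
    rw [← lt_sub_iff_add_lt]
    exact max_lt (by linarith) (by linarith)
  have hmax0 : 0 ≤ max ν 0 := le_max_right _ _
  have hs0 : 0 < s := by linarith
  obtain ⟨θ, hθ0, hθ1⟩ := exists_between ((div_lt_one hs0).2 hmax)
  have hθ : 0 ≤ θ := le_trans (by positivity) hθ0.le
  rw [div_lt_iff₀ hs0] at hθ0
  have hγe := gammaWeight_one ν
  obtain ⟨K1, hK1, h1⟩ := exists_sq_le_integral_ballLaw_one hν hν0
  obtain ⟨K2, hK2, h2⟩ := gegenbauerSum_approximation (γ := gammaWeight 1 ν) (by rwa [hγe])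
    (by rwa [hγe]) hf hf01 (s := s) (σ := 0) le_rfl (by rw [hγe]; linarith) hsum
  obtain ⟨K3, hK3, h3⟩ := exists_lintegral_inner_prod_le_rpow hν hθ hθ1
  obtain ⟨K, hK, hr⟩ := HasApproximationRate.of_parts (σ := θ * s)
    (K₃ := K3.toReal * ((1 + K2) ^ 2) ^ (1 - θ) * K2 ^ θ) h1 (fun M => (h2 M).1) fun M => by
      have hM : (0 : ℝ) < (M : ℝ) + 1 := by positivity
      refine integral_le_of_lintegral_ofReal_le (measurable_sq_sub_eval_inner hf _)
        (fun _ => sq_nonneg _) (by positivity) ?_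
      refine (h3 (fun t => ENNReal.ofReal ((f t - (linkApprox 1 ν f M).eval t) ^ 2))
        (ENNReal.ofReal ((1 + K2) ^ 2)) (measurable_sq_sub_eval hf _).ennreal_ofReal
        fun t ht => ENNReal.ofReal_le_ofReal (sq_sub_eval_le hf01 (h2 M).1 t ht)).trans ?_
      rw [lintegral_ofReal_sq_sub_eval hν hf hf01 (h2 M).1, mul_assoc _ (K2 ^ θ),
        ENNReal.ofReal_mul (by positivity), ENNReal.ofReal_mul ENNReal.toReal_nonneg,
        ENNReal.ofReal_toReal hK3, ENNReal.ofReal_rpow_of_nonneg (by positivity) (by linarith)]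
      refine mul_le_mul_right ?_ _
      rw [ENNReal.ofReal_rpow_of_nonneg (integral_nonneg fun _ => sq_nonneg _) hθ]
      refine ENNReal.ofReal_le_ofReal ?_
      have h4 := (h2 M).2.2
      rw [hγe] at h4
      calc (∫ t, (f t - (linkApprox 1 ν f M).eval t) ^ 2 ∂(gegenbauerMeasure ν)) ^ θ
          ≤ (K2 * ((M : ℝ) + 1) ^ (-(2 * s))) ^ θ := by
            refine Real.rpow_le_rpow (integral_nonneg fun _ => sq_nonneg _) ?_ hθ
            rw [linkApprox, hγe]
            exact h4
        _ = K2 ^ θ * ((M : ℝ) + 1) ^ (-(2 * (θ * s))) := by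
            rw [Real.mul_rpow hK2.le (by positivity), ← Real.rpow_mul hM.le]
            congr 2
            ring
  exact ⟨_, θ * s, K, by positivity, by push_cast; linarith, hK, hr⟩

theorem exists_approximationRate (hd : 1 ≤ d) (hν : -(1 / 2) < ν) (hγ : gammaWeight d ν ≠ 0)
    {p : ℝ} (hp : 2 * ν - 1 + 5 * (d : ℝ) / 2 < p) (hf : Measurable f)
    (hf01 : ∀ t ∈ Set.Icc (-1 : ℝ) 1, f t ∈ Set.Icc (0 : ℝ) 1) (hfp : SobolevRegular d ν p f) :
    ∃ ρ σ K : ℝ, 0 ≤ ρ ∧ (ρ + d) / 2 < σ ∧ 0 < K ∧ HasApproximationRate d ν f ρ σ K := by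
  have hd1 : (1 : ℝ) ≤ d := by exact_mod_cast hd
  have hsum := summable_orthoCoeff hd hν hγ (by linarith) hfp
  rcases hd.eq_or_lt with rfl | hd2
  · rw [gammaWeight_one] at hγ
    push_cast at hp
    exact exists_approximationRate_one hν hγ hf hf01 (by linarith) hsum
  · rcases le_or_gt ν (1 / 2) with h | h
    · exact exists_approximationRate_of_le_half hd2 hν h hf hf01 (by linarith) hsum
    · exact exists_approximationRate_of_half_lt hd2 h hf hf01 (by linarith) hsum

end KernelApproximation

end BallGraph

/-! ### Dyadic levels and the final rate -/

namespace BallGraph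

section FinalRate

universe u

variable {d : ℕ} {ν : ℝ} {f : ℝ → ℝ}

/-- The increasing sequence of polynomial spaces of dyadic degrees, starting from zero. -/
def dyadicSpace (d : ℕ) : ℕ → Submodule ℝ (EuclideanSpace ℝ (Fin d) → ℝ)
  | 0 => ⊥
  | b + 1 => polySpace d (2 ^ b)

theorem monotone_dyadicSpace (d : ℕ) : Monotone (dyadicSpace d) := by
  refine monotone_nat_of_le_succ fun b => ?_
  cases b with
  | zero => exact bot_le
  | succ b => exact polySpace_mono d (Nat.pow_le_pow_right (by norm_num) (Nat.le_succ b))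

/-- The kernels built from the Gegenbauer expansions of dyadic order, starting from zero. -/
noncomputable def dyadicKernel (d : ℕ) (ν : ℝ) (f : ℝ → ℝ) :
    ℕ → EuclideanSpace ℝ (Fin d) → EuclideanSpace ℝ (Fin d) → ℝ
  | 0 => fun _ _ => 0
  | b + 1 => fun x y => (linkApprox d ν f (2 ^ b)).eval (inner ℝ x y)

theorem isGeneratedBy_dyadicKernel (d : ℕ) (ν : ℝ) (f : ℝ → ℝ) (b : ℕ) :
    IsGeneratedBy (dyadicSpace d b) (dyadicKernel d ν f b) := by
  cases b with
  | zero => exact ⟨0, Fin.elim0, Fin.elim0, fun i => i.elim0, fun x y => by simp [dyadicKernel]⟩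
  | succ b => exact isGeneratedBy_eval_inner (natDegree_gegenbauerSum_le _ _)

theorem inner_mem_Icc {x y : EuclideanSpace ℝ (Fin d)} (hx : x ∈ Metric.closedBall 0 1)
    (hy : y ∈ Metric.closedBall 0 1) : inner ℝ x y ∈ Set.Icc (-1 : ℝ) 1 := by
  rw [mem_closedBall_zero_iff] at hx hy
  exact abs_le.1 ((abs_real_inner_le_norm x y).trans (mul_le_one₀ hx (norm_nonneg _) hy))

theorem integral_sq_dotKernel_le_one [IsProbabilityMeasure (ballLaw d ν)]
    (hf01 : ∀ t ∈ Set.Icc (-1 : ℝ) 1, f t ∈ Set.Icc (0 : ℝ) 1) :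
    ∫ z : EuclideanSpace ℝ (Fin d) × EuclideanSpace ℝ (Fin d),
      (dotKernel d f z.1 z.2 - 0) ^ 2 ∂((ballLaw d ν).prod (ballLaw d ν)) ≤ 1 := by
  calc ∫ z : EuclideanSpace ℝ (Fin d) × EuclideanSpace ℝ (Fin d),
        (dotKernel d f z.1 z.2 - 0) ^ 2 ∂((ballLaw d ν).prod (ballLaw d ν))
      ≤ ∫ z : EuclideanSpace ℝ (Fin d) × EuclideanSpace ℝ (Fin d),
          (1 : ℝ) ∂((ballLaw d ν).prod (ballLaw d ν)) := by
        refine integral_mono_of_nonneg (Filter.Eventually.of_forall fun _ => sq_nonneg _)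
          (integrable_const _) ?_
        filter_upwards [Measure.quasiMeasurePreserving_fst.ae (ae_mem_ball d ν),
          Measure.quasiMeasurePreserving_snd.ae (ae_mem_ball d ν)] with z h1 h2
        have h3 := hf01 _ (inner_mem_Icc h1 h2)
        rw [dotKernel, sub_zero]
        exact pow_le_one₀ h3.1 h3.2
    _ = 1 := by simp

/-- Degree 2^b sits at level b + 1, above the zero space. Christoffel bound times dimension grows
like s^(2b) with s = 2^((ρ + d)/2), and the error decays like q^b with q = 2^(-σ), so s q < 1 is the
assumption on σ. In the constant, 2^σ pays for the shift by one level and 1 + K covers the trivial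
error at level 0. -/
theorem exists_rate_of_approximationRate [IsProbabilityMeasure (ballLaw d ν)] (hd : 1 ≤ d)
    (hf : Measurable f) (hf01 : ∀ t ∈ Set.Icc (-1 : ℝ) 1, f t ∈ Set.Icc (0 : ℝ) 1)
    {ρ σ K : ℝ} (hρ : 0 ≤ ρ) (hσ : (ρ + d) / 2 < σ) (hK : 0 < K)
    (h : HasApproximationRate d ν f ρ σ K) {α : ℝ} (hα : 0 < α) :
    ∃ C : ℝ, 0 < C ∧ ∀ (n : ℕ), 1 ≤ n →
      ∀ (Ω : Type u) [MeasurableSpace Ω] (P : Measure Ω) [IsProbabilityMeasure P]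
        (S : Fin n → Ω → EuclideanSpace ℝ (Fin d)), iIndepFun S P →
        (∀ i, HasLaw (S i) (ballLaw d ν) P) →
        P {ω | ¬ delta2 (eigs (Matrix.toLin' (kernelMatrix f fun i => S i ω)))
            (eigs (integralOperator (isGraphon_dotKernel d ν hf hf01))) ≤
              ENNReal.ofReal (C * (n : ℝ) ^ (-(1 / 2) : ℝ))} ≤ ENNReal.ofReal α := by
  obtain ⟨hκ, happ⟩ := h
  have hd1 : (1 : ℝ) ≤ d := by exact_mod_cast hd
  have hσ0 : 0 < σ := lt_of_le_of_lt (by positivity) hσ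
  have hσ1 : (1 : ℝ) ≤ 2 ^ σ := Real.one_le_rpow (by norm_num) hσ0.le
  have hdeg : ∀ b : ℕ, (((2 ^ b : ℕ) : ℝ) + 1) ≤ 2 ^ (b + 1) := by
    intro b
    have : (1 : ℝ) ≤ 2 ^ b := one_le_pow₀ (by norm_num)
    push_cast
    rw [pow_succ]
    linarith
  have hpow : ∀ (b : ℕ) (a : ℝ), ((2 : ℝ) ^ b) ^ a = (2 ^ a) ^ b := by
    intro b a
    rw [← Real.rpow_natCast, ← Real.rpow_mul (by norm_num), mul_comm, Real.rpow_mul (by norm_num),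
      Real.rpow_natCast]
  refine exists_rate_of_approximation (isGraphon_dotKernel d ν hf hf01)
    (monotone_dyadicSpace d) rfl ?_ ?_ (ae_mem_ball d ν) ?_ (K := (1 + K) * 2 ^ σ)
    (s := 2 ^ ((ρ + d) / 2)) (q := 2 ^ (-σ)) (B := K) (by positivity)
    (Real.one_lt_rpow (by norm_num) (by positivity)) (by positivity)
    (Real.rpow_le_one_of_one_le_of_nonpos (by norm_num) (by linarith)) ?_ ?_
    (isGeneratedBy_dyadicKernel d ν f) ?_ ?_ hα
  · intro b
    cases b with
    | zero => exact inferInstanceAs (FiniteDimensional ℝ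
        (⊥ : Submodule ℝ (EuclideanSpace ℝ (Fin d) → ℝ)))
    | succ b => exact finiteDimensional_polySpace d (2 ^ b)
  · intro b p hp
    cases b with
    | zero =>
      rw [(Submodule.mem_bot ℝ).1 hp]
      exact measurable_const
    | succ b => exact (continuous_of_mem_polySpace hp).measurable
  · intro b p hp
    cases b with
    | zero => exact ⟨0, fun x _ => by simp [(Submodule.mem_bot ℝ).1 hp]⟩
    | succ b => exact exists_bound_of_mem_polySpace hp
  · rw [← Real.rpow_add (by norm_num)]
    exact Real.rpow_lt_one_of_one_lt_of_neg (by norm_num) (by linarith)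
  · intro b
    cases b with
    | zero =>
      refine ⟨0, le_rfl, fun p hp x _ => by simp [(Submodule.mem_bot ℝ).1 hp], ?_⟩
      rw [zero_mul]
      positivity
    | succ b =>
      refine ⟨K * (((2 ^ b : ℕ) : ℝ) + 1) ^ ρ, by positivity, hκ (2 ^ b), ?_⟩
      have h1 : (Module.finrank ℝ (polySpace d (2 ^ b)) : ℝ) ≤ (((2 ^ b : ℕ) : ℝ) + 1) ^ d := by
        exact_mod_cast finrank_polySpace_le d (2 ^ b)
      calc K * (((2 ^ b : ℕ) : ℝ) + 1) ^ ρ * Module.finrank ℝ (polySpace d (2 ^ b))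
          ≤ K * (2 ^ (b + 1)) ^ ρ * (2 ^ (b + 1)) ^ d := by
            have h2 := hdeg b
            gcongr
            exact h1.trans (by gcongr)
        _ = K * ((2 ^ ((ρ + d) / 2)) ^ (b + 1)) ^ 2 := by
            rw [mul_assoc, ← Real.rpow_natCast _ d, ← Real.rpow_add (by positivity), hpow,
              pow_right_comm, ← Real.rpow_mul_natCast (by norm_num) _ 2]
            congr 3
            rw [Nat.cast_ofNat, div_mul_cancel₀ _ two_ne_zero]
        _ ≤ (1 + K) * 2 ^ σ * ((2 ^ ((ρ + d) / 2)) ^ (b + 1)) ^ 2 := by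
            gcongr
            nlinarith
  · intro b
    cases b with
    | zero =>
      refine (integral_sq_dotKernel_le_one hf01).trans ?_
      rw [pow_zero, mul_one]
      exact one_le_pow₀ (by nlinarith)
    | succ b =>
      refine (happ (2 ^ b)).2.trans ?_
      have h1 : (((2 ^ b : ℕ) : ℝ) + 1) ^ (-(2 * σ)) ≤ (2 ^ b) ^ (-(2 * σ)) := by
        refine Real.rpow_le_rpow_of_nonpos (by positivity) ?_ (by linarith)
        push_cast
        linarith
      have h2 : ((2 : ℝ) ^ b) ^ (-(2 * σ)) = ((2 ^ (-σ)) ^ b) ^ 2 := by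
        rw [hpow, pow_right_comm, ← Real.rpow_mul_natCast (by norm_num) _ 2]
        congr 2
        rw [Nat.cast_ofNat, neg_mul, mul_comm]
      have h3 : (1 + K) * 2 ^ σ * (2 ^ (-σ)) ^ (b + 1) = (1 + K) * (2 ^ (-σ)) ^ b := by
        rw [pow_succ', mul_assoc, ← mul_assoc ((2 : ℝ) ^ σ), ← Real.rpow_add (by norm_num),
          add_neg_cancel, Real.rpow_zero, one_mul]
      rw [h3, mul_pow, ← h2]
      refine mul_le_mul (by nlinarith) h1 (by positivity) (by positivity)
  · intro b x hx
    cases b with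
    | zero => simpa [dyadicKernel] using hK.le
    | succ b => exact (happ (2 ^ b)).1 _ (inner_mem_Icc hx hx)

end FinalRate

end BallGraph

theorem propositionA2 (d : ℕ) (hd : 1 ≤ d) (ν : ℝ) (hν : -(1 / 2) < ν)
    (hγ : BallGraph.gammaWeight d ν ≠ 0)
    (p : ℝ) (hp : 2 * ν - 1 + 5 * (d : ℝ) / 2 < p)
    (f : ℝ → ℝ) (hf : Measurable f)
    (hf01 : ∀ t ∈ Set.Icc (-1 : ℝ) 1, f t ∈ Set.Icc (0 : ℝ) 1)
    (hfp : BallGraph.SobolevRegular d ν p f)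
    (α : ℝ) (hα0 : 0 < α) (hα1 : α < 1) :
    ∃ C : ℝ, 0 < C ∧
      ∀ (n : ℕ), 1 ≤ n →
      ∀ (Ω : Type*) [MeasurableSpace Ω] (P : Measure Ω) [IsProbabilityMeasure P]
        (X : Fin n → Ω → EuclideanSpace ℝ (Fin d)),
        iIndepFun X P →
        (∀ i, HasLaw (X i) (BallGraph.ballLaw d ν) P) →
        ENNReal.ofReal (1 - α) ≤
          P {ω | BallGraph.delta2
              (BallGraph.eigs (Matrix.toLin' (BallGraph.kernelMatrix f fun i => X i ω)))
              (BallGraph.eigs (BallGraph.integralOperator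
                (BallGraph.isGraphon_dotKernel d ν hf hf01)))
            ≤ ENNReal.ofReal (C * (n : ℝ) ^ (-(1 / 2) : ℝ))} := by
  -- One sample point with law `ballLaw` already forces it to be a probability measure, so the
  -- second case is vacuous as n ≥ 1.
  by_cases hprob : IsProbabilityMeasure (BallGraph.ballLaw d ν)
  · obtain ⟨ρ, σ, K, hρ, hσ, hK, hrate⟩ :=
      BallGraph.exists_approximationRate hd hν hγ hp hf hf01 hfp
    obtain ⟨C, hC, hbound⟩ :=
      BallGraph.exists_rate_of_approximationRate hd hf hf01 hρ hσ hK hrate hα0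
    refine ⟨C, hC, fun n hn Ω _ P _ X hind hlaw => ?_⟩
    have hbad := hbound n hn Ω P X hind hlaw
    -- The good event and its complement cover the space, so subadditivity gives the lower bound
    -- without any measurability of δ₂.
    rw [ENNReal.ofReal_sub 1 hα0.le, ENNReal.ofReal_one, tsub_le_iff_right]
    refine le_trans ?_ (add_le_add_right hbad _)
    rw [← measure_univ (μ := P)]
    refine (measure_mono fun ω _ => ?_).trans (measure_union_le _ _)
    exact Classical.em _
  · refine ⟨1, one_pos, fun n hn Ω _ P _ X _ hlaw => absurd ?_ hprob⟩
    exact (hlaw ⟨0, hn⟩).isProbabilityMeasure_iff.1 inferInstance
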